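/- **Setting.** A unary signature $\sigma$ consists of finitely many constant symbols, monadic predicate symbols and unary function symbols. A bijective $\sigma$-structure $\mathcal S$ is a finite $\sigma$-structure with non-empty domain $D=\{0,\dots,n-1\}$ in which every function symbol is interpreted by a permutation of $D$. Its size $|\mathcal S|$ is the number of registers needed to store it: $n$ for the domain, one for each constant, $\mathrm{card}(U)+1$ for each predicate $U$ (its elements and its length), and $n$ for each function. A bijective term is $\tau(x)=f_1^{\varepsilon_1}\cdots f_l^{\varepsilon_l}(x)$ with $l\ge 0$, $\varepsilon_i=\pm1$, function symbols $f_i$ and a variable $x$. $\mathbf{FO_{Bij}}$ is the set of first-order formulas (built with $\neg,\wedge,\vee,\exists,\forall$) over the atoms $\tau(x)=\tau_1(y)$, $\tau(x)=c$, $U(\tau(x))$, and cardinality statements $\exists^{\ge r}x\,\Psi(x)$, where $\Psi$ is a Boolean combination of atoms of the first three kinds in the single variable $x$. $|\varphi|$ is the number of symbols of $\varphi$ ($r$ being counted in unary). The size of a query $\varphi(x_1,\dots,x_k)$, whose free variables are among $x_1,\dots,x_k$, is $|\varphi|+k$; if all of $x_1,\dots,x_k$ occur in $\varphi$, this is at most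 $2|\varphi|$. The problem $\mathrm{Query}(\mathbf{FO_{Bij}})$: given $\sigma$, a bijective $\sigma$-structure $\mathcal S$ and a query $\varphi(x_1,\dots,x_k)$ in $\mathbf{FO_{Bij}}$ over $\sigma$ ($k\ge 0$), output $\varphi(\mathcal S)=\{a\in D^k : (\mathcal S,a)\models\varphi\}$. The size of the output is $|\varphi(\mathcal S)|=k\cdot\mathrm{card}\,\varphi(\mathcal S)$. Algorithms are random access machines with the uniform cost measure; space $s$ means that addresses and register contents are at most $s$ (the output is write-only and is not counted). **Theorem.** $\mathrm{Query}(\mathbf{FO_{Bij}})$ is in $\textsc{Constant-Delay}_{lin}$: there are one random access machine and a function $f:\mathbb N\to\mathbb N$ such that on every input $(\sigma,\mathcal S,\varphi(x_1,\dots,x_k))$, with $p=|\varphi|+k$, the machine 1. outputs exactly the tuples of $\varphi(\mathcal S)$, each exactly once, and halts; 2. first performs a precomputation of at most $f(p)\cdot|\mathcal S|$ steps without output, after which at most $f(p)$ steps pass before the first output, between two consecutive outputs, and between the last output and the halt (and before the halt if there is no output); 3. uses space at most $f(p)\cdot|\mathcal S|$. Hence $\mathrm{Query}(\mathbf{FO_{Bij}})$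 is computable in total time $O_\varphi(|\mathcal S|+|\varphi(\mathcal S)|)$ and space $O_\varphi(|\mathcal S|)$: there are a random access machine and a function $g:\mathbb N\to\mathbb N$ such that on every input the machine outputs exactly the tuples of $\varphi(\mathcal S)$, each exactly once, and halts, within $g(p)\cdot(|\mathcal S|+|\varphi(\mathcal S)|)$ steps and in space $g(p)\cdot|\mathcal S|$. -/

import Mathlib

/-! ## Unary signatures, bijective structures -/

/-- A finite unary functional signature: constant symbols, monadic predicate symbols and unary
function symbols, each kind numbered from `0`. -/
structure UnarySig where
  numConst : ℕ
  numPred : ℕ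
  numFun : ℕ

/-- A finite bijective structure: the (non-empty) domain is `{0, …, n - 1}`, and every unary
function symbol is interpreted by a permutation of the domain. -/
structure BijStructure (σ : UnarySig) where
  n : ℕ
  n_pos : 0 < n
  const : Fin σ.numConst → Fin n
  pred : Fin σ.numPred → Finset (Fin n)
  func : Fin σ.numFun → Equiv.Perm (Fin n)

namespace BijStructure

variable {σ : UnarySig} (S : BijStructure σ)

/-- The size `|S|`: `n` registers for the domain, one for every constant, `card U` registers for
the elements of a monadic predicate `U` together with one register for its length, and `n`
registers for the table of every unary function. -/
def size : ℕ :=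
  S.n + σ.numConst + ∑ i, ((S.pred i).card + 1) + σ.numFun * S.n

/-- The word by which a structure is stored: `n`, the numbers of symbols of the three kinds, the
constants, each predicate as the list of its elements preceded by its length, and the tables of
the functions. (The tables of the inverse functions are not given.) -/
def code : List ℕ :=
  [S.n, σ.numConst, σ.numPred, σ.numFun]
    ++ List.ofFn (fun i => (S.const i : ℕ))
    ++ (List.finRange σ.numPred).flatMap (fun i =>
        (S.pred i).card ::
          ((List.finRange S.n).filter (fun a => decide (a ∈ S.pred i))).map Fin.val)
    ++ (List.finRange σ.numFun).flatMap (fun i => List.ofFn (fun a => (S.func i a : ℕ)))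

end BijStructure

/-! ## Bijective first-order formulas -/

/-- The word `f₁^{ε₁} … f_l^{ε_l}` of a bijective term, `l ≥ 0`; the pair `(f, true)` stands for
the symbol `f` and `(f, false)` for its reciprocal `f⁻¹`. -/
abbrev BijWord (σ : UnarySig) := List (Fin σ.numFun × Bool)

namespace BijWord

variable {σ : UnarySig}

/-- The value of the term `f₁^{ε₁} … f_l^{ε_l}(a)`; the last symbol is applied first. -/
def eval (S : BijStructure σ) (w : BijWord σ) (a : Fin S.n) : Fin S.n :=
  w.foldr (fun p b => if p.2 then S.func p.1 b else (S.func p.1).symm b) a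

/-- Number of symbols of the term `w(x)`: function symbols, the variable, two brackets. -/
def size (w : BijWord σ) : ℕ := w.length + 3

def code (w : BijWord σ) : List ℕ :=
  w.length :: w.flatMap (fun p => [(p.1 : ℕ), if p.2 then 0 else 1])

end BijWord

/-- Bijective atoms that are not cardinality statements, over the variables `x₀, …, x_{m-1}`:
`w(x_i) = w'(x_j)`, `w(x_i) = c` and `U(w(x_i))`. -/
inductive BijAtom (σ : UnarySig) (m : ℕ) where
  | eq (w : BijWord σ) (i : Fin m) (w' : BijWord σ) (j : Fin m)
  | eqConst (w : BijWord σ) (i : Fin m) (c : Fin σ.numConst)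
  | pred (U : Fin σ.numPred) (w : BijWord σ) (i : Fin m)

namespace BijAtom

variable {σ : UnarySig} {m : ℕ}

def Holds (S : BijStructure σ) : BijAtom σ m → (Fin m → Fin S.n) → Prop
  | eq w i w' j, a => w.eval S (a i) = w'.eval S (a j)
  | eqConst w i c, a => w.eval S (a i) = S.const c
  | pred U w i, a => w.eval S (a i) ∈ S.pred U

def size : BijAtom σ m → ℕ
  | eq w _ w' _ => w.size + w'.size + 3
  | eqConst w _ _ => w.size + 4
  | pred _ w _ => w.size + 3

def code : BijAtom σ m → List ℕ
  | eq w i w' j => 0 :: (w.code ++ [(i : ℕ)] ++ w'.code ++ [(j : ℕ)])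
  | eqConst w i c => 1 :: (w.code ++ [(i : ℕ), (c : ℕ)])
  | pred U w i => 2 :: (U : ℕ) :: (w.code ++ [(i : ℕ)])

end BijAtom

/-- Boolean combinations of the atoms above over one single variable. -/
inductive BijBool (σ : UnarySig) where
  | atom (α : BijAtom σ 1)
  | neg (ψ : BijBool σ)
  | and (ψ χ : BijBool σ)
  | or (ψ χ : BijBool σ)

namespace BijBool

variable {σ : UnarySig}

def Holds (S : BijStructure σ) : BijBool σ → Fin S.n → Prop
  | atom α, a => α.Holds S (fun _ => a)
  | neg ψ, a => ¬ ψ.Holds S a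
  | and ψ χ, a => ψ.Holds S a ∧ χ.Holds S a
  | or ψ χ, a => ψ.Holds S a ∨ χ.Holds S a

def size : BijBool σ → ℕ
  | atom α => α.size
  | neg ψ => ψ.size + 1
  | and ψ χ => ψ.size + χ.size + 3
  | or ψ χ => ψ.size + χ.size + 3

def code : BijBool σ → List ℕ
  | atom α => α.code
  | neg ψ => 3 :: ψ.code
  | and ψ χ => 4 :: (ψ.code ++ χ.code)
  | or ψ χ => 5 :: (ψ.code ++ χ.code)

end BijBool

/-- Bijective first-order formulas with free variables among `x₀, …, x_{m-1}`. A quantifier in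
scope of `x₀, …, x_{m-1}` binds the variable `x_m`. The formula `card r Ψ` is the cardinality
statement "there exist at least `r` elements `x` with `Ψ(x)`". -/
inductive FOBij (σ : UnarySig) : ℕ → Type where
  | atom {m : ℕ} (α : BijAtom σ m) : FOBij σ m
  | card {m : ℕ} (r : ℕ) (Ψ : BijBool σ) : FOBij σ m
  | neg {m : ℕ} (φ : FOBij σ m) : FOBij σ m
  | and {m : ℕ} (φ ψ : FOBij σ m) : FOBij σ m
  | or {m : ℕ} (φ ψ : FOBij σ m) : FOBij σ m
  | ex {m : ℕ} (φ : FOBij σ (m + 1)) : FOBij σ m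
  | all {m : ℕ} (φ : FOBij σ (m + 1)) : FOBij σ m

namespace FOBij

variable {σ : UnarySig}

/-- Satisfaction `(S, a) ⊨ φ`. -/
def Holds (S : BijStructure σ) : {m : ℕ} → FOBij σ m → (Fin m → Fin S.n) → Prop
  | _, atom α, a => α.Holds S a
  | _, card r Ψ, _ => r ≤ Set.ncard {b : Fin S.n | Ψ.Holds S b}
  | _, neg φ, a => ¬ φ.Holds S a
  | _, and φ ψ, a => φ.Holds S a ∧ ψ.Holds S a
  | _, or φ ψ, a => φ.Holds S a ∨ ψ.Holds S a
  | _, ex φ, a => ∃ b : Fin S.n, φ.Holds S (Fin.snoc a b)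
  | _, all φ, a => ∀ b : Fin S.n, φ.Holds S (Fin.snoc a b)

/-- The size `|φ|`: the number of symbols of the fully bracketed formula. The number `r` of a
cardinality statement is counted in unary. -/
def size : {m : ℕ} → FOBij σ m → ℕ
  | _, atom α => α.size
  | _, card r Ψ => r + Ψ.size + 2
  | _, neg φ => φ.size + 1
  | _, and φ ψ => φ.size + ψ.size + 3
  | _, or φ ψ => φ.size + ψ.size + 3
  | _, ex φ => φ.size + 2
  | _, all φ => φ.size + 2

/-- The word by which a formula is stored (Polish notation). -/
def code : {m : ℕ} → FOBij σ m → List ℕ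
  | _, atom α => α.code
  | _, neg φ => 3 :: φ.code
  | _, and φ ψ => 4 :: (φ.code ++ ψ.code)
  | _, or φ ψ => 5 :: (φ.code ++ ψ.code)
  | _, ex φ => 6 :: φ.code
  | _, all φ => 7 :: φ.code
  | _, card r Ψ => 8 :: r :: Ψ.code

/-- The query result `φ(S) ⊆ D^k`. -/
def answers {k : ℕ} (φ : FOBij σ k) (S : BijStructure σ) : Set (Fin k → Fin S.n) :=
  {a | φ.Holds S a}

end FOBij

/-! ## Random access machines with uniform cost -/

namespace RAM

/-- Instructions. Registers `R₀, R₁, …` are addressed directly (a program mentions finitely many of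
them), memory cells `M₀, M₁, …` are addressed indirectly. -/
inductive Instr where
  /-- `R_d := c` -/
  | const (d c : ℕ)
  /-- `R_d := R_s` -/
  | move (d s : ℕ)
  /-- `R_d := R_a + R_b` -/
  | add (d a b : ℕ)
  /-- `R_d := max (R_a - R_b) 0` -/
  | sub (d a b : ℕ)
  /-- `R_d := M[R_a]` -/
  | load (d a : ℕ)
  /-- `M[R_a] := R_s` -/
  | store (a s : ℕ)
  /-- continue at instruction `l` -/
  | jump (l : ℕ)
  /-- continue at instruction `l` if `R_a = 0` -/
  | jumpZero (a l : ℕ)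
  /-- append `R_a` to the solution that is being written -/
  | write (a : ℕ)
  /-- output the solution that has been written, and start a new one -/
  | emit
  | halt

abbrev Program := List Instr

structure Config where
  pc : ℕ
  reg : ℕ → ℕ
  mem : ℕ → ℕ
  /-- components of the solution that is being written -/
  buf : List ℕ
  /-- the solutions output so far, in order -/
  out : List (List ℕ)

/-- At the start the input word is in the memory cells `M₀, M₁, …`; everything else is zero. -/
def init (w : List ℕ) : Config where
  pc := 0
  reg := fun _ => 0
  mem := fun i => w.getD i 0
  buf := []
  out := []

/-- The effect of one instruction. -/
def exec : Instr → Config → Config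
  | .const d c, s => { s with pc := s.pc + 1, reg := Function.update s.reg d c }
  | .move d a, s => { s with pc := s.pc + 1, reg := Function.update s.reg d (s.reg a) }
  | .add d a b, s => { s with pc := s.pc + 1, reg := Function.update s.reg d (s.reg a + s.reg b) }
  | .sub d a b, s => { s with pc := s.pc + 1, reg := Function.update s.reg d (s.reg a - s.reg b) }
  | .load d a, s => { s with pc := s.pc + 1, reg := Function.update s.reg d (s.mem (s.reg a)) }
  | .store a b, s => { s with pc := s.pc + 1, mem := Function.update s.mem (s.reg a) (s.reg b) }
  | .jump l, s => { s with pc := l }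
  | .jumpZero a l, s => { s with pc := if s.reg a = 0 then l else s.pc + 1 }
  | .write a, s => { s with pc := s.pc + 1, buf := s.buf ++ [s.reg a] }
  | .emit, s => { s with pc := s.pc + 1, buf := [], out := s.out ++ [s.buf] }
  | .halt, s => s

/-- One step; a halted machine stays where it is. -/
def step (P : Program) (s : Config) : Config :=
  match P[s.pc]? with
  | none => s
  | some i => exec i s

/-- The configuration after `t` steps on the input word `w`. -/
def run (P : Program) (w : List ℕ) (t : ℕ) : Config := (step P)^[t] (init w)

/-- The machine has halted after `t` steps: it is at a `halt` or has left the program. -/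
def HaltedAt (P : Program) (w : List ℕ) (t : ℕ) : Prop :=
  P[(run P w t).pc]? = none ∨ P[(run P w t).pc]? = some .halt

/-- The step number `t` (numbered from `0`) outputs a solution. -/
def EmitsAt (P : Program) (w : List ℕ) (t : ℕ) : Prop :=
  P[(run P w t).pc]? = some .emit

/-- During the whole run on `w`, contents and addresses of the registers and memory cells in use
are at most `s`. (An address used by a `load` or a `store` is the content of a register.) -/
def UsesSpace (P : Program) (w : List ℕ) (s : ℕ) : Prop :=
  w.length ≤ s ∧ ∀ t : ℕ,
    (∀ r, (run P w t).reg r ≤ s) ∧ (∀ a, (run P w t).mem a ≤ s) ∧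
      (∀ a, s < a → (run P w t).mem a = 0)

/-- The machine halts within `T` steps on `w` and outputs exactly the elements of `Y`, each of them
exactly once. -/
def EnumeratesWithin (P : Program) (w : List ℕ) (Y : Set (List ℕ)) (T : ℕ) : Prop :=
  HaltedAt P w T ∧ (run P w T).out.Nodup ∧ ∀ y, y ∈ (run P w T).out ↔ y ∈ Y

/-- The run on `w` consists of a precomputation of at most `pre` steps (the first `T₀` ones), that
outputs nothing, followed by an enumeration phase with delay at most `delay`: from its start, and
from every later instant, at most `delay` steps pass until a solution is output or the machine
halts. -/
def HasDelay (P : Program) (w : List ℕ) (pre delay : ℕ) : Prop :=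
  ∃ T₀ ≤ pre, (∀ t < T₀, ¬ EmitsAt P w t) ∧
    ∀ t ≥ T₀, ∃ d < delay, EmitsAt P w (t + d) ∨ HaltedAt P w (t + d)

end RAM

/-! ## Parameterized enumeration problems -/

/-- A parameterized enumeration problem: instances, the words by which they are stored, their size
and parameter, the set of solutions of each instance and the size of that set. -/
structure EnumProblem where
  Inst : Type
  code : Inst → List ℕ
  size : Inst → ℕ
  param : Inst → ℕ
  sols : Inst → Set (List ℕ)
  outSize : Inst → ℕ

namespace EnumProblem

/-- Constant delay with linear precomputation: one machine enumerates the solutions of every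
instance without repetition, with precomputation time and space linear in the size of the instance,
and constant delay; the constants depend on the parameter only. -/
def ConstantDelayLin (A : EnumProblem) : Prop :=
  ∃ (P : RAM.Program) (f : ℕ → ℕ), ∀ x : A.Inst,
    (∃ T, RAM.EnumeratesWithin P (A.code x) (A.sols x) T) ∧
    RAM.HasDelay P (A.code x) (f (A.param x) * A.size x) (f (A.param x)) ∧
    RAM.UsesSpace P (A.code x) (f (A.param x) * A.size x)

/-- Computable in total time linear in the size of input and output, and in space linear in the
size of the input; the constants depend on the parameter only. -/
def LinearTotalTime (A : EnumProblem) : Prop :=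
  ∃ (P : RAM.Program) (f : ℕ → ℕ), ∀ x : A.Inst,
    RAM.EnumeratesWithin P (A.code x) (A.sols x)
      (f (A.param x) * (A.size x + A.outSize x)) ∧
    RAM.UsesSpace P (A.code x) (f (A.param x) * A.size x)

end EnumProblem

/-! ## The query problem -/

/-- An instance of the query problem: a unary signature, a bijective structure and a bijective
first-order formula `φ(x₀, …, x_{k-1})`. -/
structure BijQueryInstance where
  sig : UnarySig
  struct : BijStructure sig
  k : ℕ
  formula : FOBij sig k

/-- The query problem for bijective first-order formulas. The instance is stored as the structure
followed by `k` and the formula. Its size is `|S|`. The parameter is the number of symbols of the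
query `φ(x₀, …, x_{k-1})`, that is `|φ| + k`: some of the listed variables may be absent from `φ`,
and if none is, then `k ≤ |φ|`. A tuple in `D^k` is output as the list of its components, and the
size of `φ(S)` is `k · card φ(S)`. -/
noncomputable def queryFOBij : EnumProblem where
  Inst := BijQueryInstance
  code x := x.struct.code ++ x.k :: x.formula.code
  size x := x.struct.size
  param x := x.formula.size + x.k
  sols x := (fun a => List.ofFn (fun i => (a i : ℕ))) '' x.formula.answers x.struct
  outSize x := x.k * (x.formula.answers x.struct).ncard

/-! A word in the function symbols and their inverses denotes a permutation. Hence, for a fixed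
radius, only boundedly many elements lie near a given tuple (are images of its components under
short words), and nearness is symmetric. The type of an element records, for every short word `u`,
whether `u` fixes the element and which predicates and constants hold at its image. Two tuples are
equivalent if corresponding components have the same predicate and constant facts in their
neighbourhoods and the same equations `u (a i) = a j` hold.

Equivalence has a back-and-forth property (`Eqv.exists_snoc`). An element near the first tuple is
carried over by the word that reaches it, which costs a factor 3 in the radius. An element far from
the first tuple is answered by an element of the same type far from the second one. Such an element
exists because both tuples live in the same structure: the elements of this type near the second
tuple inject into those near the first, so they cannot exhaust the type. No normal form of the
formula is needed: by induction every formula depends only on neighbourhoods of radius `3 ^ length`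
(`local_formula`), and so does the property of being a prefix of an answer (`local_extends`).

This has two algorithmic consequences. First, a quantifier may be restricted to the neighbourhood of
the tuple together with a bounded number of representatives of each type (`Local.exists_iff`), and
cardinality statements may be counted on the representatives (`le_ncard_iff`). Once the domain has
been grouped by types, which takes linear time, a formula can be evaluated at a tuple in time that
depends on the formula only (`evals_formula`), and so can the extendability of a prefix
(`evals_extends`).

Second, the answers are enumerated by a depth-first search in the tree of their prefixes, which has
no dead ends. The possible next components of a prefix are tried in the order: elements of its
neighbourhood and representatives, then the whole domain grouped by types. Among the far elements of
one type either all or none are possible, so a failure permits a jump to the end of the class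
(`pending_skip`). Thus the search in one level takes a bounded number of steps (`seekMeasure_le`),
and boundedly many changes of level separate two answers (`levelMeasure`).

One machine has to serve all signatures and formulas. Only numbers that occur in the code of the
formula can name relevant symbols, so tables are made for these only, and they play the role of
`vals` in the notion of type. The algorithm is written in a small imperative language with a
calculus of time bounds (`Wp`), compiled to machine code (`reach_compC`), and turned into a
statement on delay by `enumProgram_correct`. Linear total time follows by adding the delays. -/

/-! ## A structured language over registers and non-overlapping arrays -/

namespace WhileRAM

open Function

set_option linter.unusedSectionVars false

/-- Expressions over variables `V` and arrays `A`. -/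
inductive Ex (V A : Type) where
  | lit (n : ℕ)
  | var (x : V)
  | add (e f : Ex V A)
  | sub (e f : Ex V A)
  | get (T : A) (e : Ex V A)

/-- Commands; `wr e` appends a component to the solution that is being written. -/
inductive Cmd (V A : Type) where
  | skip
  | set (x : V) (e : Ex V A)
  | put (T : A) (i e : Ex V A)
  | wr (e : Ex V A)
  | seq (c d : Cmd V A)
  | ite (e : Ex V A) (c d : Cmd V A)
  | wh (e : Ex V A) (c : Cmd V A)

infixr:30 " ;; " => Cmd.seq

/-- States of the structured language. -/
structure St (V A : Type) where
  v : V → ℕ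
  a : A → ℕ → ℕ
  buf : List ℕ

variable {V A : Type}

instance : Add (Ex V A) := ⟨Ex.add⟩
instance : Sub (Ex V A) := ⟨Ex.sub⟩
instance (n : ℕ) : OfNat (Ex V A) n := ⟨Ex.lit n⟩
instance : Coe V (Ex V A) := ⟨Ex.var⟩

namespace Ex

def val (s : St V A) : Ex V A → ℕ
  | lit n => n
  | var x => s.v x
  | add e f => e.val s + f.val s
  | sub e f => e.val s - f.val s
  | get T e => s.a T (e.val s)

/-- No value computed in the evaluation of the expression exceeds `B` through a constant or a sum. -/
def ok (B : ℕ) (s : St V A) : Ex V A → Prop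
  | lit n => n ≤ B
  | var _ => True
  | add e f => e.ok B s ∧ f.ok B s ∧ e.val s + f.val s ≤ B
  | sub e f => e.ok B s ∧ f.ok B s
  | get _ e => e.ok B s

/-- Number of machine instructions of an expression, when addresses are scaled by `2 ^ h`. -/
def cost (h : ℕ) : Ex V A → ℕ
  | lit _ => 1
  | var _ => 1
  | add e f => e.cost h + f.cost h + 1
  | sub e f => e.cost h + f.cost h + 1
  | get _ e => e.cost h + h + 3

section
variable (s : St V A) (B h n : ℕ) (x : V) (T : A) (e f : Ex V A)

@[simp] theorem val_ofNat : (no_index (OfNat.ofNat n) : Ex V A).val s = OfNat.ofNat n := rfl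
@[simp] theorem val_var : (Ex.var x : Ex V A).val s = s.v x := rfl
@[simp] theorem val_add : (e + f).val s = e.val s + f.val s := rfl
@[simp] theorem val_sub : (e - f).val s = e.val s - f.val s := rfl
@[simp] theorem val_get : (Ex.get T e).val s = s.a T (e.val s) := rfl
@[simp] theorem ok_ofNat :
    (no_index (OfNat.ofNat n) : Ex V A).ok B s ↔ OfNat.ofNat n ≤ B := Iff.rfl
@[simp] theorem cost_ofNat : (no_index (OfNat.ofNat n) : Ex V A).cost h = 1 := rfl
@[simp] theorem cost_var : (Ex.var x : Ex V A).cost h = 1 := rfl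
@[simp] theorem cost_add : (e + f).cost h = e.cost h + f.cost h + 1 := rfl
@[simp] theorem cost_sub : (e - f).cost h = e.cost h + f.cost h + 1 := rfl
@[simp] theorem cost_get : (Ex.get T e).cost h = e.cost h + h + 3 := rfl
@[simp] theorem ok_var : (Ex.var x : Ex V A).ok B s ↔ True := Iff.rfl
@[simp] theorem ok_add :
    (e + f).ok B s ↔ e.ok B s ∧ f.ok B s ∧ e.val s + f.val s ≤ B := Iff.rfl
@[simp] theorem ok_sub : (e - f).ok B s ↔ e.ok B s ∧ f.ok B s := Iff.rfl
@[simp] theorem ok_get : (Ex.get T e).ok B s ↔ e.ok B s := Iff.rfl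

end

end Ex

namespace St

variable [DecidableEq V] [DecidableEq A]

def setV (s : St V A) (x : V) (n : ℕ) : St V A := { s with v := update s.v x n }
def setA (s : St V A) (T : A) (i n : ℕ) : St V A :=
  { s with a := update s.a T (update (s.a T) i n) }
def setB (s : St V A) (n : ℕ) : St V A := { s with buf := s.buf ++ [n] }

section
variable (s : St V A) (x y : V) (T U : A) (i j n : ℕ)

@[simp] theorem setV_v : (s.setV x n).v y = if y = x then n else s.v y := by
  simp [setV, update_apply]
@[simp] theorem setV_a : (s.setV x n).a = s.a := rfl
@[simp] theorem setV_buf : (s.setV x n).buf = s.buf := rfl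
@[simp] theorem setA_v : (s.setA T i n).v = s.v := rfl
@[simp] theorem setA_a :
    (s.setA T i n).a U = if U = T then update (s.a T) i n else s.a U := by
  by_cases h : U = T
  · subst h; simp [setA]
  · simp [setA, h]
@[simp] theorem setA_buf : (s.setA T i n).buf = s.buf := rfl
@[simp] theorem setB_buf : (s.setB n).buf = s.buf ++ [n] := rfl

end

/-- All values, and all addresses of non-zero array entries, are at most `B`. -/
structure Bdd (B : ℕ) (s : St V A) : Prop where
  v : ∀ x, s.v x ≤ B
  a : ∀ T i, s.a T i ≤ B
  z : ∀ T i, B < i → s.a T i = 0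

end St

section
variable [DecidableEq V] [DecidableEq A]

/-! ### Execution with running time and a bound on all values -/

/-- `Run h B c s t s'`: the command `c` leads from `s` to `s'` in `t` machine steps, and no sum or
constant exceeds `B` on the way. -/
inductive Run (h B : ℕ) : Cmd V A → St V A → ℕ → St V A → Prop
  | skip (s) : Run h B .skip s 0 s
  | set (s) (x : V) (e : Ex V A) (he : e.ok B s) :
      Run h B (.set x e) s (e.cost h + 1) (s.setV x (e.val s))
  | put (s) (T : A) (i e : Ex V A) (hi : i.ok B s) (he : e.ok B s) :
      Run h B (.put T i e) s (i.cost h + (h + 2) + e.cost h + 1)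
        (s.setA T (i.val s) (e.val s))
  | wr (s) (e : Ex V A) (he : e.ok B s) :
      Run h B (.wr e) s (e.cost h + 1) (s.setB (e.val s))
  | seq {c d : Cmd V A} {s t s' t' s''} (hc : Run h B c s t s') (hd : Run h B d s' t' s'') :
      Run h B (.seq c d) s (t + t') s''
  | iteT {e : Ex V A} {c d : Cmd V A} {s t s'} (he : e.ok B s) (hv : e.val s ≠ 0)
      (hc : Run h B c s t s') : Run h B (.ite e c d) s (e.cost h + 1 + t + 1) s'
  | iteF {e : Ex V A} {c d : Cmd V A} {s t s'} (he : e.ok B s) (hv : e.val s = 0)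
      (hd : Run h B d s t s') : Run h B (.ite e c d) s (e.cost h + 1 + t) s'
  | whT {e : Ex V A} {c : Cmd V A} {s t s' t' s''} (he : e.ok B s) (hv : e.val s ≠ 0)
      (hc : Run h B c s t s') (hw : Run h B (.wh e c) s' t' s'') :
      Run h B (.wh e c) s (e.cost h + 1 + t + 1 + t') s''
  | whF {e : Ex V A} {c : Cmd V A} {s} (he : e.ok B s) (hv : e.val s = 0) :
      Run h B (.wh e c) s (e.cost h + 1) s

/-- Only constants and sums can produce a value larger than what is stored already, and `ok` bounds
exactly these; truncated subtraction and array access cannot exceed `B`. -/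
theorem Ex.val_le {B : ℕ} {s : St V A} (hs : s.Bdd B) {e : Ex V A} (he : e.ok B s) :
    e.val s ≤ B := by
  induction e with
  | lit n => exact he
  | var x => exact hs.v x
  | add e f _ _ => exact he.2.2
  | sub e f ihe _ => exact (Nat.sub_le _ _).trans (ihe he.1)
  | get T e _ => exact hs.a _ _

/-- The side conditions of `Run` make `Bdd` an invariant, so space bounds need no separate
accounting. An index at which something is stored is itself the value of an expression, hence at
most `B`. -/
theorem Run.bdd {h B : ℕ} {c : Cmd V A} {s s' : St V A} {t : ℕ} (r : Run h B c s t s') :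
    s.Bdd B → s'.Bdd B := by
  induction r with
  | skip s => exact id
  | set s x e he =>
    intro hs
    refine ⟨fun y => ?_, hs.a, hs.z⟩
    rw [St.setV_v]; split
    · exact Ex.val_le hs he
    · exact hs.v y
  | put s T i e hi he =>
    intro hs
    refine ⟨hs.v, fun U j => ?_, fun U j hj => ?_⟩
    · rw [St.setA_a]; split
      · rw [update_apply]; split
        · exact Ex.val_le hs he
        · exact hs.a _ _
      · exact hs.a _ _
    · rw [St.setA_a]; split
      · rw [update_apply, if_neg]
        · exact hs.z _ _ hj
        · have := Ex.val_le hs hi; omega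
      · exact hs.z _ _ hj
  | wr s e he => exact fun hs => ⟨hs.v, hs.a, hs.z⟩
  | seq _ _ ih1 ih2 => exact fun hs => ih2 (ih1 hs)
  | iteT _ _ _ ih => exact ih
  | iteF _ _ _ ih => exact ih
  | whT _ _ _ _ ih1 ih2 => exact fun hs => ih2 (ih1 hs)
  | whF _ _ => exact id

namespace Cmd

/-- Does the command assign to the variable? -/
def wV : Cmd V A → V → Bool
  | set x _, y => decide (y = x)
  | seq c d, y => c.wV y || d.wV y
  | ite _ c d, y => c.wV y || d.wV y
  | wh _ c, y => c.wV y
  | _, _ => false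

/-- Does the command assign to the array? -/
def wA : Cmd V A → A → Bool
  | put T _ _, U => decide (U = T)
  | seq c d, y => c.wA y || d.wA y
  | ite _ c d, y => c.wA y || d.wA y
  | wh _ c, y => c.wA y
  | _, _ => false

/-- Does the command write to the output? -/
def wB : Cmd V A → Bool
  | wr _ => true
  | seq c d => c.wB || d.wB
  | ite _ c d => c.wB || d.wB
  | wh _ c => c.wB
  | _ => false

end Cmd

/-- The two states differ only in what the command may write. -/
structure Agree (c : Cmd V A) (s s' : St V A) : Prop where
  v : ∀ x, c.wV x = false → s'.v x = s.v x
  a : ∀ T, c.wA T = false → s'.a T = s.a T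
  buf : c.wB = false → s'.buf = s.buf

theorem Agree.refl (c : Cmd V A) (s : St V A) : Agree c s s :=
  ⟨fun _ _ => rfl, fun _ _ => rfl, fun _ => rfl⟩

theorem Agree.trans {c : Cmd V A} {s s' s'' : St V A} (h : Agree c s s') (h' : Agree c s' s'') :
    Agree c s s'' :=
  ⟨fun x hx => (h'.v x hx).trans (h.v x hx), fun x hx => (h'.a x hx).trans (h.a x hx),
    fun hx => (h'.buf hx).trans (h.buf hx)⟩

theorem Agree.mono {c d : Cmd V A} {s s' : St V A} (h : Agree c s s')
    (hv : ∀ x, d.wV x = false → c.wV x = false) (ha : ∀ x, d.wA x = false → c.wA x = false)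
    (hb : d.wB = false → c.wB = false) : Agree d s s' :=
  ⟨fun x hx => h.v x (hv x hx), fun x hx => h.a x (ha x hx), fun hx => h.buf (hb hx)⟩

/-- The frame rule. What a command may write is read off its syntax, so that for a concrete command
the preservation of a variable or an array is checked by `rfl` or `decide`. -/
theorem Run.agree {h B : ℕ} {c : Cmd V A} {s s' : St V A} {t : ℕ} (r : Run h B c s t s') :
    Agree c s s' := by
  induction r with
  | skip s => exact Agree.refl _ _
  | set s x e he =>
    exact ⟨fun y hy => by simp_all [Cmd.wV], fun _ _ => rfl, fun _ => rfl⟩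
  | put s T i e hi he =>
    exact ⟨fun _ _ => rfl, fun y hy => by simp_all [Cmd.wA], fun _ => rfl⟩
  | wr s e he => exact ⟨fun _ _ => rfl, fun _ _ => rfl, fun h => by simp [Cmd.wB] at h⟩
  | seq _ _ ih1 ih2 =>
    exact (ih1.mono (by simp +contextual [Cmd.wV]) (by simp +contextual [Cmd.wA])
      (by simp +contextual [Cmd.wB])).trans
      (ih2.mono (by simp +contextual [Cmd.wV]) (by simp +contextual [Cmd.wA])
      (by simp +contextual [Cmd.wB]))
  | iteT _ _ _ ih =>
    exact ih.mono (by simp +contextual [Cmd.wV]) (by simp +contextual [Cmd.wA])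
      (by simp +contextual [Cmd.wB])
  | iteF _ _ _ ih =>
    exact ih.mono (by simp +contextual [Cmd.wV]) (by simp +contextual [Cmd.wA])
      (by simp +contextual [Cmd.wB])
  | whT _ _ _ _ ih1 ih2 =>
    exact (ih1.mono (by simp [Cmd.wV]) (by simp [Cmd.wA]) (by simp [Cmd.wB])).trans ih2
  | whF _ _ => exact Agree.refl _ _

/-! ### Calculus of time bounds for commands -/

/-- Within `τ` steps, and without exceeding `B`, the command leads from `s` to a state in `Q`. -/
def Wp (h B : ℕ) (c : Cmd V A) (τ : ℕ) (Q : St V A → Prop) (s : St V A) : Prop :=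
  ∃ t ≤ τ, ∃ s', Run h B c s t s' ∧ Q s'

namespace Wp

variable {h B τ τ' τ₁ τ₂ : ℕ} {c d : Cmd V A} {e : Ex V A} {Q Q' R : St V A → Prop} {s : St V A}

theorem le (w : Wp h B c τ Q s) (hτ : τ ≤ τ') : Wp h B c τ' Q s :=
  let ⟨t, ht, s', r, q⟩ := w
  ⟨t, ht.trans hτ, s', r, q⟩

theorem post (w : Wp h B c τ R s) (hQ : ∀ s', Agree c s s' → R s' → Q s') : Wp h B c τ Q s :=
  let ⟨t, ht, s', r, q⟩ := w
  ⟨t, ht, s', r, hQ s' r.agree q⟩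

theorem seq (w : Wp h B c τ₁ R s) (hd : ∀ s', Agree c s s' → R s' → Wp h B d τ₂ Q s') :
    Wp h B (c ;; d) (τ₁ + τ₂) Q s := by
  obtain ⟨t, ht, s', r, q⟩ := w
  obtain ⟨t', ht', s'', r', q'⟩ := hd s' r.agree q
  exact ⟨t + t', by omega, s'', .seq r r', q'⟩

theorem iteT (he : e.ok B s) (hv : e.val s ≠ 0) (hc : Wp h B c τ Q s) :
    Wp h B (.ite e c d) (e.cost h + 2 + τ) Q s := by
  obtain ⟨t, ht, s', r, q⟩ := hc
  exact ⟨_, by omega, s', .iteT he hv r, q⟩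

theorem iteF (he : e.ok B s) (hv : e.val s = 0) (hd : Wp h B d τ Q s) :
    Wp h B (.ite e c d) (e.cost h + 2 + τ) Q s := by
  obtain ⟨t, ht, s', r, q⟩ := hd
  exact ⟨_, by omega, s', .iteF he hv r, q⟩

theorem whF (he : e.ok B s) (hv : e.val s = 0) (hQ : Q s) :
    Wp h B (.wh e c) (e.cost h + 1) Q s :=
  ⟨_, le_rfl, s, .whF he hv, hQ⟩

theorem whT (he : e.ok B s) (hv : e.val s ≠ 0)
    (hc : Wp h B c τ₁ (fun s' => Wp h B (.wh e c) τ₂ Q s') s) :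
    Wp h B (.wh e c) (e.cost h + 2 + τ₁ + τ₂) Q s := by
  obtain ⟨t, ht, s', r, t', ht', s'', r', q⟩ := hc
  exact ⟨_, by omega, s'', .whT he hv r r', q⟩

theorem skip (hQ : Q s) : Wp h B .skip τ Q s := ⟨0, Nat.zero_le _, s, .skip s, hQ⟩

/-- A loop whose measure `μ` decreases in every iteration. -/
theorem while_measure (I : St V A → Prop) (μ : St V A → ℕ) (N : ℕ)
    (hok : ∀ s, I s → e.ok B s)
    (hbody : ∀ s, I s → e.val s ≠ 0 → Wp h B c τ (fun s' => I s' ∧ μ s' < μ s) s)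
    (hI : I s) (hN : μ s ≤ N) :
    Wp h B (.wh e c) (N * (e.cost h + 2 + τ) + e.cost h + 1)
      (fun s' => I s' ∧ e.val s' = 0) s := by
  induction N generalizing s with
  | zero =>
    have hv : e.val s = 0 := by
      by_contra hv
      obtain ⟨t, ht, s', r, q⟩ := hbody s hI hv
      omega
    exact (whF (hok s hI) hv ⟨hI, hv⟩).le (by omega)
  | succ N ih =>
    by_cases hv : e.val s = 0
    · exact (whF (hok s hI) hv ⟨hI, hv⟩).le (by omega)
    · refine (whT (hok s hI) hv ((hbody s hI hv).post fun s' _ hs' => ih hs'.1 (by omega))).le ?_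
      rw [Nat.succ_mul]; omega

end Wp

/-- `for i < l do c` -/
def Cmd.for (i l : V) (c : Cmd V A) : Cmd V A :=
  .set i 0 ;; .wh (Ex.var l - Ex.var i) (c ;; .set i (Ex.var i + 1))

/-- The invariant `I t` speaks of the state in which the counter already has the value `t`, hence
the `setV` in the obligation for the body. The agreement with the state before the loop keeps
untouched data out of the invariant. Of the 9 extra steps of an iteration 5 are the test with its
jumps and 4 the increment; the final 6 are the initialization and the failing test. -/
theorem Wp.for {h B τ N : ℕ} {i l : V} {c : Cmd V A} {s : St V A}
    (I : ℕ → St V A → Prop) (hil : i ≠ l) (hi : c.wV i = false) (hl : c.wV l = false)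
    (hB : N ≤ B) (hN : s.v l = N) (h0 : I 0 (s.setV i 0))
    (hc : ∀ t < N, ∀ s', Agree (Cmd.for i l c) s s' → s'.v i = t → s'.v l = N → I t s' →
      Wp h B c τ (fun s'' => I (t + 1) (s''.setV i (t + 1))) s') :
    Wp h B (Cmd.for i l c) (N * (τ + 9) + 6) (I N) s := by
  have hag : ∀ {s s' : St V A}, Agree c s s' → Agree (Cmd.for i l c) s s' := fun h =>
    h.mono (by simp +contextual [Cmd.for, Cmd.wV]) (by simp +contextual [Cmd.for, Cmd.wA])
      (by simp +contextual [Cmd.for, Cmd.wB])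
  have hset : ∀ (s : St V A) n, Agree (Cmd.for i l c) s (s.setV i n) := fun s n =>
    ⟨fun x hx => by
      have : x ≠ i := by rintro rfl; simp [Cmd.for, Cmd.wV] at hx
      simp [this], fun _ _ => rfl, fun _ => rfl⟩
  have key : ∀ m t, t + m = N → ∀ s', Agree (Cmd.for i l c) s s' → s'.v i = t → s'.v l = N →
      I t s' → Wp h B (.wh (Ex.var l - Ex.var i) (c ;; .set i (Ex.var i + 1)))
        (m * (τ + 9) + 4) (I N) s' := by
    intro m
    induction m with
    | zero =>
      intro t ht s' hs hi' hl' hI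
      obtain rfl : t = N := by omega
      exact (Wp.whF (e := Ex.var l - Ex.var i) (by simp) (by simp [hi', hl'])
        hI).le (by simp)
    | succ m ih =>
      intro t ht s' hs hi' hl' hI
      refine (Wp.whT (τ₁ := τ + 4) (τ₂ := m * (τ + 9) + 4) (e := Ex.var l - Ex.var i)
        (by simp) (by simp [hi', hl']; omega) ?_).le ?_
      · refine Wp.seq (hc t (by omega) s' hs hi' hl' hI) fun s'' hs'' hI'' => ?_
        have e1 : s''.v i = t := (hs''.v i hi).trans hi'
        have e2 : s''.v l = N := (hs''.v l hl).trans hl'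
        refine ⟨4, le_rfl, _, .set _ _ _ ?_, ?_⟩
        · simp [e1]; omega
        · simp only [Ex.val_add, Ex.val_var, e1, Ex.val_ofNat]
          refine ih (t + 1) (by omega) _ ((hs.trans (hag hs'')).trans (hset _ _)) (by simp) ?_ hI''
          simp [hil.symm, e2]
      · simp
        rw [Nat.succ_mul]; omega
  refine (Wp.seq (τ₁ := 2) (τ₂ := N * (τ + 9) + 4)
    (R := fun s' => s' = s.setV i 0) ⟨_, le_rfl, _, .set _ _ _ (by simp), rfl⟩ ?_).le (by omega)
  rintro s' - rfl
  exact key N 0 (by omega) _ (hset _ _) (by simp) (by simp [hil.symm, hN]) h0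

/-! ### Loop-free commands -/

namespace Cmd

/-- Effect of a loop-free command. -/
def sem : Cmd V A → St V A → St V A
  | skip, s => s
  | set x e, s => s.setV x (e.val s)
  | put T i e, s => s.setA T (i.val s) (e.val s)
  | wr e, s => s.setB (e.val s)
  | seq c d, s => d.sem (c.sem s)
  | ite e c d, s => if e.val s = 0 then d.sem s else c.sem s
  | wh _ _, s => s

/-- The constants and sums computed by a loop-free command are at most `B`. -/
def okL (B : ℕ) : Cmd V A → St V A → Prop
  | skip, _ => True
  | set _ e, s => e.ok B s
  | put _ i e, s => i.ok B s ∧ e.ok B s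
  | wr e, s => e.ok B s
  | seq c d, s => c.okL B s ∧ d.okL B (c.sem s)
  | ite e c d, s => e.ok B s ∧ if e.val s = 0 then d.okL B s else c.okL B s
  | wh _ _, _ => False

/-- Bound for the running time of a loop-free command. -/
def costL (h : ℕ) : Cmd V A → ℕ
  | skip => 0
  | set _ e => e.cost h + 1
  | put _ i e => i.cost h + (h + 2) + e.cost h + 1
  | wr e => e.cost h + 1
  | seq c d => c.costL h + d.costL h
  | ite e c d => e.cost h + 2 + (c.costL h + d.costL h)
  | wh _ _ => 0

end Cmd

/-- For loop-free code the obligations separate: the cost is a closed numeral when the code is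
concrete, and admissibility and effect are computed by `simp`. The cost charges both branches of a
conditional; loops are excluded because `okL` is false on them. -/
theorem Wp.straight {h B τ : ℕ} {c : Cmd V A} {Q : St V A → Prop} {s : St V A}
    (hτ : c.costL h ≤ τ) (hok : c.okL B s) (hQ : Q (c.sem s)) : Wp h B c τ Q s := by
  suffices H : ∃ t ≤ c.costL h, Run h B c s t (c.sem s) by
    obtain ⟨t, ht, r⟩ := H
    exact ⟨t, ht.trans hτ, _, r, hQ⟩
  clear hQ hτ
  induction c generalizing s with
  | skip => exact ⟨_, le_rfl, .skip s⟩
  | set x e => exact ⟨_, le_rfl, .set _ _ _ hok⟩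
  | put T i e => exact ⟨_, le_rfl, .put _ _ _ _ hok.1 hok.2⟩
  | wr e => exact ⟨_, le_rfl, .wr _ _ hok⟩
  | seq c d ihc ihd =>
    obtain ⟨t, ht, r⟩ := ihc hok.1
    obtain ⟨t', ht', r'⟩ := ihd hok.2
    exact ⟨_, Nat.add_le_add ht ht', .seq r r'⟩
  | ite e c d ihc ihd =>
    obtain ⟨h1, h2⟩ := hok
    by_cases hv : e.val s = 0
    · rw [if_pos hv] at h2
      obtain ⟨t, ht, r⟩ := ihd h2
      refine ⟨_, ?_, by simpa [Cmd.sem, hv] using Run.iteF h1 hv r⟩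
      simp only [Cmd.costL]; omega
    · rw [if_neg hv] at h2
      obtain ⟨t, ht, r⟩ := ihc h2
      refine ⟨_, ?_, by simpa [Cmd.sem, hv] using Run.iteT h1 hv r⟩
      simp only [Cmd.costL]; omega
  | wh e c => exact hok.elim

end

end WhileRAM

/-! ## Compilation to random access machines -/

namespace WhileRAM

open Function RAM

set_option linter.unusedSectionVars false

/-- Placement of variables and arrays on the machine: the variable `x` is the register `2 * reg x`,
odd registers are auxiliary, and the array `T` occupies the cells `2 ^ h * i + cell T`. -/
structure Layout (V A : Type) where
  h : ℕ
  reg : V → ℕ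
  reg_inj : Injective reg
  cell : A → ℕ
  cell_lt : ∀ T, cell T < 2 ^ h
  cell_inj : Injective cell

variable {V A : Type} [DecidableEq V] [DecidableEq A]

/-- Code that computes an expression in the auxiliary register number `d`. -/
def compE (L : Layout V A) : Ex V A → ℕ → List Instr
  | .lit n, d => [.const (2 * d + 1) n]
  | .var x, d => [.move (2 * d + 1) (2 * L.reg x)]
  | .add e f, d =>
    compE L e d ++ (compE L f (d + 1) ++ [.add (2 * d + 1) (2 * d + 1) (2 * (d + 1) + 1)])
  | .sub e f, d =>
    compE L e d ++ (compE L f (d + 1) ++ [.sub (2 * d + 1) (2 * d + 1) (2 * (d + 1) + 1)])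
  | .get T e, d =>
    compE L e d ++ (List.replicate L.h (.add (2 * d + 1) (2 * d + 1) (2 * d + 1)) ++
      [.const (2 * (d + 1) + 1) (L.cell T), .add (2 * d + 1) (2 * d + 1) (2 * (d + 1) + 1),
        .load (2 * d + 1) (2 * d + 1)])

/-- Number of instructions of the code of a command. -/
def Cmd.len (L : Layout V A) : Cmd V A → ℕ
  | skip => 0
  | set _ e => e.cost L.h + 1
  | put _ i e => i.cost L.h + (L.h + 2) + e.cost L.h + 1
  | wr e => e.cost L.h + 1
  | seq c d => c.len L + d.len L
  | ite e c d => e.cost L.h + 1 + c.len L + 1 + d.len L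
  | wh e c => e.cost L.h + 1 + c.len L + 1

/-- Code of a command, to be placed at the address `p`. -/
def compC (L : Layout V A) : Cmd V A → ℕ → List Instr
  | .skip, _ => []
  | .set x e, _ => compE L e 0 ++ [.move (2 * L.reg x) 1]
  | .put T i e, _ =>
    compE L i 0 ++ (List.replicate L.h (.add 1 1 1) ++ ([.const 3 (L.cell T), .add 1 1 3] ++
      (compE L e 1 ++ [.store 1 3])))
  | .wr e, _ => compE L e 0 ++ [.write 1]
  | .seq c d, p => compC L c p ++ compC L d (p + c.len L)
  | .ite e c d, p =>
    compE L e 0 ++ ([.jumpZero 1 (p + e.cost L.h + 1 + c.len L + 1)] ++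
      (compC L c (p + e.cost L.h + 1) ++
        ([.jump (p + (e.cost L.h + 1 + c.len L + 1 + d.len L))] ++
          compC L d (p + e.cost L.h + 1 + c.len L + 1))))
  | .wh e c, p =>
    compE L e 0 ++ ([.jumpZero 1 (p + (e.cost L.h + 1 + c.len L + 1))] ++
      (compC L c (p + e.cost L.h + 1) ++ [.jump p]))

theorem compE_length (L : Layout V A) (e : Ex V A) (d : ℕ) :
    (compE L e d).length = e.cost L.h := by
  induction e generalizing d with
  | lit n => rfl
  | var x => rfl
  | add e f ihe ihf => simp [compE, ihe, ihf, Ex.cost]; omega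
  | sub e f ihe ihf => simp [compE, ihe, ihf, Ex.cost]; omega
  | get T e ih => simp [compE, ih, Ex.cost]; omega

theorem compC_length (L : Layout V A) (c : Cmd V A) (p : ℕ) :
    (compC L c p).length = c.len L := by
  induction c generalizing p with
  | skip => rfl
  | set x e => simp [compC, compE_length, Cmd.len]
  | put T i e => simp [compC, compE_length, Cmd.len]; omega
  | wr e => simp [compC, compE_length, Cmd.len]
  | seq c d ihc ihd => simp [compC, ihc, ihd, Cmd.len]
  | ite e c d ihc ihd => simp [compC, compE_length, ihc, ihd, Cmd.len]; omega
  | wh e c ih => simp [compC, compE_length, ih, Cmd.len]; omega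

/-! ### Simulation of commands by compiled code -/

/-- The code `l` stands in the program `P` from the address `p` on. -/
def CodeAt (P : Program) (p : ℕ) (l : List Instr) : Prop :=
  ∀ i, (hi : i < l.length) → P[p + i]? = some l[i]

theorem CodeAt.left {P : Program} {p : ℕ} {l l' : List Instr} (h : CodeAt P p (l ++ l')) :
    CodeAt P p l := fun i hi => by
  rw [h i (by simp; omega), List.getElem_append_left hi]

theorem CodeAt.right {P : Program} {p : ℕ} {l l' : List Instr} (h : CodeAt P p (l ++ l')) :
    CodeAt P (p + l.length) l' := fun i hi => by
  have := h (l.length + i) (by simp; omega)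
  rw [← Nat.add_assoc] at this
  rw [this, List.getElem_append_right (by omega)]
  simp

theorem CodeAt.right' {P : Program} {p q : ℕ} {l l' : List Instr} (h : CodeAt P p (l ++ l'))
    (hq : q = p + l.length) : CodeAt P q l' := hq ▸ h.right

theorem CodeAt.head {P : Program} {p : ℕ} {a : Instr} {l : List Instr} (h : CodeAt P p (a :: l)) :
    P[p]? = some a := h 0 (by simp)

theorem CodeAt.tail {P : Program} {p : ℕ} {a : Instr} {l : List Instr} (h : CodeAt P p (a :: l)) :
    CodeAt P (p + 1) l := by
  simpa using CodeAt.right (l := [a]) (l' := l) h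

theorem CodeAt.of_eq {P l₁ l l₂ : List Instr} (h : P = l₁ ++ (l ++ l₂)) :
    CodeAt P l₁.length l := fun i hi => by
  subst h
  rw [List.getElem?_append_right (by omega), List.getElem?_append_left (by omega)]
  simp

/-- Register contents and contents and addresses of the memory cells in use are at most `B`. -/
structure CBdd (B : ℕ) (s : Config) : Prop where
  reg : ∀ r, s.reg r ≤ B
  mem : ∀ a, s.mem a ≤ B
  z : ∀ a, B < a → s.mem a = 0

/-- The machine goes from `s` to `s'` in `t` steps without output and without exceeding `B`. -/
def Reach (P : Program) (B t : ℕ) (s s' : Config) : Prop :=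
  (step P)^[t] s = s' ∧
    ∀ i < t, CBdd B ((step P)^[i] s) ∧ P[((step P)^[i] s).pc]? ≠ some .emit

theorem Reach.refl (P : Program) (B : ℕ) (s : Config) : Reach P B 0 s s :=
  ⟨rfl, fun _ hi => absurd hi (Nat.not_lt_zero _)⟩

theorem Reach.trans {P : Program} {B t t' : ℕ} {s s' s'' : Config} (h : Reach P B t s s')
    (h' : Reach P B t' s' s'') : Reach P B (t + t') s s'' := by
  refine ⟨by rw [Nat.add_comm, iterate_add_apply, h.1, h'.1], fun i hi => ?_⟩
  by_cases hit : i < t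
  · exact h.2 i hit
  · have : (step P)^[i] s = (step P)^[i - t] s' := by
      rw [← h.1, ← iterate_add_apply]; congr 2; omega
    rw [this]
    exact h'.2 _ (by omega)

theorem Reach.one {P : Program} {B : ℕ} {s : Config} {a : Instr} (ha : P[s.pc]? = some a)
    (hne : a ≠ .emit) (hs : CBdd B s) : Reach P B 1 s (exec a s) := by
  refine ⟨by simp [step, ha], fun i hi => ?_⟩
  obtain rfl : i = 0 := by omega
  exact ⟨hs, by simpa [ha] using hne⟩

theorem CBdd.setReg {B : ℕ} {s : Config} (hs : CBdd B s) {p d n : ℕ} (hn : n ≤ B) :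
    CBdd B { s with pc := p, reg := update s.reg d n } :=
  ⟨fun r => by
    change update s.reg d n r ≤ B
    rw [update_apply]; split
    · exact hn
    · exact hs.reg r, hs.mem, hs.z⟩

/-- The configuration `s'` differs from `s` in auxiliary registers with number at least `d` and in
the program counter only. -/
structure SameUpTo (d : ℕ) (s s' : Config) : Prop where
  var : ∀ r, s'.reg (2 * r) = s.reg (2 * r)
  aux : ∀ r < d, s'.reg (2 * r + 1) = s.reg (2 * r + 1)
  mem : s'.mem = s.mem
  buf : s'.buf = s.buf
  out : s'.out = s.out

theorem SameUpTo.trans {d d' : ℕ} (hd : d ≤ d') {s s' s'' : Config} (h : SameUpTo d s s')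
    (h' : SameUpTo d' s' s'') : SameUpTo d s s'' :=
  ⟨fun r => (h'.var r).trans (h.var r), fun r hr => (h'.aux r (by omega)).trans (h.aux r hr),
    h'.mem.trans h.mem, h'.buf.trans h.buf, h'.out.trans h.out⟩

theorem sameUpTo_setReg (d : ℕ) (s : Config) {e : ℕ} (he : d ≤ e) (p n : ℕ) :
    SameUpTo d s { s with pc := p, reg := update s.reg (2 * e + 1) n } :=
  ⟨fun r => update_of_ne (by omega) _ _, fun r hr => update_of_ne (by omega) _ _, rfl, rfl, rfl⟩

/-- The configuration represents the state of the structured language. -/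
structure Sim (L : Layout V A) (B : ℕ) (s : St V A) (cf : Config) : Prop where
  v : ∀ x, cf.reg (2 * L.reg x) = s.v x
  a : ∀ T i, cf.mem (2 ^ L.h * i + L.cell T) = s.a T i
  buf : cf.buf = s.buf
  bdd : CBdd B cf

theorem Sim.same {L : Layout V A} {B d : ℕ} {s : St V A} {cf cf' : Config} (h : Sim L B s cf)
    (h' : SameUpTo d cf cf') (hb : CBdd B cf') : Sim L B s cf' :=
  ⟨fun x => (h'.var _).trans (h.v x), fun T i => by rw [h'.mem, h.a], h'.buf.trans h.buf, hb⟩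

/-- Scaling of an address. -/
theorem reach_double {P : Program} {B d : ℕ} (h : ℕ) {cf : Config}
    (hc : CodeAt P cf.pc (List.replicate h (.add (2 * d + 1) (2 * d + 1) (2 * d + 1))))
    (hb : CBdd B cf) (hB : 2 ^ h * cf.reg (2 * d + 1) ≤ B) :
    ∃ cf', Reach P B h cf cf' ∧ cf'.pc = cf.pc + h ∧
      cf'.reg (2 * d + 1) = 2 ^ h * cf.reg (2 * d + 1) ∧ SameUpTo d cf cf' ∧ CBdd B cf' := by
  induction h generalizing cf with
  | zero => exact ⟨cf, Reach.refl _ _ _, rfl, by simp, ⟨fun _ => rfl, fun _ _ => rfl, rfl, rfl, rfl⟩, hb⟩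
  | succ h ih =>
    rw [List.replicate_succ] at hc
    -- The intermediate doublings stay below the final value, so the bound on the scaled address
    -- suffices.
    have h2 : cf.reg (2 * d + 1) + cf.reg (2 * d + 1) ≤ B := by
      refine le_trans ?_ hB
      rw [pow_succ, Nat.mul_assoc, ← Nat.two_mul]
      exact Nat.le_mul_of_pos_left _ (by positivity)
    have r1 := Reach.one hc.head (by simp) hb
    obtain ⟨cf', r2, hpc, hv, hsame, hb'⟩ := ih
      (cf := exec (.add (2 * d + 1) (2 * d + 1) (2 * d + 1)) cf) hc.tail (hb.setReg h2) (by
        simp only [exec, update_self]; rw [← Nat.two_mul, ← Nat.mul_assoc, ← pow_succ]; exact hB)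
    refine ⟨cf', by rw [Nat.add_comm]; exact r1.trans r2, ?_, ?_, ?_, hb'⟩
    · rw [hpc]; simp only [exec]; omega
    · rw [hv]; simp only [exec, update_self]; rw [← Nat.two_mul, ← Nat.mul_assoc, ← pow_succ]
    · exact (sameUpTo_setReg d cf le_rfl _ _).trans le_rfl hsame

/-- Reading of the address of an array entry. -/
theorem addr_le {L : Layout V A} {B B' i : ℕ} (hBB : 2 ^ L.h * (B + 1) ≤ B') (hi : i ≤ B) (T : A) :
    2 ^ L.h * i + L.cell T ≤ B' := by
  have := L.cell_lt T
  have h2 : 2 ^ L.h * i ≤ 2 ^ L.h * B := Nat.mul_le_mul_left _ hi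
  rw [Nat.mul_add] at hBB
  omega

/-- The machine cannot multiply, so the factor `2 ^ L.h` comes from `L.h` doublings. Interleaving
the arrays in this way keeps them disjoint although their lengths are not known in advance. -/
theorem reach_addr {L : Layout V A} {P : Program} {B B' d i : ℕ} {cf : Config} {l : List Instr}
    {T : A}
    (hBB : 2 ^ L.h * (B + 1) ≤ B')
    (hc : CodeAt P cf.pc (List.replicate L.h (.add (2 * d + 1) (2 * d + 1) (2 * d + 1)) ++
      ([.const (2 * (d + 1) + 1) (L.cell T),
        .add (2 * d + 1) (2 * d + 1) (2 * (d + 1) + 1)] ++ l)))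
    (hb : CBdd B' cf) (hi : cf.reg (2 * d + 1) = i) (hiB : i ≤ B) :
    ∃ cf', Reach P B' (L.h + 2) cf cf' ∧ cf'.pc = cf.pc + (L.h + 2) ∧
      cf'.reg (2 * d + 1) = 2 ^ L.h * i + L.cell T ∧ SameUpTo d cf cf' ∧ CBdd B' cf' := by
  have haddr := addr_le hBB hiB T
  obtain ⟨c1, r1, p1, v1, s1, b1⟩ := reach_double L.h hc.left hb (by rw [hi]; omega)
  have hc2 := hc.right
  rw [List.length_replicate, ← p1] at hc2
  have r2 := Reach.one hc2.head (by simp) b1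
  have b2 : CBdd B' (exec (.const (2 * (d + 1) + 1) (L.cell T)) c1) := b1.setReg (by omega)
  have r3 := Reach.one (s := exec (.const (2 * (d + 1) + 1) (L.cell T)) c1) hc2.tail.head
    (by simp) b2
  refine ⟨_, (r1.trans r2).trans r3, ?_, ?_, ?_, ?_⟩
  · simp only [exec, p1]; omega
  · simp only [exec, update_self]
    rw [update_of_ne (by omega), v1, hi]
  · exact s1.trans le_rfl ((sameUpTo_setReg d c1 (by omega) _ _).trans le_rfl
      (sameUpTo_setReg d _ le_rfl _ _))
  · refine b2.setReg ?_
    simp only [exec, update_self]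
    rw [update_of_ne (by omega), v1, hi]; exact haddr

/-- The auxiliary registers form an evaluation stack: the code of a second operand touches only
numbers above `d`, so the first operand survives in number `d`. -/
theorem reach_compE {L : Layout V A} {P : Program} {B B' : ℕ} (hBB : 2 ^ L.h * (B + 1) ≤ B')
    {s : St V A} (hs : s.Bdd B) (e : Ex V A) (d : ℕ) (he : e.ok B s) (cf : Config)
    (hc : CodeAt P cf.pc (compE L e d)) (hsim : Sim L B' s cf) :
    ∃ cf', Reach P B' (e.cost L.h) cf cf' ∧ cf'.pc = cf.pc + e.cost L.h ∧
      cf'.reg (2 * d + 1) = e.val s ∧ SameUpTo d cf cf' ∧ CBdd B' cf' := by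
  have hB : B ≤ B' := by
    refine le_trans ?_ hBB
    exact (Nat.le_succ _).trans (Nat.le_mul_of_pos_left _ (by positivity))
  induction e generalizing d cf with
  | lit n =>
    exact ⟨_, Reach.one (CodeAt.head hc) (by simp) hsim.bdd, rfl, update_self _ _ _,
      sameUpTo_setReg d cf le_rfl _ _, hsim.bdd.setReg (le_trans he hB)⟩
  | var x =>
    refine ⟨_, Reach.one (CodeAt.head hc) (by simp) hsim.bdd, rfl, ?_,
      sameUpTo_setReg d cf le_rfl _ _, hsim.bdd.setReg (hsim.bdd.reg _)⟩
    simp only [exec, update_self, hsim.v, Ex.val]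
  | add e f ihe ihf =>
    obtain ⟨c1, r1, p1, v1, s1, b1⟩ := ihe d he.1 cf hc.left hsim
    have hc2 := hc.right
    rw [compE_length, ← p1] at hc2
    obtain ⟨c2, r2, p2, v2, s2, b2⟩ := ihf (d + 1) he.2.1 c1 hc2.left (hsim.same s1 b1)
    have hc3 := hc2.right
    rw [compE_length, ← p2] at hc3
    have r3 := Reach.one hc3.head (by simp) b2
    have hv : c2.reg (2 * d + 1) + c2.reg (2 * (d + 1) + 1) = e.val s + f.val s := by
      rw [v2, s2.aux d (by omega), v1]
    refine ⟨_, (r1.trans r2).trans r3, ?_, ?_, ?_, ?_⟩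
    · simp only [exec, p2, p1, Ex.cost]; omega
    · simp only [exec, update_self, hv, Ex.val]
    · exact (s1.trans (by omega) s2).trans le_rfl (sameUpTo_setReg d _ le_rfl _ _)
    · exact b2.setReg (by rw [hv]; exact he.2.2.trans hB)
  | sub e f ihe ihf =>
    obtain ⟨c1, r1, p1, v1, s1, b1⟩ := ihe d he.1 cf hc.left hsim
    have hc2 := hc.right
    rw [compE_length, ← p1] at hc2
    obtain ⟨c2, r2, p2, v2, s2, b2⟩ := ihf (d + 1) he.2 c1 hc2.left (hsim.same s1 b1)
    have hc3 := hc2.right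
    rw [compE_length, ← p2] at hc3
    have r3 := Reach.one hc3.head (by simp) b2
    have hv : c2.reg (2 * d + 1) - c2.reg (2 * (d + 1) + 1) = e.val s - f.val s := by
      rw [v2, s2.aux d (by omega), v1]
    refine ⟨_, (r1.trans r2).trans r3, ?_, ?_, ?_, ?_⟩
    · simp only [exec, p2, p1, Ex.cost]; omega
    · simp only [exec, update_self, hv, Ex.val]
    · exact (s1.trans (by omega) s2).trans le_rfl (sameUpTo_setReg d _ le_rfl _ _)
    · exact b2.setReg ((Nat.sub_le _ _).trans (b2.reg _))
  | get T e ih =>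
    obtain ⟨c1, r1, p1, v1, s1, b1⟩ := ih d he cf hc.left hsim
    have hc2 := hc.right
    rw [compE_length, ← p1] at hc2
    obtain ⟨c2, r2, p2, v2, s2, b2⟩ := reach_addr (l := [.load (2 * d + 1) (2 * d + 1)])
      hBB hc2 b1 v1 (Ex.val_le hs he)
    have hc3 : CodeAt P c2.pc [.load (2 * d + 1) (2 * d + 1)] := by
      have := (hc2.right).tail.tail
      rwa [List.length_replicate, Nat.add_assoc, Nat.add_assoc, ← p2] at this
    have r3 := Reach.one hc3.head (by simp) b2
    have hs2 := s1.trans le_rfl s2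
    refine ⟨_, (r1.trans r2).trans r3, ?_, ?_, ?_, ?_⟩
    · simp only [exec, p2, p1, Ex.cost]; omega
    · simp only [exec, update_self, v2, hs2.mem, hsim.a, Ex.val]
    · exact hs2.trans le_rfl (sameUpTo_setReg d _ le_rfl _ _)
    · exact b2.setReg (b2.mem _)

theorem CBdd.setPc {B : ℕ} {s : Config} (hs : CBdd B s) (p : ℕ) : CBdd B { s with pc := p } :=
  ⟨hs.reg, hs.mem, hs.z⟩

theorem Sim.setPc {L : Layout V A} {B : ℕ} {s : St V A} {cf : Config} (h : Sim L B s cf) (p : ℕ) :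
    Sim L B s { cf with pc := p } := ⟨h.v, h.a, h.buf, h.bdd.setPc p⟩

/-- Compiled code simulates the structured language. -/
theorem reach_compC {L : Layout V A} {P : Program} {B B' : ℕ} (hBB : 2 ^ L.h * (B + 1) ≤ B')
    {c : Cmd V A} {s s' : St V A} {t : ℕ} (r : Run L.h B c s t s') :
    ∀ cf, s.Bdd B → CodeAt P cf.pc (compC L c cf.pc) → Sim L B' s cf →
    ∃ cf', Reach P B' t cf cf' ∧ cf'.pc = cf.pc + c.len L ∧ Sim L B' s' cf' ∧
      cf'.out = cf.out := by
  have hB : B ≤ B' := by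
    refine le_trans ?_ hBB
    exact (Nat.le_succ _).trans (Nat.le_mul_of_pos_left _ (by positivity))
  induction r with
  | skip s => exact fun cf hs _ h => ⟨cf, Reach.refl _ _ _, rfl, h, rfl⟩
  | set s x e he =>
    intro cf hs hc h
    obtain ⟨c1, r1, p1, v1, s1, b1⟩ := reach_compE hBB hs e 0 he cf hc.left h
    have hc2 := hc.right
    rw [compE_length, ← p1] at hc2
    have r2 := Reach.one hc2.head (by simp) b1
    refine ⟨_, r1.trans r2, ?_, ⟨fun y => ?_, fun T i => ?_, ?_, ?_⟩, s1.out⟩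
    · simp only [exec, p1, Cmd.len]; omega
    · simp only [exec, St.setV_v, update_apply]
      by_cases hy : y = x
      · subst hy; simpa using v1
      · have : 2 * L.reg y ≠ 2 * L.reg x := fun h => hy (L.reg_inj (by omega))
        rw [if_neg this, if_neg hy, s1.var, h.v]
    · simp only [exec, s1.mem, h.a, St.setV_a]
    · simp only [exec, s1.buf, h.buf, St.setV_buf]
    · exact b1.setReg (b1.reg _)
  | put s T i e hi he =>
    intro cf hs hc h
    obtain ⟨c1, r1, p1, v1, s1, b1⟩ := reach_compE hBB hs i 0 hi cf hc.left h
    have hc2 := hc.right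
    rw [compE_length, ← p1] at hc2
    obtain ⟨c2, r2, p2, v2, s2, b2⟩ := reach_addr hBB hc2 b1 v1 (Ex.val_le hs hi)
    have hc3 : CodeAt P c2.pc (compE L e 1 ++ [.store 1 3]) := by
      have := hc2.right.right
      rwa [List.length_replicate, List.length_cons, List.length_singleton, Nat.add_assoc,
        ← p2] at this
    have s12 := s1.trans le_rfl s2
    obtain ⟨c3, r3, p3, v3, s3, b3⟩ := reach_compE hBB hs e 1 he c2 hc3.left (h.same s12 b2)
    have hc4 := hc3.right
    rw [compE_length, ← p3] at hc4
    have r4 := Reach.one hc4.head (by simp) b3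
    have hval := Ex.val_le hs he
    have s13 := s12.trans (by omega) s3
    have v1' : c3.reg 1 = 2 ^ L.h * i.val s + L.cell T := by
      rw [← v2]; exact s3.aux 0 (by omega)
    have v3' : c3.reg 3 = e.val s := v3
    have haddr := addr_le hBB (Ex.val_le hs hi) T
    refine ⟨_, ((r1.trans r2).trans r3).trans r4, ?_, ⟨fun y => ?_, fun U j => ?_, ?_, ?_⟩, s13.out⟩
    · simp only [exec, p3, p2, p1, Cmd.len]; omega
    · simp only [exec, St.setA_v]; rw [s13.var, h.v]
    · simp only [exec, v1', v3', St.setA_a, update_apply]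
      -- Each array owns one residue class modulo `2 ^ L.h`, so storing in one array leaves the
      -- others alone.
      have hdm : ∀ (W : A) (k : ℕ), (2 ^ L.h * k + L.cell W) % 2 ^ L.h = L.cell W := fun W k => by
        rw [Nat.mul_add_mod, Nat.mod_eq_of_lt (L.cell_lt W)]
      by_cases hU : U = T
      · subst hU
        by_cases hj : j = i.val s
        · subst hj; simp
        · have : 2 ^ L.h * j ≠ 2 ^ L.h * i.val s := fun hh =>
            hj (Nat.eq_of_mul_eq_mul_left (by positivity) hh)
          rw [if_neg (by omega), if_pos rfl, update_of_ne hj, s13.mem, h.a]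
      · have : 2 ^ L.h * j + L.cell U ≠ 2 ^ L.h * i.val s + L.cell T := fun hh =>
          hU (L.cell_inj (by rw [← hdm U j, hh, hdm]))
        rw [if_neg this, if_neg hU, s13.mem, h.a]
    · simp only [exec, s13.buf, h.buf, St.setA_buf]
    · refine ⟨b3.reg, fun a => ?_, fun a ha => ?_⟩
      · simp only [exec, v1', v3', update_apply]
        split
        · omega
        · exact b3.mem a
      · simp only [exec, v1', v3', update_apply]
        rw [if_neg (by omega)]
        exact b3.z a ha
  | wr s e he =>
    intro cf hs hc h
    obtain ⟨c1, r1, p1, v1, s1, b1⟩ := reach_compE hBB hs e 0 he cf hc.left h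
    have hc2 := hc.right
    rw [compE_length, ← p1] at hc2
    have r2 := Reach.one hc2.head (by simp) b1
    have h1 := h.same s1 b1
    refine ⟨_, r1.trans r2, ?_, ⟨h1.v, h1.a, ?_, ⟨b1.reg, b1.mem, b1.z⟩⟩, s1.out⟩
    · simp only [exec, p1, Cmd.len]; omega
    · simp only [exec, h1.buf, St.setB_buf]
      congr 2
  | seq _ _ ih1 ih2 =>
    rename_i c d s t s' t' s'' rc rd
    intro cf hs hc h
    obtain ⟨c1, r1, p1, h1, o1⟩ := ih1 cf hs hc.left h
    have hc2 := hc.right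
    rw [compC_length, ← p1] at hc2
    obtain ⟨c2, r2, p2, h2, o2⟩ := ih2 c1 (rc.bdd hs) hc2 h1
    exact ⟨c2, r1.trans r2, by rw [p2, p1, Cmd.len, Nat.add_assoc], h2, o2.trans o1⟩
  | iteT he hv _ ih =>
    rename_i e c d s t s' rc
    intro cf hs hc h
    obtain ⟨c1, r1, p1, v1, s1, b1⟩ := reach_compE hBB hs e 0 he cf hc.left h
    have hc2 := hc.right' (p1.trans (by rw [compE_length]))
    have r2 := Reach.one hc2.left.head (by simp) b1
    have v1' : c1.reg 1 = e.val s := v1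
    have e2 : exec (.jumpZero 1 (cf.pc + e.cost L.h + 1 + c.len L + 1)) c1
        = { c1 with pc := c1.pc + 1 } := by
      simp only [exec, v1', if_neg hv]
    rw [e2] at r2
    have hc3 := hc2.right
    rw [List.length_singleton] at hc3
    obtain ⟨c3, r3, p3, h3, o3⟩ := ih { c1 with pc := c1.pc + 1 } hs
      (by simpa only [p1] using hc3.left) ((h.same s1 b1).setPc _)
    have hc4 := hc3.right
    rw [compC_length] at hc4
    have hc4' : P[c3.pc]? = some (.jump (cf.pc + (e.cost L.h + 1 + c.len L + 1 + d.len L))) := by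
      rw [p3]; exact hc4.left.head
    have r4 := Reach.one hc4' (by simp) h3.bdd
    refine ⟨_, ((r1.trans r2).trans r3).trans r4, ?_, h3.setPc _, ?_⟩
    · simp only [exec, Cmd.len]
    · simp only [exec, o3, s1.out]
  | iteF he hv _ ih =>
    rename_i e c d s t s' rd
    intro cf hs hc h
    obtain ⟨c1, r1, p1, v1, s1, b1⟩ := reach_compE hBB hs e 0 he cf hc.left h
    have hc2 := hc.right' (p1.trans (by rw [compE_length]))
    have r2 := Reach.one hc2.left.head (by simp) b1
    have v1' : c1.reg 1 = e.val s := v1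
    have e2 : exec (.jumpZero 1 (cf.pc + e.cost L.h + 1 + c.len L + 1)) c1
        = { c1 with pc := cf.pc + e.cost L.h + 1 + c.len L + 1 } := by
      simp only [exec, v1', if_pos hv]
    rw [e2] at r2
    have hc3 := hc2.right.right.right
    rw [List.length_singleton, List.length_singleton, compC_length] at hc3
    obtain ⟨c3, r3, p3, h3, o3⟩ := ih { c1 with pc := cf.pc + e.cost L.h + 1 + c.len L + 1 } hs
      (by simpa only [p1] using hc3) ((h.same s1 b1).setPc _)
    refine ⟨c3, (r1.trans r2).trans r3, ?_, h3, ?_⟩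
    · simp only [p3, Cmd.len]; omega
    · simp only [o3, s1.out]
  | whT he hv _ _ ih1 ih2 =>
    rename_i e c s t s' t' s'' rc rw'
    intro cf hs hc h
    obtain ⟨c1, r1, p1, v1, s1, b1⟩ := reach_compE hBB hs e 0 he cf hc.left h
    have hc2 := hc.right' (p1.trans (by rw [compE_length]))
    have r2 := Reach.one hc2.left.head (by simp) b1
    have v1' : c1.reg 1 = e.val s := v1
    have e2 : exec (.jumpZero 1 (cf.pc + (e.cost L.h + 1 + c.len L + 1))) c1
        = { c1 with pc := c1.pc + 1 } := by
      simp only [exec, v1', if_neg hv]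
    rw [e2] at r2
    have hc3 := hc2.right
    rw [List.length_singleton] at hc3
    obtain ⟨c3, r3, p3, h3, o3⟩ := ih1 { c1 with pc := c1.pc + 1 } hs
      (by simpa only [p1] using hc3.left) ((h.same s1 b1).setPc _)
    have hc4 := hc3.right
    rw [compC_length] at hc4
    have hc4' : P[c3.pc]? = some (.jump cf.pc) := by
      rw [p3]; exact hc4.head
    have r4 := Reach.one hc4' (by simp) h3.bdd
    obtain ⟨c5, r5, p5, h5, o5⟩ := ih2 (exec (.jump cf.pc) c3) (rc.bdd hs) hc (h3.setPc _)
    refine ⟨c5, (((r1.trans r2).trans r3).trans r4).trans r5, ?_, h5, ?_⟩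
    · simp only [p5, exec]
    · simp only [o5, exec, o3, s1.out]
  | whF he hv =>
    rename_i e c s
    intro cf hs hc h
    obtain ⟨c1, r1, p1, v1, s1, b1⟩ := reach_compE hBB hs e 0 he cf hc.left h
    have hc2 := hc.right' (p1.trans (by rw [compE_length]))
    have r2 := Reach.one hc2.left.head (by simp) b1
    have v1' : c1.reg 1 = e.val s := v1
    refine ⟨_, r1.trans r2, ?_, ?_, ?_⟩
    · simp only [exec, v1', if_pos hv, Cmd.len]
    · exact (h.same s1 b1).setPc _
    · simp only [exec, s1.out]

end WhileRAM

/-! ## Enumeration by a precomputation and a successor routine -/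

namespace WhileRAM

open Function RAM

set_option linter.unusedSectionVars false

/-- The machine outputs a solution in the next step, or has halted. -/
def Stops (P : Program) (s : Config) : Prop :=
  P[s.pc]? = some .emit ∨ P[s.pc]? = none ∨ P[s.pc]? = some .halt

/-- What remains to be done by an enumeration from the configuration `cf` on. -/
structure Finishes (P : Program) (B e D T : ℕ) (Y : List (List ℕ)) (cf : Config) : Prop where
  first : ∃ d ≤ e, Stops P ((step P)^[d] cf)
  gap : ∀ i, ∃ d < D, Stops P ((step P)^[i + d] cf)
  halt : P[((step P)^[T] cf).pc]? = some .halt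
  out : ((step P)^[T] cf).out = cf.out ++ Y
  bdd : ∀ i, CBdd B ((step P)^[i] cf)

theorem step_of_halt {P : Program} {s : Config} (h : P[s.pc]? = some .halt) : step P s = s := by
  simp [step, h, exec]

theorem iterate_of_halt {P : Program} {s : Config} (h : P[s.pc]? = some .halt) (i : ℕ) :
    (step P)^[i] s = s := by
  induction i with
  | zero => rfl
  | succ i ih => rw [iterate_succ_apply, step_of_halt h, ih]

/-- Prepending a part of the run after whose first `t` steps something is output. -/
theorem Finishes.prepend {P : Program} {B e D T t u : ℕ} {Y : List (List ℕ)} {cf cf₁ cf₂ : Config}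
    (h : Finishes P B e D T Y cf₂) (r : Reach P B t cf cf₁) (h₁ : P[cf₁.pc]? = some .emit)
    (hb : CBdd B cf₁) (r₂ : Reach P B u (exec .emit cf₁) cf₂) {e' : ℕ}
    (ho₂ : cf₂.out = cf.out ++ [cf₁.buf])
    (hte : t ≤ e') (hut : t < D) (hD : u + e + 1 < D) :
    Finishes P B e' D (t + (1 + (u + T))) (cf₁.buf :: Y) cf := by
  have e1 : ∀ i, (step P)^[t + i] cf = (step P)^[i] cf₁ := fun i => by
    rw [Nat.add_comm, iterate_add_apply, r.1]
  have e2 : ∀ i, (step P)^[t + (1 + i)] cf = (step P)^[i] (exec .emit cf₁) := fun i => by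
    rw [e1, Nat.add_comm, iterate_add_apply]; congr 1; simp [step, h₁]
  have e3 : ∀ i, (step P)^[t + (1 + (u + i))] cf = (step P)^[i] cf₂ := fun i => by
    rw [e2, Nat.add_comm, iterate_add_apply, r₂.1]
  refine ⟨⟨t, hte, ?_⟩, fun i => ?_, ?_, ?_, fun i => ?_⟩
  · rw [← Nat.add_zero t, e1]; exact .inl h₁
  -- An instant lies before the output, between the output and `cf₂`, or later. In the middle range
  -- the next stop is the first one after `cf₂`, at most `u + e` steps away; this is the purpose of
  -- the component `first`.
  · by_cases hi : i ≤ t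
    · refine ⟨t - i, by omega, ?_⟩
      rw [show i + (t - i) = t + 0 by omega, e1]; exact .inl h₁
    · by_cases hi' : i ≤ t + (1 + u)
      · obtain ⟨d, hd, hs⟩ := h.first
        refine ⟨t + (1 + (u + d)) - i, by omega, ?_⟩
        rw [show i + (t + (1 + (u + d)) - i) = t + (1 + (u + d)) by omega, e3]
        exact hs
      · obtain ⟨d, hd, hs⟩ := h.gap (i - (t + (1 + u)))
        refine ⟨d, hd, ?_⟩
        rw [show i + d = t + (1 + (u + (i - (t + (1 + u)) + d))) by omega, e3]
        exact hs
  · rw [e3]; exact h.halt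
  · rw [e3, h.out, ho₂]; simp
  · by_cases hi : i < t
    · exact (r.2 i hi).1
    · by_cases hi' : i = t
      · rw [hi', ← Nat.add_zero t, e1]; exact hb
      · by_cases hi'' : i < t + (1 + u)
        · rw [show i = t + (1 + (i - t - 1)) by omega, e2]
          exact (r₂.2 _ (by omega)).1
        · rw [show i = t + (1 + (u + (i - t - 1 - u))) by omega, e3]
          exact h.bdd _

theorem Finishes.mono {P : Program} {B e e' D T : ℕ} {Y : List (List ℕ)} {cf : Config}
    (h : Finishes P B e D T Y cf) (he : e ≤ e') : Finishes P B e' D T Y cf :=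
  ⟨let ⟨d, hd, hs⟩ := h.first; ⟨d, hd.trans he, hs⟩, h.gap, h.halt, h.out, h.bdd⟩

theorem finishes_halt {P : Program} {B D t : ℕ} {cf cf' : Config} (r : Reach P B t cf cf')
    (h : P[cf'.pc]? = some .halt) (hb : CBdd B cf') (ho : cf'.out = cf.out) (hD : t < D) :
    Finishes P B t D t [] cf := by
  have key : ∀ i, t ≤ i → (step P)^[i] cf = cf' := fun i hi => by
    rw [show i = (i - t) + t by omega, iterate_add_apply, r.1, iterate_of_halt h]
  refine ⟨⟨t, le_rfl, ?_⟩, fun i => ⟨t, hD, ?_⟩, ?_, ?_, fun i => ?_⟩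
  · rw [key t le_rfl]; exact .inr (.inr h)
  · rw [key _ (by omega)]; exact .inr (.inr h)
  · rw [key t le_rfl]; exact h
  · rw [key t le_rfl]; simpa using ho
  · by_cases hi : i < t
    · exact (r.2 i hi).1
    · rw [key i (by omega)]; exact hb

variable {V A : Type} [DecidableEq V] [DecidableEq A]

/-- The state in which the memory of a machine with one array is read as that of a machine with
several arrays. -/
def reinterpret (L : Layout V A) (s : St V Unit) : St V A :=
  ⟨s.v, fun T i => s.a () (2 ^ L.h * i + L.cell T), s.buf⟩

/-- The initial state on an input word. -/
def St.init (V : Type) (w : List ℕ) : St V Unit := ⟨fun _ => 0, fun _ i => w.getD i 0, []⟩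

/-- The program that consists of a precomputation in two parts and the alternation of the
preparation `sol` of a solution with the transition `nxt` to the next one, as long as the variable
`x` is not zero. -/
def enumProgram (L₀ : Layout V Unit) (L : Layout V A) (c₀ : Cmd V Unit) (c₁ sol nxt : Cmd V A)
    (x : V) : Program :=
  let p := c₀.len L₀ + c₁.len L
  compC L₀ c₀ 0 ++ (compC L c₁ (c₀.len L₀) ++
    ([.jumpZero (2 * L.reg x) (p + (1 + sol.len L + 1 + nxt.len L + 1))] ++
      (compC L sol (p + 1) ++ ([.emit] ++ (compC L nxt (p + 1 + sol.len L + 1) ++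
        [.jump p, .halt])))))

section

variable {L₀ : Layout V Unit} {L : Layout V A} {c₀ : Cmd V Unit} {c₁ sol nxt : Cmd V A} {x : V}
  {B B' τ : ℕ} {Inv : List (List ℕ) → St V A → Prop}

/-- Induction on the list of solutions that are still due, which `Inv` ties to the state. Between
two outputs lie one run of `nxt`, the jump back, the test and one run of `sol`, which gives `2 * τ`
and a constant. -/
theorem finishes_loop (hBB : 2 ^ L.h * (B + 1) ≤ B')
    (hnil : ∀ s, Inv [] s → s.v x = 0)
    (hcons : ∀ y Y s, Inv (y :: Y) s → s.v x ≠ 0 ∧ s.buf = [] ∧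
      Wp L.h B sol τ (fun s' => s'.buf = y ∧
        Wp L.h B nxt τ (Inv Y) { s' with buf := [] }) s)
    (Y : List (List ℕ)) :
    ∀ (s : St V A) (cf : Config), Inv Y s → s.Bdd B → Sim L B' s cf →
      cf.pc = c₀.len L₀ + c₁.len L →
      ∃ T ≤ (Y.length + 1) * (2 * τ + 6),
        Finishes (enumProgram L₀ L c₀ c₁ sol nxt x) B' (τ + 1) (2 * τ + 6) T Y cf := by
  set P := enumProgram L₀ L c₀ c₁ sol nxt x with hP
  set p := c₀.len L₀ + c₁.len L with hp
  have hc : CodeAt P p ([.jumpZero (2 * L.reg x) (p + (1 + sol.len L + 1 + nxt.len L + 1))] ++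
      (compC L sol (p + 1) ++ ([.emit] ++ (compC L nxt (p + 1 + sol.len L + 1) ++
        [.jump p, .halt])))) := by
    have := CodeAt.of_eq (P := P) (l₁ := compC L₀ c₀ 0 ++ compC L c₁ (c₀.len L₀)) (l₂ := [])
      (by rw [List.append_nil, List.append_assoc]; rfl)
    rwa [List.length_append, compC_length, compC_length] at this
  have hc1 : CodeAt P (p + 1) _ := hc.right
  have hc2 : CodeAt P (p + 1 + sol.len L) _ := hc1.right' (by rw [compC_length])
  have hc3 : CodeAt P (p + 1 + sol.len L + 1) _ := hc2.right
  have hc4 : CodeAt P (p + 1 + sol.len L + 1 + nxt.len L) _ := hc3.right' (by rw [compC_length])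
  induction Y with
  | nil =>
    intro s cf hI hs hsim hpc
    have r1 := Reach.one (P := P) (s := cf) (by rw [hpc]; exact hc.left.head) (by simp) hsim.bdd
    have e1 : exec (.jumpZero (2 * L.reg x) (p + (1 + sol.len L + 1 + nxt.len L + 1))) cf =
        { cf with pc := p + (1 + sol.len L + 1 + nxt.len L + 1) } := by
      simp only [exec, hsim.v, hnil s hI, if_true]
    rw [e1] at r1
    refine ⟨1, by simp, (finishes_halt r1 ?_ (hsim.bdd.setPc _) rfl (by omega)).mono (by omega)⟩
    have := hc4.tail.head
    rw [← this]; congr 1; simp only; omega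
  | cons y Y ih =>
    intro s cf hI hs hsim hpc
    obtain ⟨hx, hbuf, t, ht, s', rs, hs'y, u, hu, s'', rn, hI'⟩ := hcons y Y s hI
    have r1 := Reach.one (P := P) (s := cf) (by rw [hpc]; exact hc.left.head) (by simp) hsim.bdd
    have e1 : exec (.jumpZero (2 * L.reg x) (p + (1 + sol.len L + 1 + nxt.len L + 1))) cf =
        { cf with pc := p + 1 } := by
      simp only [exec, hsim.v, if_neg hx, hpc]
    rw [e1] at r1
    obtain ⟨cf1, r2, p2, h2, o2⟩ := reach_compC hBB rs { cf with pc := p + 1 } hs hc1.left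
      (hsim.setPc _)
    have hem : P[cf1.pc]? = some .emit := by rw [p2]; exact hc2.left.head
    have hsim3 : Sim L B' { s' with buf := [] } (exec .emit cf1) :=
      ⟨h2.v, h2.a, rfl, h2.bdd.reg, h2.bdd.mem, h2.bdd.z⟩
    have hs' := rs.bdd hs
    have hpc3 : (exec .emit cf1).pc = p + 1 + sol.len L + 1 := by simp only [exec, p2]
    obtain ⟨cf2, r3, p3, h3, o3⟩ := reach_compC hBB rn (exec .emit cf1) ⟨hs'.v, hs'.a, hs'.z⟩
      (by rw [hpc3]; exact hc3.left) hsim3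
    have r4 := Reach.one (P := P) (s := cf2) (by rw [p3, hpc3]; exact hc4.head) (by simp) h3.bdd
    obtain ⟨T, hT, hF⟩ := ih s'' (exec (.jump p) cf2) hI' (rn.bdd ⟨hs'.v, hs'.a, hs'.z⟩)
      (h3.setPc _) rfl
    have hy : cf1.buf = y := h2.buf.trans hs'y
    refine ⟨1 + t + (1 + (u + 1 + T)), ?_, hy ▸ hF.prepend (r1.trans r2) hem h2.bdd
      (r3.trans r4) ?_ (by omega) (by omega) (by omega)⟩
    · rw [List.length_cons, Nat.succ_mul (Y.length + 1)]; omega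
    · have e : (exec (.jump p) cf2).out = cf2.out := rfl
      rw [e, o3, ← o2]; rfl

/-- Correctness of the enumeration program. -/
theorem enumProgram_correct (hBB : 2 ^ L.h * (B + 1) ≤ B') (h0 : L₀.h = 0) (hreg : L₀.reg = L.reg)
    {w : List ℕ} {Y : List (List ℕ)} {t₀ t₁ : ℕ}
    (hw : ∀ a ∈ w, a ≤ B) (hwl : w.length ≤ B)
    (hpre : Wp 0 B c₀ t₀ (fun s => Wp L.h B c₁ t₁ (Inv Y) (reinterpret L s)) (St.init V w))
    (hnil : ∀ s, Inv [] s → s.v x = 0)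
    (hcons : ∀ y Y s, Inv (y :: Y) s → s.v x ≠ 0 ∧ s.buf = [] ∧
      Wp L.h B sol τ (fun s' => s'.buf = y ∧
        Wp L.h B nxt τ (Inv Y) { s' with buf := [] }) s) :
    (∃ T ≤ t₀ + t₁ + (Y.length + 1) * (2 * τ + 6),
      HaltedAt (enumProgram L₀ L c₀ c₁ sol nxt x) w T ∧
      (run (enumProgram L₀ L c₀ c₁ sol nxt x) w T).out = Y) ∧
    HasDelay (enumProgram L₀ L c₀ c₁ sol nxt x) w (t₀ + t₁) (2 * τ + 6) ∧
    UsesSpace (enumProgram L₀ L c₀ c₁ sol nxt x) w B' := by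
  set P := enumProgram L₀ L c₀ c₁ sol nxt x with hP
  have hBB' : B + 1 ≤ B' := le_trans (Nat.le_mul_of_pos_left _ (by positivity)) hBB
  have hcell : ∀ T, L₀.cell T = 0 := fun T => by
    have := L₀.cell_lt T; rw [h0] at this; omega
  have hget : ∀ i, w.getD i 0 ≤ B := fun i => by
    by_cases hi : i < w.length
    · rw [List.getD_eq_getElem _ _ hi]; exact hw _ (List.getElem_mem hi)
    · rw [List.getD_eq_default _ _ (by omega)]; omega
  have hz : ∀ i, B < i → w.getD i 0 = 0 := fun i hi => List.getD_eq_default _ _ (by omega)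
  obtain ⟨t, ht, s₀, r₀, u, hu, s₁, r₁, hI⟩ := hpre
  rw [← h0] at r₀
  have hb0 : (St.init V w).Bdd B := ⟨fun _ => Nat.zero_le _, fun _ => hget, fun _ => hz⟩
  have hsim0 : Sim L₀ B' (St.init V w) (RAM.init w) :=
    ⟨fun _ => rfl, fun T i => by simp [h0, hcell, RAM.init, St.init], rfl,
      fun _ => Nat.zero_le _, fun a => (hget a).trans (by omega), fun a ha => hz a (by omega)⟩
  have hcp : CodeAt P 0 (compC L₀ c₀ 0 ++ _) :=
    CodeAt.of_eq (l₁ := []) (l₂ := []) (by rw [List.append_nil]; rfl)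
  obtain ⟨cf1, r1, p1, h1, o1⟩ := reach_compC (L := L₀) (P := P) (B' := B')
    (by rw [h0]; simpa using hBB') r₀ (RAM.init w) hb0 hcp.left hsim0
  have hb1 := r₀.bdd hb0
  have hmem : ∀ i, cf1.mem i = s₀.a () i := fun i => by
    have := h1.a () i; rwa [h0, hcell, pow_zero, Nat.one_mul, Nat.add_zero] at this
  -- The change of layout costs no machine step: both layouts use the same registers, and the same
  -- memory is only read differently.
  have hsim1 : Sim L B' (reinterpret L s₀) cf1 :=
    ⟨fun y => by rw [← hreg]; exact h1.v y, fun T i => by rw [hmem]; rfl, h1.buf, h1.bdd⟩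
  -- The entry `i` of any array has an address at least `i`, so it vanishes for `i > B`.
  have hb1' : (reinterpret L s₀).Bdd B :=
    ⟨hb1.v, fun T i => hb1.a _ _, fun T i hi => hb1.z _ _ (by
      have : i ≤ 2 ^ L.h * i := Nat.le_mul_of_pos_left _ (by positivity)
      omega)⟩
  have hpc1 : cf1.pc = c₀.len L₀ := by rw [p1]; simp [RAM.init]
  have hcq : CodeAt P (c₀.len L₀) _ := hcp.right' (by rw [compC_length, Nat.zero_add])
  obtain ⟨cf2, r2, p2, h2, o2⟩ := reach_compC hBB r₁ cf1 hb1' (by rw [hpc1]; exact hcq.left) hsim1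
  obtain ⟨T, hT, hF⟩ := finishes_loop (L₀ := L₀) (c₀ := c₀) (c₁ := c₁) hBB hnil hcons Y s₁ cf2 hI
    (r₁.bdd hb1') h2 (by rw [p2, hpc1])
  have r12 := r1.trans r2
  have hrun : ∀ i, run P w (t + u + i) = (step P)^[i] cf2 := fun i => by
    rw [run, Nat.add_comm, iterate_add_apply, r12.1]
  refine ⟨⟨t + u + T, by omega, ?_, ?_⟩, ⟨t + u, by omega, ?_, ?_⟩, by omega, ?_⟩
  · right; rw [hrun]; exact hF.halt
  · rw [hrun, hF.out, o2, o1]; rfl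
  · exact fun i hi => (r12.2 i hi).2
  · intro i hi
    obtain ⟨d, hd, hs⟩ := hF.gap (i - (t + u))
    refine ⟨d, hd, ?_⟩
    have : i + d = t + u + (i - (t + u) + d) := by omega
    rw [EmitsAt, HaltedAt, this, hrun]
    exact hs
  · intro i
    have hb : CBdd B' (run P w i) := by
      by_cases hi : i < t + u
      · exact (r12.2 i hi).1
      · rw [show i = t + u + (i - (t + u)) by omega, hrun]; exact hF.bdd _
    exact ⟨hb.reg, hb.mem, hb.z⟩

end

end WhileRAM

/-! ## Locality of bijective formulas -/

namespace BijQuery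

open Function Equiv

variable {σ : UnarySig}

section
variable (S : BijStructure σ)

/-- The function with number `v`, the identity if there is none. -/
def symFun (v : ℕ) : Perm (Fin S.n) :=
  if h : v < σ.numFun then S.func ⟨v, h⟩ else 1

/-- The predicate with number `v`, empty if there is none. -/
def symPred (v : ℕ) (x : Fin S.n) : Prop := ∃ h : v < σ.numPred, x ∈ S.pred ⟨v, h⟩

/-- Being the constant with number `v`. -/
def symConst (v : ℕ) (x : Fin S.n) : Prop := ∃ h : v < σ.numConst, x = S.const ⟨v, h⟩

variable (vals : List ℕ)

/-- Prolongation of words by one symbol. -/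
def wordStep (W : List (Perm (Fin S.n))) : List (Perm (Fin S.n)) :=
  W ++ vals.flatMap fun v => W.flatMap fun u => [symFun S v * u, (symFun S v)⁻¹ * u]

/-- The permutations given by words of length at most `r` in the functions with numbers in `vals`
and their inverses. -/
def words (r : ℕ) : List (Perm (Fin S.n)) := (wordStep S vals)^[r] [1]

/-- Closure of a list of elements under one application of functions and inverses. -/
def closeStep (l : List (Fin S.n)) : List (Fin S.n) :=
  l ++ vals.flatMap fun v => l.flatMap fun x => [symFun S v x, (symFun S v)⁻¹ x]

def close (r : ℕ) (l : List (Fin S.n)) : List (Fin S.n) := (closeStep S vals)^[r] l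

end

section
variable {S : BijStructure σ} {vals : List ℕ}

theorem mem_wordStep {W : List (Perm (Fin S.n))} {u : Perm (Fin S.n)} :
    u ∈ wordStep S vals W ↔ u ∈ W ∨ ∃ v ∈ vals, ∃ u' ∈ W,
      u = symFun S v * u' ∨ u = (symFun S v)⁻¹ * u' := by
  simp [wordStep]

theorem words_succ (r : ℕ) : words S vals (r + 1) = wordStep S vals (words S vals r) :=
  iterate_succ_apply' _ _ _

theorem one_mem_words (r : ℕ) : 1 ∈ words S vals r := by
  induction r with
  | zero => simp [words]
  | succ r ih => rw [words_succ]; exact mem_wordStep.2 (.inl ih)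

theorem words_mono {r s : ℕ} (h : r ≤ s) {u : Perm (Fin S.n)} (hu : u ∈ words S vals r) :
    u ∈ words S vals s := by
  induction s, h using Nat.le_induction with
  | base => exact hu
  | succ s _ ih => rw [words_succ]; exact mem_wordStep.2 (.inl ih)

/-- Radii add under composition; together with closure under inverses this is all that the locality
arguments use about words. -/
theorem mul_mem_words {r s : ℕ} {u u' : Perm (Fin S.n)} (hu : u ∈ words S vals r)
    (hu' : u' ∈ words S vals s) : u * u' ∈ words S vals (r + s) := by
  induction r generalizing u with
  | zero =>
    obtain rfl : u = 1 := by simpa [words] using hu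
    simpa using hu'
  | succ r ih =>
    rw [words_succ] at hu
    rw [Nat.add_right_comm, words_succ]
    rcases mem_wordStep.1 hu with h | ⟨v, hv, u₁, h₁, rfl | rfl⟩
    · exact mem_wordStep.2 (.inl (ih h))
    · exact mem_wordStep.2 (.inr ⟨v, hv, _, ih h₁, .inl (mul_assoc _ _ _)⟩)
    · exact mem_wordStep.2 (.inr ⟨v, hv, _, ih h₁, .inr (mul_assoc _ _ _)⟩)

theorem symFun_mem_words {v : ℕ} (hv : v ∈ vals) : symFun S v ∈ words S vals 1 := by
  rw [words_succ]
  exact mem_wordStep.2 (.inr ⟨v, hv, 1, one_mem_words _, .inl (mul_one _).symm⟩)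

theorem symFun_inv_mem_words {v : ℕ} (hv : v ∈ vals) : (symFun S v)⁻¹ ∈ words S vals 1 := by
  rw [words_succ]
  exact mem_wordStep.2 (.inr ⟨v, hv, 1, one_mem_words _, .inr (mul_one _).symm⟩)

theorem inv_mem_words {r : ℕ} {u : Perm (Fin S.n)} (hu : u ∈ words S vals r) :
    u⁻¹ ∈ words S vals r := by
  induction r generalizing u with
  | zero =>
    obtain rfl : u = 1 := by simpa [words] using hu
    simpa using one_mem_words 0
  | succ r ih =>
    rw [words_succ] at hu
    rcases mem_wordStep.1 hu with h | ⟨v, hv, u₁, h₁, rfl | rfl⟩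
    · exact words_mono (Nat.le_succ r) (ih h)
    · rw [mul_inv_rev]; exact mul_mem_words (ih h₁) (symFun_inv_mem_words hv)
    · rw [mul_inv_rev, inv_inv]; exact mul_mem_words (ih h₁) (symFun_mem_words hv)

theorem close_succ (r : ℕ) (l : List (Fin S.n)) :
    close S vals (r + 1) l = closeStep S vals (close S vals r l) := iterate_succ_apply' _ _ _

/-- The closure of one element lists the words in an order that does not depend on the element.
Facts on the neighbourhoods of two elements can therefore be compared entry by entry. -/
theorem close_singleton (r : ℕ) (b : Fin S.n) :
    close S vals r [b] = (words S vals r).map fun u => u b := by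
  induction r with
  | zero => simp [close, words]
  | succ r ih =>
    rw [close_succ, words_succ, ih]
    simp [closeStep, wordStep, List.map_flatMap, List.flatMap_map]

/-- New elements are appended, so smaller neighbourhoods are initial segments of larger ones, and
one array with several recorded lengths can hold them all. -/
theorem prefix_close (r : ℕ) (l : List (Fin S.n)) : l <+: close S vals r l := by
  induction r with
  | zero => exact List.prefix_rfl
  | succ r ih => rw [close_succ]; exact ih.trans (List.prefix_append _ _)

theorem mem_close {r : ℕ} {l : List (Fin S.n)} {x : Fin S.n} (hx : x ∈ l) {u : Perm (Fin S.n)}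
    (hu : u ∈ words S vals r) : u x ∈ close S vals r l := by
  induction r generalizing u with
  | zero =>
    obtain rfl : u = 1 := by simpa [words] using hu
    simpa [close] using hx
  | succ r ih =>
    rw [words_succ] at hu
    rw [close_succ]
    rcases mem_wordStep.1 hu with h | ⟨v, hv, u₁, h₁, rfl | rfl⟩
    · exact List.mem_append_left _ (ih h)
    · exact List.mem_append_right _ (List.mem_flatMap.2 ⟨v, hv, List.mem_flatMap.2
        ⟨_, ih h₁, by simp⟩⟩)
    · exact List.mem_append_right _ (List.mem_flatMap.2 ⟨v, hv, List.mem_flatMap.2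
        ⟨_, ih h₁, by simp⟩⟩)

theorem length_closeStep (l : List (Fin S.n)) :
    (closeStep S vals l).length = l.length * (1 + 2 * vals.length) := by
  simp [closeStep, List.length_flatMap]
  ring

/-- Repetitions are kept on purpose: the length then depends on the parameters alone and not on the
structure. -/
theorem length_close (r : ℕ) (l : List (Fin S.n)) :
    (close S vals r l).length = l.length * (1 + 2 * vals.length) ^ r := by
  induction r with
  | zero => simp [close]
  | succ r ih => rw [close_succ, length_closeStep, ih]; ring

theorem length_words (r : ℕ) :
    (words S vals r).length = (1 + 2 * vals.length) ^ r := by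
  have h := congrArg List.length (close_singleton (vals := vals) r ⟨0, S.n_pos⟩)
  rw [length_close] at h
  simpa using h.symm

/-! ### Types of elements, equivalence of tuples and locality -/

variable (S vals)

/-- The elements have the same neighbourhood of radius `r`. -/
def SameType (r : ℕ) (x y : Fin S.n) : Prop :=
  ∀ u ∈ words S vals r, (u x = x ↔ u y = y) ∧
    ∀ v ∈ vals, (symPred S v (u x) ↔ symPred S v (u y)) ∧
      (symConst S v (u x) ↔ symConst S v (u y))

/-- The tuples have the same neighbourhood of radius `r`. -/
structure Eqv (r : ℕ) {m : ℕ} (a a' : Fin m → Fin S.n) : Prop where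
  one : ∀ i, ∀ u ∈ words S vals r, ∀ v ∈ vals,
    (symPred S v (u (a i)) ↔ symPred S v (u (a' i))) ∧
      (symConst S v (u (a i)) ↔ symConst S v (u (a' i)))
  two : ∀ i j, ∀ u ∈ words S vals r, u (a i) = a j ↔ u (a' i) = a' j

/-- The property of tuples depends on neighbourhoods of radius `r` only. -/
def Local (r : ℕ) {m : ℕ} (P : (Fin m → Fin S.n) → Prop) : Prop :=
  ∀ a a', Eqv S vals r a a' → (P a ↔ P a')

variable {S vals}

theorem Eqv.mono {r s m : ℕ} (h : r ≤ s) {a a' : Fin m → Fin S.n} (e : Eqv S vals s a a') :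
    Eqv S vals r a a' :=
  ⟨fun i u hu => e.one i u (words_mono h hu), fun i j u hu => e.two i j u (words_mono h hu)⟩

theorem Eqv.symm {r m : ℕ} {a a' : Fin m → Fin S.n} (e : Eqv S vals r a a') :
    Eqv S vals r a' a :=
  ⟨fun i u hu v hv => ⟨(e.one i u hu v hv).1.symm, (e.one i u hu v hv).2.symm⟩,
    fun i j u hu => (e.two i j u hu).symm⟩

theorem Eqv.refl {r m : ℕ} (a : Fin m → Fin S.n) : Eqv S vals r a a :=
  ⟨fun _ _ _ _ _ => ⟨Iff.rfl, Iff.rfl⟩, fun _ _ _ _ => Iff.rfl⟩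

theorem SameType.symm {r : ℕ} {x y : Fin S.n} (h : SameType S vals r x y) :
    SameType S vals r y x := fun u hu =>
  ⟨(h u hu).1.symm, fun v hv => ⟨((h u hu).2 v hv).1.symm, ((h u hu).2 v hv).2.symm⟩⟩

theorem SameType.trans {r : ℕ} {x y z : Fin S.n} (h : SameType S vals r x y)
    (h' : SameType S vals r y z) : SameType S vals r x z := fun u hu =>
  ⟨(h u hu).1.trans (h' u hu).1, fun v hv => ⟨((h u hu).2 v hv).1.trans ((h' u hu).2 v hv).1,
    ((h u hu).2 v hv).2.trans ((h' u hu).2 v hv).2⟩⟩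

theorem Local.mono {r s m : ℕ} (h : r ≤ s) {P : (Fin m → Fin S.n) → Prop}
    (hP : Local S vals r P) : Local S vals s P := fun a a' e => hP a a' (e.mono h)

/-- Prolongation by elements far from the tuples. -/
theorem Eqv.snoc_far {r m : ℕ} {a a' : Fin m → Fin S.n} (e : Eqv S vals r a a') {b b' : Fin S.n}
    (hb : SameType S vals r b b') (h : ∀ i, ∀ u ∈ words S vals r, u (a i) ≠ b)
    (h' : ∀ i, ∀ u ∈ words S vals r, u (a' i) ≠ b') :
    Eqv S vals r (Fin.snoc a b : Fin (m + 1) → Fin S.n) (Fin.snoc a' b') := by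
  refine ⟨fun i => ?_, fun i j => ?_⟩
  · refine Fin.lastCases ?_ (fun i => ?_) i
    · simpa using fun u hu => (hb u hu).2
    · simpa using e.one i
  · refine Fin.lastCases ?_ (fun i => ?_) i <;> refine Fin.lastCases ?_ (fun j => ?_) j <;>
      intro u hu
    · simpa using (hb u hu).1
    -- Nearness is symmetric because the words are closed under inverses.
    · have h1 : u b ≠ a j := fun hh => h j _ (inv_mem_words hu) (by rw [← hh]; simp)
      have h2 : u b' ≠ a' j := fun hh => h' j _ (inv_mem_words hu) (by rw [← hh]; simp)
      simp [h1, h2]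
    · simp [h i u hu, h' i u hu]
    · simpa using e.two i j u hu

/-- Prolongation by elements close to the tuples. -/
theorem Eqv.snoc_near {r m : ℕ} {a a' : Fin m → Fin S.n} (e : Eqv S vals (3 * r) a a') (i₀ : Fin m)
    {u₀ : Perm (Fin S.n)} (hu₀ : u₀ ∈ words S vals r) :
    Eqv S vals r (Fin.snoc a (u₀ (a i₀)) : Fin (m + 1) → Fin S.n) (Fin.snoc a' (u₀ (a' i₀))) := by
  refine ⟨fun i => ?_, fun i j => ?_⟩
  · refine Fin.lastCases ?_ (fun i => ?_) i
    · intro u hu v hv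
      simpa using e.one i₀ (u * u₀) (words_mono (by omega) (mul_mem_words hu hu₀)) v hv
    · simpa using (e.mono (r := r) (by omega)).one i
  · refine Fin.lastCases ?_ (fun i => ?_) i <;> refine Fin.lastCases ?_ (fun j => ?_) j <;>
      intro u hu
    -- An equation between two images of the new component becomes one about the conjugate `u₀⁻¹ * u
    -- * u₀` at an old component. Its length is at most three times `r`, which is where the factor 3
    -- comes from.
    · have := e.two i₀ i₀ (u₀⁻¹ * (u * u₀)) (words_mono (by omega)
        (mul_mem_words (inv_mem_words hu₀) (mul_mem_words hu hu₀)))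
      simp only [Perm.mul_apply, Perm.inv_eq_iff_eq] at this
      simpa using this
    · have := e.two i₀ j (u * u₀) (words_mono (by omega) (mul_mem_words hu hu₀))
      simpa [Perm.mul_apply] using this
    · have := e.two i i₀ (u₀⁻¹ * u) (words_mono (by omega) (mul_mem_words (inv_mem_words hu₀) hu))
      simp only [Perm.mul_apply, Perm.inv_eq_iff_eq] at this
      simpa using this
    · simpa using e.two i j u (words_mono (by omega) hu)

/-- An element close to a tuple and the corresponding element have the same type. -/
theorem Eqv.sameType {r m : ℕ} {a a' : Fin m → Fin S.n} (e : Eqv S vals (3 * r) a a') (i : Fin m)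
    {u₀ : Perm (Fin S.n)} (hu₀ : u₀ ∈ words S vals r) :
    SameType S vals r (u₀ (a i)) (u₀ (a' i)) := fun u hu => by
  have h := e.snoc_near i hu₀
  exact ⟨by simpa using h.two (Fin.last m) (Fin.last m) u hu,
    fun v hv => by simpa using h.one (Fin.last m) u hu v hv⟩

/-- The back-and-forth property: since both tuples live in the same structure, counting the
elements of a type that are close to them suffices. -/
theorem Eqv.exists_snoc {r m : ℕ} {a a' : Fin m → Fin S.n} (e : Eqv S vals (3 * r) a a')
    (b : Fin S.n) : ∃ b', Eqv S vals r (Fin.snoc a b : Fin (m + 1) → Fin S.n) (Fin.snoc a' b') := by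
  classical
  by_cases hn : ∃ i, ∃ u ∈ words S vals r, u (a i) = b
  · obtain ⟨i, u, hu, rfl⟩ := hn
    exact ⟨_, e.snoc_near i hu⟩
  push Not at hn
  let near (c : Fin m → Fin S.n) : Finset (Fin S.n) := Finset.univ.filter fun x =>
    SameType S vals r b x ∧ ∃ i, ∃ u ∈ words S vals r, u (c i) = x
  -- An element `u (a' i)` of the type of `b` is sent to `u (a i)`, for some choice of `u` and `i`.
  -- The image has the same type by `Eqv.sameType`.
  have hcard : (near a').card ≤ (near a).card := by
    have hch : ∀ x ∈ near a', ∃ i, ∃ u ∈ words S vals r, u (a' i) = x := fun x hx =>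
      (Finset.mem_filter.1 hx).2.2
    rcases isEmpty_or_nonempty (Fin m) with hm | hm
    · rw [Finset.card_eq_zero.2 (Finset.eq_empty_of_forall_notMem fun x hx =>
        isEmptyElim (hch x hx).choose)]
      exact Nat.zero_le _
    choose! i u hu hx using hch
    refine Finset.card_le_card_of_injOn (fun x => u x (a (i x))) (fun x h => ?_)
      (fun x h y h' hxy => ?_)
    · have h1 := (Finset.mem_filter.1 h).2.1
      refine Finset.mem_coe.2 (Finset.mem_filter.2 ⟨Finset.mem_univ _, ?_, i x, u x, hu x h, rfl⟩)
      refine h1.trans ?_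
      have := (e.sameType (i x) (hu x h)).symm
      rwa [hx x h] at this
    -- Injectivity: a coincidence of two images is an equation with the word `(u y)⁻¹ * u x` of
    -- length at most `2 * r`, which holds for both tuples or for neither.
    · have h2 := e.two (i x) (i y) ((u y)⁻¹ * u x) (words_mono (by omega)
        (mul_mem_words (inv_mem_words (hu y h')) (hu x h)))
      simp only [Perm.mul_apply, Perm.inv_eq_iff_eq] at h2
      rw [hx x h, hx y h'] at h2
      exact (h2.1 hxy)
  let θ : Finset (Fin S.n) := Finset.univ.filter fun x => SameType S vals r b x
  have hθ : b ∈ θ := Finset.mem_filter.2 ⟨Finset.mem_univ _, fun _ _ =>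
    ⟨Iff.rfl, fun _ _ => ⟨Iff.rfl, Iff.rfl⟩⟩⟩
  -- The element `b` itself belongs to its type but is not near `a`. Hence the elements near `a'`
  -- cannot exhaust the type, and one that remains serves as `b'`.
  have hlt : (near a).card < θ.card := by
    refine Finset.card_lt_card (Finset.ssubset_iff_subset_ne.2 ⟨fun x hx => ?_, fun hh => ?_⟩)
    · exact Finset.mem_filter.2 ⟨Finset.mem_univ _, (Finset.mem_filter.1 hx).2.1⟩
    · rw [← hh] at hθ
      obtain ⟨i, u, hu, h⟩ := (Finset.mem_filter.1 hθ).2.2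
      exact hn i u hu h
  obtain ⟨b', hb', hfar⟩ := Finset.exists_mem_notMem_of_card_lt_card (hcard.trans_lt hlt)
  have hb := (Finset.mem_filter.1 hb').2
  refine ⟨b', (e.mono (by omega)).snoc_far hb hn fun i u hu h => hfar ?_⟩
  exact Finset.mem_filter.2 ⟨Finset.mem_univ _, hb, i, u, hu, h⟩

theorem Local.exists {r m : ℕ} {P : (Fin (m + 1) → Fin S.n) → Prop} (hP : Local S vals r P) :
    Local S vals (3 * r) fun a : Fin m → Fin S.n => ∃ b, P (Fin.snoc a b) := by
  have key : ∀ a a' : Fin m → Fin S.n, Eqv S vals (3 * r) a a' → (∃ b, P (Fin.snoc a b)) →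
      ∃ b, P (Fin.snoc a' b) := fun a a' e ⟨b, hb⟩ =>
    let ⟨b', hb'⟩ := e.exists_snoc b
    ⟨b', (hP _ _ hb').1 hb⟩
  exact fun a a' e => ⟨key a a' e, key a' a e.symm⟩

theorem Local.not {r m : ℕ} {P : (Fin m → Fin S.n) → Prop} (hP : Local S vals r P) :
    Local S vals r fun a => ¬ P a := fun a a' e => not_congr (hP a a' e)

theorem Local.forall {r m : ℕ} {P : (Fin (m + 1) → Fin S.n) → Prop} (hP : Local S vals r P) :
    Local S vals (3 * r) fun a : Fin m → Fin S.n => ∀ b, P (Fin.snoc a b) := by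
  have := hP.not.exists.not
  simpa using this

/-! ### Restriction of quantifiers to representatives -/

/-- The list contains all elements of the type of any element, or at least `N` of them. -/
def Represents (S : BijStructure σ) (vals : List ℕ) (R N : ℕ) (W : List (Fin S.n)) : Prop :=
  ∀ b, (∀ x, SameType S vals R b x → x ∈ W) ∨
    ∃ F : Finset (Fin S.n), N ≤ F.card ∧ ∀ x ∈ F, x ∈ W ∧ SameType S vals R b x

/-- Quantifiers may be restricted to representatives and the neighbourhood of the tuple. -/
theorem Local.exists_iff {R N m : ℕ} {P : (Fin (m + 1) → Fin S.n) → Prop} (hP : Local S vals R P)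
    {W V : List (Fin S.n)} (hW : Represents S vals R N W) (hN : m * (words S vals R).length < N)
    (hWV : ∀ x ∈ W, x ∈ V) {a : Fin m → Fin S.n}
    (ha : ∀ i, ∀ u ∈ words S vals R, u (a i) ∈ V) :
    (∃ b, P (Fin.snoc a b)) ↔ ∃ b ∈ V, P (Fin.snoc a b) := by
  classical
  refine ⟨fun ⟨b, hb⟩ => ?_, fun ⟨b, _, hb⟩ => ⟨b, hb⟩⟩
  by_cases hn : ∃ i, ∃ u ∈ words S vals R, u (a i) = b
  · obtain ⟨i, u, hu, rfl⟩ := hn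
    exact ⟨_, ha i u hu, hb⟩
  push Not at hn
  -- A witness `b` far from the tuple is itself on the list, or the list holds more elements of its
  -- type than there can be elements near the tuple. In the second case one of them is far, and by
  -- locality it may replace `b`.
  rcases hW b with h | ⟨F, hF, h⟩
  · exact ⟨b, hWV b (h b fun _ _ => ⟨Iff.rfl, fun _ _ => ⟨Iff.rfl, Iff.rfl⟩⟩), hb⟩
  · let near : Finset (Fin S.n) := (Finset.univ ×ˢ (words S vals R).toFinset).image
      fun p : Fin m × Perm (Fin S.n) => p.2 (a p.1)
    have hnear : near.card ≤ m * (words S vals R).length := by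
      refine Finset.card_image_le.trans ?_
      rw [Finset.card_product, Finset.card_univ, Fintype.card_fin]
      exact Nat.mul_le_mul_left _ (List.toFinset_card_le _)
    obtain ⟨b', hb', hfar⟩ := Finset.exists_mem_notMem_of_card_lt_card
      (hnear.trans_lt (hN.trans_le hF))
    refine ⟨b', hWV _ (h b' hb').1, (hP _ _ ?_).1 hb⟩
    refine (Eqv.refl a).snoc_far (h b' hb').2 hn fun i u hu hh => hfar ?_
    exact Finset.mem_image.2 ⟨(i, u), by simpa using hu, hh⟩

theorem Local.forall_iff {R N m : ℕ} {P : (Fin (m + 1) → Fin S.n) → Prop} (hP : Local S vals R P)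
    {W V : List (Fin S.n)} (hW : Represents S vals R N W) (hN : m * (words S vals R).length < N)
    (hWV : ∀ x ∈ W, x ∈ V) {a : Fin m → Fin S.n}
    (ha : ∀ i, ∀ u ∈ words S vals R, u (a i) ∈ V) :
    (∀ b, P (Fin.snoc a b)) ↔ ∀ b ∈ V, P (Fin.snoc a b) := by
  have := not_congr (hP.not.exists_iff hW hN hWV ha)
  simpa using this

open scoped Classical in
/-- Cardinality statements may be evaluated on representatives. -/
theorem le_ncard_iff {R N r : ℕ} {P : Fin S.n → Prop}
    (hP : ∀ x y, SameType S vals R x y → (P x ↔ P y))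
    {W : List (Fin S.n)} (hW : Represents S vals R N W) (hWn : W.Nodup) (hr : r ≤ N) :
    r ≤ Set.ncard {b | P b} ↔ r ≤ W.countP (fun b => decide (P b)) := by
  have hcount : W.countP (fun b => decide (P b)) = (W.toFinset.filter P).card := by
    rw [List.countP_eq_length_filter, ← List.toFinset_card_of_nodup (hWn.filter _)]
    congr 1; ext; simp
  have hset : Set.ncard {b | P b} = (Finset.univ.filter P).card := by
    rw [← Set.ncard_coe_finset]; congr 1; ext; simp
  rw [hcount, hset]
  refine ⟨fun h => ?_, fun h => h.trans (Finset.card_le_card fun x hx => by simp_all)⟩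
  -- If some element with `P` is missing from `W`, its type has `N ≥ r` members in `W`, and all of
  -- them satisfy `P`; so the threshold is reached on the list anyway.
  by_cases hall : ∀ b, P b → b ∈ W
  · refine h.trans (Finset.card_le_card fun x hx => ?_)
    have hx' : P x := by simpa using hx
    simpa using ⟨hall x hx', hx'⟩
  · push Not at hall
    obtain ⟨b, hb, hbW⟩ := hall
    rcases hW b with h' | ⟨F, hF, h'⟩
    · exact absurd (h' b fun _ _ => ⟨Iff.rfl, fun _ _ => ⟨Iff.rfl, Iff.rfl⟩⟩) hbW
    · refine hr.trans (hF.trans (Finset.card_le_card fun x hx => ?_))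
      simpa using ⟨(h' x hx).1, (hP _ _ (h' x hx).2).1 hb⟩

/-! ### Formulas are local -/

/-- The permutation given by a word. -/
def wordPerm (S : BijStructure σ) (w : BijWord σ) : Perm (Fin S.n) :=
  (w.map fun p => if p.2 then S.func p.1 else (S.func p.1)⁻¹).prod

theorem wordPerm_apply (w : BijWord σ) (x : Fin S.n) : wordPerm S w x = w.eval S x := by
  induction w with
  | nil => rfl
  | cons p w ih =>
    simp only [wordPerm, List.map_cons, List.prod_cons, Perm.mul_apply, BijWord.eval,
      List.foldr_cons] at ih ⊢
    rw [ih]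
    split <;> rfl

theorem symFun_val (f : Fin σ.numFun) : symFun S f = S.func f := by simp [symFun]

theorem wordPerm_mem {w : BijWord σ} (h : ∀ v ∈ w.code, v ∈ vals) :
    wordPerm S w ∈ words S vals w.length := by
  have h' : ∀ p ∈ w, (p.1 : ℕ) ∈ vals := fun p hp => h _ (by
    refine List.mem_cons_of_mem _ (List.mem_flatMap.2 ⟨p, hp, by simp⟩))
  clear h
  induction w with
  | nil => exact one_mem_words 0
  | cons p w ih =>
    rw [wordPerm, List.map_cons, List.prod_cons, List.length_cons, words_succ]
    refine mem_wordStep.2 (.inr ⟨p.1, h' p (by simp), _, ih fun q hq => h' q (by simp [hq]), ?_⟩)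
    rw [symFun_val]
    by_cases hp : p.2 = true
    · left; rw [if_pos hp]; rfl
    · right; rw [if_neg hp]; rfl

theorem length_le_code (w : BijWord σ) : w.length ≤ w.code.length := by
  simp [BijWord.code, List.length_flatMap]; omega

/-- An equation between terms says that `(wordPerm S w')⁻¹ * wordPerm S w` sends one component to
another, and this word is shorter than the code. The generous radius `3 ^ length` gives atoms and
quantified formulas a bound of the same shape. -/
theorem local_atom {m : ℕ} (α : BijAtom σ m) (h : ∀ v ∈ α.code, v ∈ vals) :
    Local S vals (3 ^ α.code.length) (α.Holds S) := by
  intro a a' e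
  replace e := e.mono (Nat.lt_pow_self (n := α.code.length) (by norm_num : 1 < 3)).le
  cases α with
  | eq w i w' j =>
    have hw : ∀ v ∈ w.code, v ∈ vals := fun v hv => h v (by simp [BijAtom.code, hv])
    have hw' : ∀ v ∈ w'.code, v ∈ vals := fun v hv => h v (by simp [BijAtom.code, hv])
    have := length_le_code w
    have := length_le_code w'
    have := e.two i j ((wordPerm S w')⁻¹ * wordPerm S w) (words_mono (by
      simp [BijAtom.code]; omega) (mul_mem_words (inv_mem_words (wordPerm_mem hw'))
        (wordPerm_mem hw)))
    simp only [Perm.mul_apply, Perm.inv_eq_iff_eq] at this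
    simpa [wordPerm_apply, BijAtom.Holds] using this
  | eqConst w i c =>
    have hw : ∀ v ∈ w.code, v ∈ vals := fun v hv => h v (by simp [BijAtom.code, hv])
    have := length_le_code w
    have := (e.one i (wordPerm S w) (words_mono (by simp [BijAtom.code]; omega)
      (wordPerm_mem hw)) c (h _ (by simp [BijAtom.code]))).2
    simpa [symConst, wordPerm_apply, BijAtom.Holds] using this
  | pred U w i =>
    have hw : ∀ v ∈ w.code, v ∈ vals := fun v hv => h v (by simp [BijAtom.code, hv])
    have := length_le_code w
    have := (e.one i (wordPerm S w) (words_mono (by simp [BijAtom.code]; omega)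
      (wordPerm_mem hw)) U (h _ (by simp [BijAtom.code]))).1
    simpa [symPred, wordPerm_apply, BijAtom.Holds] using this

/-- For a single element, equivalence of one-component tuples reduces to equality of types. -/
theorem local_bool (ψ : BijBool σ) (h : ∀ v ∈ ψ.code, v ∈ vals) {x y : Fin S.n}
    (hxy : SameType S vals (3 ^ ψ.code.length) x y) : ψ.Holds S x ↔ ψ.Holds S y := by
  have mono : ∀ {r s : ℕ}, r ≤ s → SameType S vals (3 ^ s) x y → SameType S vals (3 ^ r) x y :=
    fun hrs h u hu => h u (words_mono (Nat.pow_le_pow_right (by norm_num) hrs) hu)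
  induction ψ with
  | atom α =>
    exact local_atom α h _ _ ⟨fun _ u hu => (hxy u hu).2, fun _ _ u hu => (hxy u hu).1⟩
  | neg ψ ih =>
    exact not_congr (ih (fun v hv => h v (by simp [BijBool.code, hv]))
      (mono (by simp [BijBool.code]) hxy))
  | and ψ χ ihψ ihχ =>
    exact and_congr (ihψ (fun v hv => h v (by simp [BijBool.code, hv]))
      (mono (by simp [BijBool.code]; omega) hxy)) (ihχ (fun v hv => h v (by simp [BijBool.code, hv]))
      (mono (by simp [BijBool.code]; omega) hxy))
  | or ψ χ ihψ ihχ =>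
    exact or_congr (ihψ (fun v hv => h v (by simp [BijBool.code, hv]))
      (mono (by simp [BijBool.code]; omega) hxy)) (ihχ (fun v hv => h v (by simp [BijBool.code, hv]))
      (mono (by simp [BijBool.code]; omega) hxy))

/-- A quantifier triples the radius and adds one symbol to the code. A cardinality statement does
not depend on the tuple at all. -/
theorem local_formula {m : ℕ} (φ : FOBij σ m) (h : ∀ v ∈ φ.code, v ∈ vals) :
    Local S vals (3 ^ φ.code.length) (fun a => φ.Holds S a) := by
  have hpow : ∀ {r s : ℕ}, r ≤ s → 3 ^ r ≤ 3 ^ s := Nat.pow_le_pow_right (by norm_num)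
  induction φ with
  | atom α => exact local_atom α h
  | card r Ψ => exact fun _ _ _ => Iff.rfl
  | neg φ ih =>
    exact ((ih fun v hv => h v (by simp [FOBij.code, hv])).mono
      (hpow (by simp [FOBij.code]))).not
  | and φ ψ ihφ ihψ =>
    have h1 := (ihφ fun v hv => h v (by simp [FOBij.code, hv])).mono
      (hpow (s := (FOBij.and φ ψ).code.length) (by simp [FOBij.code]; omega))
    have h2 := (ihψ fun v hv => h v (by simp [FOBij.code, hv])).mono
      (hpow (s := (FOBij.and φ ψ).code.length) (by simp [FOBij.code]; omega))
    exact fun a a' e => and_congr (h1 a a' e) (h2 a a' e)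
  | or φ ψ ihφ ihψ =>
    have h1 := (ihφ fun v hv => h v (by simp [FOBij.code, hv])).mono
      (hpow (s := (FOBij.or φ ψ).code.length) (by simp [FOBij.code]; omega))
    have h2 := (ihψ fun v hv => h v (by simp [FOBij.code, hv])).mono
      (hpow (s := (FOBij.or φ ψ).code.length) (by simp [FOBij.code]; omega))
    exact fun a a' e => or_congr (h1 a a' e) (h2 a a' e)
  | ex φ ih =>
    have := (ih fun v hv => h v (by simp [FOBij.code, hv])).exists
    rw [← pow_succ'] at this
    exact this
  | all φ ih =>
    have := (ih fun v hv => h v (by simp [FOBij.code, hv])).forall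
    rw [← pow_succ'] at this
    exact this

/-! ### Prefixes of answers -/

/-- The tuple is a prefix of an answer. -/
def Extends {k : ℕ} (φ : FOBij σ k) (S : BijStructure σ) (m : ℕ) (a : Fin m → Fin S.n) : Prop :=
  ∃ y : Fin k → Fin S.n, φ.Holds S y ∧ ∀ (i : Fin m) (h : (i : ℕ) < k), y ⟨i, h⟩ = a i

theorem extends_self {k : ℕ} (φ : FOBij σ k) (a : Fin k → Fin S.n) :
    Extends φ S k a ↔ φ.Holds S a := by
  refine ⟨fun ⟨y, hy, h⟩ => ?_, fun h => ⟨a, h, fun _ _ => rfl⟩⟩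
  obtain rfl : y = a := funext fun i => h i i.2
  exact hy

theorem extends_iff {k : ℕ} (φ : FOBij σ k) {m : ℕ} (hm : m < k) (a : Fin m → Fin S.n) :
    Extends φ S m a ↔ ∃ b, Extends φ S (m + 1) (Fin.snoc a b) := by
  constructor
  · rintro ⟨y, hy, h⟩
    refine ⟨y ⟨m, hm⟩, y, hy, fun i => ?_⟩
    refine Fin.lastCases ?_ (fun i => ?_) i
    · intro _; simp
    · intro hi; simpa using h i hi
  · rintro ⟨b, y, hy, h⟩
    exact ⟨y, hy, fun i hi => by simpa using h i.castSucc hi⟩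

/-- Being a prefix of an answer is the formula preceded by `d` existential quantifiers, each of
which triples the radius. -/
theorem local_extends {k : ℕ} (φ : FOBij σ k) (h : ∀ v ∈ φ.code, v ∈ vals) (d : ℕ) {m : ℕ}
    (hm : m + d = k) : Local S vals (3 ^ (φ.code.length + d)) (Extends φ S m) := by
  induction d generalizing m with
  | zero =>
    obtain rfl : m = k := hm
    exact fun a a' e => by rw [extends_self, extends_self]; exact local_formula φ h a a' e
  | succ d ih =>
    intro a a' e
    rw [extends_iff φ (by omega), extends_iff φ (by omega)]
    exact (ih (m := m + 1) (by omega)).exists a a' (by rw [← pow_succ']; exact e)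

end

end BijQuery

/-! ## The layout of the input -/

namespace BijQuery

open Function

/-- The word `l` stands in `f` from the position `p` on. -/
def Seg (f : ℕ → ℕ) (p : ℕ) (l : List ℕ) : Prop := ∀ i, (h : i < l.length) → f (p + i) = l[i]

section
variable {f : ℕ → ℕ} {p : ℕ}

@[simp] theorem seg_nil : Seg f p [] := fun _ h => absurd h (by simp)

@[simp] theorem seg_cons {a : ℕ} {l : List ℕ} : Seg f p (a :: l) ↔ f p = a ∧ Seg f (p + 1) l := by
  constructor
  · refine fun h => ⟨h 0 (by simp), fun i hi => ?_⟩
    have := h (i + 1) (by simpa using hi)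
    rw [show p + 1 + i = p + (i + 1) by omega, this]; simp
  · rintro ⟨h, h'⟩ i hi
    cases i with
    | zero => simpa using h
    | succ i =>
      rw [show p + (i + 1) = p + 1 + i by omega, h' i (by simpa using hi)]; simp

@[simp] theorem seg_append {l l' : List ℕ} :
    Seg f p (l ++ l') ↔ Seg f p l ∧ Seg f (p + l.length) l' := by
  induction l generalizing p with
  | nil => simp
  | cons a l ih => simp [ih, and_assoc, Nat.add_assoc, Nat.add_comm 1]

theorem Seg.congr {g : ℕ → ℕ} {l : List ℕ} (h : Seg f p l)
    (hg : ∀ i < l.length, g (p + i) = f (p + i)) : Seg g p l :=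
  fun i hi => (hg i hi).trans (h i hi)

theorem seg_push {l : List ℕ} {i x : ℕ} (h : Seg f 0 l) (hi : i = l.length) :
    Seg (update f i x) 0 (l ++ [x]) := by
  subst hi
  rw [seg_append]
  refine ⟨h.congr fun i hi => update_of_ne (by omega) _ _, ?_⟩
  simp

theorem seg_zero {l : List ℕ} (h : Seg f 0 l) {i : ℕ} (hi : i < l.length) : f i = l[i] := by
  simpa using h i hi

theorem seg_ofFn {m : ℕ} {g : Fin m → ℕ} (h : Seg f p (List.ofFn g)) (i : Fin m) :
    f (p + i) = g i := by
  rw [h i (by simp)]; simp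

theorem seg_flatMap {α : Type} {l : List α} {g : α → List ℕ} (h : Seg f p (l.flatMap g)) {i : ℕ}
    (hi : i < l.length) : Seg f (p + ((l.take i).flatMap g).length) (g l[i]) := by
  have e : l.flatMap g = (l.take i).flatMap g ++ (g l[i] ++ (l.drop (i + 1)).flatMap g) := by
    rw [← List.flatMap_cons, ← List.flatMap_append, ← List.drop_eq_getElem_cons hi,
      List.take_append_drop]
  rw [e, seg_append, seg_append] at h
  exact h.2.1

theorem length_flatMap_take_succ {α : Type} {l : List α} {g : α → List ℕ} {i : ℕ}
    (hi : i < l.length) : ((l.take (i + 1)).flatMap g).length =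
      ((l.take i).flatMap g).length + (g l[i]).length := by
  rw [List.take_succ_eq_append_getElem hi, List.flatMap_append, List.length_append,
    List.flatMap_cons, List.flatMap_nil, List.append_nil]

end

section
variable {σ : UnarySig} (S : BijStructure σ)

/-- The word by which a predicate is stored. -/
def predCode (i : Fin σ.numPred) : List ℕ :=
  (S.pred i).card :: ((List.finRange S.n).filter (fun a => decide (a ∈ S.pred i))).map Fin.val

/-- The position of a predicate in the input. -/
def predPos (i : ℕ) : ℕ :=
  4 + σ.numConst + (((List.finRange σ.numPred).take i).flatMap (predCode S)).length

/-- The position of the first function in the input. -/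
def funPos : ℕ := predPos S σ.numPred

/-- The position of the number of variables in the input. -/
def queryPos : ℕ := funPos S + σ.numFun * S.n

variable {S}

theorem predCode_length (i : Fin σ.numPred) : (predCode S i).length = (S.pred i).card + 1 := by
  rw [predCode, List.length_cons, List.length_map, ← List.toFinset_card_of_nodup
    ((List.nodup_finRange _).filter _)]
  congr 2; ext; simp

theorem predPos_zero : predPos S 0 = 4 + σ.numConst := by simp [predPos]

theorem predPos_succ {i : ℕ} (hi : i < σ.numPred) :
    predPos S (i + 1) = predPos S i + (S.pred ⟨i, hi⟩).card + 1 := by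
  rw [predPos, length_flatMap_take_succ (by simpa using hi), predCode_length, predPos]
  simp [Nat.add_assoc]

theorem funPos_eq : funPos S = 4 + σ.numConst + ∑ i, ((S.pred i).card + 1) := by
  rw [funPos, predPos, List.take_of_length_le (by simp), List.length_flatMap,
    ← List.ofFn_id, List.map_ofFn, List.sum_ofFn]
  simp [predCode_length]

/-- The size counts `n` registers for the domain where the word has four header cells; otherwise
both count the same. So the length of the stored structure is linear in its size. -/
theorem queryPos_add : queryPos S + S.n = S.size + 4 := by
  rw [queryPos, funPos_eq, BijStructure.size]; omega

theorem predPos_le {i : ℕ} (hi : i ≤ σ.numPred) : predPos S i ≤ funPos S := by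
  obtain ⟨d, hd⟩ := Nat.exists_eq_add_of_le hi
  rw [funPos, hd]
  have key : ∀ d, i + d ≤ σ.numPred → predPos S i ≤ predPos S (i + d) := by
    intro d
    induction d with
    | zero => intro _; simp
    | succ d ih =>
      intro h
      rw [← Nat.add_assoc, predPos_succ (by omega)]
      have := ih (by omega); omega
  exact key d (by omega)

theorem length_structCode : S.code.length = queryPos S := by
  have h : ((List.finRange σ.numFun).flatMap
      (fun i => List.ofFn (fun a => (S.func i a : ℕ)))).length = σ.numFun * S.n := by
    simp [List.length_flatMap]
  rw [BijStructure.code, List.length_append, h, queryPos, funPos_eq]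
  simp only [List.length_append, List.length_ofFn, List.length_cons, List.length_nil]
  congr 2
  have := funPos_eq (S := S)
  rw [funPos, predPos, List.take_of_length_le (by simp)] at this
  rw [show predCode S = fun i => (S.pred i).card :: ((List.finRange S.n).filter
    (fun a => decide (a ∈ S.pred i))).map Fin.val from rfl] at this
  omega

/-- The facts on the memory in which a structure is stored. -/
structure Stored (S : BijStructure σ) (f : ℕ → ℕ) : Prop where
  n : f 0 = S.n
  numConst : f 1 = σ.numConst
  numPred : f 2 = σ.numPred
  numFun : f 3 = σ.numFun
  const : ∀ c : Fin σ.numConst, f (4 + c) = S.const c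
  card : ∀ i : Fin σ.numPred, f (predPos S i) = (S.pred i).card
  elems : ∀ i : Fin σ.numPred, Seg f (predPos S i + 1)
    (((List.finRange S.n).filter (fun a => decide (a ∈ S.pred i))).map Fin.val)
  func : ∀ (i : Fin σ.numFun) (a : Fin S.n), f (funPos S + i * S.n + a) = S.func i a

theorem stored_of_seg {f : ℕ → ℕ} (h : Seg f 0 S.code) : Stored S f := by
  rw [BijStructure.code] at h
  obtain ⟨h, h4⟩ := seg_append.1 h
  obtain ⟨h, h3⟩ := seg_append.1 h
  obtain ⟨h1, h2⟩ := seg_append.1 h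
  have hpos : ∀ i : ℕ, 0 + ([S.n, σ.numConst, σ.numPred, σ.numFun] ++
      List.ofFn (fun i => (S.const i : ℕ))).length = 4 + σ.numConst := fun _ => by
    simp; omega
  rw [hpos 0] at h3
  have hp : ∀ i : Fin σ.numPred, Seg f (predPos S i) (predCode S i) := fun i => by
    have := seg_flatMap h3 (i := i) (by simp)
    rw [List.getElem_finRange] at this
    exact this
  have h4' : Seg f (funPos S) ((List.finRange σ.numFun).flatMap
      (fun i => List.ofFn (fun a => (S.func i a : ℕ)))) := by
    convert h4 using 1
    rw [List.length_append, ← Nat.add_assoc, hpos 0, funPos, predPos,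
      List.take_of_length_le (by simp)]
    rfl
  simp only [seg_cons] at h1
  refine ⟨h1.1, h1.2.1, h1.2.2.1, h1.2.2.2.1, fun c => ?_, fun i => ?_, fun i => ?_, fun i a => ?_⟩
  · have := seg_ofFn h2 c
    simpa using this
  · have := hp i
    rw [predCode, seg_cons] at this
    exact this.1
  · have := hp i
    rw [predCode, seg_cons] at this
    exact this.2
  · have := seg_flatMap h4' (i := i) (by simp)
    rw [List.getElem_finRange] at this
    have h5 := seg_ofFn this a
    have e : (((List.finRange σ.numFun).take i).flatMap
        (fun i => List.ofFn (fun a => (S.func i a : ℕ)))).length = i * S.n := by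
      simp [List.length_flatMap]
    rw [e] at h5
    simpa using h5

theorem length_wordCode (w : BijWord σ) : w.code.length = 2 * w.length + 1 := by
  simp [BijWord.code, List.length_flatMap]; omega

theorem seg_wordCode {f : ℕ → ℕ} {p : ℕ} {w : BijWord σ} (h : Seg f p w.code) :
    f p = w.length := by
  rw [BijWord.code, seg_cons] at h; exact h.1

end

/-- Sum of the thresholds in the cardinality statements of a formula. -/
def thresholds {σ : UnarySig} : {m : ℕ} → FOBij σ m → ℕ
  | _, .atom _ => 0
  | _, .card r _ => r
  | _, .neg φ => thresholds φ
  | _, .and φ ψ => thresholds φ + thresholds ψ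
  | _, .or φ ψ => thresholds φ + thresholds ψ
  | _, .ex φ => thresholds φ
  | _, .all φ => thresholds φ

/-! ## Variables and arrays of the program -/

inductive Var where
  | n | nc | np | nf | fb | k | fs | tl | wd | rho | dep | rad | num | th | wl
  | pos | pend | tok | q | x | y | z | i | l | ir | bt | i1 | i2 | i3 | i4 | i5 | i6
  | b | c1 | cnt | len | len0 | base | lim | jl | lv | go | alive | res | ell | cc | dup
  | m | md | sp | val | v | t
  | fr | fl | fn | fq | fx | top
  deriving DecidableEq

/-- `inp` stands first, hence has cell number 0, which is where `spread` leaves the input. `bas`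
gives the offset of the row of a number in the tables `fwd`, `bwd`, `prd`, `cst`. `ord` is the
domain grouped by the type numbers in `typ`, `fin` the ends of the classes, `rep` the
representatives. `vs` with the lengths `lens` holds the ranges of quantifiers, `env` the assignment,
`ctr` the positions of the search in its levels. The arrays from `sr` on are the fields of the
evaluation stack. -/
inductive Arr where
  | inp | bas | fwd | bwd | prd | cst | vs | typ | ord | fin | rep | env | ctr | lens
  | sr | sl | si | sc | sn | sq | sp | sx | sv
  deriving DecidableEq

open WhileRAM

theorem Var.ctorIdx_injective : Injective Var.ctorIdx := fun x y h => by
  rw [← Var.ofNat_ctorIdx x, ← Var.ofNat_ctorIdx y, h]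

theorem Arr.ctorIdx_injective : Injective Arr.ctorIdx := fun x y h => by
  rw [← Arr.ofNat_ctorIdx x, ← Arr.ofNat_ctorIdx y, h]

/-- Placement with the input as the only array. -/
def layout₀ : Layout Var Unit where
  h := 0
  reg := Var.ctorIdx
  reg_inj := Var.ctorIdx_injective
  cell _ := 0
  cell_lt _ := by simp
  cell_inj _ _ _ := rfl

/-- Placement with all arrays. -/
def layout : Layout Var Arr where
  h := 5
  reg := Var.ctorIdx
  reg_inj := Var.ctorIdx_injective
  cell := Arr.ctorIdx
  cell_lt T := by cases T <;> decide
  cell_inj := Arr.ctorIdx_injective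

end BijQuery

/-! ## First part of the precomputation: reading the input -/

namespace BijQuery

open Function WhileRAM

set_option linter.constructorNameAsVariable false

infix:40 " ≔ " => Cmd.set

abbrev rd {A : Type} (x : Var) : Ex Var A := .var x

/-- Reading of the sizes and search for the end of the structure. -/
def readSizes : Cmd Var Unit :=
  .n ≔ .get () 0 ;; .nc ≔ .get () 1 ;; .np ≔ .get () 2 ;; .nf ≔ .get () 3 ;;
    .q ≔ 4 + rd .nc

/-- Predicates have different lengths, so the table of the first function is found by passing over
them one by one; from there the functions are passed by adding `n` repeatedly. At the end one
formula is pending. -/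
def readHeader : Cmd Var Unit :=
  readSizes ;;
  Cmd.for .i .np (.q ≔ rd .q + .get () (rd .q) + 1) ;;
  .fb ≔ rd .q ;;
  Cmd.for .i .nf (.q ≔ rd .q + rd .n) ;;
  (.k ≔ .get () (rd .q) ;; .fs ≔ rd .q + 1 ;; .pos ≔ rd .q + 1 ;; .pend ≔ 1 ;; .rho ≔ 0)

theorem wp_readHeader {σ : UnarySig} {S : BijStructure σ} {B : ℕ} {s : St Var Unit}
    (hs : Stored S (s.a ())) (hB : queryPos S + 5 ≤ B) :
    Wp 0 B readHeader (100 * (σ.numPred + σ.numFun + 1)) (fun s' => s'.v .n = S.n ∧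
      s'.v .nc = σ.numConst ∧ s'.v .np = σ.numPred ∧ s'.v .nf = σ.numFun ∧ s'.v .fb = funPos S ∧
      s'.v .k = s.a () (queryPos S) ∧ s'.v .fs = queryPos S + 1 ∧ s'.v .pos = queryPos S + 1 ∧
      s'.v .pend = 1 ∧ s'.v .rho = 0) s := by
  have h1 : σ.numPred ≤ funPos S := by
    have key : ∀ i ≤ σ.numPred, i ≤ predPos S i := by
      intro i
      induction i with
      | zero => simp
      | succ i ih => intro h; rw [predPos_succ (by omega)]; have := ih (by omega); omega
    exact key _ le_rfl
  have h2 : σ.numFun ≤ σ.numFun * S.n := Nat.le_mul_of_pos_right _ S.n_pos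
  have h3 : funPos S + σ.numFun * S.n = queryPos S := rfl
  have h4 : 4 + σ.numConst ≤ funPos S := predPos_zero (S := S) ▸ predPos_le (Nat.zero_le _)
  refine (Wp.seq (τ₁ := 60) (R := fun s' => s'.v .n = S.n ∧ s'.v .nc = σ.numConst ∧
    s'.v .np = σ.numPred ∧ s'.v .nf = σ.numFun ∧ s'.v .q = 4 + σ.numConst) ?_ ?_).le (τ := 60 +
      ((σ.numPred * (20 + 9) + 6) + (2 + ((σ.numFun * (20 + 9) + 6) + 20)))) (by omega)
  · refine Wp.straight (by decide) ?_ ?_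
    · simp [readSizes, Cmd.okL, Cmd.sem, hs.numConst]; omega
    · simp [readSizes, Cmd.sem, hs.n, hs.numConst, hs.numPred, hs.numFun]
  · rintro s1 g1 ⟨e1, e2, e3, e4, e5⟩
    have hs1 : s1.a () = s.a () := g1.a () rfl
    refine Wp.seq (Wp.for (fun t s' => s'.v .q = predPos S t)
      (by decide) rfl rfl (by omega) e3 ?_ ?_) ?_
    · simp [e5, predPos_zero]
    · intro t ht s2 g2 _ _ h
      have ha : s2.a () = s.a () := (g2.a () rfl).trans hs1
      have hc := hs.card ⟨t, ht⟩
      have hp := predPos_succ (S := S) ht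
      have hle := predPos_le (S := S) (i := t + 1) (by omega)
      refine Wp.straight (by decide) ?_ ?_
      · simp [Cmd.okL, h, ha, hc]; omega
      · simp [Cmd.sem, h, ha, hc, hp]
    intro s2 g2 (hq : s2.v .q = funPos S)
    have ha2 : s2.a () = s.a () := (g2.a () rfl).trans hs1
    refine Wp.seq (R := fun s' => s' = s2.setV .fb (funPos S)) (Wp.straight (by decide) ?_ ?_) ?_
    · simp [Cmd.okL]
    · simp [Cmd.sem, hq]
    rintro s3 - rfl
    refine Wp.seq (Wp.for
      (fun t s' => s'.v .q = funPos S + t * S.n)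
      (by decide) rfl rfl (by omega) (by simpa using (g2.v _ rfl).trans e4) ?_ ?_) ?_
    · simp [hq]
    · intro t ht s4 g4 _ _ h
      have hn : s4.v .n = S.n := (g4.v _ rfl).trans (by simpa using (g2.v _ rfl).trans e1)
      have : (t + 1) * S.n ≤ σ.numFun * S.n := Nat.mul_le_mul_right _ (by omega)
      rw [Nat.succ_mul] at this
      refine Wp.straight (by decide) ?_ ?_
      · simp [Cmd.okL, h, hn]; omega
      · simp [Cmd.sem, h, hn]; ring
    intro s4 g4 (hq4 : s4.v .q = queryPos S)
    have ha4 : s4.a () = s.a () := (g4.a () rfl).trans ha2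
    have v4 : ∀ x, x ≠ .q → x ≠ .i → x ≠ .fb → s4.v x = s1.v x := fun x h h' h'' => by
      rw [g4.v x (by simp [Cmd.for, Cmd.wV, h, h']), St.setV_v, if_neg h'',
        g2.v x (by simp [Cmd.for, Cmd.wV, h, h'])]
    have hfb : s4.v .fb = funPos S := (g4.v _ rfl).trans (by simp)
    refine Wp.straight (by decide) ?_ ?_
    · simp [Cmd.okL, Cmd.sem, hq4]; omega
    · simp [Cmd.sem, hq4, v4, ha4, e1, e2, e3, e4, hfb]

/-! ### Search for the end of the formula, and spreading of the input -/

/-- One step of the search for the end of the formula; `pend` is the number of subformulas that are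
still to be read. -/
def scanBody : Cmd Var Unit :=
  .tok ≔ .get () (rd .pos) ;; .pos ≔ rd .pos + 1 ;;
  -- Prefix notation needs no stack: an atom (symbols 0, 1, 2) settles one pending subformula, a
  -- binary connective (4, 5) adds one, the other symbols leave the number unchanged. A word
  -- occupies its length cell and two cells per letter, and is followed by its variable.
  .ite (3 - rd .tok)
    (.ite (rd .tok - 1) (.pos ≔ rd .pos + 1) .skip ;;
      .pos ≔ rd .pos + .get () (rd .pos) + .get () (rd .pos) + 2 ;;
      .ite (rd .tok - 1) .skip (.ite (rd .tok) (.pos ≔ rd .pos + 1)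
        (.pos ≔ rd .pos + .get () (rd .pos) + .get () (rd .pos) + 2)) ;;
      .pend ≔ rd .pend - 1)
    (.ite (6 - rd .tok) (.ite (rd .tok - 3) (.pend ≔ rd .pend + 1) .skip)
      (.ite (rd .tok - 7) (.rho ≔ rd .rho + .get () (rd .pos) ;; .pos ≔ rd .pos + 1) .skip))

def scan : Cmd Var Unit := .wh (rd .pend) scanBody

/-- The search reads the word `l`, with `d` added to the sum of thresholds. -/
def Scans (l : List ℕ) (d : ℕ) : Prop :=
  ∀ {B : ℕ} {s : St Var Unit} {p q r τ : ℕ} {Q : St Var Unit → Prop}, Seg (s.a ()) p l →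
    s.v .pos = p → s.v .pend = q + 1 → s.v .rho = r → p + l.length + 8 ≤ B → q + l.length + 1 ≤ B →
    r + d ≤ B →
    (∀ s', Agree scan s s' → s'.v .pos = p + l.length → s'.v .pend = q → s'.v .rho = r + d →
      Wp 0 B scan τ Q s') →
    Wp 0 B scan (τ + 200 * l.length) Q s

theorem agree_scanBody {s s' : St Var Unit} (h : Agree scanBody s s') : Agree scan s s' :=
  h.mono (fun _ h => h) (fun _ h => h) (fun h => h)

/-- A single iteration of the search. -/
theorem wp_scan_step {B : ℕ} {s : St Var Unit} {τ : ℕ} {Q : St Var Unit → Prop}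
    (hp : s.v .pend ≠ 0) (hok : scanBody.okL B s)
    (h : Wp 0 B scan τ Q (scanBody.sem s)) : Wp 0 B scan (τ + 200) Q s := by
  refine (Wp.whT (τ₁ := 190) (e := rd .pend) trivial hp
    (Wp.straight (by decide) hok h)).le ?_
  simp only [rd, Ex.cost_var]; omega

theorem agree_sem {A : Type} [DecidableEq A] {c : Cmd Var A} {B : ℕ} {s : St Var A} (h : c.okL B s) :
    Agree c s (c.sem s) := by
  obtain ⟨_, _, s', r, rfl⟩ := Wp.straight (h := 0) (Q := fun s' => s' = c.sem s) le_rfl h rfl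
  exact r.agree

section
variable {σ : UnarySig}

/-- `Scans` has continuation form because the search is a single loop without visible recursion:
what happens after the word is a hypothesis. In this form the statements for subformulas compose by
plain application. -/
theorem scans_atom {m : ℕ} (α : BijAtom σ m) : Scans α.code 0 := by
  intro B s p q r τ Q hseg hpos hpend hrho hB hB' hB'' h
  cases α with
  | eq w i w' j =>
    simp only [BijAtom.code, seg_cons, seg_append, length_wordCode, List.length_append,
      List.length_cons, List.length_nil] at hseg hB h ⊢
    obtain ⟨h0, ⟨⟨hw, -⟩, hw'⟩, -⟩ := hseg
    replace hw := seg_wordCode hw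
    replace hw' := seg_wordCode hw'
    rw [show p + 1 + (2 * List.length w + 1 + (0 + 1)) = p + 1 + w.length + w.length + 2 by omega] at hw'
    have hok : scanBody.okL B s := by
      simp [scanBody, Cmd.okL, Cmd.sem, hpos, h0, hw, hw']; omega
    refine (wp_scan_step (τ := τ) (by omega) hok (h _ (agree_scanBody (agree_sem hok)) ?_ ?_ ?_)).le
      (by omega)
    · simp [scanBody, Cmd.sem, hpos, h0, hw, hw']; omega
    · simp [scanBody, Cmd.sem, hpos, h0, hw, hw', hpend]
    · simp [scanBody, Cmd.sem, hpos, h0, hw, hw', hrho]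
  | eqConst w i c =>
    simp only [BijAtom.code, seg_cons, seg_append, length_wordCode, List.length_append,
      List.length_cons, List.length_nil] at hseg hB h ⊢
    obtain ⟨h0, hw, -⟩ := hseg
    replace hw := seg_wordCode hw
    have hok : scanBody.okL B s := by
      simp [scanBody, Cmd.okL, Cmd.sem, hpos, h0, hw]; omega
    refine (wp_scan_step (τ := τ) (by omega) hok (h _ (agree_scanBody (agree_sem hok)) ?_ ?_ ?_)).le
      (by omega)
    · simp [scanBody, Cmd.sem, hpos, h0, hw]; omega
    · simp [scanBody, Cmd.sem, hpos, h0, hw, hpend]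
    · simp [scanBody, Cmd.sem, hpos, h0, hw, hrho]
  | pred U w i =>
    simp only [BijAtom.code, seg_cons, seg_append, length_wordCode, List.length_append,
      List.length_cons, List.length_nil] at hseg hB h ⊢
    obtain ⟨h0, -, hw, -⟩ := hseg
    replace hw := seg_wordCode hw
    have hok : scanBody.okL B s := by
      simp [scanBody, Cmd.okL, Cmd.sem, hpos, h0, hw]; omega
    refine (wp_scan_step (τ := τ) (by omega) hok (h _ (agree_scanBody (agree_sem hok)) ?_ ?_ ?_)).le
      (by omega)
    · simp [scanBody, Cmd.sem, hpos, h0, hw]; omega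
    · simp [scanBody, Cmd.sem, hpos, h0, hw, hpend]
    · simp [scanBody, Cmd.sem, hpos, h0, hw, hrho]

theorem Scans.unary {l : List ℕ} {d c : ℕ} (h : Scans l d) (hc : c = 3 ∨ c = 6 ∨ c = 7) :
    Scans (c :: l) d := by
  intro B s p q r τ Q hseg hpos hpend hrho hB hB' hB'' hQ
  simp only [seg_cons, List.length_cons] at hseg hB hB' hQ ⊢
  obtain ⟨h0, hl⟩ := hseg
  have hok : scanBody.okL B s := by
    rcases hc with rfl | rfl | rfl <;> simp [scanBody, Cmd.okL, Cmd.sem, hpos, h0] <;> omega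
  have hag := agree_scanBody (agree_sem hok)
  have e : ∀ x, x ≠ .pos → x ≠ .tok → (scanBody.sem s).v x = s.v x := fun x h1 h2 => by
    rcases hc with rfl | rfl | rfl <;> simp [scanBody, Cmd.sem, hpos, h0, h1, h2]
  have ep : (scanBody.sem s).v .pos = p + 1 := by
    rcases hc with rfl | rfl | rfl <;> simp [scanBody, Cmd.sem, hpos, h0]
  refine (wp_scan_step (τ := τ + 200 * l.length) (by omega) hok (h (by rw [hag.a () rfl]; exact hl)
    ep ((e _ (by decide) (by decide)).trans hpend) ((e _ (by decide) (by decide)).trans hrho)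
    (by omega) (by omega) (by omega) fun s' g e1 e2 e3 => hQ s' (hag.trans g) (by omega) e2 e3)).le
    (by omega)

theorem Scans.binary {l l' : List ℕ} {d d' c : ℕ} (h : Scans l d) (h' : Scans l' d')
    (hc : c = 4 ∨ c = 5) : Scans (c :: (l ++ l')) (d + d') := by
  intro B s p q r τ Q hseg hpos hpend hrho hB hB' hB'' hQ
  simp only [seg_cons, seg_append, List.length_cons, List.length_append] at hseg hB hB' hQ ⊢
  obtain ⟨h0, hl, hl'⟩ := hseg
  have hok : scanBody.okL B s := by
    rcases hc with rfl | rfl <;> simp [scanBody, Cmd.okL, Cmd.sem, hpos, h0, hpend] <;> omega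
  have hag := agree_scanBody (agree_sem hok)
  have er : (scanBody.sem s).v .rho = r := by
    rcases hc with rfl | rfl <;> simp [scanBody, Cmd.sem, hpos, h0, hrho]
  have eq' : (scanBody.sem s).v .pend = q + 1 + 1 := by
    rcases hc with rfl | rfl <;> simp [scanBody, Cmd.sem, hpos, h0, hpend]
  have ep : (scanBody.sem s).v .pos = p + 1 := by
    rcases hc with rfl | rfl <;> simp [scanBody, Cmd.sem, hpos, h0]
  refine (wp_scan_step (τ := τ + 200 * l'.length + 200 * l.length) (by omega) hok
    (h (by rw [hag.a () rfl]; exact hl) ep eq' er (by omega) (by omega) (by omega)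
      fun s' g e1 e2 e3 => h' (by rw [g.a () rfl, hag.a () rfl]; exact hl') e1 e2 e3
        (by omega) (by omega) (by omega) fun s'' g' e1 e2 e3 =>
        hQ s'' ((hag.trans g).trans g') (by omega) e2 (by omega))).le (by omega)

theorem scans_bool (ψ : BijBool σ) : Scans ψ.code 0 := by
  induction ψ with
  | atom α => exact scans_atom α
  | neg ψ ih => exact ih.unary (.inl rfl)
  | and ψ χ ih ih' => exact ih.binary ih' (.inl rfl)
  | or ψ χ ih ih' => exact ih.binary ih' (.inr rfl)

theorem Scans.card {l : List ℕ} (h : Scans l 0) (d : ℕ) : Scans (8 :: d :: l) d := by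
  intro B s p q r τ Q hseg hpos hpend hrho hB hB' hB'' hQ
  simp only [seg_cons, List.length_cons] at hseg hB hB' hQ ⊢
  obtain ⟨h0, hd, hl⟩ := hseg
  have hok : scanBody.okL B s := by
    simp [scanBody, Cmd.okL, Cmd.sem, hpos, h0, hd, hrho]; omega
  have hag := agree_scanBody (agree_sem hok)
  refine (wp_scan_step (τ := τ + 200 * l.length) (by omega) hok (h (p := p + 1 + 1) (q := q)
    (r := r + d) (by rw [hag.a () rfl]; exact hl)
    (by simp [scanBody, Cmd.sem, hpos, h0]) (by simp [scanBody, Cmd.sem, hpos, h0, hpend])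
    (by simp [scanBody, Cmd.sem, hpos, h0, hrho, hd])
    (by omega) (by omega) (by omega) fun s' g e1 e2 e3 => hQ s' (hag.trans g) (by omega) e2 e3)).le
    (by omega)

theorem scans_formula {m : ℕ} (φ : FOBij σ m) : Scans φ.code (thresholds φ) := by
  induction φ with
  | atom α => exact scans_atom α
  | card r Ψ => exact Scans.card (scans_bool Ψ) r
  | neg φ ih => exact ih.unary (.inl rfl)
  | and φ ψ ih ih' => exact ih.binary ih' (.inl rfl)
  | or φ ψ ih ih' => exact ih.binary ih' (.inr rfl)
  | ex φ ih => exact ih.unary (.inr (.inl rfl))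
  | all φ ih => exact ih.unary (.inr (.inr rfl))

end

/-- Spreading of the input over the array of the second part. -/
def spreadBody : Cmd Var Unit :=
  (.pos ≔ rd .pos - 1 ;; .x ≔ .get () (rd .pos) ;; .y ≔ rd .pos + rd .pos ;; .y ≔ rd .y + rd .y ;;
    .y ≔ rd .y + rd .y ;; .y ≔ rd .y + rd .y ;; .y ≔ rd .y + rd .y ;; .z ≔ rd .y ;; .l ≔ 32) ;;
  Cmd.for .i .l (.put () (rd .z) 0 ;; .z ≔ rd .z + 1) ;;
  .put () (rd .y) (rd .x)

/-- The entries move downwards from the last one: entry `p` goes to the cell `32 * p`, never below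
`p`, so no entry still to be read is overwritten. For `p = 0` the block contains the source cell
itself, whose content has been saved before the block is cleared. -/
def spread : Cmd Var Unit := .wh (rd .pos) spreadBody

theorem wp_spread {B w : ℕ} {s : St Var Unit} (hp : s.v .pos = w) (hB : 32 * w + 32 ≤ B)
    (hz : ∀ i, w ≤ i → s.a () i = 0) :
    Wp 0 B spread (w * 3000 + 2) (fun s' => s'.a () =
      fun i => if i % 32 = 0 then s.a () (i / 32) else 0) s := by
  have key := Wp.while_measure (h := 0) (B := B) (e := rd .pos) (c := spreadBody) (τ := 2900) (N := w)
    -- Invariant: the cells from `32 * pos` on have their final contents, all lower cells are still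
    -- those of the input.
    (s := s) (fun s' => s'.v .pos ≤ w ∧ s'.a () = fun i => if i < 32 * s'.v .pos then s.a () i else
      if i % 32 = 0 then s.a () (i / 32) else 0) (fun s' => s'.v .pos) (fun _ _ => trivial) ?_
    ⟨hp.le, ?_⟩ hp.le
  · refine (key.post fun s' _ hh => ?_).le ?_
    · obtain ⟨⟨_, h2⟩, h3⟩ := hh
      have h3' : s'.v .pos = 0 := h3
      rw [h2, h3']; simp
    · simp only [rd, Ex.cost_var]; omega
  · intro s1 ⟨h1, h2⟩ hne
    replace hne : s1.v .pos ≠ 0 := hne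
    obtain ⟨p, hp1⟩ := Nat.exists_eq_succ_of_ne_zero hne
    rw [hp1] at h1 h2
    refine (Wp.seq (τ₁ := 60) (R := fun s' => s'.v .pos = p ∧ s'.v .x = s1.a () p ∧
      s'.v .y = 32 * p ∧ s'.v .z = 32 * p ∧ s'.v .l = 32) (Wp.straight (by decide) ?_ ?_) ?_).le
      (τ := 60 + ((32 * (20 + 9) + 6) + 20)) (by omega)
    · simp [Cmd.okL, Cmd.sem, hp1]; omega
    · simp [Cmd.sem, hp1]; omega
    rintro s2 g2 ⟨e1, e2, e3, e4, e5⟩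
    have ha2 : s2.a () = s1.a () := g2.a () rfl
    refine Wp.seq (Wp.for (fun t s' => s'.v .z = 32 * p + t ∧ s'.a () = fun i =>
      if 32 * p ≤ i ∧ i < 32 * p + t then 0 else s1.a () i)
      (by decide) rfl rfl (by omega) e5 ?_ ?_) ?_
    · refine ⟨by simp [e4], ?_⟩
      rw [St.setV_a, ha2]; funext i
      rw [if_neg (by omega)]
    · rintro t ht s3 g3 _ _ ⟨h3, h4⟩
      refine Wp.straight (by decide) ?_ ?_
      · simp [Cmd.okL, Cmd.sem, h3]; omega
      · simp only [Cmd.sem, Ex.val_var, h3, St.setA_a, St.setV_a, if_true, h4, Ex.val_ofNat]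
        refine ⟨by simp [h3]; omega, ?_⟩
        funext i
        rw [update_apply]
        split_ifs <;> first | rfl | (exfalso; omega)
    rintro s3 g3 ⟨-, h4⟩
    have hy : s3.v .y = 32 * p := (g3.v _ rfl).trans e3
    have hx : s3.v .x = s1.a () p := (g3.v _ rfl).trans e2
    have hpos : s3.v .pos = p := (g3.v _ rfl).trans e1
    refine Wp.straight (by decide) ?_ ?_
    · simp [Cmd.okL]
    · simp only [Cmd.sem, Ex.val_var, St.setA_v, St.setA_a, if_true, hy, hx, hpos, hp1, h4]
      refine ⟨⟨by omega, ?_⟩, by omega⟩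
      funext i
      rw [update_apply, h2]
      simp only
      split_ifs <;> first | rfl | (exfalso; omega) | (congr 1; omega)
  · funext i
    rw [hp]
    split_ifs with h1 h2
    · rfl
    · rw [hz _ (by omega), hz _ (by omega)]
    · exact hz _ (by omega)

section
variable {σ : UnarySig} (S : BijStructure σ) {k : ℕ} (φ : FOBij σ k)

/-- The input word. -/
def inputWord : List ℕ := S.code ++ k :: φ.code

/-- The facts on the variables that hold after the input has been read. -/
structure Sizes {A : Type} (s : St Var A) : Prop where
  n : s.v .n = S.n
  nc : s.v .nc = σ.numConst
  np : s.v .np = σ.numPred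
  nf : s.v .nf = σ.numFun
  fb : s.v .fb = funPos S
  k : s.v .k = k
  fs : s.v .fs = queryPos S + 1
  tl : s.v .tl = φ.code.length
  rho : s.v .rho = thresholds φ

theorem length_inputWord : (inputWord S φ).length = queryPos S + 1 + φ.code.length := by
  simp [inputWord, length_structCode]; omega

theorem seg_inputWord {f : ℕ → ℕ} (h : Seg f 0 (inputWord S φ)) :
    Stored S f ∧ f (queryPos S) = k ∧ Seg f (queryPos S + 1) φ.code := by
  rw [inputWord, seg_append, length_structCode, Nat.zero_add, seg_cons] at h
  exact ⟨stored_of_seg h.1, h.2⟩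

/-- The first part of the precomputation. -/
def readInput : Cmd Var Unit :=
  readHeader ;; scan ;; (.tl ≔ rd .pos - rd .fs) ;; spread

theorem wp_readInput {B : ℕ} (hB : 32 * (inputWord S φ).length + 32 + thresholds φ ≤ B) :
    Wp 0 B readInput (100 * (σ.numPred + σ.numFun + 1) + 3200 * (inputWord S φ).length + 100)
      (fun s' => Sizes S φ s' ∧ s'.buf = [] ∧ ∀ T : Arr, (reinterpret layout s').a T =
        if T = .inp then fun i => (inputWord S φ).getD i 0 else fun _ => 0)
      (St.init Var (inputWord S φ)) := by
  have hw := length_inputWord S φ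
  have hseg : Seg (fun i => (inputWord S φ).getD i 0) 0 (inputWord S φ) := fun i hi => by
    simp [List.getElem?_eq_getElem hi]
  obtain ⟨h1, h2, h3⟩ := seg_inputWord S φ hseg
  refine (Wp.seq (wp_readHeader (S := S) h1 (by omega)) ?_).le (τ := 100 * (σ.numPred + σ.numFun + 1)
    + ((10 + ((inputWord S φ).length * 3000 + 2) + 10) + 200 * φ.code.length)) (by omega)
  rintro s1 g1 ⟨e1, e2, e3, e4, e5, e6, e7, e8, e9, e10⟩
  have ha1 : s1.a () = fun i => (inputWord S φ).getD i 0 := g1.a () rfl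
  suffices H : ∀ s', Agree scan s1 s' → s'.v .pos = queryPos S + 1 + φ.code.length →
      s'.v .rho = thresholds φ → Wp 0 B ((.tl ≔ rd .pos - rd .fs) ;; spread)
        (10 + ((inputWord S φ).length * 3000 + 2)) (fun s' => Sizes S φ s' ∧ s'.buf = [] ∧
          ∀ T : Arr, (reinterpret layout s').a T =
        if T = .inp then fun i => (inputWord S φ).getD i 0 else fun _ => 0) s' by
    have := scans_formula φ (B := B) (s := s1) (τ := 2) (q := 0) (r := 0)
      (Q := fun s' => Agree scan s1 s' ∧ s'.v .pos = queryPos S + 1 + φ.code.length ∧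
        s'.v .rho = thresholds φ) (by rw [ha1]; exact h3) e8 e9 e10 (by omega) (by omega) (by omega)
      (fun s' g p1 p2 p3 => Wp.whF (e := rd .pend) trivial p2 ⟨g, p1, by omega⟩)
    exact (this.seq fun s' _ ⟨g, p1, p2⟩ => H s' g p1 p2).le (by omega)
  intro s2 g2 hpos hrho
  refine Wp.seq (R := fun s' => s'.v .tl = φ.code.length) (Wp.straight (by decide) ?_ ?_) ?_
  · simp [Cmd.okL]
  · simp [Cmd.sem, hpos, (g2.v .fs rfl).trans e7]
  intro s3 g3 htl
  have ha3 : s3.a () = fun i => (inputWord S φ).getD i 0 :=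
    ((g3.a () rfl).trans (g2.a () rfl)).trans ha1
  refine (wp_spread (w := (inputWord S φ).length) (by rw [g3.v _ rfl, hpos]; omega) (by omega)
    fun i hi => by rw [ha3]; exact List.getD_eq_default _ _ hi).post fun s4 g4 h4 => ?_
  have hv : ∀ x, scan.wV x = false → x ≠ .tl → spread.wV x = false → s4.v x = s1.v x :=
    fun x h1 h2 h3 => by rw [g4.v x h3, g3.v x (by simp [Cmd.wV, h2]), g2.v x h1]
  refine ⟨⟨(hv _ rfl (by decide) rfl).trans e1, (hv _ rfl (by decide) rfl).trans e2,
    (hv _ rfl (by decide) rfl).trans e3, (hv _ rfl (by decide) rfl).trans e4,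
    (hv _ rfl (by decide) rfl).trans e5, (hv _ rfl (by decide) rfl).trans (e6.trans h2),
    (hv _ rfl (by decide) rfl).trans e7, (g4.v _ rfl).trans htl,
    ((g4.v _ rfl).trans (g3.v _ rfl)).trans hrho⟩, ?_, fun T => ?_⟩
  · rw [g4.buf rfl, g3.buf rfl, g2.buf rfl, g1.buf rfl]; rfl
  · funext i
    have hlt : T.ctorIdx < 32 := layout.cell_lt T
    have e : (reinterpret layout s4).a T i = s4.a () (32 * i + T.ctorIdx) := rfl
    rw [e, h4]
    by_cases hT : T = .inp
    · subst hT
      have : (32 * i + Arr.inp.ctorIdx) = 32 * i := rfl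
      simp only [this, if_true]
      rw [if_pos (by omega), ha3]
      congr 1; omega
    · have : T.ctorIdx ≠ 0 := fun h => hT (Arr.ctorIdx_injective h)
      simp only [if_neg hT]
      rw [if_neg (by omega)]

end

end BijQuery

/-! ## Tables of the symbols that occur in the formula -/

namespace BijQuery

open Function WhileRAM

set_option linter.constructorNameAsVariable false

/-- Computation of the position of the table of the function `v` in the input. -/
def locateFun : Cmd Var Arr :=
  .q ≔ rd .fb ;; .ite (rd .nf - rd .v) (Cmd.for .i .v (.q ≔ rd .q + rd .n)) .skip

/-- A number that names no function gets the identity as its table, in accordance with `symFun`. The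
inverse, which the input does not contain, is filled in by the same pass. -/
def fillFunBody : Cmd Var Arr :=
  .x ≔ rd .b ;; .ite (rd .nf - rd .v) (.x ≔ .get .inp (rd .q + rd .b)) .skip ;;
  .put .fwd (rd .base + rd .b) (rd .x) ;; .put .bwd (rd .base + rd .x) (rd .b)

/-- Tables of a function and its inverse. -/
def fillFun : Cmd Var Arr := Cmd.for .b .n fillFunBody

def fillPredBody : Cmd Var Arr :=
  .q ≔ rd .q + 1 ;; .put .prd (rd .base + .get .inp (rd .q)) 1

/-- Table of a predicate. -/
def fillPred : Cmd Var Arr :=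
  .ite (rd .np - rd .v)
    (.q ≔ 4 + rd .nc ;; Cmd.for .i .v (.q ≔ rd .q + .get .inp (rd .q) + 1) ;;
      .l ≔ .get .inp (rd .q) ;; Cmd.for .i .l fillPredBody)
    .skip

/-- Table of a constant. -/
def fillConst : Cmd Var Arr :=
  .ite (rd .nc - rd .v) (.put .cst (rd .base + .get .inp (4 + rd .v)) 1) .skip

/-- Row `t` of every table belongs to the `t`-th number in the code of the formula, which is treated
at once as a possible function, predicate and constant. This makes an analysis of the formula
unnecessary. If a number is repeated, `bas` points to its last row, and all its rows are equal. -/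
def tableBody : Cmd Var Arr :=
  (.v ≔ .get .inp (rd .fs + rd .t) ;; .put .bas (rd .v) (rd .base)) ;;
  locateFun ;; fillFun ;; fillPred ;; fillConst ;; .base ≔ rd .base + rd .n

def buildTables : Cmd Var Arr := .base ≔ 0 ;; Cmd.for .t .tl tableBody

section
variable {σ : UnarySig} {S : BijStructure σ} {B : ℕ}

/-- The characteristic function of a predicate. -/
noncomputable def bit (p : Prop) : ℕ := open Classical in if p then 1 else 0

theorem bit_pos {p : Prop} (h : p) : bit p = 1 := by simp [bit, h]
theorem bit_neg {p : Prop} (h : ¬ p) : bit p = 0 := by simp [bit, h]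

theorem funPos_add_le {f : ℕ} (hf : f < σ.numFun) : funPos S + f * S.n + S.n ≤ queryPos S := by
  have : (f + 1) * S.n ≤ σ.numFun * S.n := Nat.mul_le_mul_right _ hf
  rw [Nat.succ_mul] at this
  rw [queryPos]; omega

theorem wp_locateFun {s : St Var Arr} {v : ℕ} (hfb : s.v .fb = funPos S) (hn : s.v .n = S.n)
    (hnf : s.v .nf = σ.numFun) (hv : s.v .v = v) (hB : queryPos S ≤ B) :
    Wp 5 B locateFun (σ.numFun * 30 + 30) (fun s' => v < σ.numFun → s'.v .q = funPos S + v * S.n)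
      s := by
  refine (Wp.seq (R := fun s' => s' = s.setV .q (funPos S)) (Wp.straight (τ := 2) (by decide) ?_ ?_)
    ?_).le (τ := 2 + (3 + 2 + (σ.numFun * (20 + 9) + 6))) (by omega)
  · simp [Cmd.okL]
  · simp [Cmd.sem, hfb]
  rintro s1 - rfl
  by_cases h : v < σ.numFun
  · refine Wp.iteT (by simp) (by simp [hnf, hv]; omega) ?_
    have h2 := funPos_add_le (S := S) h
    have h3 : v ≤ v * S.n := Nat.le_mul_of_pos_right _ S.n_pos
    refine ((Wp.for (i := Var.i) (l := Var.v) (c := .q ≔ rd .q + rd .n) (N := v) (τ := 20)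
      (fun t s' => s'.v Var.q = funPos S + t * S.n) (by decide) rfl rfl
      (by omega) (by simpa using hv) (by simp) ?_).post fun s' _ h _ => h).le (by
        have := Nat.mul_le_mul_right 29 h.le; omega)
    intro t ht s' g _ _ hq
    have hn' : s'.v .n = S.n := (g.v _ rfl).trans (by simpa using hn)
    have h4 : (t + 1) * S.n ≤ v * S.n := Nat.mul_le_mul_right _ (by omega)
    rw [Nat.succ_mul] at h4
    refine Wp.straight (by decide) ?_ ?_
    · simp [Cmd.okL, hq, hn']; omega
    · simp [Cmd.sem, hq, hn']; ring
  · exact Wp.iteF (by simp) (by simp [hnf, hv]; omega) (Wp.skip fun hh => absurd hh h)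

theorem wp_fillFun {s : St Var Arr} {v base : ℕ} (hs : Stored S (s.a .inp)) (hn : s.v .n = S.n)
    (hnf : s.v .nf = σ.numFun) (hv : s.v .v = v) (hb : s.v .base = base)
    (hq : v < σ.numFun → s.v .q = funPos S + v * S.n) (hB : queryPos S + base + S.n ≤ B) :
    Wp 5 B fillFun (S.n * 110 + 6) (fun s' => ((∀ a : Fin S.n, s'.a .fwd (base + a) = symFun S v a) ∧
      ∀ a : Fin S.n, s'.a .bwd (base + a) = (symFun S v)⁻¹ a) ∧
      ∀ i < base, s'.a .fwd i = s.a .fwd i ∧ s'.a .bwd i = s.a .bwd i) s := by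
  refine ((Wp.for (N := S.n) (τ := 100) (fun t s' => (∀ a : Fin S.n, (a : ℕ) < t →
    s'.a .fwd (base + a) = symFun S v a ∧ s'.a .bwd (base + symFun S v a) = a) ∧
    ∀ i < base, s'.a .fwd i = s.a .fwd i ∧ s'.a .bwd i = s.a .bwd i) (by decide) rfl rfl
      (by omega) hn ?_ ?_).post ?_).le (by omega)
  · exact ⟨fun a ha => absurd ha (by omega), fun i _ => ⟨rfl, rfl⟩⟩
  · rintro t ht s1 g1 hi hn1 ⟨h1, h2⟩
    have hx : (if v < σ.numFun then s1.a .inp (s1.v .q + t) else t) = symFun S v ⟨t, ht⟩ := by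
      rw [g1.a _ rfl, g1.v .q rfl]
      split
      · next h =>
        rw [hq h]
        have := hs.func ⟨v, h⟩ ⟨t, ht⟩
        simpa [symFun, h] using this
      · next h => simp [symFun, h]
    have hx' : (if s1.v .nf - s1.v .v = 0 then t else s1.a .inp (s1.v .q + t)) =
        symFun S v ⟨t, ht⟩ := by
      rw [← hx, g1.v .nf rfl, g1.v .v rfl, hnf, hv]
      by_cases h : v < σ.numFun
      · rw [if_pos h, if_neg (by omega)]
      · rw [if_neg h, if_pos (by omega)]
    have hb1 : s1.v .base = base := (g1.v _ rfl).trans hb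
    have hqB : v < σ.numFun → s1.v .q + t ≤ B := fun h => by
      have := funPos_add_le (S := S) h
      rw [g1.v .q rfl, hq h]; omega
    have hlt := (symFun S v ⟨t, ht⟩).isLt
    have hsem : fillFunBody.okL B s1 ∧ fillFunBody.sem s1 =
        ((s1.setV .x (symFun S v ⟨t, ht⟩)).setA .fwd (base + t) (symFun S v ⟨t, ht⟩)).setA .bwd
          (base + symFun S v ⟨t, ht⟩) t := by
      have hnv : s1.v .nf - s1.v .v = 0 ↔ ¬ v < σ.numFun := by
        rw [g1.v .nf rfl, g1.v .v rfl, hnf, hv]; omega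
      by_cases h : v < σ.numFun
      · have hne : ¬ (s1.v .nf - s1.v .v = 0) := by rw [hnv]; exact not_not.2 h
        rw [if_neg hne] at hx'
        have := hqB h
        constructor
        · simp [fillFunBody, Cmd.okL, Cmd.sem, hi, hne, hx', hb1]; omega
        · simp [fillFunBody, Cmd.sem, hi, hne, hx', hb1, St.setV, St.setA]
      · have hne : s1.v .nf - s1.v .v = 0 := by rw [hnv]; exact h
        rw [if_pos hne] at hx'
        constructor
        · simp [fillFunBody, Cmd.okL, Cmd.sem, hi, hne, hb1]; omega
        · simp [fillFunBody, Cmd.sem, hi, hne, hb1, St.setV, St.setA, ← hx']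
    refine Wp.straight (by decide) hsem.1 ?_
    rw [hsem.2]
    refine ⟨fun a ha => ?_, fun i hi => ?_⟩
    · rcases Nat.lt_succ_iff_lt_or_eq.1 ha with ha | ha
      -- Since the function is injective, the new entry of the inverse table does not overwrite an
      -- earlier one.
      · have hne : symFun S v a ≠ symFun S v ⟨t, ht⟩ := fun h => by
          have := (symFun S v).injective h
          rw [this] at ha; simp at ha
        have hne' : (symFun S v a : ℕ) ≠ symFun S v ⟨t, ht⟩ := fun h => hne (Fin.ext h)
        have hat : (a : ℕ) ≠ t := by omega
        simpa [update_apply, hne', hat] using h1 a ha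
      · obtain rfl : a = ⟨t, ht⟩ := Fin.ext ha
        simp
    · have e1 : i ≠ base + t := by omega
      have e2 : i ≠ base + symFun S v ⟨t, ht⟩ := by omega
      simpa [update_apply, e1, e2] using h2 i hi
  · rintro s' g' ⟨h1, h2⟩
    refine ⟨⟨fun a => (h1 a a.2).1, fun a => ?_⟩, h2⟩
    have := (h1 ((symFun S v)⁻¹ a) (Fin.is_lt _)).2
    simpa using this

theorem wp_fillPred {s : St Var Arr} {v base : ℕ} (hs : Stored S (s.a .inp))
    (hnc : s.v .nc = σ.numConst) (hnp : s.v .np = σ.numPred) (hv : s.v .v = v)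
    (hb : s.v .base = base) (hz : ∀ i, base ≤ i → s.a .prd i = 0)
    (hB : queryPos S + base + S.n + 1 ≤ B) :
    Wp 5 B fillPred (σ.numPred * 80 + S.n * 80 + 100)
      (fun s' => (∀ a : Fin S.n, s'.a .prd (base + a) = bit (symPred S v a)) ∧
      (∀ i < base, s'.a .prd i = s.a .prd i) ∧ ∀ i, base + S.n ≤ i → s'.a .prd i = 0) s := by
  by_cases h : v < σ.numPred
  · have hnpos : v ≤ S.size := by
      have : ∑ _i : Fin σ.numPred, 1 ≤ ∑ i, ((S.pred i).card + 1) :=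
        Finset.sum_le_sum fun i _ => by omega
      simp at this
      rw [BijStructure.size]
      have h2 := Finset.sum_add_distrib (s := Finset.univ) (f := fun i => (S.pred i).card)
        (g := fun _ : Fin σ.numPred => 1)
      simp at h2
      omega
    have hq := queryPos_add (S := S)
    have hfq : funPos S ≤ queryPos S := Nat.le_add_right _ _
    have hpq := predPos_le (S := S) h
    rw [predPos_succ h] at hpq
    have hcard : (S.pred ⟨v, h⟩).card ≤ S.n := by
      simpa using Finset.card_le_univ (S.pred ⟨v, h⟩)
    refine (Wp.iteT (τ := 10 + ((v * (50 + 9) + 6) + (10 + ((S.pred ⟨v, h⟩).card * (50 + 9) + 6))))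
      (by simp) (by simp [hnp, hv]; omega) ?_).le (by simp [Ex.cost]; omega)
    refine Wp.seq (R := fun s' => s' = s.setV .q (4 + σ.numConst))
      (Wp.straight (by decide) ?_ ?_) ?_
    · simp [Cmd.okL, hnc]; have := predPos_le (S := S) (Nat.zero_le σ.numPred)
      rw [predPos_zero] at this; omega
    · simp [Cmd.sem, hnc]
    rintro s1 - rfl
    refine Wp.seq (Wp.for (fun t s' => s'.v .q = predPos S t) (by decide) rfl rfl (by omega)
      (by simpa using hv) (by simp [predPos_zero]) ?_) ?_
    · intro t ht s2 g2 _ _ hq2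
      have ha : s2.a .inp = s.a .inp := g2.a _ rfl
      have hc := hs.card ⟨t, by omega⟩
      have hp := predPos_succ (S := S) (i := t) (by omega)
      have hle := predPos_le (S := S) (i := t + 1) (by omega)
      refine Wp.straight (by decide) ?_ ?_
      · simp [Cmd.okL, hq2, ha, hc]; omega
      · simp [Cmd.sem, hq2, ha, hc, hp]
    intro s2 g2 hq2
    have ha2 : s2.a = s.a := by
      funext T; exact g2.a T (by simp [Cmd.for, Cmd.wA])
    have hc := hs.card ⟨v, h⟩
    refine Wp.seq (R := fun s' => s' = s2.setV .l (S.pred ⟨v, h⟩).card)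
      (Wp.straight (by decide) ?_ ?_) ?_
    · simp [Cmd.okL]
    · simp [Cmd.sem, hq2, ha2, hc]
    rintro s3 - rfl
    have hel := hs.elems ⟨v, h⟩
    set L := ((List.finRange S.n).filter (fun a => decide (a ∈ S.pred ⟨v, h⟩))) with hL
    have hLlen : L.length = (S.pred ⟨v, h⟩).card := by
      have := predCode_length (S := S) ⟨v, h⟩
      rw [predCode, List.length_cons, List.length_map] at this
      exact Nat.succ_injective this
    have hb2 : s2.v .base = base := (g2.v _ rfl).trans (by simpa using hb)
    refine (Wp.for (fun t s' => s'.v .q = predPos S v + t ∧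
      (∀ a : Fin S.n, s'.a .prd (base + a) = bit (a ∈ L.take t)) ∧
      (∀ i < base, s'.a .prd i = s.a .prd i) ∧ ∀ i, base + S.n ≤ i → s'.a .prd i = 0)
      (by decide) rfl rfl (by omega) (by simp) ?_ ?_).post ?_
    · refine ⟨by simpa using hq2, fun a => ?_, fun i _ => ?_, fun i hi => ?_⟩
      · rw [bit_neg (by simp)]; simpa [ha2] using hz _ (by omega)
      · simp [ha2]
      · simpa [ha2] using hz _ (by omega)
    · rintro t ht s4 g4 _ _ ⟨h1, h2, h3, h4⟩
      have ha4 : s4.a .inp = s.a .inp := (g4.a _ rfl).trans (by simp [ha2])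
      have hb4 : s4.v .base = base := (g4.v _ rfl).trans (by simpa using hb2)
      have htL : t < L.length := by omega
      have hx : s.a .inp (predPos S v + t + 1) = (L[t] : ℕ) := by
        have := hel t (by simpa using htL)
        rw [Nat.add_right_comm] at this
        simpa using this
      refine Wp.straight (by decide) ?_ ?_
      · simp [fillPredBody, Cmd.okL, Cmd.sem, h1, ha4, hb4, hx]; omega
      · simp only [fillPredBody, Cmd.sem, Ex.val_add, Ex.val_var, Ex.val_get, St.setV_v, St.setV_a,
          St.setA_a, St.setA_v, h1, ha4, hb4, hx, Ex.val_ofNat, if_true]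
        refine ⟨by simp; omega, fun a => ?_, fun i hi => ?_, fun i hi => ?_⟩
        · simp only [reduceCtorEq, if_false, update_apply]
          by_cases ha : a = L[t]
          · subst ha
            rw [if_pos rfl, bit_pos]
            rw [List.take_succ_eq_append_getElem htL]
            exact List.mem_append_right _ (List.mem_singleton_self _)
          · have : (base + (a : ℕ)) ≠ base + (L[t] : ℕ) := fun h => ha (Fin.ext (by omega))
            rw [if_neg this, h2]
            congr 1
            rw [List.take_succ_eq_append_getElem htL, List.mem_append, List.mem_singleton,
              or_iff_left ha]
        · simp only [reduceCtorEq, if_false, update_apply]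
          rw [if_neg (by omega)]; exact h3 i hi
        · simp only [reduceCtorEq, if_false, update_apply]
          rw [if_neg (by omega)]; exact h4 i hi
    · rintro s' _ ⟨-, h2, h3, h4⟩
      refine ⟨fun a => ?_, h3, h4⟩
      rw [h2, ← hLlen, List.take_length]
      congr 1
      simp [hL, symPred, h]
  · refine (Wp.iteF (τ := 10) (by simp) (by simp [hnp, hv]; omega) (Wp.skip ?_)).le
      (by simp [Ex.cost])
    refine ⟨fun a => ?_, fun _ _ => rfl, fun i hi => hz i (by omega)⟩
    rw [hz _ (by omega), bit_neg]
    rintro ⟨h', _⟩; exact h h'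

theorem wp_fillConst {s : St Var Arr} {v base : ℕ} (hs : Stored S (s.a .inp))
    (hnc : s.v .nc = σ.numConst) (hv : s.v .v = v)
    (hb : s.v .base = base) (hz : ∀ i, base ≤ i → s.a .cst i = 0)
    (hB : queryPos S + base + S.n + 4 ≤ B) :
    Wp 5 B fillConst 60
      (fun s' => (∀ a : Fin S.n, s'.a .cst (base + a) = bit (symConst S v a)) ∧
      (∀ i < base, s'.a .cst i = s.a .cst i) ∧ ∀ i, base + S.n ≤ i → s'.a .cst i = 0) s := by
  have hfq : funPos S ≤ queryPos S := Nat.le_add_right _ _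
  have h0 := predPos_le (S := S) (Nat.zero_le σ.numPred)
  rw [predPos_zero] at h0
  by_cases h : v < σ.numConst
  · have hne : ¬ (σ.numConst - v = 0) := by omega
    have hc := hs.const ⟨v, h⟩
    have hlt := (S.const ⟨v, h⟩).isLt
    simp only at hc
    refine Wp.straight (by decide) ?_ ?_
    · simp [fillConst, Cmd.okL, hnc, hv, hne, hb, hc]; omega
    · simp only [fillConst, Cmd.sem, Ex.val_sub, Ex.val_var, hnc, hv, hne, if_false, Ex.val_add,
        Ex.val_get, Ex.val_ofNat, hb, hc, St.setA_a, if_true, update_apply]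
      refine ⟨fun a => ?_, fun i hi => ?_, fun i hi => ?_⟩
      · by_cases ha : a = S.const ⟨v, h⟩
        · subst ha
          rw [if_pos rfl, bit_pos ⟨h, rfl⟩]
        · have : base + (a : ℕ) ≠ base + (S.const ⟨v, h⟩ : ℕ) := fun h => ha (Fin.ext (by omega))
          rw [if_neg this, hz _ (by omega), bit_neg]
          rintro ⟨_, h'⟩; exact ha h'
      · rw [if_neg (by omega)]
      · rw [if_neg (by omega)]; exact hz _ (by omega)
  · have hne : σ.numConst - v = 0 := by omega
    refine Wp.straight (by decide) ?_ ?_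
    · simp [fillConst, Cmd.okL, hnc, hv, hne]
    · simp only [fillConst, Cmd.sem, Ex.val_sub, Ex.val_var, hnc, hv, hne, if_true]
      refine ⟨fun a => ?_, by simp, fun i hi => hz i (by omega)⟩
      rw [hz _ (by omega), bit_neg]
      rintro ⟨h', _⟩; exact h h'

/-- The tables of the symbols with the numbers in `l` have been built. -/
structure Tables (S : BijStructure σ) (l : List ℕ) (s : St Var Arr) : Prop where
  fwd : ∀ t, (h : t < l.length) → ∀ a : Fin S.n, s.a .fwd (t * S.n + a) = symFun S l[t] a
  bwd : ∀ t, (h : t < l.length) → ∀ a : Fin S.n, s.a .bwd (t * S.n + a) = (symFun S l[t])⁻¹ a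
  prd : ∀ t, (h : t < l.length) → ∀ a : Fin S.n, s.a .prd (t * S.n + a) = bit (symPred S l[t] a)
  cst : ∀ t, (h : t < l.length) → ∀ a : Fin S.n, s.a .cst (t * S.n + a) = bit (symConst S l[t] a)
  bas : ∀ v ∈ l, ∃ t, ∃ h : t < l.length, l[t] = v ∧ s.a .bas v = t * S.n

theorem forall_getElem_concat {l : List ℕ} {v : ℕ} {P : ℕ → ℕ → Prop}
    (h : ∀ t, (h : t < l.length) → P t l[t]) (hv : P l.length v) :
    ∀ t, (h : t < (l ++ [v]).length) → P t (l ++ [v])[t] := by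
  intro t ht
  rw [List.length_append, List.length_singleton] at ht
  rcases Nat.lt_succ_iff_lt_or_eq.1 ht with h' | rfl
  · rw [List.getElem_append_left h']; exact h t h'
  · simpa using hv

theorem row_le {t l n : ℕ} (h : t < l) (a : Fin n) : t * n + a < l * n := by
  have : (t + 1) * n ≤ l * n := Nat.mul_le_mul_right _ h
  rw [Nat.succ_mul] at this; omega

/-- In the tables of predicates and constants only the ones are written, so the part beyond the
current row must be known to be zero. Rows of function tables are written completely. -/
theorem wp_tableBody {k : ℕ} {φ : FOBij σ k} {s : St Var Arr} {t : ℕ} (ht : t < φ.code.length)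
    (hz : Sizes S φ s) (hs : Stored S (s.a .inp)) (hseg : Seg (s.a .inp) (queryPos S + 1) φ.code)
    (hst : s.v .t = t) (hb : s.v .base = t * S.n)
    (hT : Tables S (φ.code.take t) s)
    (hp : ∀ i, t * S.n ≤ i → s.a .prd i = 0) (hc : ∀ i, t * S.n ≤ i → s.a .cst i = 0)
    (hB : queryPos S + 5 + φ.code.length + φ.code.length * S.n ≤ B) :
    Wp 5 B tableBody (σ.numFun * 30 + S.n * 200 + σ.numPred * 80 + 300)
      (fun s' => s'.v .base = (t + 1) * S.n ∧ Tables S (φ.code.take (t + 1)) s' ∧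
      (∀ i, (t + 1) * S.n ≤ i → s'.a .prd i = 0) ∧ ∀ i, (t + 1) * S.n ≤ i → s'.a .cst i = 0) s := by
  have htn : (t + 1) * S.n ≤ φ.code.length * S.n := Nat.mul_le_mul_right _ ht
  rw [Nat.succ_mul] at htn ⊢
  have hlen : (φ.code.take t).length = t := by simp; omega
  set v := φ.code[t] with hv
  have hx : s.a .inp (queryPos S + 1 + t) = v := hseg t ht
  refine (Wp.seq (τ₁ := 60) (R := fun s' => s' = (s.setV .v v).setA .bas v (t * S.n))
    (Wp.straight (by decide) ?_ ?_) ?_).le (τ := 60 + ((σ.numFun * 30 + 30) + ((S.n * 110 + 6) +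
      ((σ.numPred * 80 + S.n * 80 + 100) + (60 + 10))))) (by omega)
  · simp [Cmd.okL, Cmd.sem, hz.fs, hst]; omega
  · simp [Cmd.sem, hz.fs, hst, hx, hb]
  rintro s1 - rfl
  have hs1 : ∀ T, T ≠ .bas → ((s.setV .v v).setA .bas v (t * S.n)).a T = s.a T := fun T hT => by
    simp [hT]
  have hs1v : ∀ x, x ≠ .v → ((s.setV .v v).setA .bas v (t * S.n)).v x = s.v x := fun x hx => by
    simp [hx]
  have hvv : ((s.setV .v v).setA .bas v (t * S.n)).v .v = v := by simp
  have hbas : ((s.setV .v v).setA .bas v (t * S.n)).a .bas = update (s.a .bas) v (t * S.n) := by simp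
  generalize (s.setV .v v).setA .bas v (t * S.n) = s1 at hs1 hs1v hvv hbas
  refine Wp.seq (wp_locateFun (S := S) (v := v) ((hs1v _ (by decide)).trans hz.fb)
    ((hs1v _ (by decide)).trans hz.n) ((hs1v _ (by decide)).trans hz.nf) hvv (by omega)) ?_
  intro s2 g2 hq
  have g2a : s2.a = s1.a := by
    funext T; exact g2.a T (by simp [locateFun, Cmd.for, Cmd.wA])
  have g2v : ∀ x, locateFun.wV x = false → x ≠ .v → s2.v x = s.v x := fun x h h' =>
    (g2.v x h).trans (hs1v x h')
  have hinp2 : s2.a .inp = s.a .inp := by rw [g2a, hs1 _ (by decide)]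
  refine Wp.seq (wp_fillFun (S := S) (v := v) (base := t * S.n) (by rw [hinp2]; exact hs)
    ((g2v _ rfl (by decide)).trans hz.n) ((g2v _ rfl (by decide)).trans hz.nf)
    ((g2.v _ rfl).trans hvv) ((g2v _ rfl (by decide)).trans hb) hq (by omega)) ?_
  rintro s3 g3 ⟨⟨f1, f2⟩, f3⟩
  have hinp3 : s3.a .inp = s.a .inp := (g3.a _ rfl).trans hinp2
  have g3v : ∀ x, locateFun.wV x = false → fillFun.wV x = false → x ≠ .v → s3.v x = s.v x :=
    fun x h h'' h' => (g3.v x h'').trans (g2v x h h')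
  have hp3 : s3.a .prd = s.a .prd := by rw [g3.a _ rfl, g2a, hs1 _ (by decide)]
  have hc3 : s3.a .cst = s.a .cst := by rw [g3.a _ rfl, g2a, hs1 _ (by decide)]
  have hbas3 : s3.a .bas = update (s.a .bas) v (t * S.n) := by rw [g3.a _ rfl, g2a, hbas]
  have hb3 : s3.v .base = t * S.n := (g3v _ rfl rfl (by decide)).trans hb
  have hv3 : s3.v .v = v := ((g3.v _ rfl).trans (g2.v _ rfl)).trans hvv
  refine Wp.seq (wp_fillPred (S := S) (v := v) (base := t * S.n) (by rw [hinp3]; exact hs)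
    ((g3v _ rfl rfl (by decide)).trans hz.nc) ((g3v _ rfl rfl (by decide)).trans hz.np)
    hv3 hb3 (by rw [hp3]; exact hp) (by omega)) ?_
  rintro s4 g4 ⟨p1, p2, p3⟩
  refine Wp.seq (wp_fillConst (S := S) (v := v) (base := t * S.n)
    (by rw [g4.a _ rfl, hinp3]; exact hs)
    ((g4.v _ rfl).trans ((g3v _ rfl rfl (by decide)).trans hz.nc))
    ((g4.v _ rfl).trans hv3) ((g4.v _ rfl).trans hb3) (by rw [g4.a _ rfl, hc3]; exact hc)
    (by omega)) ?_
  rintro s5 g5 ⟨c1, c2, c3⟩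
  have hb5 : s5.v .base = t * S.n := (g5.v _ rfl).trans ((g4.v _ rfl).trans hb3)
  have hn5 : s5.v .n = S.n := (g5.v _ rfl).trans ((g4.v _ rfl).trans
    ((g3v _ rfl rfl (by decide)).trans hz.n))
  have hfwd : s5.a .fwd = s3.a .fwd := (g5.a _ rfl).trans (g4.a _ rfl)
  have hbwd : s5.a .bwd = s3.a .bwd := (g5.a _ rfl).trans (g4.a _ rfl)
  have hprd : s5.a .prd = s4.a .prd := g5.a _ rfl
  have hbas5 : s5.a .bas = update (s.a .bas) v (t * S.n) :=
    ((g5.a _ rfl).trans (g4.a _ rfl)).trans hbas3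
  have hfo : s2.a .fwd = s.a .fwd := by rw [g2a, hs1 _ (by decide)]
  have hbo : s2.a .bwd = s.a .bwd := by rw [g2a, hs1 _ (by decide)]
  have htake : φ.code.take (t + 1) = φ.code.take t ++ [v] := List.take_succ_eq_append_getElem ht
  refine Wp.straight (by decide) ?_ ?_
  · simp [Cmd.okL, hb5, hn5]; omega
  · refine ⟨by simp [Cmd.sem, hb5, hn5], ?_, ?_, ?_⟩
    · rw [htake]
      refine ⟨?_, ?_, ?_, ?_, ?_⟩
      · simp only [Cmd.sem, St.setV_a, hfwd]
        refine forall_getElem_concat (P := fun t u => ∀ a : Fin S.n,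
          s3.a .fwd (t * S.n + a) = symFun S u a) (fun t' h a => ?_) ?_
        · rw [(f3 _ (by rw [hlen] at h; exact row_le h a)).1, hfo]; exact hT.fwd t' h a
        · rw [hlen]; exact f1
      · simp only [Cmd.sem, St.setV_a, hbwd]
        refine forall_getElem_concat (P := fun t u => ∀ a : Fin S.n,
          s3.a .bwd (t * S.n + a) = (symFun S u)⁻¹ a) (fun t' h a => ?_) ?_
        · rw [(f3 _ (by rw [hlen] at h; exact row_le h a)).2, hbo]; exact hT.bwd t' h a
        · rw [hlen]; exact f2
      · simp only [Cmd.sem, St.setV_a, hprd]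
        refine forall_getElem_concat (P := fun t u => ∀ a : Fin S.n,
          s4.a .prd (t * S.n + a) = bit (symPred S u a)) (fun t' h a => ?_) ?_
        · rw [p2 _ (by rw [hlen] at h; exact row_le h a), hp3]; exact hT.prd t' h a
        · rw [hlen]; exact p1
      · simp only [Cmd.sem, St.setV_a]
        refine forall_getElem_concat (P := fun t u => ∀ a : Fin S.n,
          s5.a .cst (t * S.n + a) = bit (symConst S u a)) (fun t' h a => ?_) ?_
        · rw [c2 _ (by rw [hlen] at h; exact row_le h a), g4.a _ rfl, hc3]; exact hT.cst t' h a
        · rw [hlen]; exact c1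
      · intro u hu
        simp only [Cmd.sem, St.setV_a, hbas5, update_apply]
        by_cases huv : u = v
        · subst huv
          exact ⟨t, by simp; omega, by rw [List.getElem_append_right (by omega)]; simp,
            if_pos rfl⟩
        · rw [if_neg huv]
          have hu' : u ∈ φ.code.take t := by simpa [huv] using hu
          obtain ⟨t', h1, h2, h3⟩ := hT.bas u hu'
          exact ⟨t', by rw [List.length_append]; omega,
            by rw [List.getElem_append_left h1]; exact h2, h3⟩
    · intro i hi
      simp only [Cmd.sem, St.setV_a, hprd]; exact p3 i hi
    · intro i hi
      simp only [Cmd.sem, St.setV_a]; exact c3 i hi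

theorem Sizes.of_eq {k : ℕ} {φ : FOBij σ k} {A A' : Type} {s : St Var A} {s' : St Var A'}
    (h : Sizes S φ s)
    (e : ∀ x ∈ [Var.n, .nc, .np, .nf, .fb, .k, .fs, .tl, .rho], s'.v x = s.v x) : Sizes S φ s' :=
  ⟨(e _ (by decide)).trans h.n, (e _ (by decide)).trans h.nc, (e _ (by decide)).trans h.np,
    (e _ (by decide)).trans h.nf, (e _ (by decide)).trans h.fb, (e _ (by decide)).trans h.k,
    (e _ (by decide)).trans h.fs, (e _ (by decide)).trans h.tl, (e _ (by decide)).trans h.rho⟩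

theorem Sizes.agree {k : ℕ} {φ : FOBij σ k} {c : Cmd Var Arr} {s s' : St Var Arr}
    (h : Sizes S φ s) (g : Agree c s s')
    (hc : [Var.n, .nc, .np, .nf, .fb, .k, .fs, .tl, .rho].all (fun x => !c.wV x) = true) :
    Sizes S φ s' :=
  h.of_eq fun x hx => g.v x (by simpa using List.all_eq_true.1 hc x hx)

theorem wp_buildTables {k : ℕ} {φ : FOBij σ k} {s : St Var Arr}
    (hz : Sizes S φ s) (hs : Stored S (s.a .inp)) (hseg : Seg (s.a .inp) (queryPos S + 1) φ.code)
    (hp : ∀ i, s.a .prd i = 0) (hc : ∀ i, s.a .cst i = 0)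
    (hB : queryPos S + 5 + φ.code.length + φ.code.length * S.n ≤ B) :
    Wp 5 B buildTables (φ.code.length * (σ.numFun * 30 + S.n * 200 + σ.numPred * 80 + 310) + 10)
      (Tables S φ.code) s := by
  refine (Wp.seq (τ₁ := 2) (R := fun s' => s' = s.setV .base 0) (Wp.straight (by decide) ?_ ?_) ?_).le
    (τ := 2 + (φ.code.length * ((σ.numFun * 30 + S.n * 200 + σ.numPred * 80 + 300) + 9) + 6)) ?_
  · simp [Cmd.okL]
  · simp [Cmd.sem]
  · rintro s1 - rfl
    refine (Wp.for (fun t s' => s'.v .base = t * S.n ∧ Tables S (φ.code.take t) s' ∧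
      (∀ i, t * S.n ≤ i → s'.a .prd i = 0) ∧ ∀ i, t * S.n ≤ i → s'.a .cst i = 0)
      (by decide) rfl rfl (by omega) (by simpa using hz.tl) ?_ ?_).post ?_
    · refine ⟨by simp, ?_, by simpa using hp, by simpa using hc⟩
      constructor <;> simp
    · rintro t ht s2 g2 hti _ ⟨h1, h2, h3, h4⟩
      have hinp : s2.a .inp = s.a .inp := g2.a _ rfl
      have hz2 : Sizes S φ s2 := Sizes.agree (s := s.setV .base 0)
        (hz.of_eq fun x hx => by simp at hx ⊢; rintro rfl; simp at hx) g2 (by decide)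
      refine (wp_tableBody ht hz2 (by rw [hinp]; exact hs) (by rw [hinp]; exact hseg) hti h1 h2 h3
        h4 hB).post ?_
      rintro s3 _ ⟨e1, e2, e3, e4⟩
      refine ⟨by simpa using e1, ⟨e2.fwd, e2.bwd, e2.prd, e2.cst, e2.bas⟩, e3, e4⟩
    · rintro s' _ ⟨-, h, -⟩
      rwa [List.take_length] at h
  · have := Nat.mul_le_mul_left φ.code.length
      (show σ.numFun * 30 + S.n * 200 + σ.numPred * 80 + 300 + 9 ≤
        σ.numFun * 30 + S.n * 200 + σ.numPred * 80 + 310 by omega)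
    omega

end

end BijQuery

/-! ## Neighbourhoods and types -/

namespace BijQuery

open Function WhileRAM

set_option linter.constructorNameAsVariable false

/-- The variable holds the length of the list that stands at the beginning of the array. -/
structure Lst {N : ℕ} (s : St Var Arr) (T : Arr) (x : Var) (l : List (Fin N)) : Prop where
  len : s.v x = l.length
  seg : Seg (s.a T) 0 (l.map Fin.val)

theorem Lst.get {N : ℕ} {s : St Var Arr} {T : Arr} {x : Var} {l : List (Fin N)} (h : Lst s T x l)
    {i : ℕ} (hi : i < l.length) : s.a T i = l[i] := by
  rw [seg_zero h.seg (by simpa using hi), List.getElem_map]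

theorem seg_map_push {N : ℕ} {f : ℕ → ℕ} {l : List (Fin N)} {i : ℕ} (h : Seg f 0 (l.map Fin.val))
    (hi : i = l.length) (x : Fin N) : Seg (update f i x) 0 ((l ++ [x]).map Fin.val) := by
  rw [List.map_append]
  exact seg_push h (by simpa using hi)

/-- Prolongation of the list in `vs` by the images of its members. -/
def closureInner : Cmd Var Arr :=
  .x ≔ .get .vs (rd .i1) ;; .put .vs (rd .len) (.get .fwd (rd .base + rd .x)) ;;
    .put .vs (rd .len + 1) (.get .bwd (rd .base + rd .x)) ;; .len ≔ rd .len + 2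

def closureRow : Cmd Var Arr :=
  Cmd.for .i1 .len0 closureInner ;; .base ≔ rd .base + rd .n

/-- `len0` freezes the old length, so that only the members present at the beginning of the step are
prolonged although the list grows meanwhile. -/
def closureStep : Cmd Var Arr :=
  (.len0 ≔ rd .len ;; .base ≔ 0) ;; Cmd.for .bt .tl closureRow

def closure : Cmd Var Arr := Cmd.for .ir .rad closureStep

section
variable {σ : UnarySig} {S : BijStructure σ} {B : ℕ} {vals : List ℕ}

theorem Tables.of_eq {s s' : St Var Arr} (h : Tables S vals s)
    (e : ∀ T ∈ [Arr.fwd, .bwd, .prd, .cst, .bas], s'.a T = s.a T) : Tables S vals s' := by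
  refine ⟨?_, ?_, ?_, ?_, ?_⟩
  · rw [e _ (by decide)]; exact h.fwd
  · rw [e _ (by decide)]; exact h.bwd
  · rw [e _ (by decide)]; exact h.prd
  · rw [e _ (by decide)]; exact h.cst
  · rw [e _ (by decide)]; exact h.bas

theorem Tables.agree {c : Cmd Var Arr} {s s' : St Var Arr} (h : Tables S vals s)
    (g : Agree c s s')
    (hc : [Arr.fwd, .bwd, .prd, .cst, .bas].all (fun x => !c.wA x) = true) : Tables S vals s' :=
  h.of_eq fun x hx => g.a x (by simpa using List.all_eq_true.1 hc x hx)

theorem wp_closureRow {s : St Var Arr} {l l' : List (Fin S.n)} {t : ℕ} (ht : t < vals.length)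
    (hT : Tables S vals s) (hn : s.v .n = S.n) (hl0 : s.v .len0 = l.length)
    (hb : s.v .base = t * S.n) (hpre : l <+: l') (hl : Lst s .vs .len l')
    (hB : l'.length + 2 * l.length + 2 ≤ B) (hB' : vals.length * S.n ≤ B) :
    Wp 5 B closureRow (l.length * 90 + 20) (fun s' => s'.v .base = (t + 1) * S.n ∧
      Lst s' .vs .len (l' ++ l.flatMap fun x => [symFun S vals[t] x, (symFun S vals[t])⁻¹ x])) s := by
  have htn : (t + 1) * S.n ≤ vals.length * S.n := Nat.mul_le_mul_right _ ht
  rw [Nat.succ_mul] at htn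
  refine (Wp.seq (Wp.for (i := Var.i1) (l := Var.len0) (N := l.length) (τ := 80) (fun i s' =>
    Lst s' .vs .len (l' ++ (l.take i).flatMap fun x =>
      [symFun S vals[t] x, (symFun S vals[t])⁻¹ x])) (by decide) rfl rfl
    (by omega) hl0 ?_ ?_) ?_).le (τ := (l.length * (80 + 9) + 6) + 10) (by omega)
  · simp only [List.take_zero, List.flatMap_nil, List.append_nil]
    exact ⟨by simpa using hl.len, hl.seg⟩
  · intro i hi s1 g1 hi1 _ h1
    have hbs : s1.v .base = t * S.n := (g1.v _ rfl).trans hb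
    have hfwd : s1.a .fwd = s.a .fwd := g1.a _ rfl
    have hbwd : s1.a .bwd = s.a .bwd := g1.a _ rfl
    have hlen := h1.len
    have hlen' : (l' ++ (l.take i).flatMap fun x =>
        [symFun S vals[t] x, (symFun S vals[t])⁻¹ x]).length = l'.length + 2 * i := by
      simp [List.length_flatMap]
      omega
    rw [hlen'] at hlen
    have hx : s1.a .vs i = l[i] := by
      obtain ⟨r, hr⟩ := hpre
      rw [h1.get (by rw [hlen', ← hr, List.length_append]; omega)]
      congr 1
      subst hr
      rw [List.getElem_append_left (by simp; omega), List.getElem_append_left hi]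
    have e1 := hT.fwd t ht l[i]
    have e2 := hT.bwd t ht l[i]
    have hlt := (l[i]).isLt
    refine Wp.straight (by decide) ?_ ?_
    · simp [closureInner, Cmd.okL, Cmd.sem, hi1, hx, hbs, hlen]; omega
    · rw [List.take_succ_eq_append_getElem hi, List.flatMap_append, ← List.append_assoc]
      have h2 := seg_map_push h1.seg (i := l'.length + 2 * i) hlen'.symm (symFun S vals[t] l[i])
      have h3 := seg_map_push h2 (i := l'.length + 2 * i + 1) (by rw [List.length_append, hlen']; rfl)
        ((symFun S vals[t])⁻¹ l[i])
      rw [List.append_assoc _ [_] [_]] at h3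
      refine ⟨?_, ?_⟩
      · simp [closureInner, Cmd.sem, hlen, List.length_flatMap]; omega
      · simpa [closureInner, Cmd.sem, hi1, hx, hbs, hlen, hfwd, hbwd, e1, e2] using h3
  · intro s1 g1 h1
    have hbs : s1.v .base = t * S.n := (g1.v _ rfl).trans hb
    have hns : s1.v .n = S.n := (g1.v _ rfl).trans hn
    rw [List.take_length] at h1
    refine Wp.straight (by decide) ?_ ?_
    · simp [Cmd.okL, hbs, hns]; omega
    · refine ⟨by simp [Cmd.sem, hbs, hns]; ring, ⟨?_, ?_⟩⟩
      · simpa [Cmd.sem] using h1.len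
      · simpa [Cmd.sem] using h1.seg

theorem wp_closureStep {s : St Var Arr} {l : List (Fin S.n)} (hT : Tables S vals s)
    (hn : s.v .n = S.n) (htl : s.v .tl = vals.length) (hl : Lst s .vs .len l)
    (hB : l.length * (1 + 2 * vals.length) + 2 ≤ B) (hB' : vals.length * S.n ≤ B) :
    Wp 5 B closureStep (vals.length * (l.length * 90 + 30) + 20)
      (fun s' => Lst s' .vs .len (closeStep S vals l)) s := by
  have hvl : vals.length ≤ B := (Nat.le_mul_of_pos_right _ S.n_pos).trans hB'
  refine (Wp.seq (τ₁ := 10) (R := fun s' => s' = (s.setV .len0 l.length).setV .base 0)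
    (Wp.straight (by decide) ?_ ?_) ?_).le (τ := 10 + (vals.length * (l.length * 90 + 20 + 9) + 6)) ?_
  · simp [Cmd.okL]
  · simp [Cmd.sem, hl.len]
  · rintro s0 - rfl
    refine (Wp.for (i := Var.bt) (l := Var.tl) (N := vals.length) (fun t s' => s'.v .base = t * S.n ∧
      Lst s' .vs .len (l ++ (vals.take t).flatMap fun v => l.flatMap fun x =>
        [symFun S v x, (symFun S v)⁻¹ x])) (by decide) rfl rfl hvl (by simpa using htl) ?_ ?_).post ?_
    · refine ⟨by simp, ?_⟩
      simp only [List.take_zero, List.flatMap_nil, List.append_nil]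
      exact ⟨by simpa using hl.len, hl.seg⟩
    · rintro t ht s1 g1 _ _ ⟨h1, h2⟩
      have hT1 : Tables S vals s1 :=
        Tables.agree (s := (s.setV .len0 l.length).setV .base 0) (hT.of_eq fun _ _ => rfl) g1
          (by decide)
      have hlen' : (l ++ (vals.take t).flatMap fun v => l.flatMap fun x =>
        [symFun S v x, (symFun S v)⁻¹ x]).length = l.length * (1 + 2 * t) := by
        simp [List.length_flatMap, Nat.min_eq_left ht.le]; ring
      have hmul : l.length * (1 + 2 * (t + 1)) ≤ l.length * (1 + 2 * vals.length) :=
        Nat.mul_le_mul_left _ (by omega)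
      have hmul' : l.length * (1 + 2 * (t + 1)) = l.length * (1 + 2 * t) + 2 * l.length := by ring
      refine (wp_closureRow (l := l) ht hT1 ((g1.v _ rfl).trans (by simpa using hn))
        ((g1.v _ rfl).trans (by simp)) h1 (List.prefix_append _ _) h2 (by rw [hlen']; omega)
        hB').post ?_
      rintro s2 _ ⟨h3, h4⟩
      refine ⟨by simpa using h3, ?_⟩
      rw [List.take_succ_eq_append_getElem ht, List.flatMap_append, ← List.append_assoc]
      simp only [List.flatMap_cons, List.flatMap_nil, List.append_nil]
      exact ⟨by simpa using h4.len, h4.seg⟩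
    · rintro s' _ ⟨-, h⟩
      rwa [List.take_length] at h
  · have : vals.length * (l.length * 90 + 20 + 9) ≤ vals.length * (l.length * 90 + 30) :=
      Nat.mul_le_mul_left _ (by omega)
    omega

/-- The time depends on the radius, the number of rows and the bound `L` for the list, but not on
the size of the domain. The closure may therefore be recomputed during the enumeration. -/
theorem wp_closure {s : St Var Arr} {l : List (Fin S.n)} {R L : ℕ} (hT : Tables S vals s)
    (hn : s.v .n = S.n) (htl : s.v .tl = vals.length) (hR : s.v .rad = R) (hl : Lst s .vs .len l)
    (hL : l.length * (1 + 2 * vals.length) ^ R ≤ L) (hB : L + 2 ≤ B) (hRB : R ≤ B)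
    (hB' : vals.length * S.n ≤ B) :
    Wp 5 B closure (R * (vals.length * (L * 90 + 30) + 30) + 6)
      (fun s' => Lst s' .vs .len (close S vals R l)) s := by
  refine (Wp.for (i := Var.ir) (l := Var.rad) (N := R)
    (τ := vals.length * (L * 90 + 30) + 20) (fun r s' => Lst s' .vs .len (close S vals r l))
    (by decide) rfl rfl hRB hR ⟨by simpa [close] using hl.len, by simpa [close] using hl.seg⟩ ?_).le ?_
  · intro r hr s1 g1 _ _ h1
    have hr1 : l.length * (1 + 2 * vals.length) ^ (r + 1) ≤ L :=
      (Nat.mul_le_mul_left _ (Nat.pow_le_pow_right (by omega) hr)).trans hL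
    have hr2 : (close S vals r l).length * (1 + 2 * vals.length) ≤ L := by
      rw [length_close, Nat.mul_assoc, ← pow_succ]; exact hr1
    have hr3 : (close S vals r l).length ≤ L :=
      (Nat.le_mul_of_pos_right _ (by omega)).trans hr2
    refine ((wp_closureStep (hT.agree g1 (by decide)) ((g1.v _ rfl).trans hn)
      ((g1.v _ rfl).trans htl) h1 (by omega) hB').post fun s2 _ h2 => ?_).le ?_
    · rw [close_succ]; exact ⟨by simpa using h2.len, h2.seg⟩
    · have := Nat.mul_le_mul_left vals.length
        (show (close S vals r l).length * 90 + 30 ≤ L * 90 + 30 by omega)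
      omega
  · have := Nat.mul_le_mul_left R (show vals.length * (L * 90 + 30) + 20 + 9 ≤
      vals.length * (L * 90 + 30) + 30 by omega)
    omega

end

end BijQuery

/-! ## Numbers of types -/

namespace BijQuery

open Function WhileRAM

set_option linter.constructorNameAsVariable false

/-- The number with the given binary digits. -/
def binary (l : List ℕ) : ℕ := l.foldl (fun a x => a + a + x) 0

theorem binary_concat (l : List ℕ) (x : ℕ) : binary (l ++ [x]) = binary l + binary l + x := by
  simp [binary]

theorem binary_lt {l : List ℕ} (h : ∀ x ∈ l, x ≤ 1) : binary l < 2 ^ l.length := by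
  induction l using List.reverseRecOn with
  | nil => simp [binary]
  | append_singleton l x ih =>
    have h1 := ih fun y hy => h y (by simp [hy])
    have h2 := h x (by simp)
    rw [binary_concat, List.length_append, List.length_singleton, pow_succ]; omega

theorem binary_injective {l l' : List ℕ} (h : ∀ x ∈ l, x ≤ 1) (h' : ∀ x ∈ l', x ≤ 1)
    (hl : l.length = l'.length) (e : binary l = binary l') : l = l' := by
  induction l using List.reverseRecOn generalizing l' with
  | nil => exact (List.length_eq_zero_iff.1 hl.symm).symm
  | append_singleton l x ih =>
    rcases List.eq_nil_or_concat l' with rfl | ⟨m, y, rfl⟩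
    · simp at hl
    · rw [List.concat_eq_append] at *
      rw [binary_concat, binary_concat] at e
      have h2 := h x (by simp)
      have h3 := h' y (by simp)
      rw [ih (l' := m) (fun z hz => h z (by simp [hz])) (fun z hz => h' z (by simp [hz]))
        (by simpa using hl) (by omega), show x = y by omega]

theorem eq_of_flatMap_eq {α β : Type} {l : List α} {f g : α → List β}
    (h : ∀ x ∈ l, (f x).length = (g x).length) (e : l.flatMap f = l.flatMap g) :
    ∀ x ∈ l, f x = g x := by
  induction l with
  | nil => simp
  | cons a l ih =>
    rw [List.flatMap_cons, List.flatMap_cons] at e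
    obtain ⟨e1, e2⟩ := List.append_inj e (h a (by simp))
    intro x hx
    rcases List.mem_cons.1 hx with rfl | hx
    · exact e1
    · exact ih (fun y hy => h y (by simp [hy])) e2 x hx

theorem bit_le (p : Prop) : bit p ≤ 1 := by
  by_cases h : p
  · rw [bit_pos h]
  · rw [bit_neg h]; exact Nat.zero_le _

theorem bit_inj {p q : Prop} (h : bit p = bit q) : p ↔ q := by
  by_cases hp : p <;> by_cases hq : q <;> simp_all [bit_pos, bit_neg]

theorem bit_congr {p q : Prop} (h : p ↔ q) : bit p = bit q := by rw [propext h]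

section
variable {σ : UnarySig} (S : BijStructure σ) (vals : List ℕ)

noncomputable def rowBits (x : Fin S.n) : List ℕ :=
  vals.flatMap fun v => [bit (symPred S v x), bit (symConst S v x)]

/-- The atomic facts on the neighbourhood of an element. -/
noncomputable def typeBits (r : ℕ) (b : Fin S.n) : List ℕ :=
  (close S vals r [b]).flatMap fun x => bit (x = b) :: rowBits S vals x

/-- The number of the type of an element. -/
noncomputable def typeNum (r : ℕ) (b : Fin S.n) : ℕ := binary (typeBits S vals r b)

/-- A bound for the numbers of types. -/
def numTypes (r T : ℕ) : ℕ := 2 ^ ((1 + 2 * T) ^ r * (1 + 2 * T))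

variable {S vals}

theorem length_rowBits (x : Fin S.n) : (rowBits S vals x).length = 2 * vals.length := by
  simp [rowBits, List.length_flatMap]; omega

theorem length_typeBits (r : ℕ) (b : Fin S.n) : (typeBits S vals r b).length =
    (1 + 2 * vals.length) ^ r * (1 + 2 * vals.length) := by
  simp [typeBits, List.length_flatMap, length_rowBits, length_close]; ring

theorem typeBits_le {r : ℕ} {b : Fin S.n} : ∀ x ∈ typeBits S vals r b, x ≤ 1 := by
  intro x hx
  simp only [typeBits, rowBits, List.mem_flatMap, List.mem_cons, List.not_mem_nil, or_false] at hx
  obtain ⟨_, _, rfl | ⟨_, _, rfl | rfl⟩⟩ := hx <;> exact bit_le _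

theorem typeNum_lt (r : ℕ) (b : Fin S.n) : typeNum S vals r b < numTypes r vals.length := by
  have := binary_lt (typeBits_le (S := S) (vals := vals) (r := r) (b := b))
  rwa [length_typeBits] at this

/-- The two bit lists have the same length and list the same facts in the same order, so equal
numbers mean agreement fact by fact. -/
theorem sameType_of_typeNum {r : ℕ} {b b' : Fin S.n} (h : typeNum S vals r b = typeNum S vals r b') :
    SameType S vals r b b' := by
  have e := binary_injective typeBits_le typeBits_le (by rw [length_typeBits, length_typeBits]) h
  rw [typeBits, typeBits, close_singleton, close_singleton, List.flatMap_map, List.flatMap_map] at e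
  intro u hu
  have e1 := eq_of_flatMap_eq (fun _ _ => by simp [length_rowBits]) e u hu
  simp only [List.cons.injEq] at e1
  refine ⟨bit_inj e1.1, fun v hv => ?_⟩
  have e2 := eq_of_flatMap_eq (f := fun v => [bit (symPred S v (u b)), bit (symConst S v (u b))])
    (g := fun v => [bit (symPred S v (u b')), bit (symConst S v (u b'))]) (fun _ _ => rfl) e1.2 v hv
  simp only [List.cons.injEq, and_true] at e2
  exact ⟨bit_inj e2.1, bit_inj e2.2⟩

end

/-! ### Computation of the type numbers -/

/-- Computation of the type of `b`, and of the number of types. -/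
def typeRow : Cmd Var Arr :=
  .y ≔ rd .y + rd .y + .get .prd (rd .base + rd .x) ;;
    .y ≔ rd .y + rd .y + .get .cst (rd .base + rd .x) ;;
    .th ≔ rd .th + rd .th ;; .th ≔ rd .th + rd .th ;; .base ≔ rd .base + rd .n

/-- With truncated subtraction, `1 - (x - b) - (b - x)` is the truth value of `x = b`. The variable
`th` doubles with every bit and so ends as the bound `numTypes`. -/
def typeElem : Cmd Var Arr :=
  (.x ≔ .get .vs (rd .i2) ;; .y ≔ rd .y + rd .y + (1 - (rd .x - rd .b) - (rd .b - rd .x)) ;;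
    .th ≔ rd .th + rd .th ;; .base ≔ 0) ;; Cmd.for .bt .tl typeRow

def typeOf : Cmd Var Arr :=
  (.put .vs 0 (rd .b) ;; .len ≔ 1) ;; closure ;; (.y ≔ 0 ;; .th ≔ 1) ;;
    Cmd.for .i2 .len typeElem ;; .put .typ (rd .b) (rd .y)

def computeTypes : Cmd Var Arr := Cmd.for .b .n typeOf

section
variable {σ : UnarySig} {S : BijStructure σ} {B : ℕ} {vals : List ℕ}

theorem flatMap_take_succ {α β : Type} {l : List α} {i : ℕ} (hi : i < l.length) (f : α → List β) :
    (l.take (i + 1)).flatMap f = (l.take i).flatMap f ++ f l[i] := by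
  rw [List.take_succ_eq_append_getElem hi, List.flatMap_append, List.flatMap_cons, List.flatMap_nil,
    List.append_nil]

theorem wp_typeElem {s : St Var Arr} {l : List ℕ} {b x : Fin S.n} {i : ℕ} (hT : Tables S vals s)
    (hn : s.v .n = S.n) (htl : s.v .tl = vals.length) (hi : s.v .i2 = i) (hb : s.v .b = b)
    (hx : s.a .vs i = x) (hy : s.v .y = binary l) (hth : s.v .th = 2 ^ l.length)
    (hl : ∀ y ∈ l, y ≤ 1) (hB : 2 ^ (l.length + 1 + 2 * vals.length) + 2 ≤ B)
    (hB' : vals.length * S.n ≤ B) :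
    Wp 5 B typeElem (vals.length * 100 + 50) (fun s' =>
      s'.v .y = binary (l ++ bit (x = b) :: rowBits S vals x) ∧
      s'.v .th = 2 ^ (l ++ bit (x = b) :: rowBits S vals x).length) s := by
  have hvl : vals.length ≤ B := (Nat.le_mul_of_pos_right _ S.n_pos).trans hB'
  have hlt := binary_lt hl
  have hp1 : 2 ^ (l.length + 1) ≤ 2 ^ (l.length + 1 + 2 * vals.length) :=
    Nat.pow_le_pow_right (by norm_num) (by omega)
  rw [pow_succ] at hp1
  have heq : 1 - ((x : ℕ) - b) - (b - x) = bit (x = b) := by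
    by_cases h : x = b
    · subst h; simp [bit_pos]
    · rw [bit_neg h]
      have : (x : ℕ) ≠ b := fun h' => h (Fin.ext h')
      omega
  have hbit := bit_le (x = b)
  refine (Wp.seq (τ₁ := 40) (R := fun s' => s' = (((s.setV .x x).setV .y
    (binary (l ++ [bit (x = b)]))).setV .th (2 ^ (l.length + 1))).setV .base 0)
    (Wp.straight (by decide) ?_ ?_) ?_).le (τ := 40 + (vals.length * (80 + 9) + 6)) (by omega)
  · simp [Cmd.okL, Cmd.sem, hi, hx, hy, hth, hb, heq]; omega
  · simp [Cmd.sem, hi, hx, hy, hth, hb, heq, binary_concat, pow_succ, Nat.mul_two]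
  rintro s0 - rfl
  refine (Wp.for (i := Var.bt) (l := Var.tl) (N := vals.length) (fun t s' => s'.v .base = t * S.n ∧
    s'.v .y = binary (l ++ bit (x = b) :: rowBits S (vals.take t) x) ∧
    s'.v .th = 2 ^ (l ++ bit (x = b) :: rowBits S (vals.take t) x).length) (by decide) rfl rfl hvl
    (by simpa using htl) ?_ ?_).post ?_
  · simp [rowBits]
  · rintro t ht s1 g1 _ _ ⟨h1, h2, h3⟩
    have hT1 : Tables S vals s1 := Tables.agree (s := (((s.setV .x x).setV .y
      (binary (l ++ [bit (x = b)]))).setV .th (2 ^ (l.length + 1))).setV .base 0)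
      (hT.of_eq fun _ _ => rfl) g1 (by decide)
    have htn : (t + 1) * S.n ≤ vals.length * S.n := Nat.mul_le_mul_right _ ht
    rw [Nat.succ_mul] at htn
    have hn1 : s1.v .n = S.n := (g1.v _ rfl).trans (by simpa using hn)
    have hx1 : s1.v .x = x := (g1.v _ rfl).trans (by simp)
    have e1 := hT1.prd t ht x
    have e2 := hT1.cst t ht x
    have hb1 := bit_le (symPred S vals[t] x)
    have hb2 := bit_le (symConst S vals[t] x)
    have hrow : rowBits S (vals.take (t + 1)) x = rowBits S (vals.take t) x ++
        [bit (symPred S vals[t] x)] ++ [bit (symConst S vals[t] x)] := by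
      rw [rowBits, flatMap_take_succ ht, rowBits]; simp
    have hlen : (l ++ bit (x = b) :: rowBits S (vals.take t) x).length = l.length + 1 + 2 * t := by
      simp [length_rowBits, Nat.min_eq_left ht.le]; omega
    have hlt' : binary (l ++ bit (x = b) :: rowBits S (vals.take t) x) <
        2 ^ (l.length + 1 + 2 * t) := by
      rw [← hlen]
      refine binary_lt fun y hy => ?_
      simp only [List.mem_append, List.mem_cons, rowBits, List.mem_flatMap, List.not_mem_nil,
        or_false] at hy
      obtain hy | rfl | ⟨_, _, rfl | rfl⟩ := hy
      · exact hl y hy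
      all_goals exact bit_le _
    have hp2 : 2 ^ (l.length + 1 + 2 * (t + 1)) ≤ 2 ^ (l.length + 1 + 2 * vals.length) :=
      Nat.pow_le_pow_right (by norm_num) (by omega)
    rw [show l.length + 1 + 2 * (t + 1) = l.length + 1 + 2 * t + 1 + 1 by ring, pow_succ,
      pow_succ] at hp2
    rw [hlen] at h3
    have hxlt := x.isLt
    have hcat : l ++ bit (x = b) :: rowBits S (vals.take (t + 1)) x =
        l ++ bit (x = b) :: rowBits S (vals.take t) x ++
        [bit (symPred S vals[t] x)] ++ [bit (symConst S vals[t] x)] := by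
      rw [hrow]; simp
    rw [hcat]
    generalize l ++ bit (x = b) :: rowBits S (vals.take t) x = l₁ at h2 hlen hlt'
    refine Wp.straight (by decide) ?_ ?_
    · simp [typeRow, Cmd.okL, Cmd.sem, h1, h2, h3, hx1, hn1, e1, e2]; omega
    · refine ⟨?_, ?_, ?_⟩
      · simp [typeRow, Cmd.sem, h1, hn1]; ring
      · rw [binary_concat, binary_concat]; simp [typeRow, Cmd.sem, h1, h2, hx1, e1, e2]
      · simp [typeRow, Cmd.sem, h3, hlen, pow_succ]; ring
  · rintro s' _ ⟨-, h⟩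
    rwa [List.take_length] at h

theorem wp_typeOf {s : St Var Arr} {b : Fin S.n} {R L : ℕ} (hT : Tables S vals s)
    (hn : s.v .n = S.n) (htl : s.v .tl = vals.length) (hR : s.v .rad = R) (hb : s.v .b = b)
    (hL : (1 + 2 * vals.length) ^ R ≤ L) (hB : L + 2 ≤ B) (hRB : R ≤ B)
    (hB' : vals.length * S.n ≤ B) (hΘ : numTypes R vals.length + 2 ≤ B) :
    Wp 5 B typeOf (R * (vals.length * (L * 90 + 30) + 30) + L * (vals.length * 100 + 60) + 100)
      (fun s' => s'.v .th = numTypes R vals.length ∧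
        s'.a .typ = update (s.a .typ) b (typeNum S vals R b)) s := by
  refine (Wp.seq (τ₁ := 20) (R := fun s' => s' = (s.setA .vs 0 b).setV .len 1)
    (Wp.straight (by decide) ?_ ?_) ?_).le (τ := 20 + ((R * (vals.length * (L * 90 + 30) + 30) + 6) +
      (5 + ((L * ((vals.length * 100 + 50) + 9) + 6) + 20)))) ?_
  · simp [Cmd.okL]; omega
  · simp [Cmd.sem, hb]
  · rintro s0 - rfl
    refine Wp.seq (wp_closure (vals := vals) (l := [b]) (R := R) (L := L) (hT.of_eq (by
      simp)) (by simpa using hn) (by simpa using htl) (by simpa using hR) ⟨by simp, by simp⟩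
      (by simpa using hL) hB hRB hB') ?_
    intro s1 g1 hl
    have hcl : (close S vals R [b]).length = (1 + 2 * vals.length) ^ R := by
      simp [length_close]
    refine Wp.seq (R := fun s' => s' = (s1.setV .y 0).setV .th 1) (Wp.straight (by decide) ?_ ?_) ?_
    · simp [Cmd.okL]; omega
    · simp [Cmd.sem]
    rintro s2 - rfl
    have hs1 : ∀ x, closure.wV x = false → x ≠ .len → s1.v x = s.v x := fun x h h' => by
      rw [g1.v x h]; simp [h']
    refine Wp.seq (Wp.le (Wp.for (i := Var.i2) (l := Var.len) (N := (1 + 2 * vals.length) ^ R)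
      (τ := vals.length * 100 + 50)
      (fun i s' => s'.v .y = binary (((close S vals R [b]).take i).flatMap fun x =>
        bit (x = b) :: rowBits S vals x) ∧ s'.v .th =
        2 ^ (((close S vals R [b]).take i).flatMap fun x => bit (x = b) :: rowBits S vals x).length)
      (by decide) rfl rfl (by omega) (by simpa [hcl] using hl.len) ?_ ?_) (Nat.add_le_add_right
        (Nat.mul_le_mul_right _ hL) _)) ?_
    · simp [binary]
    · rintro i hi s3 g3 hi3 _ ⟨h1, h2⟩
      have hi' : i < (close S vals R [b]).length := by rw [hcl]; exact hi
      have hv3 : ∀ x, (Cmd.for Var.i2 Var.len typeElem).wV x = false → closure.wV x = false →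
          x ≠ .len → x ≠ .y → x ≠ .th → s3.v x = s.v x := fun x h h' h1 h2 h3 => by
        rw [g3.v x h]; simp [h2, h3, hs1 x h' h1]
      have ha3 : s3.a = s1.a := by
        funext T; exact g3.a T (by simp [Cmd.for, Cmd.wA, typeElem, typeRow])
      have hT3 : Tables S vals s3 := by
        refine hT.of_eq fun T hT => ?_
        rw [ha3, g1.a T (by revert hT; revert T; decide)]
        simp at hT ⊢
        rintro rfl; simp at hT
      have hpw : 2 ^ ((1 + 2 * vals.length) * (i + 1)) ≤ numTypes R vals.length := by
        rw [numTypes, Nat.mul_comm]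
        exact Nat.pow_le_pow_right (by norm_num) (Nat.mul_le_mul_right _ hi)
      have hlen : ((((close S vals R [b]).take i).flatMap fun x =>
          bit (x = b) :: rowBits S vals x)).length = (1 + 2 * vals.length) * i := by
        simp [List.length_flatMap, length_rowBits, Nat.min_eq_left hi'.le]; ring
      refine (wp_typeElem (x := (close S vals R [b])[i]) hT3
        ((hv3 _ rfl rfl (by decide) (by decide) (by decide)).trans hn)
        ((hv3 _ rfl rfl (by decide) (by decide) (by decide)).trans htl) hi3
        ((hv3 _ rfl rfl (by decide) (by decide) (by decide)).trans hb)
        (by rw [ha3]; exact hl.get hi') h1 h2 ?_ ?_ hB').post ?_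
      · intro y hy
        refine typeBits_le (S := S) (vals := vals) (r := R) (b := b) y ?_
        obtain ⟨x, hx, hy⟩ := List.mem_flatMap.1 hy
        exact List.mem_flatMap.2 ⟨x, List.mem_of_mem_take hx, hy⟩
      · rw [hlen, show (1 + 2 * vals.length) * i + 1 + 2 * vals.length =
          (1 + 2 * vals.length) * (i + 1) by ring]
        omega
      · rintro s4 _ ⟨h3, h4⟩
        rw [flatMap_take_succ hi']
        exact ⟨by simpa using h3, by simpa using h4⟩
    · rintro s3 g3 ⟨h1, h2⟩
      rw [← hcl, List.take_length] at h1 h2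
      have hb3 : s3.v .b = b := by
        rw [g3.v _ rfl]; simp [hs1 .b rfl (by decide), hb]
      have ht3 : s3.a .typ = s.a .typ := by
        rw [g3.a _ rfl, St.setV_a, St.setV_a, g1.a _ rfl]; simp
      refine Wp.straight (by decide) ?_ ?_
      · simp [Cmd.okL]
      · refine ⟨?_, ?_⟩
        · have := length_typeBits (S := S) (vals := vals) R b
          rw [typeBits] at this
          simpa [Cmd.sem, numTypes, this] using h2
        · simp [Cmd.sem, hb3, ht3, h1, typeNum, typeBits]
  · have := Nat.mul_le_mul_left L (show (vals.length * 100 + 50) + 9 ≤ vals.length * 100 + 60 by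
      omega)
    omega

theorem wp_computeTypes {s : St Var Arr} {R L : ℕ} (hT : Tables S vals s)
    (hn : s.v .n = S.n) (htl : s.v .tl = vals.length) (hR : s.v .rad = R)
    (hL : (1 + 2 * vals.length) ^ R ≤ L) (hB : L + 2 ≤ B) (hRB : R ≤ B)
    (hB' : vals.length * S.n ≤ B) (hΘ : numTypes R vals.length + 2 ≤ B) (hnB : S.n ≤ B) :
    Wp 5 B computeTypes
      (S.n * (R * (vals.length * (L * 90 + 30) + 30) + L * (vals.length * 100 + 60) + 110) + 6)
      (fun s' => s'.v .th = numTypes R vals.length ∧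
        ∀ b : Fin S.n, s'.a .typ b = typeNum S vals R b) s := by
  refine ((Wp.for (i := Var.b) (l := Var.n) (N := S.n)
    (τ := R * (vals.length * (L * 90 + 30) + 30) + L * (vals.length * 100 + 60) + 100)
    -- Every element recomputes `th` with the same result; the value is available after the loop
    -- because the domain is not empty.
    (fun t s' => (0 < t → s'.v .th = numTypes R vals.length) ∧
      ∀ b : Fin S.n, (b : ℕ) < t → s'.a .typ b = typeNum S vals R b) (by decide) rfl rfl hnB hn
    ⟨by simp, by simp⟩ ?_).post ?_).le ?_
  · rintro t ht s1 g1 hb1 _ ⟨-, h2⟩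
    refine (wp_typeOf (b := ⟨t, ht⟩) (hT.agree g1 (by decide)) ((g1.v _ rfl).trans hn)
      ((g1.v _ rfl).trans htl) ((g1.v _ rfl).trans hR) hb1 hL hB hRB hB' hΘ).post ?_
    rintro s2 _ ⟨h3, h4⟩
    refine ⟨fun _ => by simpa using h3, fun b hb => ?_⟩
    simp only [St.setV_a, h4, update_apply]
    split_ifs with h
    · congr 1; exact (Fin.ext h).symm
    · exact h2 b (by omega)
  · rintro s' _ ⟨h1, h2⟩
    exact ⟨h1 S.n_pos, fun b => h2 b b.2⟩
  · exact Nat.add_le_add_right (Nat.mul_le_mul_left _ (by omega)) _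

end

end BijQuery

/-! ## Classes of elements and representatives -/

namespace BijQuery

open Function WhileRAM

set_option linter.constructorNameAsVariable false

section
variable {n : ℕ} (ty : Fin n → ℕ)

/-- The elements with the given number. -/
def classOf (c : ℕ) : List (Fin n) := (List.finRange n).filter fun b => decide (ty b = c)

/-- The elements with numbers less than `c`, grouped by their numbers. -/
def grouped (c : ℕ) : List (Fin n) := (List.range c).flatMap (classOf ty)

/-- At most `N` elements with each number less than `c`. -/
def selected (N c : ℕ) : List (Fin n) := (List.range c).flatMap fun c => (classOf ty c).take N

variable {ty}

theorem mem_classOf {c : ℕ} {b : Fin n} : b ∈ classOf ty c ↔ ty b = c := by simp [classOf]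

theorem mem_grouped {c : ℕ} {b : Fin n} : b ∈ grouped ty c ↔ ty b < c := by
  simp [grouped, mem_classOf]

theorem grouped_succ (c : ℕ) : grouped ty (c + 1) = grouped ty c ++ classOf ty c := by
  simp [grouped, List.range_succ, List.flatMap_append]

theorem selected_succ (N c : ℕ) :
    selected ty N (c + 1) = selected ty N c ++ (classOf ty c).take N := by
  simp [selected, List.range_succ, List.flatMap_append]

theorem mem_of_mem_selected {N c : ℕ} {b : Fin n} (h : b ∈ selected ty N c) : ty b < c := by
  obtain ⟨c', hc, hb⟩ := List.mem_flatMap.1 h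
  rw [mem_classOf.1 (List.mem_of_mem_take hb)]
  exact List.mem_range.1 hc

theorem nodup_classOf (c : ℕ) : (classOf ty c).Nodup := (List.nodup_finRange n).filter _

theorem nodup_grouped (c : ℕ) : (grouped ty c).Nodup := by
  induction c with
  | zero => simp [grouped]
  | succ c ih =>
    rw [grouped_succ]
    refine List.nodup_append.2 ⟨ih, nodup_classOf c, fun a ha b hb => ?_⟩
    rintro rfl
    have := mem_grouped.1 ha
    rw [mem_classOf.1 hb] at this
    exact lt_irrefl _ this

theorem nodup_selected (N c : ℕ) : (selected ty N c).Nodup := by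
  induction c with
  | zero => simp [selected]
  | succ c ih =>
    rw [selected_succ]
    refine List.nodup_append.2 ⟨ih, (nodup_classOf c).sublist (List.take_sublist _ _),
      fun a ha b hb => ?_⟩
    rintro rfl
    have := mem_of_mem_selected ha
    rw [mem_classOf.1 (List.mem_of_mem_take hb)] at this
    exact lt_irrefl _ this

theorem length_selected_le (N c : ℕ) : (selected ty N c).length ≤ c * N := by
  induction c with
  | zero => simp [selected]
  | succ c ih =>
    rw [selected_succ, List.length_append, Nat.succ_mul]
    have := List.length_take_le N (classOf ty c)
    omega

theorem length_grouped_le (c : ℕ) : (grouped ty c).length ≤ n := by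
  have := (nodup_grouped (ty := ty) c).length_le_card
  simpa using this

theorem length_grouped {c : ℕ} (h : ∀ b, ty b < c) : (grouped ty c).length = n := by
  have h1 : (grouped ty c).toFinset = Finset.univ := by
    ext b; simp [mem_grouped, h]
  rw [← List.toFinset_card_of_nodup (nodup_grouped c), h1]; simp

theorem length_grouped_mono {c d : ℕ} (h : c ≤ d) :
    (grouped ty c).length ≤ (grouped ty d).length := by
  induction d, h using Nat.le_induction with
  | base => exact le_rfl
  | succ d _ ih => rw [grouped_succ, List.length_append]; omega

/-- An element is followed by elements of the same class up to the end of the class. -/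
theorem grouped_class {c i i' : ℕ} (hi : i < (grouped ty c).length) (hii : i ≤ i')
    (h : i' < (grouped ty (ty (grouped ty c)[i] + 1)).length) (hi' : i' < (grouped ty c).length) :
    ty (grouped ty c)[i'] = ty (grouped ty c)[i] := by
  induction c with
  | zero => simp [grouped] at hi
  | succ c ih =>
    have hg := grouped_succ (ty := ty) c
    by_cases h1 : i' < (grouped ty c).length
    · have e1 : (grouped ty (c + 1))[i'] = (grouped ty c)[i'] := by
        simp only [hg]; rw [List.getElem_append_left]
      have e2 : (grouped ty (c + 1))[i] = (grouped ty c)[i]'(by omega) := by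
        simp only [hg]; rw [List.getElem_append_left]
      rw [e2] at h
      rw [e1, e2]
      exact ih (by omega) h h1
    · have e1 : ty (grouped ty (c + 1))[i'] = c := by
        simp only [hg]; rw [List.getElem_append_right (by omega)]
        exact mem_classOf.1 (List.getElem_mem _)
      rw [e1]
      have h3 : ty (grouped ty (c + 1))[i] < c + 1 := mem_grouped.1 (List.getElem_mem _)
      by_contra hne
      have := length_grouped_mono (ty := ty) (show ty (grouped ty (c + 1))[i] + 1 ≤ c by omega)
      omega

/-- The end of the class of an element lies strictly beyond the element, so a jump to that end
always makes progress. -/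
theorem lt_length_grouped {c i : ℕ} (hi : i < (grouped ty c).length) :
    i < (grouped ty (ty (grouped ty c)[i] + 1)).length := by
  induction c with
  | zero => simp [grouped] at hi
  | succ c ih =>
    have hg := grouped_succ (ty := ty) c
    by_cases h1 : i < (grouped ty c).length
    · have e2 : (grouped ty (c + 1))[i] = (grouped ty c)[i]'(by omega) := by
        simp only [hg]; rw [List.getElem_append_left]
      rw [e2]; exact ih h1
    · have e1 : ty (grouped ty (c + 1))[i] = c := by
        simp only [hg]; rw [List.getElem_append_right (by omega)]
        exact mem_classOf.1 (List.getElem_mem _)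
      rw [e1]; exact hi

end

/-! ### Computation of the classes and of the representatives -/

def classElem : Cmd Var Arr :=
  .ite (1 - (.get .typ (rd .b) - rd .c1) - (rd .c1 - .get .typ (rd .b)))
    (.put .ord (rd .q) (rd .b) ;; .q ≔ rd .q + 1 ;;
      .ite (rd .num - rd .cnt)
        (.put .rep (rd .wl) (rd .b) ;; .wl ≔ rd .wl + 1 ;; .cnt ≔ rd .cnt + 1) .skip)
    .skip

/-- Every type number costs one pass over the whole domain. This stays linear because the number of
types depends on the parameter only. `cnt` caps the representatives of the class at the quota in
`num`, and `fin` records where the class ends in `ord`. -/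
def classBody : Cmd Var Arr :=
  .cnt ≔ 0 ;; Cmd.for .b .n classElem ;; .put .fin (rd .c1) (rd .q)

/-- Grouping of the elements and selection of representatives. -/
def computeClasses : Cmd Var Arr :=
  (.q ≔ 0 ;; .wl ≔ 0) ;; Cmd.for .c1 .th classBody

section
variable {n B : ℕ} {ty : Fin n → ℕ}

theorem take_concat {α : Type} (l : List α) (x : α) (N : ℕ) :
    (l ++ [x]).take N = if l.length < N then l.take N ++ [x] else l.take N := by
  split_ifs with h
  · rw [List.take_of_length_le (by simp; omega), List.take_of_length_le (by omega)]
  · rw [List.take_append_of_le_length (by omega)]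

theorem wp_classBody {s : St Var Arr} {c N Θ : ℕ} (hn : s.v .n = n)
    (hty : ∀ b : Fin n, s.a .typ b = ty b) (hN : s.v .num = N) (hc : s.v .c1 = c) (hcΘ : c < Θ)
    (ho : Lst s .ord .q (grouped ty c)) (hr : Lst s .rep .wl (selected ty N c))
    (hB : n + Θ * N + 2 ≤ B) :
    Wp 5 B classBody (n * 120 + 30) (fun s' => Lst s' .ord .q (grouped ty (c + 1)) ∧
      Lst s' .rep .wl (selected ty N (c + 1)) ∧
      s'.a .fin = update (s.a .fin) c (grouped ty (c + 1)).length) s := by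
  have hsel := length_selected_le (ty := ty) N (c + 1)
  have hΘ : (c + 1) * N ≤ Θ * N := Nat.mul_le_mul_right _ hcΘ
  rw [selected_succ] at hsel ⊢
  have hg := length_grouped_le (ty := ty) (c + 1)
  rw [grouped_succ] at hg ⊢
  refine (Wp.seq (τ₁ := 2) (R := fun s' => s' = s.setV .cnt 0) (Wp.straight (by decide) ?_ ?_) ?_).le
    (τ := 2 + ((n * (100 + 9) + 6) + 20)) (by omega)
  · simp [Cmd.okL]
  · simp [Cmd.sem]
  rintro s0 - rfl
  refine Wp.seq (Wp.for (i := Var.b) (l := Var.n) (N := n) (τ := 100) (fun t s' =>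
    Lst s' .ord .q (grouped ty c ++ ((List.finRange n).take t).filter fun b => decide (ty b = c)) ∧
    Lst s' .rep .wl (selected ty N c ++
      (((List.finRange n).take t).filter fun b => decide (ty b = c)).take N) ∧
    s'.v .cnt = min (((List.finRange n).take t).filter fun b => decide (ty b = c)).length N)
    (by decide) rfl rfl (by omega) (by simpa using hn) ?_ ?_) ?_
  · refine ⟨⟨?_, ?_⟩, ⟨?_, ?_⟩, ?_⟩
    · simpa using ho.len
    · simpa using ho.seg
    · simpa using hr.len
    · simpa using hr.seg
    · simp
  · rintro t ht s1 g1 hb _ ⟨h1, h2, h3⟩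
    have htL : t < (List.finRange n).length := by simpa using ht
    have hty1 : s1.a .typ t = ty ⟨t, ht⟩ := by
      rw [g1.a _ rfl]; exact hty ⟨t, ht⟩
    have hc1 : s1.v .c1 = c := (g1.v _ rfl).trans (by simpa using hc)
    have hN1 : s1.v .num = N := (g1.v _ rfl).trans (by simpa using hN)
    have hpre : (((List.finRange n).take (t + 1)).filter fun b => decide (ty b = c)) <+:
        classOf ty c := (List.take_prefix _ _).filter _
    have htk : ((List.finRange n).take (t + 1)).filter (fun b => decide (ty b = c)) =
        ((List.finRange n).take t).filter (fun b => decide (ty b = c)) ++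
          if ty ⟨t, ht⟩ = c then [⟨t, ht⟩] else [] := by
      rw [List.take_succ_eq_append_getElem htL, List.filter_append, List.getElem_finRange]
      congr 1
      by_cases h : ty ⟨t, ht⟩ = c <;> simp [h]
    by_cases h : ty ⟨t, ht⟩ = c
    · have heq : ¬ (1 - (s1.a .typ t - c) - (c - s1.a .typ t) = 0) := by rw [hty1, h]; omega
      rw [htk, if_pos h] at hpre ⊢
      generalize ((List.finRange n).take t).filter (fun b => decide (ty b = c)) = l at h1 h2 h3 hpre ⊢
      have hl1 := h1.len
      have hl2 := h2.len
      have hpl := hpre.length_le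
      rw [List.length_append, List.length_singleton] at hpl
      rw [List.length_append] at hl1 hl2 hg
      rw [List.length_append] at hsel
      have htl : (l.take N).length = min N l.length := List.length_take
      have htl' : ((classOf ty c).take N).length = min N (classOf ty c).length := List.length_take
      have p1 := seg_map_push h1.seg (i := s1.v .q) (by rw [hl1, List.length_append]) ⟨t, ht⟩
      have p2 := seg_map_push h2.seg (i := s1.v .wl) (by rw [hl2, List.length_append]) ⟨t, ht⟩
      by_cases hlN : l.length < N
      · have hcnt : ¬ (N - s1.v .cnt = 0) := by omega
        rw [take_concat, if_pos hlN, ← List.append_assoc, ← List.append_assoc]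
        refine Wp.straight (by decide) ?_ ?_
        · simp [classElem, Cmd.okL, Cmd.sem, hb, hc1, heq, hN1, hcnt]; omega
        · refine ⟨⟨?_, ?_⟩, ⟨?_, ?_⟩, ?_⟩
          · simp [classElem, Cmd.sem, hb, hc1, heq, hN1, hcnt, hl1]; omega
          · simpa [classElem, Cmd.sem, hb, hc1, heq, hN1, hcnt] using p1
          · simp [classElem, Cmd.sem, hb, hc1, heq, hN1, hcnt, hl2]; omega
          · simpa [classElem, Cmd.sem, hb, hc1, heq, hN1, hcnt] using p2
          · simp [classElem, Cmd.sem, hb, hc1, heq, hN1, hcnt]; omega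
      · have hcnt : N - s1.v .cnt = 0 := by omega
        rw [take_concat, if_neg hlN, ← List.append_assoc]
        refine Wp.straight (by decide) ?_ ?_
        · simp [classElem, Cmd.okL, Cmd.sem, hb, hc1, heq, hN1, hcnt]; omega
        · refine ⟨⟨?_, ?_⟩, ⟨?_, ?_⟩, ?_⟩
          · simp [classElem, Cmd.sem, hb, hc1, heq, hN1, hcnt, hl1]; omega
          · simpa [classElem, Cmd.sem, hb, hc1, heq, hN1, hcnt] using p1
          · simpa [classElem, Cmd.sem, hb, hc1, heq, hN1, hcnt] using h2.len
          · simpa [classElem, Cmd.sem, hb, hc1, heq, hN1, hcnt] using h2.seg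
          · simp [classElem, Cmd.sem, hb, hc1, heq, hN1, hcnt]; omega
    · have heq : 1 - (s1.a .typ t - c) - (c - s1.a .typ t) = 0 := by rw [hty1]; omega
      rw [htk, if_neg h, List.append_nil]
      refine Wp.straight (by decide) ?_ ?_
      · simp [classElem, Cmd.okL, hb, hc1, heq]; omega
      · simp only [classElem, Cmd.sem, Ex.val_sub, Ex.val_get, Ex.val_var, Ex.val_ofNat, hb, hc1, heq,
          if_true]
        exact ⟨⟨by simpa using h1.len, h1.seg⟩, ⟨by simpa using h2.len, h2.seg⟩, by simpa using h3⟩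
  · rintro s1 g1 ⟨h1, h2, h3⟩
    have hall : (List.finRange n).take n = List.finRange n := List.take_of_length_le (by simp)
    rw [hall] at h1 h2
    change Lst s1 .ord .q (grouped ty c ++ classOf ty c) at h1
    change Lst s1 .rep .wl (selected ty N c ++ (classOf ty c).take N) at h2
    have hc1 : s1.v .c1 = c := (g1.v _ rfl).trans (by simpa using hc)
    have hf : s1.a .fin = s.a .fin := g1.a _ rfl
    refine Wp.straight (by decide) ?_ ?_
    · simp [Cmd.okL]
    · refine ⟨⟨by simpa [Cmd.sem] using h1.len, by simpa [Cmd.sem] using h1.seg⟩,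
        ⟨by simpa [Cmd.sem] using h2.len, by simpa [Cmd.sem] using h2.seg⟩, ?_⟩
      have := h1.len
      simp only [Cmd.sem, Ex.val_var, St.setA_a, if_true, hc1, hf, this]

theorem wp_computeClasses {s : St Var Arr} {N Θ : ℕ} (hn : s.v .n = n)
    (hty : ∀ b : Fin n, s.a .typ b = ty b) (hN : s.v .num = N) (hth : s.v .th = Θ)
    (hB : n + Θ * N + Θ + 2 ≤ B) :
    Wp 5 B computeClasses (Θ * (n * 120 + 40) + 20) (fun s' => Lst s' .ord .q (grouped ty Θ) ∧
      Lst s' .rep .wl (selected ty N Θ) ∧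
      ∀ c < Θ, s'.a .fin c = (grouped ty (c + 1)).length) s := by
  refine (Wp.seq (τ₁ := 10) (R := fun s' => s' = (s.setV .q 0).setV .wl 0)
    (Wp.straight (by decide) ?_ ?_) ?_).le (τ := 10 + (Θ * ((n * 120 + 30) + 9) + 6)) ?_
  · simp [Cmd.okL]
  · simp [Cmd.sem]
  · rintro s0 - rfl
    refine (Wp.for (i := Var.c1) (l := Var.th) (N := Θ) (τ := n * 120 + 30) (fun c s' =>
      Lst s' .ord .q (grouped ty c) ∧ Lst s' .rep .wl (selected ty N c) ∧
      ∀ d < c, s'.a .fin d = (grouped ty (d + 1)).length)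
      (by decide) rfl rfl (by omega) (by simpa using hth) ?_ ?_)
    · exact ⟨⟨by simp [grouped], by simp [grouped]⟩, ⟨by simp [selected], by simp [selected]⟩,
        by simp⟩
    · rintro c hc s1 g1 hc1 _ ⟨h1, h2, h3⟩
      refine (wp_classBody (Θ := Θ) ((g1.v _ rfl).trans (by simpa using hn))
        (fun b => by rw [g1.a _ rfl]; exact hty b) ((g1.v _ rfl).trans (by simpa using hN)) hc1 hc
        h1 h2 (by omega)).post ?_
      rintro s2 _ ⟨h4, h5, h6⟩
      refine ⟨⟨by simpa using h4.len, h4.seg⟩, ⟨by simpa using h5.len, h5.seg⟩, fun d hd => ?_⟩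
      simp only [St.setV_a, h6, update_apply]
      split_ifs with h
      · rw [h]
      · exact h3 d (by omega)
  · have := Nat.mul_le_mul_left Θ (show (n * 120 + 30) + 9 ≤ n * 120 + 40 by omega)
    omega

end

/-! ### Properties of the grouped domain and of the representatives -/

section
variable {σ : UnarySig} {S : BijStructure σ} {vals : List ℕ}

/-- The representatives of all types. -/
noncomputable def reps (S : BijStructure σ) (vals : List ℕ) (R N : ℕ) : List (Fin S.n) :=
  selected (typeNum S vals R) N (numTypes R vals.length)

/-- The domain, grouped by types. -/
noncomputable def domain (S : BijStructure σ) (vals : List ℕ) (R : ℕ) : List (Fin S.n) :=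
  grouped (typeNum S vals R) (numTypes R vals.length)

/-- Elements of the same type have the same number. -/
theorem typeNum_eq {R : ℕ} {b b' : Fin S.n} (h : SameType S vals R b b') :
    typeNum S vals R b = typeNum S vals R b' := by
  rw [typeNum, typeNum, typeBits, typeBits, close_singleton, close_singleton, List.flatMap_map,
    List.flatMap_map]
  congr 1
  refine List.flatMap_congr fun u hu => ?_
  rw [bit_congr (h u hu).1, rowBits, rowBits]
  congr 1
  refine List.flatMap_congr fun v hv => ?_
  rw [bit_congr ((h u hu).2 v hv).1, bit_congr ((h u hu).2 v hv).2]

/-- A class with at most `N` elements is taken whole, and from a larger one `N` elements are taken.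
-/
theorem represents_reps (R N : ℕ) : Represents S vals R N (reps S vals R N) := by
  intro b
  have hsub : ∀ x ∈ (classOf (typeNum S vals R) (typeNum S vals R b)).take N,
      x ∈ reps S vals R N := fun x hx => List.mem_flatMap.2
    ⟨_, List.mem_range.2 (typeNum_lt R b), hx⟩
  by_cases h : (classOf (typeNum S vals R) (typeNum S vals R b)).length ≤ N
  · left
    intro x hx
    refine hsub x ?_
    rw [List.take_of_length_le h]
    exact mem_classOf.2 (typeNum_eq hx).symm
  · right
    refine ⟨((classOf (typeNum S vals R) (typeNum S vals R b)).take N).toFinset, ?_, fun x hx => ?_⟩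
    · rw [List.toFinset_card_of_nodup ((nodup_classOf _).sublist (List.take_sublist _ _)),
        List.length_take]
      omega
    · have hx' := List.mem_toFinset.1 hx
      exact ⟨hsub x hx', sameType_of_typeNum (mem_classOf.1 (List.mem_of_mem_take hx')).symm⟩

theorem nodup_reps (R N : ℕ) : (reps S vals R N).Nodup := nodup_selected _ _

/-- The evaluation loop performs at least one evaluation before it tests for the end, so the range
of a quantifier must not be empty. -/
theorem reps_ne_nil {R N : ℕ} (hN : 0 < N) : reps S vals R N ≠ [] := by
  intro h
  have hb := represents_reps (S := S) (vals := vals) R N ⟨0, S.n_pos⟩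
  rw [h] at hb
  rcases hb with hb | ⟨F, hF, hF'⟩
  · exact absurd (hb _ fun u _ => ⟨Iff.rfl, fun _ _ => ⟨Iff.rfl, Iff.rfl⟩⟩) (by simp)
  · obtain ⟨x, hx⟩ := Finset.card_pos.1 (hN.trans_le hF)
    exact absurd (hF' x hx).1 (by simp)

theorem mem_domain (R : ℕ) (b : Fin S.n) : b ∈ domain S vals R := mem_grouped.2 (typeNum_lt R b)

theorem length_domain (R : ℕ) : (domain S vals R).length = S.n := length_grouped (typeNum_lt R)

theorem nodup_domain (R : ℕ) : (domain S vals R).Nodup := nodup_grouped _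

end

end BijQuery

/-! ## Second part of the precomputation -/

namespace BijQuery

open Function WhileRAM

set_option linter.constructorNameAsVariable false

/-- The radius of the neighbourhoods. -/
def radius (d : ℕ) : ℕ := 3 ^ (d + 1)

/-- The number of words whose length is at most the radius. -/
def ballSize (d T : ℕ) : ℕ := (1 + 2 * T) ^ radius d

/-- The number of representatives of a type. -/
def quota (d T : ℕ) : ℕ := d * ballSize d T + 1

/-- A bound for the length of the lists to which quantifiers are restricted. -/
def hoodBound (d T : ℕ) : ℕ :=
  (numTypes (radius d) T * quota d T + d) * ballSize d T ^ (d + 1)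

theorem ballSize_pos (d T : ℕ) : 0 < ballSize d T := Nat.pow_pos (by omega)

theorem ballSize_le (d T : ℕ) : (d + 1) * ballSize d T ≤ hoodBound d T := by
  have h1 : 0 < numTypes (radius d) T := Nat.pow_pos (by norm_num)
  have h2 : 1 ≤ numTypes (radius d) T * quota d T := Nat.mul_pos h1 (Nat.succ_pos _)
  have h3 : ballSize d T ^ 1 ≤ ballSize d T ^ (d + 1) :=
    Nat.pow_le_pow_right (ballSize_pos d T) (by omega)
  rw [pow_one] at h3
  exact Nat.mul_le_mul (by omega) h3

/-- Running time of the closure. -/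
def closureTime (d T : ℕ) : ℕ := radius d * (T * (hoodBound d T * 90 + 30) + 30) + 6

/-- Computation of the parameters. -/
def computeParams : Cmd Var Arr :=
  (.dep ≔ rd .k + rd .tl + rd .rho ;; .rad ≔ 3) ;;
  Cmd.for .i2 .dep (.rad ≔ rd .rad + rd .rad + rd .rad) ;;
  -- The length of a closure is known exactly, so closing a dummy list of `dep` entries yields the
  -- product of `dep` and the size of a ball without computing a power. The dummy entries are the
  -- zeros initially in `vs`, that is, copies of the element 0.
  .len ≔ rd .dep ;; closure ;; .num ≔ rd .len + 1

def prepare : Cmd Var Arr := buildTables ;; computeParams ;; computeTypes ;; computeClasses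

/-- Preparation of the lists to which quantifiers are restricted. -/
def copyReps : Cmd Var Arr :=
  Cmd.for .i3 .wl (.put .vs (rd .i3) (.get .rep (rd .i3))) ;; .len ≔ rd .wl

def copyPrefix : Cmd Var Arr :=
  Cmd.for .i3 .jl (.put .vs (rd .len) (.get .env (rd .i3)) ;; .len ≔ rd .len + 1)

/-- One array serves all quantifier levels: the successive closures of the representatives with the
current prefix are initial segments of one another, and `lens` at `m` tells how much of `vs` is the
range of the variable `x_m`. -/
def buildHoods : Cmd Var Arr :=
  copyReps ;; copyPrefix ;; (.lim ≔ rd .dep + 1 - rd .jl ;; .z ≔ rd .jl) ;;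
    Cmd.for .i2 .lim (closure ;; (.put .lens (rd .z) (rd .len) ;; .z ≔ rd .z + 1))

section
variable {σ : UnarySig} (S : BijStructure σ) {k : ℕ} (φ : FOBij σ k)

/-- A single crude number that bounds the number of variables in scope, the exponents of all radii
of locality, and the thresholds of cardinality statements. -/
def depth : ℕ := k + φ.code.length + thresholds φ

/-- The bounds under which the computation takes place. -/
structure Room (B : ℕ) : Prop where
  input : 32 * (inputWord S φ).length + 32 + thresholds φ ≤ B
  tables : queryPos S + 5 + φ.code.length + φ.code.length * S.n ≤ B
  radius : radius (depth φ) * 3 ≤ B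
  hood : hoodBound (depth φ) φ.code.length + S.n + 8 ≤ B
  types : S.n + numTypes (BijQuery.radius (depth φ)) φ.code.length * quota (depth φ) φ.code.length +
    numTypes (BijQuery.radius (depth φ)) φ.code.length + 2 ≤ B
  depth : 2 * depth φ + 8 ≤ B

/-- Representatives. -/
noncomputable def sample : List (Fin S.n) :=
  reps S φ.code (radius (depth φ)) (quota (depth φ) φ.code.length)

/-- The list to which the quantifier over the variable with number `i + l.length` is restricted,
where `l` is the list of the values of the first variables. -/
noncomputable def hood (l : List (Fin S.n)) (i : ℕ) : List (Fin S.n) :=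
  (close S φ.code (radius (depth φ)))^[i + 1] (sample S φ ++ l)

/-- The facts established by the precomputation. -/
structure Ready (s : St Var Arr) : Prop where
  sizes : Sizes S φ s
  code : Seg (s.a .inp) (queryPos S + 1) φ.code
  tables : Tables S φ.code s
  dep : s.v .dep = depth φ
  rad : s.v .rad = radius (depth φ)
  sample : Lst s .rep .wl (sample S φ)
  ord : Seg (s.a .ord) 0 ((domain S φ.code (radius (depth φ))).map Fin.val)
  typ : ∀ b : Fin S.n, s.a .typ b = typeNum S φ.code (radius (depth φ)) b
  fin : ∀ c < numTypes (radius (depth φ)) φ.code.length,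
    s.a .fin c = (grouped (typeNum S φ.code (radius (depth φ))) (c + 1)).length

variable {S φ} {B : ℕ}

theorem Ready.of_eq {s s' : St Var Arr} (h : Ready S φ s)
    (hv : ∀ x ∈ [Var.n, .nc, .np, .nf, .fb, .k, .fs, .tl, .rho, .dep, .rad, .wl], s'.v x = s.v x)
    (ha : ∀ T ∈ [Arr.inp, .fwd, .bwd, .prd, .cst, .bas, .rep, .ord, .typ, .fin], s'.a T = s.a T) :
    Ready S φ s' where
  sizes := h.sizes.of_eq fun x hx => hv x (by revert hx; revert x; decide)
  code := by rw [ha _ (by decide)]; exact h.code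
  tables := h.tables.of_eq fun x hx => ha x (by revert hx; revert x; decide)
  dep := (hv _ (by decide)).trans h.dep
  rad := (hv _ (by decide)).trans h.rad
  sample := ⟨(hv _ (by decide)).trans h.sample.len, by rw [ha _ (by decide)]; exact h.sample.seg⟩
  ord := by rw [ha _ (by decide)]; exact h.ord
  typ := by rw [ha _ (by decide)]; exact h.typ
  fin := by rw [ha _ (by decide)]; exact h.fin

theorem Ready.agree {s s' : St Var Arr} {c : Cmd Var Arr} (h : Ready S φ s) (g : Agree c s s')
    (hc : ([Var.n, .nc, .np, .nf, .fb, .k, .fs, .tl, .rho, .dep, .rad, .wl].all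
      (fun x => !c.wV x) && [Arr.inp, .fwd, .bwd, .prd, .cst, .bas, .rep, .ord, .typ, .fin].all
      (fun x => !c.wA x)) = true) : Ready S φ s' := by
  rw [Bool.and_eq_true] at hc
  exact h.of_eq (fun x hx => g.v x (by simpa using List.all_eq_true.1 hc.1 x hx))
    (fun x hx => g.a x (by simpa using List.all_eq_true.1 hc.2 x hx))

theorem wp_computeParams {s : St Var Arr} (hz : Sizes S φ s) (hT : Tables S φ.code s)
    (hvs : ∀ i, s.a .vs i = 0) (hB : Room S φ B) :
    Wp 5 B computeParams (depth φ * 20 + closureTime (depth φ) φ.code.length + 60)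
      (fun s' => s'.v .dep = depth φ ∧ s'.v .rad = radius (depth φ) ∧
        s'.v .num = quota (depth φ) φ.code.length) s := by
  have hd := hB.depth
  have hr := hB.radius
  have hb := ballSize_le (depth φ) φ.code.length
  have hh := hB.hood
  have htab := hB.tables
  have hdep : depth φ = k + φ.code.length + thresholds φ := rfl
  rw [Nat.succ_mul] at hb
  refine (Wp.seq (τ₁ := 20) (R := fun s' => s' = (s.setV .dep (depth φ)).setV .rad 3)
    (Wp.straight (by decide) ?_ ?_) ?_).le (τ := 20 + ((depth φ * (6 + 9) + 6) +
      (5 + (closureTime (depth φ) φ.code.length + 10)))) (by omega)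
  · simp [Cmd.okL, Cmd.sem, hz.k, hz.tl, hz.rho]; omega
  · simp [Cmd.sem, hz.k, hz.tl, hz.rho, hdep]
  rintro s0 - rfl
  refine Wp.seq (Wp.for (i := Var.i2) (l := Var.dep) (N := depth φ) (τ := 6)
    (fun t s' => s'.v .rad = 3 ^ (t + 1)) (by decide) rfl rfl (by omega) (by simp) (by simp) ?_) ?_
  · intro t ht s1 g1 _ _ h1
    have : 3 ^ (t + 1 + 1) ≤ radius (depth φ) :=
      Nat.pow_le_pow_right (by norm_num) (by omega)
    rw [pow_succ] at this
    refine Wp.straight (by decide) ?_ ?_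
    · simp [Cmd.okL, h1]; omega
    · simp [Cmd.sem, h1, pow_succ]; ring
  intro s1 g1 h1
  have hd1 : s1.v .dep = depth φ := (g1.v _ rfl).trans (by simp)
  refine Wp.seq (R := fun s' => s' = s1.setV .len (depth φ)) (Wp.straight (by decide) ?_ ?_) ?_
  · simp [Cmd.okL]
  · simp [Cmd.sem, hd1]
  rintro s2 - rfl
  have ha1 : s1.a = s.a := by
    funext T; exact g1.a T (by simp [Cmd.for, Cmd.wA])
  refine Wp.seq (wp_closure (S := S) (vals := φ.code) (R := radius (depth φ))
    (L := hoodBound (depth φ) φ.code.length) (l := List.replicate (depth φ) ⟨0, S.n_pos⟩)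
    (hT.of_eq (by simp [ha1])) ?_ ?_ ?_ ⟨?_, ?_⟩ ?_ (by omega) (by omega) (by omega)) ?_
  · have := g1.v .n rfl
    simpa [hz.n] using this
  · have := g1.v .tl rfl
    simpa [hz.tl] using this
  · simpa [radius] using h1
  · simp
  · intro i hi
    simp [ha1, hvs]
  · rw [List.length_replicate]
    exact le_trans (Nat.le_add_right _ _) hb
  · intro s3 g3 h3
    have hl := h3.len
    rw [length_close, List.length_replicate] at hl
    have hl' : s3.v .len = depth φ * ballSize (depth φ) φ.code.length := hl
    refine Wp.straight (by decide) ?_ ?_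
    · simp [Cmd.okL, hl']; omega
    · have e1 : s3.v .dep = depth φ := by rw [g3.v _ rfl]; simp [hd1]
      have e2 : s3.v .rad = radius (depth φ) := by rw [g3.v _ rfl]; simpa [radius] using h1
      simp [Cmd.sem, hl', e1, e2, quota]

/-- Running time of the second part of the precomputation. -/
def prepareTime (d T n np nf : ℕ) : ℕ :=
  (T * (nf * 30 + n * 200 + np * 80 + 310) + 10) + (d * 20 + closureTime d T + 60) +
  (n * (closureTime d T + hoodBound d T * (T * 100 + 60) + 110) + 6) +
  (numTypes (radius d) T * (n * 120 + 40) + 20)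

theorem wp_prepare {s : St Var Arr} (hz : Sizes S φ s) (hs : Stored S (s.a .inp))
    (hseg : Seg (s.a .inp) (queryPos S + 1) φ.code)
    (h0 : ∀ T, T ≠ .inp → s.a T = fun _ => 0) (hB : Room S φ B) :
    Wp 5 B prepare (prepareTime (depth φ) φ.code.length S.n σ.numPred σ.numFun) (Ready S φ) s := by
  have hb := ballSize_le (depth φ) φ.code.length
  have hh := hB.hood
  have htab := hB.tables
  have hty := hB.types
  have hr := hB.radius
  refine (Wp.seq (wp_buildTables hz hs hseg (by simp [h0]) (by simp [h0]) hB.tables) ?_).le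
    (τ := (φ.code.length * (σ.numFun * 30 + S.n * 200 + σ.numPred * 80 + 310) + 10) +
      ((depth φ * 20 + closureTime (depth φ) φ.code.length + 60) +
      ((S.n * (closureTime (depth φ) φ.code.length + hoodBound (depth φ) φ.code.length *
        (φ.code.length * 100 + 60) + 110) + 6) +
      (numTypes (radius (depth φ)) φ.code.length * (S.n * 120 + 40) + 20))))
    (by rw [prepareTime]; omega)
  intro s1 g1 hT
  have hz1 : Sizes S φ s1 := hz.agree g1 (by decide)
  refine Wp.seq (wp_computeParams hz1 hT (by rw [g1.a _ rfl]; simp [h0]) hB) ?_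
  rintro s2 g2 ⟨hd, hR, hN⟩
  have hz2 : Sizes S φ s2 := hz1.agree g2 (by decide)
  have hT2 : Tables S φ.code s2 := hT.agree g2 (by decide)
  refine Wp.seq ((wp_computeTypes (L := hoodBound (depth φ) φ.code.length) hT2 hz2.n hz2.tl hR
    ?_ (by omega) (by omega) (by omega) (by omega) (by omega)).le ?_) ?_
  · refine le_trans ?_ hb
    exact Nat.le_mul_of_pos_left _ (by omega)
  · refine Nat.add_le_add_right (Nat.mul_le_mul_left _ ?_) _
    rw [closureTime]; omega
  rintro s3 g3 ⟨hth, hty3⟩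
  have hz3 : Sizes S φ s3 := hz2.agree g3 (by decide)
  refine (wp_computeClasses (ty := typeNum S φ.code (radius (depth φ))) hz3.n hty3
    ((g3.v _ rfl).trans hN) hth (by omega)).post ?_
  rintro s4 g4 ⟨h1, h2, h3⟩
  exact ⟨hz3.agree g4 (by decide),
    by rw [g4.a _ rfl, g3.a _ rfl, g2.a _ rfl, g1.a _ rfl]; exact hseg,
    (hT2.agree g3 (by decide)).agree g4 (by decide),
    ((g4.v _ rfl).trans (g3.v _ rfl)).trans hd, ((g4.v _ rfl).trans (g3.v _ rfl)).trans hR,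
    h2, h1.seg, by rw [g4.a _ rfl]; exact hty3, h3⟩

/-! ### Restriction of quantifiers -/

theorem length_sample_le : (sample S φ).length ≤
    numTypes (radius (depth φ)) φ.code.length * quota (depth φ) φ.code.length :=
  length_selected_le _ _

theorem hood_succ (l : List (Fin S.n)) (i : ℕ) :
    hood S φ l (i + 1) = close S φ.code (radius (depth φ)) (hood S φ l i) := iterate_succ_apply' _ _ _

theorem length_hood (l : List (Fin S.n)) (i : ℕ) : (hood S φ l i).length =
    ((sample S φ).length + l.length) * ballSize (depth φ) φ.code.length ^ (i + 1) := by
  induction i with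
  | zero => simp [hood, length_close, ballSize]
  | succ i ih => rw [hood_succ, length_close, ih, ← ballSize, pow_succ _ (i + 1)]; ring

theorem length_hood_le {l : List (Fin S.n)} {i : ℕ} (h : l.length + i ≤ depth φ) :
    (hood S φ l i).length ≤ hoodBound (depth φ) φ.code.length := by
  rw [length_hood]
  have := length_sample_le (S := S) (φ := φ)
  exact Nat.mul_le_mul (by omega) (Nat.pow_le_pow_right (ballSize_pos _ _) (by omega))

theorem hood_prefix {l : List (Fin S.n)} {i j : ℕ} (h : i ≤ j) : hood S φ l i <+: hood S φ l j := by
  induction j, h using Nat.le_induction with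
  | base => exact List.prefix_rfl
  | succ j _ ih => rw [hood_succ]; exact ih.trans (prefix_close _ _)

theorem append_prefix_hood (l : List (Fin S.n)) (i : ℕ) : sample S φ ++ l <+: hood S φ l i := by
  refine List.IsPrefix.trans ?_ (hood_prefix (Nat.zero_le i))
  exact prefix_close _ _

theorem mem_hood_of_mem {l : List (Fin S.n)} {i : ℕ} {x : Fin S.n} (hx : x ∈ l)
    {u : Equiv.Perm (Fin S.n)} (hu : u ∈ words S φ.code (radius (depth φ))) :
    u x ∈ hood S φ l i := by
  refine (hood_prefix (Nat.zero_le i)).subset ?_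
  exact mem_close (List.mem_append_right _ hx) hu

/-- A value chosen for a quantified variable has its neighbourhood in the ranges of all deeper
variables; hence one further closure per level. -/
theorem mem_hood_of_hood {l : List (Fin S.n)} {i j : ℕ} (hij : i < j) {x : Fin S.n}
    (hx : x ∈ hood S φ l i) {u : Equiv.Perm (Fin S.n)}
    (hu : u ∈ words S φ.code (radius (depth φ))) : u x ∈ hood S φ l j := by
  refine (hood_prefix (Nat.succ_le_of_lt hij)).subset ?_
  rw [hood_succ]; exact mem_close hx hu

/-- The lists have been prepared for the prefix `l`. -/
structure Hoods (S : BijStructure σ) (φ : FOBij σ k) (l : List (Fin S.n)) (s : St Var Arr) :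
    Prop where
  vs : Seg (s.a .vs) 0 ((hood S φ l (depth φ - l.length)).map Fin.val)
  lens : ∀ i, l.length + i ≤ depth φ → s.a .lens (l.length + i) = (hood S φ l i).length

theorem Hoods.get {l : List (Fin S.n)} {s : St Var Arr} (h : Hoods S φ l s) {i c : ℕ}
    (hi : l.length + i ≤ depth φ) (hc : c < (hood S φ l i).length) :
    s.a .vs c = (hood S φ l i)[c] := by
  obtain ⟨r, hr⟩ := hood_prefix (φ := φ) (l := l) (show i ≤ depth φ - l.length by omega)
  have := h.vs
  rw [← hr, List.map_append, seg_append] at this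
  rw [seg_zero this.1 (by simpa using hc), List.getElem_map]

theorem wp_buildHoods {s : St Var Arr} {l : List (Fin S.n)} (hr : Ready S φ s)
    (hl : Seg (s.a .env) 0 (l.map Fin.val)) (hjl : s.v .jl = l.length) (hld : l.length ≤ depth φ)
    (hB : Room S φ B) :
    Wp 5 B buildHoods (hoodBound (depth φ) φ.code.length * 40 + depth φ * 60 + 100 +
      (depth φ + 1) * (closureTime (depth φ) φ.code.length + 40)) (Hoods S φ l) s := by
  have hh := hB.hood
  have hd := hB.depth
  have htab := hB.tables
  have hrad := hB.radius
  have hle : ∀ i, l.length + i ≤ depth φ → _ := fun i hi => length_hood_le (S := S) (φ := φ) hi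
  have hW : (sample S φ).length + l.length ≤ hoodBound (depth φ) φ.code.length := by
    have := (append_prefix_hood (φ := φ) l 0).length_le
    rw [List.length_append] at this
    exact this.trans (hle 0 hld)
  refine (Wp.seq (R := fun s' => Lst s' .vs .len (sample S φ)) (Wp.seq (Wp.for (i := Var.i3)
    (l := Var.wl) (N := (sample S φ).length) (τ := 30)
    (fun t s' => Seg (s'.a .vs) 0 (((sample S φ).take t).map Fin.val)) (by decide) rfl rfl
    (by omega) hr.sample.len (by simp) ?_) ?_) ?_).le
    (τ := ((((sample S φ).length * (30 + 9) + 6) + 4)) + ((l.length * (40 + 9) + 6) + (20 +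
      ((depth φ + 1 - l.length) * ((closureTime (depth φ) φ.code.length + 30) + 9) + 6)))) ?_
  · intro t ht s1 g1 hi _ h1
    have hg : s1.a .rep t = (sample S φ)[t] := by
      rw [g1.a _ rfl]; exact hr.sample.get ht
    have h2 := seg_map_push h1 (i := t) (by simp; omega) (sample S φ)[t]
    rw [← List.take_succ_eq_append_getElem ht] at h2
    refine Wp.straight (by decide) (by simp [Cmd.okL]) ?_
    simpa [Cmd.sem, hi, hg] using h2
  · intro s1 g1 h1
    rw [List.take_length] at h1
    have hw : s1.v .wl = (sample S φ).length := (g1.v _ rfl).trans hr.sample.len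
    exact Wp.straight (by decide) (by simp [Cmd.okL]) ⟨by simp [Cmd.sem, hw], h1⟩
  · intro s1 g1 h1
    have he1 : s1.a .env = s.a .env := g1.a _ rfl
    refine Wp.seq (Wp.for (i := Var.i3) (l := Var.jl) (N := l.length) (τ := 40)
      (fun t s' => Lst s' .vs .len (sample S φ ++ l.take t)) (by decide) rfl rfl (by omega)
      ((g1.v _ rfl).trans hjl) ⟨by simpa using h1.len, by simpa using h1.seg⟩ ?_) ?_
    · intro t ht s2 g2 hi _ h2
      have hg : s2.a .env t = l[t] := by
        rw [g2.a _ rfl, he1, seg_zero hl (by simpa using ht), List.getElem_map]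
      have hlen := h2.len
      rw [List.length_append, List.length_take, Nat.min_eq_left ht.le] at hlen
      have h3 := seg_map_push h2.seg (i := s2.v .len) h2.len l[t]
      rw [List.append_assoc, ← List.take_succ_eq_append_getElem ht] at h3
      refine Wp.straight (by decide) ?_ ⟨?_, ?_⟩
      · simp [Cmd.okL, Cmd.sem, hlen]; omega
      · simp [Cmd.sem, hlen]; omega
      · simpa [Cmd.sem, hi, hg] using h3
    intro s2 g2 h2
    rw [List.take_length] at h2
    have g12 := (g1.v .dep rfl)
    have hdep : s2.v .dep = depth φ := ((g2.v _ rfl).trans (g1.v _ rfl)).trans hr.dep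
    have hjl2 : s2.v .jl = l.length := ((g2.v _ rfl).trans (g1.v _ rfl)).trans hjl
    refine Wp.seq (R := fun s' => s' = (s2.setV .lim (depth φ + 1 - l.length)).setV .z l.length)
      (Wp.straight (by decide) ?_ ?_) ?_
    · simp [Cmd.okL, hdep]; omega
    · simp [Cmd.sem, hdep, hjl2]
    rintro s3 - rfl
    have hr2 : Ready S φ ((s2.setV .lim (depth φ + 1 - l.length)).setV .z l.length) := by
      have := (hr.agree g1 (by decide)).agree g2 (by decide)
      refine this.of_eq (fun x hx => ?_) (fun _ _ => rfl)
      simp at hx ⊢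
      split_ifs with h h'
      · subst h; simp at hx
      · subst h'; simp at hx
      · rfl
    refine (Wp.for (i := Var.i2) (l := Var.lim) (N := depth φ + 1 - l.length)
      (τ := closureTime (depth φ) φ.code.length + 30) (fun t s' => s'.v .z = l.length + t ∧
      Lst s' .vs .len ((close S φ.code (radius (depth φ)))^[t] (sample S φ ++ l)) ∧
      ∀ i < t, s'.a .lens (l.length + i) = (hood S φ l i).length) (by decide) rfl rfl (by omega)
      (by simp) ⟨by simp, ⟨by simpa using h2.len, by simpa using h2.seg⟩, by simp⟩ ?_).post ?_
    · rintro t ht s3 g3 _ _ ⟨h3, h4, h5⟩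
      have hr3 : Ready S φ s3 := hr2.agree g3 (by decide)
      have hlt := hle t (by omega)
      have hcl : hood S φ l t = close S φ.code (radius (depth φ))
        ((close S φ.code (radius (depth φ)))^[t] (sample S φ ++ l)) := iterate_succ_apply' _ _ _
      refine Wp.seq (wp_closure (L := hoodBound (depth φ) φ.code.length) hr3.tables hr3.sizes.n
        hr3.sizes.tl hr3.rad h4 ?_ (by omega) (by omega) (by omega)) ?_
      · rw [hcl, length_close] at hlt; exact hlt
      intro s4 g4 h6
      rw [← hcl] at h6
      have hz4 : s4.v .z = l.length + t := (g4.v _ rfl).trans h3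
      have hl4 : s4.a .lens = s3.a .lens := g4.a _ rfl
      have hlen := h6.len
      refine Wp.straight (by decide) ?_ ⟨?_, (?_ : Lst _ _ _ (hood S φ l t)), ?_⟩
      · simp [Cmd.okL, Cmd.sem, hz4]; omega
      · simp [Cmd.sem, hz4]; omega
      · exact ⟨by simpa [Cmd.sem] using hlen, by simpa [Cmd.sem] using h6.seg⟩
      · intro i hi
        simp only [Cmd.sem, St.setV_a, St.setA_a, if_true, Ex.val_var, hz4, update_apply, hlen, hl4]
        split_ifs with h
        · rw [show i = t by omega]
        · exact h5 i (by omega)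
    · rintro s4 _ ⟨-, h4, h5⟩
      refine ⟨?_, fun i hi => h5 i (by omega)⟩
      rw [hood, ← Nat.sub_add_comm hld]; exact h4.seg
  · have h1 := Nat.mul_le_mul_right (closureTime (depth φ) φ.code.length + 30 + 9)
      (show depth φ + 1 - l.length ≤ depth φ + 1 by omega)
    have h2 := Nat.mul_le_mul_left (depth φ + 1) (show closureTime (depth φ) φ.code.length + 30 + 9 ≤
      closureTime (depth φ) φ.code.length + 40 by omega)
    omega

end

end BijQuery

/-! ## Evaluation of formulas -/

namespace BijQuery

open Function WhileRAM

set_option linter.constructorNameAsVariable false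

/-- Evaluation of a term. -/
def termStep : Cmd Var Arr :=
  .q ≔ rd .q - 2 ;;
  .ite (.get .inp (rd .q + 1)) (.z ≔ .get .bwd (.get .bas (.get .inp (rd .q)) + rd .z))
    (.z ≔ .get .fwd (.get .bas (.get .inp (rd .q)) + rd .z))

/-- The last letter of a word is applied first, so the word is read backwards, starting from the
variable that stands behind it. The exponent is stored as 0 for a function and as 1 for an inverse.
-/
def termValue : Cmd Var Arr :=
  (.l ≔ .get .inp (rd .pos) ;; .q ≔ rd .pos + 1 + rd .l + rd .l ;; .pos ≔ rd .q + 1 ;;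
    .z ≔ .get .env (.get .inp (rd .q))) ;;
  Cmd.for .i .l termStep

/-- Evaluation of an atom, after its first symbol has been read. -/
def evalAtom : Cmd Var Arr :=
  .ite (rd .tok - 1)
    ((.x ≔ .get .inp (rd .pos) ;; .pos ≔ rd .pos + 1) ;; termValue ;;
      .val ≔ .get .prd (.get .bas (rd .x) + rd .z))
    (.ite (rd .tok)
      (termValue ;;
        (.val ≔ .get .cst (.get .bas (.get .inp (rd .pos)) + rd .z) ;; .pos ≔ rd .pos + 1))
      (termValue ;; .x ≔ rd .z ;; termValue ;; .val ≔ 1 - (rd .x - rd .z) - (rd .z - rd .x)))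

/-- Reading of a symbol; as long as the variables `x_m` with `m < k` have no values, the formula is
taken to begin with a quantifier. -/
def readTok : Cmd Var Arr :=
  .ite (rd .k - rd .m) (.tok ≔ 6) (.tok ≔ .get .inp (rd .pos) ;; .pos ≔ rd .pos + 1)

/-- The parameters of the loop that evaluates a compound formula: the number `fl` of evaluations of
subformulas, the number `fr` of them that have to succeed, a flag for negation, a flag for
quantifiers and the quantified variable. -/
def decode : Cmd Var Arr :=
  -- Every compound formula asks whether at least `fr` of `fl` evaluations differ from `fn`: 1 of 1
  -- with `fn = 1` for a negation, 2 of 2 for a conjunction, 1 of 2 for a disjunction; 1 or all of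
  -- the range for a quantifier, and `r` of the representatives for a cardinality statement. The
  -- last one binds the variable number 0.
  .fr ≔ 1 ;; .fl ≔ 2 ;; .fn ≔ 0 ;; .fq ≔ 0 ;; .fx ≔ rd .m ;;
  .ite (5 - rd .tok) (.ite (4 - rd .tok) (.fl ≔ 1 ;; .fn ≔ 1) (.fr ≔ 2))
    (.ite (6 - rd .tok) .skip
      (.fq ≔ 1 ;; .ite (8 - rd .tok)
        (.fl ≔ .get .lens (rd .m) ;; .ite (7 - rd .tok) .skip (.fr ≔ rd .fl))
        (.fl ≔ rd .wl ;; .fx ≔ 0 ;; .fr ≔ .get .inp (rd .pos) ;; .pos ≔ rd .pos + 1)))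

/-- The frame saves the former value of the bound variable in `sv`. This matters for cardinality
statements, which reuse the number 0 of a variable that may be in scope. -/
def pushFrame : Cmd Var Arr :=
  .put .sr (rd .sp) (rd .fr) ;; .put .sl (rd .sp) (rd .fl) ;; .put .si (rd .sp) 0 ;;
  .put .sc (rd .sp) 0 ;; .put .sn (rd .sp) (rd .fn) ;; .put .sq (rd .sp) (rd .fq) ;;
  .put .sp (rd .sp) (rd .pos) ;; .put .sx (rd .sp) (rd .fx) ;;
  .put .sv (rd .sp) (.get .env (rd .fx)) ;;
  .ite (rd .fq) (.put .env (rd .fx) (.get .vs 0) ;; .m ≔ rd .m + 1) .skip ;; .sp ≔ rd .sp + 1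

/-- The mode `md` is 1 while a subformula is to be evaluated, 2 when its value is to be returned to
the frame on top of the stack, and 0 at the end. -/
def evalStep : Cmd Var Arr :=
  readTok ;; .ite (3 - rd .tok) (evalAtom ;; .md ≔ 2) (decode ;; pushFrame)

/-- Return of the value of a subformula to the loop that has asked for it. -/
def returnStep : Cmd Var Arr :=
  .ite (rd .sp)
    (.top ≔ rd .sp - 1 ;;
      .put .sc (rd .top) (.get .sc (rd .top) +
        ((.get .sn (rd .top) - rd .val) + (rd .val - .get .sn (rd .top)))) ;;
      .put .si (rd .top) (.get .si (rd .top) + 1) ;;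
      .ite (.get .sl (rd .top) - .get .si (rd .top))
        (.ite (.get .sq (rd .top)) (.pos ≔ .get .sp (rd .top) ;;
            .put .env (.get .sx (rd .top)) (.get .vs (.get .si (rd .top)))) .skip ;;
          .md ≔ 1)
        (.val ≔ 1 - (.get .sr (rd .top) - .get .sc (rd .top)) ;;
          .ite (.get .sq (rd .top))
            (.put .env (.get .sx (rd .top)) (.get .sv (rd .top)) ;; .m ≔ rd .m - 1) .skip ;;
          .sp ≔ rd .top))
    (.md ≔ 0)

def evalBody : Cmd Var Arr := .ite (rd .md - 1) returnStep evalStep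

def evalLoop : Cmd Var Arr := .wh (rd .md) evalBody

section
variable {σ : UnarySig} {S : BijStructure σ} {B : ℕ} {vals : List ℕ}

theorem Tables.lookup {s : St Var Arr} (h : Tables S vals s) {v : ℕ} (hv : v ∈ vals) (x : Fin S.n) :
    s.a .fwd (s.a .bas v + x) = symFun S v x ∧ s.a .bwd (s.a .bas v + x) = (symFun S v)⁻¹ x ∧
    s.a .prd (s.a .bas v + x) = bit (symPred S v x) ∧
    s.a .cst (s.a .bas v + x) = bit (symConst S v x) ∧ s.a .bas v + x ≤ vals.length * S.n := by
  obtain ⟨t, ht, rfl, hb⟩ := h.bas v hv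
  rw [hb]
  exact ⟨h.fwd t ht x, h.bwd t ht x, h.prd t ht x, h.cst t ht x, (row_le ht x).le⟩

theorem seg_wordCode_pair {f : ℕ → ℕ} {p : ℕ} {w : BijWord σ} (h : Seg f p w.code) {j : ℕ}
    (hj : j < w.length) : f (p + 1 + 2 * j) = w[j].1 ∧
      f (p + 1 + 2 * j + 1) = if w[j].2 then 0 else 1 := by
  rw [BijWord.code, seg_cons] at h
  have h2 := seg_flatMap h.2 hj
  have hl : ((w.take j).flatMap (fun p => [(p.1 : ℕ), if p.2 then 0 else 1])).length = 2 * j := by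
    simp [List.length_flatMap, Nat.min_eq_left hj.le]; omega
  rw [hl] at h2
  simpa using h2

theorem wp_termValue {s : St Var Arr} {w : BijWord σ} {p i : ℕ} {x : Fin S.n}
    (hT : Tables S vals s) (hw : ∀ v ∈ w.code, v ∈ vals) (hseg : Seg (s.a .inp) p (w.code ++ [i]))
    (hp : s.v .pos = p) (hx : s.a .env i = x) (hB : p + 2 * w.length + 3 ≤ B)
    (hB' : vals.length * S.n ≤ B) :
    Wp 5 B termValue (w.length * 120 + 100)
      (fun s' => s'.v .pos = p + w.code.length + 1 ∧ s'.v .z = w.eval S x) s := by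
  rw [length_wordCode]
  rw [seg_append, length_wordCode] at hseg
  have hlen := seg_wordCode hseg.1
  have hi : s.a .inp (p + (2 * w.length + 1)) = i := by simpa using hseg.2
  have e1 : p + 1 + w.length + w.length = p + (2 * w.length + 1) := by omega
  refine (Wp.seq (τ₁ := 80) (R := fun s' => s' = (((s.setV .l w.length).setV .q
    (p + (2 * w.length + 1))).setV .pos (p + (2 * w.length + 1) + 1)).setV .z x)
    (Wp.straight (by decide) ?_ ?_) ?_).le (τ := 80 + (w.length * (100 + 9) + 6)) (by omega)
  · simp [Cmd.okL, Cmd.sem, hp, hlen]; omega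
  · simp [Cmd.sem, hp, hlen, e1, hi, hx]
  rintro s0 - rfl
  refine (Wp.for (i := Var.i) (l := Var.l) (N := w.length) (τ := 100) (fun t s' =>
    s'.v .q = p + 1 + 2 * (w.length - t) ∧
      s'.v .z = BijWord.eval S (w.drop (w.length - t)) x) (by decide) rfl rfl (by omega) (by simp)
      ?_ ?_).post ?_
  · simpa [BijWord.eval] using by omega
  · rintro t ht s1 g1 _ _ ⟨h1, h2⟩
    have ha : s1.a = s.a := by
      funext T; exact g1.a T (by simp [Cmd.for, Cmd.wA, termStep])
    set j := w.length - (t + 1) with hj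
    have hjt : w.length - t = j + 1 := by omega
    have hjl : j < w.length := by omega
    rw [hjt] at h1 h2
    obtain ⟨e2, e3⟩ := seg_wordCode_pair hseg.1 hjl
    have hdrop : w.drop j = w[j] :: w.drop (j + 1) := List.drop_eq_getElem_cons hjl
    have hq : s1.v .q - 2 = p + 1 + 2 * j := by omega
    have hmem : (w[j].1 : ℕ) ∈ vals := hw _ (by
      refine List.mem_cons_of_mem _ (List.mem_flatMap.2 ⟨w[j], List.getElem_mem _, by simp⟩))
    obtain ⟨f1, f2, -, -, f3⟩ := hT.lookup hmem (BijWord.eval S (w.drop (j + 1)) x)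
    have hev : BijWord.eval S (w.drop j) x = if w[j].2 then S.func w[j].1
        (BijWord.eval S (w.drop (j + 1)) x) else (S.func w[j].1).symm
        (BijWord.eval S (w.drop (j + 1)) x) := by
      rw [hdrop, BijWord.eval, List.foldr_cons]; rfl
    rw [symFun_val] at f1 f2
    by_cases hb : w[j].2 = true
    · rw [if_pos hb] at e3 hev
      refine Wp.straight (by decide) ?_ ?_
      · simp [termStep, Cmd.okL, Cmd.sem, hq, ha, e2, e3, h2]; omega
      · simp only [termStep, Cmd.sem, Ex.val_sub, Ex.val_var, Ex.val_ofNat, hq, Ex.val_get, Ex.val_add,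
          St.setV_v, St.setV_a, if_true, ha, e3, e2, reduceCtorEq, if_false, h2, f1, hev]
        exact ⟨trivial, trivial⟩
    · rw [if_neg hb] at e3 hev
      refine Wp.straight (by decide) ?_ ?_
      · simp [termStep, Cmd.okL, Cmd.sem, hq, ha, e2, e3, h2]; omega
      · simp only [termStep, Cmd.sem, Ex.val_sub, Ex.val_var, Ex.val_ofNat, hq, Ex.val_get, Ex.val_add,
          St.setV_v, St.setV_a, if_true, ha, e3, e2, reduceCtorEq, if_false, h2, f2, hev,
          one_ne_zero]
        exact ⟨trivial, rfl⟩
  · rintro s1 g1 ⟨-, h2⟩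
    rw [Nat.sub_self, List.drop_zero] at h2
    exact ⟨by rw [g1.v _ rfl]; simp, h2⟩

theorem wp_evalAtom {m : ℕ} (α : BijAtom σ m) {s : St Var Arr} {p : ℕ} {a : Fin m → Fin S.n}
    (hT : Tables S vals s) (hv : ∀ v ∈ α.code, v ∈ vals) (hseg : Seg (s.a .inp) p α.code)
    (hp : s.v .pos = p + 1) (htok : s.v .tok = s.a .inp p) (he : ∀ i : Fin m, s.a .env i = a i)
    (hB : p + α.code.length + 4 ≤ B) (hB' : vals.length * S.n ≤ B) :
    Wp 5 B evalAtom (α.code.length * 120 + 400)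
      (fun s' => s'.v .pos = p + α.code.length ∧ s'.v .val = bit (α.Holds S a)) s := by
  cases α with
  | eq w i w' j =>
    have hc : (BijAtom.eq w i w' j).code = 0 :: ((w.code ++ [(i : ℕ)]) ++ (w'.code ++ [(j : ℕ)])) := by
      simp [BijAtom.code]
    rw [hc] at hseg hB hv ⊢
    simp only [List.length_cons, List.length_append, List.length_nil] at hB ⊢
    rw [seg_cons, seg_append] at hseg
    obtain ⟨h0, h1, h2⟩ := hseg
    rw [h0] at htok
    rw [length_wordCode, length_wordCode] at hB
    refine (Wp.iteF (e := rd .tok - 1) (by simp; omega) (by simp [htok]) (Wp.iteF (e := rd .tok)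
      (by simp) (by simp [htok])
      (Wp.seq (wp_termValue (x := a i) hT (fun v h => hv v (by simp [h])) h1 hp (he i) (by omega) hB') ?_))).le
        (τ := 5 + (3 + ((w.length * 120 + 100) + (5 + ((w'.length * 120 + 100) + 30))))) (by
          rw [length_wordCode, length_wordCode]; omega)
    rintro s1 g1 ⟨p1, z1⟩
    refine Wp.seq (R := fun s' => s' = s1.setV .x (w.eval S (a i))) (Wp.straight (by decide) ?_ ?_) ?_
    · simp [Cmd.okL]
    · simp [Cmd.sem, z1]
    rintro s2 - rfl
    have ha1 : s1.a = s.a := by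
      funext T; exact g1.a T (by simp [termValue, Cmd.for, Cmd.wA, termStep])
    refine Wp.seq (wp_termValue (x := a j) (w := w') (i := j) (p := p + 1 + w.code.length + 1)
      (hT.of_eq (by simp [ha1])) (fun v h => hv v (by simp [h]))
      (by simpa [ha1, Nat.add_assoc] using h2) (by simpa using p1) (by simpa [ha1] using he j)
      (by rw [length_wordCode]; omega) hB') ?_
    rintro s3 g3 ⟨p3, z3⟩
    have hx3 : s3.v .x = w.eval S (a i) := by rw [g3.v _ rfl]; simp
    refine Wp.straight (by decide) ?_ ⟨?_, ?_⟩
    · simp [Cmd.okL]; omega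
    · simp [Cmd.sem, p3]; omega
    · simp only [Cmd.sem, Ex.val_sub, Ex.val_var, Ex.val_ofNat, St.setV_v, if_true, hx3, z3,
        BijAtom.Holds]
      by_cases h : w.eval S (a i) = w'.eval S (a j)
      · rw [bit_pos h, h]; omega
      · rw [bit_neg h]
        have : (w.eval S (a i) : ℕ) ≠ w'.eval S (a j) := fun h' => h (Fin.ext h')
        omega
  | eqConst w i c =>
    simp only [BijAtom.code, List.length_cons, List.length_append, List.length_nil] at hseg hB hv ⊢
    rw [show [(i : ℕ), (c : ℕ)] = [(i : ℕ)] ++ [(c : ℕ)] from rfl, ← List.append_assoc, seg_cons,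
      seg_append] at hseg
    obtain ⟨h0, h1, h2⟩ := hseg
    rw [h0] at htok
    rw [length_wordCode] at hB
    refine (Wp.iteF (e := rd .tok - 1) (by simp; omega) (by simp [htok]) (Wp.iteT (e := rd .tok)
      (by simp) (by simp [htok])
      (Wp.seq (wp_termValue (x := a i) hT (fun v h => hv v (by simp [h])) h1 hp (he i) (by omega) hB') ?_))).le
        (τ := 5 + (3 + ((w.length * 120 + 100) + 80))) (by
          rw [length_wordCode]; omega)
    rintro s1 g1 ⟨p1, z1⟩
    have ha1 : s1.a = s.a := by
      funext T; exact g1.a T (by simp [termValue, Cmd.for, Cmd.wA, termStep])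
    have hc : s.a .inp (p + 1 + w.code.length + 1) = c := by simpa [Nat.add_assoc] using h2
    obtain ⟨-, -, -, f4, f5⟩ := hT.lookup (hv c (by simp)) (w.eval S (a i))
    rw [length_wordCode] at p1 hc
    refine Wp.straight (by decide) ?_ ⟨?_, ?_⟩
    · simp [Cmd.okL, Cmd.sem, p1, ha1, hc, z1]; omega
    · simp [Cmd.sem, p1, length_wordCode]; omega
    · simp [Cmd.sem, p1, ha1, hc, z1, f4, symConst, BijAtom.Holds]
  | pred U w i =>
    simp only [BijAtom.code, List.length_cons, List.length_append, List.length_nil] at hseg hB hv ⊢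
    rw [seg_cons, seg_cons] at hseg
    obtain ⟨h0, h1, h2⟩ := hseg
    rw [h0] at htok
    rw [length_wordCode] at hB
    refine (Wp.iteT (e := rd .tok - 1) (by simp; omega) (by simp [htok]) (Wp.seq (τ₁ := 20)
      (R := fun s' => s' = (s.setV .x U).setV .pos (p + 1 + 1)) (Wp.straight (by decide) ?_ ?_)
      ?_)).le (τ := 5 + (20 + ((w.length * 120 + 100) + 80))) (by
          rw [length_wordCode]; omega)
    · simp [Cmd.okL, Cmd.sem, hp]; omega
    · simp [Cmd.sem, hp, h1]
    rintro s0 - rfl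
    refine Wp.seq (wp_termValue (x := a i) (w := w) (i := i) (p := p + 1 + 1) (hT.of_eq (by simp))
      (fun v h => hv v (by simp [h])) h2 (by simp) (he i) (by omega) hB') ?_
    rintro s1 g1 ⟨p1, z1⟩
    have ha1 : s1.a = s.a := by
      funext T; exact g1.a T (by simp [termValue, Cmd.for, Cmd.wA, termStep])
    have hx : s1.v .x = U := by rw [g1.v _ rfl]; simp
    obtain ⟨-, -, f4, -, f5⟩ := hT.lookup (hv U (by simp)) (w.eval S (a i))
    refine Wp.straight (by decide) ?_ ⟨?_, ?_⟩
    · simp [Cmd.okL, ha1, hx, z1]; omega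
    · simp [Cmd.sem, p1, length_wordCode]; omega
    · simp [Cmd.sem, hx, ha1, z1, f4, symPred, BijAtom.Holds]

/-! ### Stack frames and the specification of evaluation -/

/-- Between the states, nothing has changed on the stack below `q`. -/
def Below (q : ℕ) (s s' : St Var Arr) : Prop := ∀ T, T ≠ .env → ∀ i < q, s'.a T i = s.a T i

/-- The evaluation of the subformula between the positions `p` and `p'` under the assignment `e` of
values to variables leads to the value `v`. -/
def Evals (B : ℕ) (s₀ : St Var Arr) (p p' m d : ℕ) (e : ℕ → ℕ) (v c : ℕ) : Prop :=
  ∀ (s : St Var Arr) (q τ : ℕ) (Q : St Var Arr → Prop), Agree evalLoop s₀ s → s.v .md = 1 →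
    s.v .pos = p → s.v .m = m → s.v .sp = q → q + d ≤ B → s.a .env = e →
    (∀ s', Agree evalLoop s₀ s' → s'.v .md = 2 → s'.v .pos = p' → s'.v .m = m → s'.v .sp = q →
      s'.v .val = v → s'.a .env = e → Below q s s' → Wp 5 B evalLoop τ Q s') →
    Wp 5 B evalLoop (τ + c) Q s

theorem Evals.mono {s₀ : St Var Arr} {p p' m d d' v c c' : ℕ} {e : ℕ → ℕ}
    (h : Evals B s₀ p p' m d e v c) (hd : d ≤ d') (hc : c ≤ c') : Evals B s₀ p p' m d' e v c' :=
  fun s q τ Q h1 h2 h3 h4 h5 h6 h7 h8 => (h s q τ Q h1 h2 h3 h4 h5 (by omega) h7 h8).le (by omega)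

theorem agree_evalStep {s s' : St Var Arr} (h : Agree evalStep s s') : Agree evalLoop s s' :=
  h.mono (fun _ h => (Bool.or_eq_false_iff.1 h).2) (fun _ h => (Bool.or_eq_false_iff.1 h).2)
    (fun _ => rfl)

/-- The loop of a compound formula on top of the stack. -/
structure Frame (s : St Var Arr) (q r lim i cnt neg quant pos x old : ℕ) : Prop where
  sr : s.a .sr q = r
  sl : s.a .sl q = lim
  si : s.a .si q = i
  sc : s.a .sc q = cnt
  sn : s.a .sn q = neg
  sq : s.a .sq q = quant
  sp : s.a .sp q = pos
  sx : s.a .sx q = x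
  sv : s.a .sv q = old

theorem Frame.below {s s' : St Var Arr} {q r lim i cnt neg quant pos x old : ℕ}
    (h : Frame s q r lim i cnt neg quant pos x old) (hb : Below (q + 1) s s') :
    Frame s' q r lim i cnt neg quant pos x old :=
  ⟨(hb _ (by decide) q (by omega)).trans h.sr, (hb _ (by decide) q (by omega)).trans h.sl,
    (hb _ (by decide) q (by omega)).trans h.si, (hb _ (by decide) q (by omega)).trans h.sc,
    (hb _ (by decide) q (by omega)).trans h.sn, (hb _ (by decide) q (by omega)).trans h.sq,
    (hb _ (by decide) q (by omega)).trans h.sp, (hb _ (by decide) q (by omega)).trans h.sx,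
    (hb _ (by decide) q (by omega)).trans h.sv⟩

end

end BijQuery

/-! ## Evaluation of compound formulas -/

namespace BijQuery

open Function WhileRAM

set_option linter.constructorNameAsVariable false

section
variable {σ : UnarySig} {S : BijStructure σ} {B : ℕ}

theorem Below.trans {q : ℕ} {s s' s'' : St Var Arr} (h : Below q s s') (h' : Below q s' s'') :
    Below q s s'' := fun T hT i hi => (h' T hT i hi).trans (h T hT i hi)

theorem Below.mono {q q' : ℕ} {s s' : St Var Arr} (h : Below q s s') (hq : q' ≤ q) :
    Below q' s s' := fun T hT i hi => h T hT i (by omega)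

theorem wp_return {s : St Var Arr} {τ : ℕ} {Q : St Var Arr → Prop} (h : s.v .md = 2)
    (hB : 2 ≤ B) (hok : returnStep.okL B s)
    (hQ : Wp 5 B evalLoop τ Q (returnStep.sem s)) : Wp 5 B evalLoop (τ + 400) Q s := by
  refine (Wp.whT (e := rd .md) (τ₁ := 5 + 380) (by simp) (by simp [h]) (Wp.iteT (e := rd .md - 1)
    (by simp; omega) (by simp [h]) (Wp.straight (by decide) hok hQ))).le ?_
  simp only [Ex.cost_var]; omega

theorem agree_returnStep {s : St Var Arr} (h : returnStep.okL B s) :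
    Agree evalLoop s (returnStep.sem s) :=
  (agree_sem h).mono (fun _ h => (Bool.or_eq_false_iff.1 h).1)
    (fun _ h => (Bool.or_eq_false_iff.1 h).1) (fun _ => rfl)

/-- More evaluations are due. A quantifier goes back to the beginning of its body with the next
element of `vs`; a connective simply goes on, since the reading position already stands at its next
operand. -/
theorem wp_return_next {s : St Var Arr} {τ q r lim i cnt neg quant pos x old b : ℕ}
    {Q : St Var Arr → Prop} (h : s.v .md = 2) (hsp : s.v .sp = q + 1) (hval : s.v .val = b)
    (hf : Frame s q r lim i cnt neg quant pos x old) (hi : i + 1 < lim) (hcnt : cnt ≤ i)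
    (hb : b ≤ 1) (hneg : neg ≤ 1) (hB : lim + 2 ≤ B)
    (hQ : ∀ s', Agree evalLoop s s' → s'.v .md = 1 →
      s'.v .pos = (if quant = 0 then s.v .pos else pos) → s'.v .m = s.v .m → s'.v .sp = q + 1 →
      s'.a .env = (if quant = 0 then s.a .env else update (s.a .env) x (s.a .vs (i + 1))) →
      Frame s' q r lim (i + 1) (cnt + ((neg - b) + (b - neg))) neg quant pos x old → Below q s s' →
      Wp 5 B evalLoop τ Q s') :
    Wp 5 B evalLoop (τ + 400) Q s := by
  have hlim : ¬ (lim - (i + 1) = 0) := by omega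
  have hok : returnStep.okL B s := by
    by_cases hq : quant = 0
    · simp [returnStep, Cmd.okL, Cmd.sem, hsp, hval, hf.sc, hf.sn, hf.si, hf.sl, hf.sq, hlim, hq]
      omega
    · simp [returnStep, Cmd.okL, Cmd.sem, hsp, hval, hf.sc, hf.sn, hf.si, hf.sl, hf.sq, hlim, hq]
      omega
  refine wp_return h (by omega) hok (hQ _ (agree_returnStep hok) ?_ ?_ ?_ ?_ ?_ ?_ ?_)
  all_goals by_cases hq : quant = 0
  all_goals try simp [returnStep, Cmd.sem, hsp, hval, hf.sc, hf.sn, hf.si, hf.sl, hf.sq, hf.sp,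
    hf.sx, hlim, hq]
  · constructor <;> simp [hf.sr, hf.sl, hf.sn, hf.sq, hf.sp, hf.sx, hf.sv, hq]
  · constructor <;> simp [hf.sr, hf.sl, hf.sn, hf.sq, hf.sp, hf.sx, hf.sv]
  · intro T hT j hj
    simp only [St.setV_a, St.setA_a]
    split_ifs with h1 h2 <;> simp_all [update_apply] <;> omega
  · intro T hT j hj
    simp only [St.setV_a, St.setA_a]
    split_ifs with h1 h2 <;> simp_all [update_apply] <;> omega

/-- The last evaluation of a frame: the count is compared with the threshold, the saved value of the
bound variable is restored, and the frame is given up. -/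
theorem wp_return_done {s : St Var Arr} {τ q r lim i cnt neg quant pos x old b : ℕ}
    {Q : St Var Arr → Prop} (h : s.v .md = 2) (hsp : s.v .sp = q + 1) (hval : s.v .val = b)
    (hf : Frame s q r lim i cnt neg quant pos x old) (hi : i + 1 = lim) (hcnt : cnt ≤ i)
    (hb : b ≤ 1) (hneg : neg ≤ 1) (hB : lim + 2 ≤ B)
    (hQ : ∀ s', Agree evalLoop s s' → s'.v .md = 2 → s'.v .pos = s.v .pos →
      s'.v .m = (if quant = 0 then s.v .m else s.v .m - 1) → s'.v .sp = q →
      s'.v .val = (if r ≤ cnt + ((neg - b) + (b - neg)) then 1 else 0) →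
      s'.a .env = (if quant = 0 then s.a .env else update (s.a .env) x old) → Below q s s' →
      Wp 5 B evalLoop τ Q s') :
    Wp 5 B evalLoop (τ + 400) Q s := by
  have hlim : lim - (i + 1) = 0 := by omega
  have hok : returnStep.okL B s := by
    by_cases hq : quant = 0
    · simp [returnStep, Cmd.okL, Cmd.sem, hsp, hval, hf.sc, hf.sn, hf.si, hf.sl, hf.sq, hlim, hq]
      omega
    · simp [returnStep, Cmd.okL, Cmd.sem, hsp, hval, hf.sc, hf.sn, hf.si, hf.sl, hf.sq, hlim, hq]
      omega
  refine wp_return h (by omega) hok (hQ _ (agree_returnStep hok) ?_ ?_ ?_ ?_ ?_ ?_ ?_)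
  all_goals by_cases hq : quant = 0
  all_goals try simp [returnStep, Cmd.sem, hsp, hval, hf.sc, hf.sn, hf.si, hf.sl, hf.sq,
    hf.sx, hf.sr, hf.sv, hlim, hq, h]
  · split_ifs <;> omega
  · split_ifs <;> omega
  · intro T hT j hj
    simp only [St.setV_a, St.setA_a]
    split_ifs with h1 h2 <;> simp_all [update_apply] <;> omega
  · intro T hT j hj
    simp only [St.setV_a, St.setA_a]
    split_ifs with h1 h2 <;> simp_all [update_apply] <;> omega

end

end BijQuery

/-! ## The loop of a compound formula -/

namespace BijQuery

open Function WhileRAM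

set_option linter.constructorNameAsVariable false

section
variable {σ : UnarySig} {S : BijStructure σ} {B : ℕ}

/-- Induction on the number of evaluations that are left. `P i` and `E i` are the positions where
the evaluation number `i` begins and ends, and `b i` is its value; `Below` guarantees that
subformulas leave the frame intact. -/
theorem wp_frame {s₀ : St Var Arr} {q r lim neg quant pos x old m d c : ℕ} {P E b : ℕ → ℕ}
    {e : ℕ → ℕ} (hb : ∀ i, b i ≤ 1) (hneg : neg ≤ 1) (hquant : quant ≤ 1) (hB : lim + 2 ≤ B)
    (hold : e x = old)
    (hP : ∀ i, i + 1 < lim → P (i + 1) = if quant = 0 then E i else pos)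
    (hch : ∀ i < lim, Evals B s₀ (P i) (E i) (m + quant) d
      (if quant = 0 then e else update e x (s₀.a .vs i)) (b i) c) :
    ∀ (j i : ℕ) (s : St Var Arr) (τ : ℕ) (Q : St Var Arr → Prop), i + j + 1 = lim →
    Agree evalLoop s₀ s → s.v .md = 1 → s.v .pos = P i → s.v .m = m + quant → s.v .sp = q + 1 →
    q + 1 + d ≤ B → s.a .env = (if quant = 0 then e else update e x (s₀.a .vs i)) →
    Frame s q r lim i (∑ t ∈ Finset.range i, ((neg - b t) + (b t - neg))) neg quant pos x old →
    (∀ s', Agree evalLoop s₀ s' → s'.v .md = 2 → s'.v .pos = E (lim - 1) → s'.v .m = m →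
      s'.v .sp = q → s'.v .val =
        (if r ≤ ∑ t ∈ Finset.range lim, ((neg - b t) + (b t - neg)) then 1 else 0) →
      s'.a .env = e → Below q s s' → Wp 5 B evalLoop τ Q s') →
    Wp 5 B evalLoop (τ + (j + 1) * (c + 400)) Q s := by
  have hcnt : ∀ i, ∑ t ∈ Finset.range i, ((neg - b t) + (b t - neg)) ≤ i := fun i => by
    refine (Finset.sum_le_card_nsmul _ _ 1 fun t _ => ?_).trans (by simp)
    have := hb t; omega
  intro j
  induction j with
  | zero =>
    intro i s τ Q hi hag hmd hpos hm hsp hd henv hf hQ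
    refine (hch i (by omega) s (q + 1) (τ + 400) Q hag hmd hpos hm hsp hd henv
      fun s' g1 g2 g3 g4 g5 g6 g7 g8 => ?_).le (by omega)
    refine wp_return_done g2 g5 g6 (hf.below g8) hi (hcnt i) (hb i) hneg hB
      fun s'' k1 k2 k3 k4 k5 k6 k7 k8 => hQ s'' (g1.trans k1) k2 ?_ ?_ k5 ?_ ?_ ?_
    · rw [k3, g3, ← hi]; simp
    · rw [k4, g4]; split_ifs <;> omega
    · rw [k6, ← hi, Nat.add_zero, Finset.sum_range_succ]
    · rw [k7, g7]
      split_ifs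
      · rfl
      · rw [update_idem, ← hold, update_eq_self]
    · exact (g8.mono (by omega)).trans k8
  | succ j ih =>
    intro i s τ Q hi hag hmd hpos hm hsp hd henv hf hQ
    refine (hch i (by omega) s (q + 1) (τ + (j + 1) * (c + 400) + 400) Q hag hmd hpos hm hsp hd henv
      fun s' g1 g2 g3 g4 g5 g6 g7 g8 => ?_).le (by rw [Nat.succ_mul (j + 1)]; omega)
    refine wp_return_next g2 g5 g6 (hf.below g8) (by omega) (hcnt i) (hb i) hneg hB
      fun s'' k1 k2 k3 k4 k5 k6 k7 k8 => ?_
    refine ih (i + 1) s'' τ Q (by omega) (g1.trans k1) k2 ?_ (k4.trans g4) k5 hd ?_ ?_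
      fun t l1 l2 l3 l4 l5 l6 l7 l8 => hQ t l1 l2 l3 l4 l5 l6 l7
        (((g8.mono (by omega)).trans k8).trans l8)
    · rw [k3, g3, hP i (by omega)]
    · rw [k6, g7]
      split_ifs
      · rfl
      · rw [update_idem, g1.a .vs rfl]
    · rw [Finset.sum_range_succ]; exact k7

theorem wp_push {s : St Var Arr} {q r lim neg quant pos x m : ℕ} {e : ℕ → ℕ} (hsp : s.v .sp = q)
    (hfr : s.v .fr = r) (hfl : s.v .fl = lim) (hfn : s.v .fn = neg) (hfq : s.v .fq = quant)
    (hfx : s.v .fx = x) (hpos : s.v .pos = pos) (hm : s.v .m = m) (henv : s.a .env = e)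
    (hquant : quant ≤ 1) (hB : q + 1 ≤ B) (hB' : m + 1 ≤ B) :
    Wp 5 B pushFrame 300 (fun s' => s'.v .md = s.v .md ∧ s'.v .pos = pos ∧ s'.v .m = m + quant ∧
      s'.v .sp = q + 1 ∧ s'.a .env = (if quant = 0 then e else update e x (s.a .vs 0)) ∧
      Frame s' q r lim 0 0 neg quant pos x (e x) ∧ Below q s s') s := by
  rcases Nat.le_one_iff_eq_zero_or_eq_one.1 hquant with rfl | rfl
  · refine Wp.straight (by decide) ?_ ⟨?_, ?_, ?_, ?_, ?_, ?_, ?_⟩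
    · simp [pushFrame, Cmd.okL, Cmd.sem, hsp, hfq]; omega
    · simp [pushFrame, Cmd.sem, hfq]
    · simp [pushFrame, Cmd.sem, hfq, hpos]
    · simp [pushFrame, Cmd.sem, hfq, hm]
    · simp [pushFrame, Cmd.sem, hfq, hsp]
    · simp [pushFrame, Cmd.sem, hfq, henv]
    · constructor <;> simp [pushFrame, Cmd.sem, hfq, hsp, hfr, hfl, hfn, hfx, hpos, henv]
    · intro T hT j hj
      cases T <;> simp [pushFrame, Cmd.sem, hfq, hsp, update_apply] <;> omega
  · refine Wp.straight (by decide) ?_ ⟨?_, ?_, ?_, ?_, ?_, ?_, ?_⟩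
    · simp [pushFrame, Cmd.okL, Cmd.sem, hsp, hfq, hm]; omega
    · simp [pushFrame, Cmd.sem, hfq]
    · simp [pushFrame, Cmd.sem, hfq, hpos]
    · simp [pushFrame, Cmd.sem, hfq, hm]
    · simp [pushFrame, Cmd.sem, hfq, hsp]
    · simp [pushFrame, Cmd.sem, hfq, henv, hfx]
    · constructor <;> simp [pushFrame, Cmd.sem, hfq, hsp, hfr, hfl, hfn, hfx, hpos, henv]
    · intro T hT j hj
      cases T <;> first | exact absurd rfl hT |
        (simp [pushFrame, Cmd.sem, hfq, hsp, update_apply] <;> omega)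

/-- Reading of a symbol of a subformula. -/
theorem wp_readTok {s : St Var Arr} {k p m : ℕ} (hk : s.v .k = k) (hp : s.v .pos = p)
    (hm : s.v .m = m) (hB : p + 7 ≤ B) :
    Wp 5 B readTok 40 (fun s' => s' = if m < k then s.setV .tok 6 else
      (s.setV .tok (s.a .inp p)).setV .pos (p + 1)) s := by
  by_cases h : m < k
  · have : ¬ (k - m = 0) := by omega
    refine Wp.straight (by decide) ?_ ?_
    · simp [readTok, Cmd.okL, hk, hm, this]; omega
    · simp [readTok, Cmd.sem, hk, hm, this, h]
  · have : k - m = 0 := by omega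
    refine Wp.straight (by decide) ?_ ?_
    · simp [readTok, Cmd.okL, Cmd.sem, hk, hm, this, hp]; omega
    · simp [readTok, Cmd.sem, hk, hm, this, h, hp]

/-- The common core of all connectives and quantifiers. Since `Evals` is in continuation form, the
specifications of the subformulas may be used inside the single evaluation loop, and a special case
has only to supply the threshold, the number of evaluations and the positions. -/
theorem evals_frame {s₀ : St Var Arr} {k p p1 tok r lim neg quant pos x m d c : ℕ} {P E b : ℕ → ℕ}
    {e : ℕ → ℕ} (hk : s₀.v .k = k) (hB : p + 7 ≤ B)
    (htok : 3 ≤ tok) (hread : if m < k then tok = 6 ∧ p1 = p else tok = s₀.a .inp p ∧ p1 = p + 1)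
    (hdec : ∀ s, Agree evalLoop s₀ s → s.v .tok = tok → s.v .pos = p1 → s.v .m = m →
      decode.okL B s ∧ (decode.sem s).v .fr = r ∧ (decode.sem s).v .fl = lim ∧
      (decode.sem s).v .fn = neg ∧ (decode.sem s).v .fq = quant ∧ (decode.sem s).v .fx = x ∧
      (decode.sem s).v .pos = pos)
    (hb : ∀ i, b i ≤ 1) (hneg : neg ≤ 1) (hquant : quant ≤ 1) (hBl : lim + 2 ≤ B)
    (hBm : m + 1 ≤ B) (hlim : 0 < lim) (h0 : P 0 = pos)
    (hP : ∀ i, i + 1 < lim → P (i + 1) = if quant = 0 then E i else pos)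
    (hch : ∀ i < lim, Evals B s₀ (P i) (E i) (m + quant) d
      (if quant = 0 then e else update e x (s₀.a .vs i)) (b i) c) :
    Evals B s₀ p (E (lim - 1)) m (d + 1) e
      (if r ≤ ∑ t ∈ Finset.range lim, ((neg - b t) + (b t - neg)) then 1 else 0)
      (lim * (c + 400) + 600) := by
  intro s q τ Q hag hmd hpos hm hsp hd henv hQ
  have hk' : s.v .k = k := (hag.v _ rfl).trans hk
  have hinp : s.a .inp = s₀.a .inp := hag.a _ rfl
  suffices H : ∀ s', Agree evalStep s s' → s'.v .md = 1 → s'.v .pos = P 0 →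
      s'.v .m = m + quant → s'.v .sp = q + 1 →
      s'.a .env = (if quant = 0 then e else update e x (s₀.a .vs 0)) →
      Frame s' q r lim 0 0 neg quant pos x (e x) → Below q s s' →
      Wp 5 B evalLoop (τ + lim * (c + 400)) Q s' by
    have key : Wp 5 B evalStep (40 + (5 + (80 + 300))) (fun s' => s'.v .md = 1 ∧ s'.v .pos = P 0 ∧
        s'.v .m = m + quant ∧ s'.v .sp = q + 1 ∧
        s'.a .env = (if quant = 0 then e else update e x (s₀.a .vs 0)) ∧
        Frame s' q r lim 0 0 neg quant pos x (e x) ∧ Below q s s') s := by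
      refine Wp.seq (R := fun s' => Agree evalStep s s' ∧ s'.v .tok = tok ∧ s'.v .pos = p1 ∧
            s'.v .m = m ∧ s'.v .md = 1 ∧ s'.v .sp = q ∧ s'.a = s.a)
          (Wp.post (wp_readTok hk' hpos hm hB) ?_) ?_
      · rintro s' g rfl
        have g' : Agree evalStep s _ := g.mono (fun _ h => (Bool.or_eq_false_iff.1 h).1)
          (fun _ h => (Bool.or_eq_false_iff.1 h).1) (fun _ => rfl)
        refine ⟨g', ?_⟩
        by_cases h : m < k
        · rw [if_pos h] at hread
          simp [h, hm, hmd, hsp, hpos, hread]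
        · rw [if_neg h] at hread
          simp [h, hm, hmd, hsp, hread, hinp]
      · rintro s' - ⟨g, h1, h2, h3, h4, h5, h6⟩
        obtain ⟨hok, d1, d2, d3, d4, d5, d6⟩ := hdec s' (hag.trans (agree_evalStep g)) h1 h2 h3
        refine Wp.iteF (e := 3 - rd .tok) (by simp; omega) (by simp [h1]; omega)
          (Wp.seq (R := fun s'' => s'' = decode.sem s') (Wp.straight (by decide) hok rfl) ?_)
        rintro s'' g2 rfl
        have ha : (decode.sem s').a = s.a := by
          rw [← h6]; funext T; exact g2.a T (by simp [decode, Cmd.wA])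
        refine (wp_push (m := m) (e := e) ((g2.v _ rfl).trans h5) d1 d2 d3 d4 d5 d6
          ((g2.v _ rfl).trans h3) (by rw [ha]; exact henv) hquant (by omega) hBm).post ?_
        rintro t _ ⟨t1, t2, t3, t4, t5, t6, t7⟩
        refine ⟨t1.trans ((g2.v _ rfl).trans h4), t2.trans h0.symm, t3, t4, ?_, t6, ?_⟩
        · rw [t5, ha, hag.a .vs rfl]
        · intro T hT i hi
          rw [t7 T hT i hi, ha]
    refine (Wp.whT (e := rd .md) (τ₁ := 5 + (40 + (5 + (80 + 300)))) (by simp) (by simp [hmd])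
      (Wp.iteF (e := rd .md - 1) (by simp; omega) (by simp [hmd])
        (key.post fun s' g ⟨e1, e2, e3, e4, e5, e6, e7⟩ => H s' g e1 e2 e3 e4 e5 e6 e7))).le ?_
    simp only [Ex.cost_var]; omega
  intro s' g h1 h2 h3 h4 h5 h6 h7
  obtain ⟨j, rfl⟩ := Nat.exists_eq_succ_of_ne_zero hlim.ne'
  exact wp_frame hb hneg hquant hBl rfl hP hch j 0 s' τ Q (by omega) (hag.trans (agree_evalStep g)) h1 h2
    h3 h4 (by omega) h5 h6 fun s'' k1 k2 k3 k4 k5 k6 k7 k8 => hQ s'' k1 k2 k3 k4 k5 k6 k7 (h7.trans k8)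

end

end BijQuery

/-! ## Correctness of the evaluation -/

namespace BijQuery

open Function WhileRAM

set_option linter.constructorNameAsVariable false

open scoped Classical in
theorem sum_bit {α : Type} (l : List α) (P : α → Prop) :
    ∑ i ∈ Finset.range l.length, bit (∃ h : i < l.length, P l[i]) = l.countP (fun x => decide (P x)) := by
  have key : ∀ l : List α, ∑ i ∈ Finset.range l.length, bit (∃ y, l[i]? = some y ∧ P y) =
      l.countP (fun x => decide (P x)) := fun l => by
    induction l using List.reverseRecOn with
    | nil => simp
    | append_singleton l x ih =>
      have : (l ++ [x]).length = l.length + 1 := by simp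
      rw [this, Finset.sum_range_succ, List.countP_append, ← ih]
      congr 1
      · refine Finset.sum_congr rfl fun i hi => ?_
        rw [List.getElem?_append_left (Finset.mem_range.1 hi)]
      · by_cases h : P x <;> simp [h, bit]
  rw [← key]
  refine Finset.sum_congr rfl fun i hi => bit_congr ?_
  simp [Finset.mem_range.1 hi]

theorem bit_eq_ite {p q : Prop} [Decidable q] (h : p ↔ q) : bit p = if q then 1 else 0 := by
  by_cases hq : q
  · rw [if_pos hq, bit_pos (h.2 hq)]
  · rw [if_neg hq, bit_neg fun hp => hq (h.1 hp)]

section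
variable {σ : UnarySig} {S : BijStructure σ} {k : ℕ} {φ : FOBij σ k} {B : ℕ} {s₀ : St Var Arr}

theorem evals_atom (hr : Ready S φ s₀) (hB : Room S φ B) {p m m' d : ℕ} (α : BijAtom σ m)
    (hv : ∀ v ∈ α.code, v ∈ φ.code) (hseg : Seg (s₀.a .inp) p α.code)
    (hp : p + α.code.length ≤ queryPos S + 1 + φ.code.length) (hk : k ≤ m') {e : ℕ → ℕ}
    {a : Fin m → Fin S.n} (he : ∀ i : Fin m, e i = a i) :
    Evals B s₀ p (p + α.code.length) m' d e (bit (α.Holds S a)) (α.code.length * 120 + 500) := by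
  intro s q τ Q hag hmd hpos hm hsp hd henv hQ
  have h1 := hB.input
  have h2 := hB.tables
  rw [length_inputWord] at h1
  have hlt : s₀.a .inp p < 3 := by
    cases α <;> simp only [BijAtom.code, seg_cons] at hseg <;> omega
  have key : Wp 5 B evalStep (40 + (5 + ((α.code.length * 120 + 400) + 2))) (fun s' => s'.v .md = 2 ∧
      s'.v .pos = p + α.code.length ∧ s'.v .m = m' ∧ s'.v .sp = q ∧
      s'.v .val = bit (α.Holds S a) ∧ s'.a = s.a) s := by
    refine Wp.seq (wp_readTok ((hag.v _ rfl).trans hr.sizes.k) hpos hm (by omega)) ?_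
    rintro s' g1 h1
    rw [if_neg (by omega)] at h1
    subst h1
    refine Wp.iteT (e := 3 - rd .tok) (by simp; omega) (by simp [hag.a .inp rfl]; omega)
      (Wp.seq (wp_evalAtom α (a := a) (vals := φ.code)
      ((hr.tables.agree hag rfl).of_eq (by simp)) hv (by simpa [hag.a .inp rfl] using hseg)
      (by simp) (by simp) (by simpa [henv] using he) (by omega) (by omega)) ?_)
    rintro s' g2 ⟨e1, e2⟩
    refine Wp.straight (h := 5) (by decide) (by simp [Cmd.okL]; omega) ?_
    refine ⟨by simp [Cmd.sem], by simpa [Cmd.sem] using e1, ?_, ?_, by simpa [Cmd.sem] using e2, ?_⟩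
    · simpa [Cmd.sem, hm] using g2.v .m rfl
    · simpa [Cmd.sem, hsp] using g2.v .sp rfl
    · funext T
      simpa [Cmd.sem] using g2.a T (by simp [evalAtom, Cmd.wA, termValue, Cmd.for, termStep])
  refine (Wp.whT (e := rd .md) (τ₁ := (rd .md - 1 : Ex Var Arr).cost 5 + 2 + _)
    (by simp) (by simp [hmd]) (Wp.iteF (e := rd .md - 1) (by simp; omega) (by simp [hmd])
        (key.post fun s' g ⟨e1, e2, e3, e4, e5, e6⟩ => hQ s' (hag.trans (agree_evalStep g)) e1 e2 e3 e4
          e5 (by rw [e6]; exact henv) fun T _ i _ => by rw [e6]))).le ?_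
  have : (rd .md - 1 : Ex Var Arr).cost 5 = 3 := rfl
  simp only [Ex.cost_var, this]; omega

section
variable {p p' p'' m d c : ℕ} {e : ℕ → ℕ} {P P' : Prop}

theorem evals_neg (hk : s₀.v .k = k) (hkm : k ≤ m) (hB : p + m + 7 ≤ B) (hp : s₀.a .inp p = 3)
    (h : Evals B s₀ (p + 1) p' m d e (bit P) c) :
    Evals B s₀ p p' m (d + 1) e (bit (¬ P)) (2 * (c + 400) + 600) := by
  have := evals_frame (B := B) (s₀ := s₀) (k := k)
    (p1 := p + 1) (tok := 3) (r := 1) (lim := 1) (neg := 1) (quant := 0)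
    (pos := p + 1) (x := m) (c := c) (P := fun _ => p + 1) (E := fun _ => p') (b := fun _ => bit P)
    (e := e) (d := d) (m := m) (p := p)
    hk (by omega) le_rfl (by rw [if_neg (by omega)]; exact ⟨hp.symm, rfl⟩)
    (fun s _ e1 e2 e3 => by
      simp [decode, Cmd.okL, Cmd.sem, e1, e2, e3]; omega)
    (fun _ => bit_le P) le_rfl (by omega) (by omega) (by omega) (by omega) rfl
    (fun i hi => by omega) (fun i _ => by simpa using h)
  rw [bit_eq_ite (q := 1 ≤ ∑ t ∈ Finset.range 1, ((1 - bit P) + (bit P - 1)))]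
  · exact this.mono le_rfl (by omega)
  · by_cases hP : P <;> simp [hP, bit]

theorem evals_and (hk : s₀.v .k = k) (hkm : k ≤ m) (hB : p + m + 7 ≤ B) (hp : s₀.a .inp p = 4)
    (h : Evals B s₀ (p + 1) p' m d e (bit P) c) (h' : Evals B s₀ p' p'' m d e (bit P') c) :
    Evals B s₀ p p'' m (d + 1) e (bit (P ∧ P')) (2 * (c + 400) + 600) := by
  have := evals_frame (B := B) (s₀ := s₀) (k := k)
    (p1 := p + 1) (tok := 4) (r := 2) (lim := 2) (neg := 0) (quant := 0)
    (pos := p + 1) (x := m) (c := c) (P := fun i => if i = 0 then p + 1 else p')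
    (E := fun i => if i = 0 then p' else p'') (b := fun i => if i = 0 then bit P else bit P')
    (e := e) (d := d) (m := m) (p := p)
    hk (by omega) (by omega) (by rw [if_neg (by omega)]; exact ⟨hp.symm, rfl⟩)
    (fun s _ e1 e2 e3 => by
      simp [decode, Cmd.okL, Cmd.sem, e1, e2, e3]; omega)
    (fun i => by split_ifs <;> exact bit_le _) (by omega) (by omega) (by omega) (by omega) (by omega)
    rfl
    (fun i hi => by obtain rfl : i = 0 := by omega
                    simp) (fun i hi => by
                      obtain rfl | rfl : i = 0 ∨ i = 1 := by omega
                      · simpa using h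
                      · simpa using h')
  rw [bit_eq_ite (q := 2 ≤ ∑ t ∈ Finset.range 2, ((0 - if t = 0 then bit P else bit P') +
    ((if t = 0 then bit P else bit P') - 0)))]
  · exact this
  · by_cases hP : P <;> by_cases hP' : P' <;> simp [hP, hP', bit, Finset.sum_range_succ]

theorem evals_or (hk : s₀.v .k = k) (hkm : k ≤ m) (hB : p + m + 7 ≤ B) (hp : s₀.a .inp p = 5)
    (h : Evals B s₀ (p + 1) p' m d e (bit P) c) (h' : Evals B s₀ p' p'' m d e (bit P') c) :
    Evals B s₀ p p'' m (d + 1) e (bit (P ∨ P')) (2 * (c + 400) + 600) := by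
  have := evals_frame (B := B) (s₀ := s₀) (k := k)
    (p1 := p + 1) (tok := 5) (r := 1) (lim := 2) (neg := 0) (quant := 0)
    (pos := p + 1) (x := m) (c := c) (P := fun i => if i = 0 then p + 1 else p')
    (E := fun i => if i = 0 then p' else p'') (b := fun i => if i = 0 then bit P else bit P')
    (e := e) (d := d) (m := m) (p := p)
    hk (by omega) (by omega) (by rw [if_neg (by omega)]; exact ⟨hp.symm, rfl⟩)
    (fun s _ e1 e2 e3 => by
      simp [decode, Cmd.okL, Cmd.sem, e1, e2, e3]; omega)
    (fun i => by split_ifs <;> exact bit_le _) (by omega) (by omega) (by omega) (by omega) (by omega)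
    rfl
    (fun i hi => by obtain rfl : i = 0 := by omega
                    simp) (fun i hi => by
                      obtain rfl | rfl : i = 0 ∨ i = 1 := by omega
                      · simpa using h
                      · simpa using h')
  rw [bit_eq_ite (q := 1 ≤ ∑ t ∈ Finset.range 2, ((0 - if t = 0 then bit P else bit P') +
    ((if t = 0 then bit P else bit P') - 0)))]
  · exact this
  · by_cases hP : P <;> by_cases hP' : P' <;> simp [hP, hP', bit, Finset.sum_range_succ]

open scoped Classical in
-- Existential and universal quantifiers and cardinality statements are the same loop over a list
-- with different thresholds. The bits summed by the loop are identified with `countP` by `sum_bit`.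
theorem evals_count {N tok r x pos p1 : ℕ} {V : List (Fin N)} {P : Fin N → Prop}
    (hk : s₀.v .k = k) (hB : p + m + 7 ≤ B) (htok : 6 ≤ tok)
    (hread : if m < k then tok = 6 ∧ p1 = p else tok = s₀.a .inp p ∧ p1 = p + 1)
    (hdec : ∀ s, Agree evalLoop s₀ s → s.v .tok = tok → s.v .pos = p1 → s.v .m = m →
      decode.okL B s ∧ (decode.sem s).v .fr = r ∧ (decode.sem s).v .fl = V.length ∧
      (decode.sem s).v .fn = 0 ∧ (decode.sem s).v .fq = 1 ∧ (decode.sem s).v .fx = x ∧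
      (decode.sem s).v .pos = pos)
    (hV : V ≠ []) (hVB : V.length + 2 ≤ B) (hvs : ∀ i, (h : i < V.length) → s₀.a .vs i = V[i])
    (h : ∀ b ∈ V, Evals B s₀ pos p' (m + 1) d (update e x b) (bit (P b)) c) :
    Evals B s₀ p p' m (d + 1) e (bit (r ≤ V.countP fun b => decide (P b)))
      (V.length * (c + 400) + 600) := by
  have hlen := List.length_pos_iff.2 hV
  have := evals_frame (B := B) (s₀ := s₀) (k := k)
    (p1 := p1) (tok := tok) (r := r) (lim := V.length) (neg := 0) (quant := 1)
    (pos := pos) (x := x) (c := c) (P := fun _ => pos) (E := fun _ => p')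
    (b := fun i => bit (∃ h : i < V.length, P V[i])) (e := e) (d := d) (m := m) (p := p)
    hk (by omega) (by omega) hread hdec (fun _ => bit_le _) (by omega) le_rfl hVB (by omega)
    hlen rfl (fun i hi => rfl) (fun i hi => by
      have := h _ (List.getElem_mem hi)
      rw [bit_congr (show (∃ h : i < V.length, P V[i]) ↔ P V[i] from
        ⟨fun ⟨_, h⟩ => h, fun h => ⟨hi, h⟩⟩), hvs i hi]
      simpa using this)
  simp only [Nat.zero_sub, Nat.sub_zero, Nat.zero_add, sum_bit] at this
  rw [bit_eq_ite (q := r ≤ V.countP fun b => decide (P b)) Iff.rfl]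
  exact this

/-- Below `k` the quantifier is virtual: it asks for a component not yet chosen and consumes no
symbol, whence the two possibilities for `p1`. -/
theorem evals_ex {N p1 : ℕ} {V : List (Fin N)} {P : Fin N → Prop} (hk : s₀.v .k = k)
    (hB : p + m + 9 ≤ B)
    (hread : if m < k then p1 = p else s₀.a .inp p = 6 ∧ p1 = p + 1)
    (hlens : s₀.a .lens m = V.length)
    (hV : V ≠ []) (hVB : V.length + 2 ≤ B) (hvs : ∀ i, (h : i < V.length) → s₀.a .vs i = V[i])
    (h : ∀ b ∈ V, Evals B s₀ p1 p' (m + 1) d (update e m b) (bit (P b)) c) :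
    Evals B s₀ p p' m (d + 1) e (bit (∃ b ∈ V, P b)) (V.length * (c + 400) + 600) := by
  classical
  have hp1 : p1 ≤ p + 1 := by split_ifs at hread <;> omega
  rw [bit_congr (q := 1 ≤ V.countP fun b => decide (P b))]
  · refine evals_count (tok := 6) (p1 := p1) (pos := p1) (x := m) hk (by omega) le_rfl ?_
      (fun s g e1 e2 e3 => ?_) hV hVB hvs h
    · split_ifs at hread ⊢
      · exact ⟨rfl, hread⟩
      · exact ⟨hread.1.symm, hread.2⟩
    · have hl : s.a .lens m = V.length := by rw [g.a _ rfl]; exact hlens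
      simp [decode, Cmd.okL, Cmd.sem, e1, e2, e3, hl]; omega
  · rw [Nat.one_le_iff_ne_zero, ← Nat.pos_iff_ne_zero, List.countP_pos_iff]
    simp

theorem evals_all {N : ℕ} {V : List (Fin N)} {P : Fin N → Prop} (hk : s₀.v .k = k)
    (hB : p + m + 9 ≤ B) (hkm : k ≤ m) (hp : s₀.a .inp p = 7)
    (hlens : s₀.a .lens m = V.length)
    (hV : V ≠ []) (hVB : V.length + 2 ≤ B) (hvs : ∀ i, (h : i < V.length) → s₀.a .vs i = V[i])
    (h : ∀ b ∈ V, Evals B s₀ (p + 1) p' (m + 1) d (update e m b) (bit (P b)) c) :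
    Evals B s₀ p p' m (d + 1) e (bit (∀ b ∈ V, P b)) (V.length * (c + 400) + 600) := by
  classical
  rw [bit_congr (q := V.length ≤ V.countP fun b => decide (P b))]
  · refine evals_count (tok := 7) (p1 := p + 1) (pos := p + 1) (x := m) hk (by omega) (by omega) ?_
      (fun s g e1 e2 e3 => ?_) hV hVB hvs h
    · rw [if_neg (by omega)]; exact ⟨hp.symm, rfl⟩
    · have hl : s.a .lens m = V.length := by rw [g.a _ rfl]; exact hlens
      simp [decode, Cmd.okL, Cmd.sem, e1, e2, e3, hl]; omega
  · have := List.countP_le_length (p := fun b => decide (P b)) (l := V)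
    rw [show V.length ≤ V.countP (fun b => decide (P b)) ↔ V.countP (fun b => decide (P b)) = V.length
      by omega, List.countP_eq_length]
    simp

open scoped Classical in
-- The body has the variable number 0 only, so the outer value of this variable is overwritten for
-- the duration of the loop and restored from the frame.
theorem evals_card {N r : ℕ} {V : List (Fin N)} {P : Fin N → Prop} (hk : s₀.v .k = k)
    (hB : p + m + 9 ≤ B) (hkm : k ≤ m) (hp : s₀.a .inp p = 8) (hp' : s₀.a .inp (p + 1) = r)
    (hwl : s₀.v .wl = V.length)
    (hV : V ≠ []) (hVB : V.length + 2 ≤ B) (hvs : ∀ i, (h : i < V.length) → s₀.a .vs i = V[i])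
    (h : ∀ b ∈ V, Evals B s₀ (p + 2) p' (m + 1) d (update e 0 b) (bit (P b)) c) :
    Evals B s₀ p p' m (d + 1) e (bit (r ≤ V.countP fun b => decide (P b)))
      (V.length * (c + 400) + 600) := by
  refine evals_count (tok := 8) (p1 := p + 1) (pos := p + 2) (x := 0) hk (by omega) (by omega) ?_
      (fun s g e1 e2 e3 => ?_) hV hVB hvs h
  · rw [if_neg (by omega)]; exact ⟨hp.symm, rfl⟩
  · have hl : s.v .wl = V.length := by rw [g.v _ rfl]; exact hwl
    have hi : s.a .inp = s₀.a .inp := g.a _ rfl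
    simp [decode, Cmd.okL, Cmd.sem, e1, e2, e3, hl, hi, hp']; omega

end

end

end BijQuery

/-! ## Evaluation of formulas and of the extendability of tuples -/

namespace BijQuery

open Function WhileRAM

set_option linter.constructorNameAsVariable false

/-- A bound for the time of the evaluation of a formula, where `X` bounds the lengths of the lists
to which quantifiers are restricted. -/
def evalCost (X L : ℕ) : ℕ := 2000 * (2 * X) ^ L

theorem evalCost_mono {X L L' : ℕ} (hX : 2 ≤ X) (h : L ≤ L') : evalCost X L ≤ evalCost X L' :=
  Nat.mul_le_mul_left _ (Nat.pow_le_pow_right (by omega) h)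

theorem atom_cost {X L : ℕ} (hX : 2 ≤ X) : L * 120 + 500 ≤ evalCost X L := by
  have h1 : L < 4 ^ L := Nat.lt_pow_self (by norm_num)
  have h2 : 4 ^ L ≤ (2 * X) ^ L := Nat.pow_le_pow_left (by omega) L
  rw [evalCost]; omega

/-- One more symbol multiplies the bound by `2 * X`: the factor `X` pays for the repetitions of the
subformula, the factor 2 for the constant overhead. -/
theorem frame_cost {X lim L L' : ℕ} (hX : 2 ≤ X) (hl : lim ≤ X) (h : L < L') :
    lim * (evalCost X L + 400) + 600 ≤ evalCost X L' := by
  refine le_trans ?_ (evalCost_mono hX (Nat.succ_le_of_lt h))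
  have h1 : 1 ≤ (2 * X) ^ L := Nat.pow_pos (by omega)
  rw [evalCost, evalCost, pow_succ]
  have h2 : lim * (2000 * (2 * X) ^ L + 400) ≤ X * (2000 * (2 * X) ^ L + 400) :=
    Nat.mul_le_mul_right _ hl
  nlinarith

section
variable {σ : UnarySig} {S : BijStructure σ} {k : ℕ} {φ : FOBij σ k} {B : ℕ} {s₀ : St Var Arr}

theorem code_pos {m : ℕ} (ψ : FOBij σ m) : 0 < ψ.code.length := by
  cases ψ <;> simp [FOBij.code]
  rename_i α; cases α <;> simp [BijAtom.code]

theorem position_le (hB : Room S φ B) {p m : ℕ} (hp : p ≤ queryPos S + 1 + φ.code.length)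
    (hm : m ≤ depth φ + 1) : p + m + 9 ≤ B := by
  have h1 := hB.input
  have h2 := hB.depth
  rw [length_inputWord] at h1
  omega

theorem evals_bool (hr : Ready S φ s₀) (hB : Room S φ B) {m X : ℕ} (hX : 2 ≤ X) (hkm : k ≤ m)
    (hm : m ≤ depth φ + 1) {e : ℕ → ℕ} {b : Fin S.n} (he : e 0 = b) (ψ : BijBool σ) {p : ℕ}
    (hv : ∀ v ∈ ψ.code, v ∈ φ.code) (hseg : Seg (s₀.a .inp) p ψ.code)
    (hp : p + ψ.code.length ≤ queryPos S + 1 + φ.code.length) :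
    Evals B s₀ p (p + ψ.code.length) m ψ.code.length e (bit (ψ.Holds S b))
      (evalCost X ψ.code.length) := by
  have hk := hr.sizes.k
  have hpos : ∀ p, p ≤ queryPos S + 1 + φ.code.length → p + m + 7 ≤ B := fun p hp => by
    have := position_le hB hp hm; omega
  induction ψ generalizing p with
  | atom α =>
    exact (evals_atom hr hB α hv hseg hp hkm (a := fun _ => b) (fun i => by simpa using he)).mono
      (Nat.zero_le _) (atom_cost hX)
  | neg ψ ih =>
    simp only [BijBool.code, seg_cons, List.length_cons] at hseg hp ⊢
    have h := (evals_neg hk hkm (hpos _ (by omega)) hseg.1 (ih (fun v h => hv v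
      (List.mem_cons_of_mem _ h)) hseg.2 (by omega))).mono le_rfl
      (frame_cost (L' := ψ.code.length + 1) hX hX (by omega))
    rw [show p + (ψ.code.length + 1) = p + 1 + ψ.code.length by omega]
    exact h
  | and ψ χ ih ih' =>
    simp only [BijBool.code, seg_cons, seg_append, List.length_cons, List.length_append] at hseg hp ⊢
    have h1 := ih (fun v h => hv v (by simp [BijBool.code, h])) hseg.2.1 (by omega)
    have h2 := ih' (fun v h => hv v (by simp [BijBool.code, h])) hseg.2.2 (by omega)
    have h3 := evals_and hk hkm (hpos _ (by omega)) hseg.1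
      (h1.mono (d' := ψ.code.length + χ.code.length) (by omega)
        (evalCost_mono (L' := ψ.code.length + χ.code.length) hX (by omega)))
      (h2.mono (by omega) (evalCost_mono hX (by omega)))
    rw [show p + (ψ.code.length + χ.code.length + 1) = p + 1 + ψ.code.length + χ.code.length by omega]
    exact h3.mono le_rfl (frame_cost hX hX (by omega))
  | or ψ χ ih ih' =>
    simp only [BijBool.code, seg_cons, seg_append, List.length_cons, List.length_append] at hseg hp ⊢
    have h1 := ih (fun v h => hv v (by simp [BijBool.code, h])) hseg.2.1 (by omega)
    have h2 := ih' (fun v h => hv v (by simp [BijBool.code, h])) hseg.2.2 (by omega)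
    have h3 := evals_or hk hkm (hpos _ (by omega)) hseg.1
      (h1.mono (d' := ψ.code.length + χ.code.length) (by omega)
        (evalCost_mono (L' := ψ.code.length + χ.code.length) hX (by omega)))
      (h2.mono (by omega) (evalCost_mono hX (by omega)))
    rw [show p + (ψ.code.length + χ.code.length + 1) = p + 1 + ψ.code.length + χ.code.length by omega]
    exact h3.mono le_rfl (frame_cost hX hX (by omega))

theorem represents_sample : Represents S φ.code (radius (depth φ))
    (quota (depth φ) φ.code.length) (sample S φ) := represents_reps _ _

theorem sample_ne_nil : sample S φ ≠ [] := reps_ne_nil (Nat.succ_pos _)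

theorem hood_ne_nil (l : List (Fin S.n)) (i : ℕ) : hood S φ l i ≠ [] := fun h =>
  sample_ne_nil (S := S) (φ := φ)
    (List.append_eq_nil_iff.1 (List.prefix_nil.1 (h ▸ append_prefix_hood l i))).1

theorem pow_le_radius {c : ℕ} (h : c ≤ depth φ) : 3 ^ c ≤ radius (depth φ) :=
  Nat.pow_le_pow_right (by norm_num) (by omega)

/-- At most `depth φ` balls surround a tuple, and the quota exceeds their total size by one, so some
representative of a fully supplied type is far from the tuple. -/
theorem mul_words_lt {m : ℕ} (h : m ≤ depth φ) :
    m * (words S φ.code (radius (depth φ))).length < quota (depth φ) φ.code.length := by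
  rw [length_words, quota, ballSize]
  exact Nat.lt_succ_of_le (Nat.mul_le_mul_right _ h)

/-- The thresholds are part of `depth φ`, so the quota also suffices for cardinality statements. -/
theorem le_quota {r : ℕ} (h : r ≤ depth φ) : r ≤ quota (depth φ) φ.code.length := by
  have := Nat.mul_le_mul h (ballSize_pos (depth φ) φ.code.length)
  rw [quota]; omega

/-- This propagates the invariant of quantifier restriction: the range of the next variable contains
the neighbourhoods of all values assigned so far. -/
theorem mem_hood_snoc {m : ℕ} {a : Fin m → Fin S.n} {l : List (Fin S.n)} (hl : l.length ≤ m)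
    (ha : ∀ i, ∀ u ∈ words S φ.code (radius (depth φ)), u (a i) ∈ hood S φ l (m - l.length))
    {b : Fin S.n} (hb : b ∈ hood S φ l (m - l.length)) (i : Fin (m + 1)) :
    ∀ u ∈ words S φ.code (radius (depth φ)),
      u ((Fin.snoc a b : Fin (m + 1) → Fin S.n) i) ∈ hood S φ l (m + 1 - l.length) := by
  refine Fin.lastCases ?_ (fun i => ?_) i
  · intro u hu
    rw [Fin.snoc_last]
    exact mem_hood_of_hood (by omega) hb hu
  · intro u hu
    rw [Fin.snoc_castSucc]
    exact (hood_prefix (by omega)).subset (ha i u hu)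

theorem update_snoc {m : ℕ} {a : Fin m → Fin S.n} {e : ℕ → ℕ} (he : ∀ i : Fin m, e i = a i)
    (b : Fin S.n) (i : Fin (m + 1)) :
    update e m (b : ℕ) i = ((Fin.snoc a b : Fin (m + 1) → Fin S.n) i : ℕ) := by
  refine Fin.lastCases (by simp) (fun i => ?_) i
  rw [Fin.snoc_castSucc, Fin.val_castSucc, update_of_ne (by have := i.2; omega)]
  exact he i

/-- Evaluation of subformulas of `φ`. -/
theorem evals_formula (hr : Ready S φ s₀) (hB : Room S φ B) {l : List (Fin S.n)}
    (hl : Hoods S φ l s₀) {m : ℕ} (ψ : FOBij σ m) (hkm : k ≤ m) (hlm : l.length ≤ m)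
    (hm : m + ψ.code.length ≤ depth φ) (ht : thresholds ψ ≤ depth φ) {p : ℕ} {e : ℕ → ℕ}
    {a : Fin m → Fin S.n} (he : ∀ i : Fin m, e i = a i)
    (ha : ∀ i, ∀ u ∈ words S φ.code (radius (depth φ)), u (a i) ∈ hood S φ l (m - l.length))
    (hv : ∀ v ∈ ψ.code, v ∈ φ.code) (hseg : Seg (s₀.a .inp) p ψ.code)
    (hp : p + ψ.code.length ≤ queryPos S + 1 + φ.code.length) :
    Evals B s₀ p (p + ψ.code.length) m ψ.code.length e (bit (ψ.Holds S a))
      (evalCost (hoodBound (depth φ) φ.code.length + 2) ψ.code.length) := by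
  classical
  have hk := hr.sizes.k
  have hh := hB.hood
  have hX : 2 ≤ hoodBound (depth φ) φ.code.length + 2 := by omega
  have hpos : ∀ {p m}, p ≤ queryPos S + 1 + φ.code.length → m ≤ depth φ + 1 → p + m + 9 ≤ B :=
    fun hp hm => position_le hB hp hm
  induction ψ generalizing p e with
  | atom α =>
    exact (evals_atom hr hB α hv hseg hp hkm he).mono (Nat.zero_le _) (atom_cost hX)
  | @neg m ψ ih =>
    simp only [FOBij.code, seg_cons, List.length_cons] at hseg hp hm ⊢
    have h1 := hpos (p := p) (m := m) (by omega) (by omega)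
    have h := (evals_neg hk hkm (by omega) hseg.1 (ih hkm hlm (by omega) ht he ha (fun v h => hv v
      (List.mem_cons_of_mem _ h)) hseg.2 (by omega))).mono le_rfl
      (frame_cost (L' := ψ.code.length + 1) hX hX (by omega))
    rw [show p + (ψ.code.length + 1) = p + 1 + ψ.code.length by omega]
    exact h
  | @and m ψ χ ih ih' =>
    simp only [FOBij.code, seg_cons, seg_append, List.length_cons, List.length_append] at hseg hp hm ⊢
    simp only [thresholds] at ht
    have h0 := hpos (p := p) (m := m) (by omega) (by omega)
    have h1 := ih hkm hlm (by omega) (by omega) he ha (fun v h => hv v (by simp [FOBij.code, h]))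
      hseg.2.1 (by omega)
    have h2 := ih' hkm hlm (by omega) (by omega) he ha (fun v h => hv v (by simp [FOBij.code, h]))
      hseg.2.2 (by omega)
    have h3 := evals_and hk hkm (by omega) hseg.1
      (h1.mono (d' := ψ.code.length + χ.code.length) (by omega)
        (evalCost_mono (L' := ψ.code.length + χ.code.length) hX (by omega)))
      (h2.mono (by omega) (evalCost_mono hX (by omega)))
    rw [show p + (ψ.code.length + χ.code.length + 1) = p + 1 + ψ.code.length + χ.code.length by omega]
    exact h3.mono le_rfl (frame_cost hX hX (by omega))
  | @or m ψ χ ih ih' =>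
    simp only [FOBij.code, seg_cons, seg_append, List.length_cons, List.length_append] at hseg hp hm ⊢
    simp only [thresholds] at ht
    have h0 := hpos (p := p) (m := m) (by omega) (by omega)
    have h1 := ih hkm hlm (by omega) (by omega) he ha (fun v h => hv v (by simp [FOBij.code, h]))
      hseg.2.1 (by omega)
    have h2 := ih' hkm hlm (by omega) (by omega) he ha (fun v h => hv v (by simp [FOBij.code, h]))
      hseg.2.2 (by omega)
    have h3 := evals_or hk hkm (by omega) hseg.1
      (h1.mono (d' := ψ.code.length + χ.code.length) (by omega)
        (evalCost_mono (L' := ψ.code.length + χ.code.length) hX (by omega)))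
      (h2.mono (by omega) (evalCost_mono hX (by omega)))
    rw [show p + (ψ.code.length + χ.code.length + 1) = p + 1 + ψ.code.length + χ.code.length by omega]
    exact h3.mono le_rfl (frame_cost hX hX (by omega))
  | @ex m ψ ih =>
    simp only [FOBij.code, seg_cons, List.length_cons] at hseg hp hm ⊢
    have h0 := hpos (p := p) (m := m) (by omega) (by omega)
    have hv' : ∀ v ∈ ψ.code, v ∈ φ.code := fun v h => hv v (List.mem_cons_of_mem _ h)
    have hlen := length_hood_le (φ := φ) (l := l) (i := m - l.length) (by omega)
    -- By locality the quantifier over the domain may be replaced by one over the list in `vs`,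
    -- which contains the representatives and, by `ha`, all elements near the tuple.
    rw [bit_congr (show (FOBij.ex ψ).Holds S a ↔ _ from
      ((local_formula ψ hv').mono (pow_le_radius (φ := φ) (by omega))).exists_iff represents_sample
      (mul_words_lt (by omega)) (fun x hx => (append_prefix_hood l (m - l.length)).subset
      (List.mem_append_left _ hx)) ha)]
    have h := evals_ex (p := p) (p1 := p + 1) (V := hood S φ l (m - l.length))
      (P := fun b => ψ.Holds S (Fin.snoc a b)) hk h0 (by rw [if_neg (by omega)]; exact ⟨hseg.1, rfl⟩)
      (by have := hl.lens (m - l.length) (by omega)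
          rwa [Nat.add_sub_cancel' hlm] at this)
      (hood_ne_nil _ _) (by omega) (fun i hi => hl.get (by omega) hi)
      (fun b hb => ih (by omega) (by omega) (by omega) ht (update_snoc he b) (mem_hood_snoc hlm ha hb)
        hv' hseg.2 (by omega))
    rw [show p + (ψ.code.length + 1) = p + 1 + ψ.code.length by omega]
    exact h.mono le_rfl (frame_cost hX (by omega) (by omega))
  | @all m ψ ih =>
    simp only [FOBij.code, seg_cons, List.length_cons] at hseg hp hm ⊢
    have h0 := hpos (p := p) (m := m) (by omega) (by omega)
    have hv' : ∀ v ∈ ψ.code, v ∈ φ.code := fun v h => hv v (List.mem_cons_of_mem _ h)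
    have hlen := length_hood_le (φ := φ) (l := l) (i := m - l.length) (by omega)
    rw [bit_congr (show (FOBij.all ψ).Holds S a ↔ _ from
      ((local_formula ψ hv').mono (pow_le_radius (φ := φ) (by omega))).forall_iff represents_sample
      (mul_words_lt (by omega)) (fun x hx => (append_prefix_hood l (m - l.length)).subset
      (List.mem_append_left _ hx)) ha)]
    have h := evals_all (p := p) (V := hood S φ l (m - l.length))
      (P := fun b => ψ.Holds S (Fin.snoc a b)) hk h0 hkm hseg.1
      (by have := hl.lens (m - l.length) (by omega)
          rwa [Nat.add_sub_cancel' hlm] at this)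
      (hood_ne_nil _ _) (by omega) (fun i hi => hl.get (by omega) hi)
      (fun b hb => ih (by omega) (by omega) (by omega) ht (update_snoc he b) (mem_hood_snoc hlm ha hb)
        hv' hseg.2 (by omega))
    rw [show p + (ψ.code.length + 1) = p + 1 + ψ.code.length by omega]
    exact h.mono le_rfl (frame_cost hX (by omega) (by omega))
  | @card m r Ψ =>
    simp only [FOBij.code, seg_cons, List.length_cons] at hseg hp hm ⊢
    simp only [thresholds] at ht
    have h0 := hpos (p := p) (m := m) (by omega) (by omega)
    have hv' : ∀ v ∈ Ψ.code, v ∈ φ.code := fun v h => hv v (by simp [FOBij.code, h])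
    have hlen := length_hood_le (φ := φ) (l := l) (i := m - l.length) (by omega)
    have hsam : (sample S φ).length ≤ (hood S φ l (m - l.length)).length := by
      have := (append_prefix_hood (φ := φ) l (m - l.length)).length_le
      rw [List.length_append] at this
      omega
    have hloc : ∀ x y, SameType S φ.code (radius (depth φ)) x y → (Ψ.Holds S x ↔ Ψ.Holds S y) :=
      fun x y h => local_bool Ψ hv' fun u hu => h u (words_mono (pow_le_radius (φ := φ) (by omega)) hu)
    -- The representatives are an initial segment of `vs`, so the loop over the first `wl` entries
    -- runs through exactly these.
    have h := evals_card (p := p) (p' := p + 2 + Ψ.code.length) (m := m) (r := r) (V := sample S φ)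
      (P := fun b => Ψ.Holds S b) (e := e) hk h0 hkm hseg.1 hseg.2.1 hr.sample.len
      sample_ne_nil (by omega) (fun i hi => by
        have hi' : i < (hood S φ l (m - l.length)).length := by omega
        rw [hl.get (i := m - l.length) (by omega) hi']
        obtain ⟨t, ht⟩ := append_prefix_hood (φ := φ) l (m - l.length)
        congr 1
        rw [List.append_assoc] at ht
        simp only [← ht, List.getElem_append_left hi])
      (fun b hb => evals_bool hr hB hX (by omega) (by omega) (by simp) Ψ hv' hseg.2.2 (by omega))
    have hc := le_ncard_iff hloc represents_sample (nodup_reps _ _) (le_quota ht)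
    rw [show p + (Ψ.code.length + 1 + 1) = p + 2 + Ψ.code.length by omega,
      bit_congr (show (FOBij.card r Ψ).Holds S a ↔ _ from hc)]
    exact h.mono (by omega) (frame_cost hX (by omega) (by omega))

/-- Evaluation of the extendability of tuples. -/
theorem evals_extends (hr : Ready S φ s₀) (hB : Room S φ B) {l : List (Fin S.n)}
    (hl : Hoods S φ l s₀) (j : ℕ) {m : ℕ} (hm : m + j = k) (hlm : l.length ≤ m) {e : ℕ → ℕ}
    {a : Fin m → Fin S.n} (he : ∀ i : Fin m, e i = a i)
    (ha : ∀ i, ∀ u ∈ words S φ.code (radius (depth φ)), u (a i) ∈ hood S φ l (m - l.length)) :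
    Evals B s₀ (queryPos S + 1) (queryPos S + 1 + φ.code.length) m (φ.code.length + j) e
      (bit (Extends φ S m a))
      (evalCost (hoodBound (depth φ) φ.code.length + 2) (φ.code.length + j)) := by
  have hh := hB.hood
  have hX : 2 ≤ hoodBound (depth φ) φ.code.length + 2 := by omega
  have hdep : depth φ = k + φ.code.length + thresholds φ := rfl
  induction j generalizing m e with
  | zero =>
    obtain rfl : m = k := hm
    rw [bit_congr (extends_self φ a)]
    exact evals_formula hr hB hl φ le_rfl hlm (by omega) (by omega) he ha (fun _ h => h) hr.code le_rfl
  | succ j ih =>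
    have hlen := length_hood_le (φ := φ) (l := l) (i := m - l.length) (by omega)
    -- The next missing component is treated as existentially quantified and then restricted like
    -- any other quantifier.
    rw [bit_congr (extends_iff φ (by omega) a), bit_congr (((local_extends φ (fun _ h => h) j
      (by omega)).mono (pow_le_radius (φ := φ) (by omega))).exists_iff represents_sample
      (mul_words_lt (by omega)) (fun x hx => (append_prefix_hood l (m - l.length)).subset
      (List.mem_append_left _ hx)) ha)]
    have h := evals_ex (p := queryPos S + 1) (p1 := queryPos S + 1) (V := hood S φ l (m - l.length))
      (P := fun b => Extends φ S (m + 1) (Fin.snoc a b)) hr.sizes.k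
      (position_le hB (m := m) (by omega) (by omega)) (by rw [if_pos (by omega)])
      (by have := hl.lens (m - l.length) (by omega)
          rwa [Nat.add_sub_cancel' hlm] at this)
      (hood_ne_nil _ _) (by omega) (fun i hi => hl.get (by omega) hi)
      (fun b hb => ih (by omega) (by omega) (update_snoc he b) (mem_hood_snoc hlm ha hb))
    exact h.mono le_rfl (frame_cost hX (by omega) (by omega))

/-- Does the tuple given by the first `m` variables extend to a solution? -/
def evaluate : Cmd Var Arr := (.pos ≔ rd .fs ;; .sp ≔ 0 ;; .md ≔ 1) ;; evalLoop

theorem wp_evaluate {s : St Var Arr} (hr : Ready S φ s) (hB : Room S φ B) {l : List (Fin S.n)}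
    (hl : Hoods S φ l s) (hlk : l.length ≤ k) (hm : s.v .m = l.length)
    (he : Seg (s.a .env) 0 (l.map Fin.val)) :
    Wp 5 B evaluate (evalCost (hoodBound (depth φ) φ.code.length + 2) (φ.code.length + k) + 440)
      (fun s' => s'.v .val = bit (Extends φ S l.length l.get) ∧ s'.a .env = s.a .env) s := by
  have hdep : depth φ = k + φ.code.length + thresholds φ := rfl
  have hd := hB.depth
  have hX : 2 ≤ hoodBound (depth φ) φ.code.length + 2 := by omega
  refine (Wp.seq (R := fun s' => s' = ((s.setV .pos (queryPos S + 1)).setV .sp 0).setV .md 1)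
    (Wp.straight (τ := 20) (by decide) ?_ ?_) ?_).le (τ := 20 + (420 +
      evalCost (hoodBound (depth φ) φ.code.length + 2) (φ.code.length + k))) (by omega)
  · simp [Cmd.okL]; omega
  · simp [Cmd.sem, hr.sizes.fs]
  rintro s1 - rfl
  have h := (evals_extends (S := S) (B := B) (φ := φ) (l := l) (e := s.a .env) (a := l.get)
    (s₀ := ((s.setV .pos (queryPos S + 1)).setV .sp 0).setV .md 1)
    (hr.of_eq (by simp) (by simp)) hB ⟨by simpa using hl.vs, by simpa using hl.lens⟩ (k - l.length)
    (by omega) le_rfl (fun i => by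
      have := seg_zero he (i := i) (by simp)
      simpa using this) (fun i u hu =>
      mem_hood_of_mem (List.get_mem _ _) hu)).mono le_rfl (evalCost_mono hX
        (show _ ≤ φ.code.length + k by omega))
  have hc : (rd .md : Ex Var Arr).cost 5 ≤ 5 := by decide
  refine (h _ 0 ((rd .md : Ex Var Arr).cost 5 + 1 + 400) _ (Agree.refl _ _) (by simp) (by simp)
    (by simpa using hm) (by simp) (by omega) (by simp) fun s' g h1 h2 h3 h4 h5 h6 h7 => ?_).le
    (by omega)
  -- With the stack empty again, the last return step only sets the mode to 0.
  refine wp_return h1 (by omega) (by simp [returnStep, Cmd.okL, h4]) (Wp.whF (e := rd .md) (by simp)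
    (by simp [returnStep, Cmd.sem, h4]) ⟨?_, ?_⟩)
  · simpa [returnStep, Cmd.sem, h4] using h5
  · simpa [returnStep, Cmd.sem, h4] using h6

end

end BijQuery

/-! ## The order of the enumeration -/

namespace BijQuery

open Function WhileRAM

set_option linter.constructorNameAsVariable false

section
variable {α : Type} (good : α → Prop)

open scoped Classical in
/-- The good elements of the second list in the order of their first occurrences, without those of
the first list. -/
noncomputable def news : List α → List α → List α
  | _, [] => []
  | seen, b :: r => if b ∉ seen ∧ good b then b :: news (seen ++ [b]) r else news (seen ++ [b]) r

variable {good}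

theorem mem_news {b : α} {seen r : List α} : b ∈ news good seen r ↔ b ∈ r ∧ b ∉ seen ∧ good b := by
  induction r generalizing seen with
  | nil => simp [news]
  | cons x r ih =>
    rw [news]
    split_ifs with h
    · rw [List.mem_cons, ih, List.mem_cons, List.mem_append, List.mem_singleton]
      by_cases hb : b = x
      · subst hb; simp [h]
      · simp [hb]
    · rw [ih, List.mem_cons, List.mem_append, List.mem_singleton]
      by_cases hb : b = x
      · subst hb; simpa using h
      · simp [hb]

theorem nodup_news {seen r : List α} : (news good seen r).Nodup := by
  induction r generalizing seen with
  | nil => simp [news]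
  | cons x r ih =>
    rw [news]
    split_ifs with h
    · refine List.nodup_cons.2 ⟨fun h' => ?_, ih⟩
      simpa using (mem_news.1 h').2.1
    · exact ih

end

variable {σ : UnarySig} (S : BijStructure σ) {k : ℕ} (φ : FOBij σ k)

/-- The tuple is the beginning of a solution. -/
def Good (l : List (Fin S.n)) : Prop := Extends φ S l.length l.get

/-- The possible next components, in the order in which they are tried. -/
noncomputable def candidates (l : List (Fin S.n)) : List (Fin S.n) :=
  hood S φ l 0 ++ domain S φ.code (radius (depth φ))

/-- The next components of the tuple from position `c` on. -/
noncomputable def pending (l : List (Fin S.n)) (c : ℕ) : List (Fin S.n) :=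
  news (fun b => Good S φ (l ++ [b])) ((candidates S φ l).take c) ((candidates S φ l).drop c)

/-- The solutions that prolong the tuple by `d` components. -/
noncomputable def sols : ℕ → List (Fin S.n) → List (List (Fin S.n))
  | 0, l => [l]
  | d + 1, l => (pending S φ l 0).flatMap fun b => sols d (l ++ [b])

/-- The solutions that follow when the first `h` levels of the search are at the positions given by
`ctr`. -/
noncomputable def remaining (p : List (Fin S.n)) (ctr : ℕ → ℕ) : ℕ → List (List (Fin S.n))
  | 0 => []
  | h + 1 => ((pending S φ (p.take h) (ctr h)).flatMap fun b => sols S φ (k - h - 1) (p.take h ++ [b]))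
      ++ remaining p ctr h

variable {S φ} {l : List (Fin S.n)}

theorem Good.of_prefix {y : List (Fin S.n)} (h : l <+: y) (hy : Good S φ y) : Good S φ l := by
  obtain ⟨z, hz, hzy⟩ := hy
  refine ⟨z, hz, fun i hi => ?_⟩
  rw [hzy ⟨i, i.2.trans_le h.length_le⟩ hi]
  simp [h.getElem i.2]

theorem good_snoc (b : Fin S.n) :
    Good S φ (l ++ [b]) ↔ Extends φ S (l.length + 1) (Fin.snoc l.get b) := by
  refine exists_congr fun y => and_congr_right fun _ => ?_
  have key : ∀ i (h : i < (l ++ [b]).length) (h' : i < l.length + 1), (l ++ [b]).get ⟨i, h⟩ =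
      (Fin.snoc l.get b : Fin (l.length + 1) → Fin S.n) ⟨i, h'⟩ := fun i h h' => by
    by_cases hi : i < l.length
    · rw [show (⟨i, h'⟩ : Fin (l.length + 1)) = Fin.castSucc ⟨i, hi⟩ from rfl, Fin.snoc_castSucc]
      simp [List.getElem_append_left hi]
    · obtain rfl : i = l.length := by omega
      rw [show (⟨l.length, h'⟩ : Fin (l.length + 1)) = Fin.last _ from rfl, Fin.snoc_last]
      simp
  refine ⟨fun h i hi => ?_, fun h i hi => ?_⟩
  · rw [← key i (by simp [i.2]) i.2]; exact h ⟨i, by simp [i.2]⟩ hi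
  · have := i.2
    rw [key i i.2 (by simpa using this)]; exact h ⟨i, by simpa using this⟩ hi

/-- The tree of prefixes of answers has no dead ends, so once a component has been found the search
descends without failing. -/
theorem Good.exists (hl : Good S φ l) (h : l.length < k) : ∃ b, Good S φ (l ++ [b]) :=
  let ⟨b, hb⟩ := (extends_iff φ h l.get).1 hl
  ⟨b, (good_snoc b).2 hb⟩

theorem length_candidates : (candidates S φ l).length = (hood S φ l 0).length + S.n := by
  rw [candidates, List.length_append, length_domain]

open scoped Classical in
theorem pending_step {c : ℕ} (hc : c < (candidates S φ l).length) : pending S φ l c =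
    if (candidates S φ l)[c] ∉ (candidates S φ l).take c ∧ Good S φ (l ++ [(candidates S φ l)[c]])
    then (candidates S φ l)[c] :: pending S φ l (c + 1) else pending S φ l (c + 1) := by
  rw [pending, List.drop_eq_getElem_cons hc, news, pending, List.take_succ_eq_append_getElem hc]
  congr

theorem pending_end {c : ℕ} (hc : (candidates S φ l).length ≤ c) : pending S φ l c = [] := by
  rw [pending, List.drop_eq_nil_of_le hc]; rfl

theorem pending_of_mem {c : ℕ} (hc : c < (candidates S φ l).length)
    (h : (candidates S φ l)[c] ∈ (candidates S φ l).take c) :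
    pending S φ l c = pending S φ l (c + 1) := by
  rw [pending_step hc, if_neg (by tauto)]

theorem pending_of_not_good {c : ℕ} (hc : c < (candidates S φ l).length)
    (h : ¬ Good S φ (l ++ [(candidates S φ l)[c]])) : pending S φ l c = pending S φ l (c + 1) := by
  rw [pending_step hc, if_neg (by tauto)]

theorem pending_of_good {c : ℕ} (hc : c < (candidates S φ l).length)
    (h : (candidates S φ l)[c] ∉ (candidates S φ l).take c)
    (h' : Good S φ (l ++ [(candidates S φ l)[c]])) :
    pending S φ l c = (candidates S φ l)[c] :: pending S φ l (c + 1) := by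
  rw [pending_step hc, if_pos ⟨h, h'⟩]

theorem mem_pending_zero {b : Fin S.n} : b ∈ pending S φ l 0 ↔ Good S φ (l ++ [b]) := by
  simp [pending, mem_news, candidates, mem_domain]

theorem good_of_mem_pending {b : Fin S.n} {c : ℕ} (h : b ∈ pending S φ l c) : Good S φ (l ++ [b]) :=
  (mem_news.1 h).2.2

theorem mem_take_candidates_left {c : ℕ} (hc : c < (hood S φ l 0).length)
    (h : c < (candidates S φ l).length) :
    (candidates S φ l)[c] = (hood S φ l 0)[c] ∧
      (candidates S φ l).take c = (hood S φ l 0).take c := by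
  constructor
  · simp [candidates, List.getElem_append_left hc]
  · rw [candidates, List.take_append_of_le_length hc.le]

/-- The grouped domain has no repetitions. A candidate in this part has therefore been tried before
only if it belongs to the hood, which can be tested in bounded time. -/
theorem mem_take_candidates_right {c : ℕ} (hc : (hood S φ l 0).length ≤ c)
    (h : c < (candidates S φ l).length) :
    ∃ h' : c - (hood S φ l 0).length < (domain S φ.code (radius (depth φ))).length,
      (candidates S φ l)[c] = (domain S φ.code (radius (depth φ)))[c - (hood S φ l 0).length] ∧
      ((candidates S φ l)[c] ∈ (candidates S φ l).take c ↔ (candidates S φ l)[c] ∈ hood S φ l 0) := by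
  have hlen := length_candidates (φ := φ) (l := l)
  have h' : c - (hood S φ l 0).length < (domain S φ.code (radius (depth φ))).length := by
    rw [length_domain]; omega
  have e : (candidates S φ l)[c] =
      (domain S φ.code (radius (depth φ)))[c - (hood S φ l 0).length] := by
    simp [candidates, List.getElem_append_right hc]
  refine ⟨h', e, ?_⟩
  rw [e, candidates, List.take_append, List.take_of_length_le hc, List.mem_append]
  refine or_iff_left fun hm => ?_
  obtain ⟨i, hi, hi'⟩ := List.mem_take_iff_getElem.1 hm
  have := (List.Nodup.getElem_inj_iff (nodup_domain (S := S) (vals := φ.code)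
    (radius (depth φ)))).1 hi'
  omega

/-- Elements far from the tuple may be skipped up to the end of their class if one of them is not a
possible next component. -/
theorem pending_skip (hlk : l.length < k) {c : ℕ} (hc : (hood S φ l 0).length ≤ c)
    (h : c < (candidates S φ l).length) (hn : (candidates S φ l)[c] ∉ hood S φ l 0)
    (hg : ¬ Good S φ (l ++ [(candidates S φ l)[c]])) {c' : ℕ} (hcc : c ≤ c')
    (hc' : c' ≤ (hood S φ l 0).length + (grouped (typeNum S φ.code (radius (depth φ)))
      (typeNum S φ.code (radius (depth φ)) (candidates S φ l)[c] + 1)).length) :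
    pending S φ l c = pending S φ l c' := by
  have hdep : depth φ = k + φ.code.length + thresholds φ := rfl
  have hlen := length_candidates (φ := φ) (l := l)
  have hfar : ∀ b : Fin S.n, b ∉ hood S φ l 0 → ∀ i, ∀ u ∈ words S φ.code (radius (depth φ)),
      u (l.get i) ≠ b := fun b hb i u hu e => hb (e ▸ mem_hood_of_mem (List.get_mem _ _) hu)
  induction c', hcc using Nat.le_induction with
  | base => rfl
  | succ c' hcc' ih =>
    rw [ih (by omega)]
    have hle := length_grouped_le (ty := typeNum S φ.code (radius (depth φ)))
      (typeNum S φ.code (radius (depth φ)) (candidates S φ l)[c] + 1)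
    have h2 : c' < (candidates S φ l).length := by omega
    obtain ⟨hd, e, -⟩ := mem_take_candidates_right hc h
    obtain ⟨hd', e', hm⟩ := mem_take_candidates_right (hc.trans hcc') h2
    by_cases hn' : (candidates S φ l)[c'] ∈ hood S φ l 0
    · exact pending_of_mem h2 (hm.2 hn')
    refine pending_of_not_good h2 fun hg' => hg ?_
    rw [e] at hc'
    have hc2 : c' - (hood S φ l 0).length < (grouped (typeNum S φ.code (radius (depth φ)))
        (typeNum S φ.code (radius (depth φ)) (domain S φ.code (radius (depth φ)))[c -
          (hood S φ l 0).length] + 1)).length := by omega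
    have hty := grouped_class (ty := typeNum S φ.code (radius (depth φ))) hd
      (show c - (hood S φ l 0).length ≤ c' - (hood S φ l 0).length by omega)
      hc2 hd'
    have hsame : SameType S φ.code (radius (depth φ)) (candidates S φ l)[c] (candidates S φ l)[c'] := by
      rw [e, e']
      exact sameType_of_typeNum hty.symm
    -- Two far elements of the same type prolong the tuple to equivalent tuples, so the second one
    -- cannot succeed where the first has failed.
    have hloc := (local_extends φ (vals := φ.code) (S := S) (fun _ h => h) (m := l.length + 1)
      (k - (l.length + 1)) (by omega)).mono (pow_le_radius (φ := φ) (by omega))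
    rw [good_snoc] at hg' ⊢
    exact (hloc _ _ ((Eqv.refl l.get).snoc_far hsame (hfar _ hn) (hfar _ hn'))).2 hg'

/-! ### The search in one level -/

open scoped Classical in
/-- A bound for the number of further steps of the search in one level. -/
noncomputable def seekMeasure (S : BijStructure σ) (φ : FOBij σ k) (l : List (Fin S.n)) (c : ℕ) : ℕ :=
  -- The summands count the positions left in the hood, the elements still to come in the grouped
  -- domain that repeat elements of the hood, and the type numbers whose class ends are still ahead.
  -- Every unsuccessful step decreases one of them and increases none.
  ((hood S φ l 0).length - c) + ((domain S φ.code (radius (depth φ))).drop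
    (c - (hood S φ l 0).length)).countP (fun b => decide (b ∈ hood S φ l 0)) +
  (List.range (numTypes (radius (depth φ)) φ.code.length)).countP (fun θ =>
    decide (c - (hood S φ l 0).length < (grouped (typeNum S φ.code (radius (depth φ))) (θ + 1)).length))

/-- The bound does not involve the size of the domain: the grouped domain is free of repetitions, so
it meets the hood in at most as many elements as the hood has entries. -/
theorem seekMeasure_le (c : ℕ) : seekMeasure S φ l c ≤
    2 * (hood S φ l 0).length + numTypes (radius (depth φ)) φ.code.length := by
  classical
  have h1 : ((domain S φ.code (radius (depth φ))).drop
    (c - (hood S φ l 0).length)).countP (fun b => decide (b ∈ hood S φ l 0)) ≤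
      (hood S φ l 0).length := by
    rw [List.countP_eq_length_filter]
    refine (List.Nodup.subperm (((nodup_domain _).sublist (List.drop_sublist _ _)).filter _)
      fun b hb => ?_).length_le
    simpa using (List.mem_filter.1 hb).2
  have h2 := List.countP_le_length (l := List.range (numTypes (radius (depth φ)) φ.code.length))
    (p := fun θ => decide (c - (hood S φ l 0).length <
      (grouped (typeNum S φ.code (radius (depth φ))) (θ + 1)).length))
  rw [List.length_range] at h2
  rw [seekMeasure]; omega

theorem seekMeasure_left {c : ℕ} (hc : c < (hood S φ l 0).length) :
    seekMeasure S φ l (c + 1) < seekMeasure S φ l c := by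
  rw [seekMeasure, seekMeasure, show c + 1 - (hood S φ l 0).length = c - (hood S φ l 0).length by omega]
  omega

theorem countP_range_mono {T a b : ℕ} (hab : a ≤ b) (f : ℕ → ℕ) :
    (List.range T).countP (fun θ => decide (b < f θ)) ≤
      (List.range T).countP (fun θ => decide (a < f θ)) :=
  List.countP_mono_left fun θ _ h => by simp at h ⊢; omega

theorem seekMeasure_mem {c : ℕ} (hc : (hood S φ l 0).length ≤ c)
    (h : c < (candidates S φ l).length) (hm : (candidates S φ l)[c] ∈ hood S φ l 0) :
    seekMeasure S φ l (c + 1) < seekMeasure S φ l c := by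
  obtain ⟨hd, e, -⟩ := mem_take_candidates_right hc h
  rw [e] at hm
  have h1 := countP_range_mono (T := numTypes (radius (depth φ)) φ.code.length)
    (show c - (hood S φ l 0).length ≤ c + 1 - (hood S φ l 0).length by omega)
    (fun θ => (grouped (typeNum S φ.code (radius (depth φ))) (θ + 1)).length)
  rw [seekMeasure, seekMeasure, List.drop_eq_getElem_cons hd, List.countP_cons_of_pos (by simpa using hm),
    show c + 1 - (hood S φ l 0).length = c - (hood S φ l 0).length + 1 by omega]
  rw [show c + 1 - (hood S φ l 0).length = c - (hood S φ l 0).length + 1 by omega] at h1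
  omega

theorem countP_range_lt {T a b θ₀ : ℕ} (hθ : θ₀ < T) (f : ℕ → ℕ) (ha : a < f θ₀) (hb : f θ₀ ≤ b) :
    (List.range T).countP (fun θ => decide (b < f θ)) <
      (List.range T).countP (fun θ => decide (a < f θ)) := by
  induction T with
  | zero => omega
  | succ T ih =>
    rw [List.range_succ, List.countP_append, List.countP_append]
    have h1 := countP_range_mono (T := T) (show a ≤ b by omega) f
    by_cases h : θ₀ = T
    · subst h
      rw [List.countP_cons_of_pos (p := fun θ => decide (a < f θ)) (by simpa using ha),
        List.countP_cons_of_neg (p := fun θ => decide (b < f θ)) (by simpa using hb)]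
      simp only [List.countP_nil]; omega
    · have h2 := ih (by omega)
      have h3 : [T].countP (fun θ => decide (b < f θ)) ≤ [T].countP (fun θ => decide (a < f θ)) :=
        List.countP_mono_left fun θ _ h => by simp at h ⊢; omega
      omega

/-- The end of the candidate's class was ahead and is no longer ahead after the jump, so this class
drops out of the third summand. -/
theorem seekMeasure_skip {c : ℕ} (hc : (hood S φ l 0).length ≤ c)
    (h : c < (candidates S φ l).length) :
    c ≤ (hood S φ l 0).length + (grouped (typeNum S φ.code (radius (depth φ)))
      (typeNum S φ.code (radius (depth φ)) (candidates S φ l)[c] + 1)).length ∧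
    seekMeasure S φ l ((hood S φ l 0).length + (grouped (typeNum S φ.code (radius (depth φ)))
      (typeNum S φ.code (radius (depth φ)) (candidates S φ l)[c] + 1)).length) <
      seekMeasure S φ l c := by
  obtain ⟨hd, e, -⟩ := mem_take_candidates_right hc h
  have hlt := lt_length_grouped (ty := typeNum S φ.code (radius (depth φ))) hd
  change c - (hood S φ l 0).length < (grouped (typeNum S φ.code (radius (depth φ)))
    (typeNum S φ.code (radius (depth φ)) (domain S φ.code (radius (depth φ)))[c - (hood S φ l 0).length]
      + 1)).length at hlt
  rw [← e] at hlt
  refine ⟨by omega, ?_⟩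
  have h1 := countP_range_lt (typeNum_lt (vals := φ.code) (radius (depth φ)) (candidates S φ l)[c])
    (fun θ => (grouped (typeNum S φ.code (radius (depth φ))) (θ + 1)).length) hlt le_rfl
  rw [seekMeasure, seekMeasure, Nat.add_sub_cancel_left]
  have h2 := (List.drop_sublist_drop_left (domain S φ.code (radius (depth φ))) hlt.le).countP_le
    (p := fun b => decide (b ∈ hood S φ l 0))
  omega

/-! ### The list of solutions -/

theorem prefix_of_mem_sols {d : ℕ} {y : List (Fin S.n)} (h : y ∈ sols S φ d l) : l <+: y := by
  induction d generalizing l with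
  | zero => rw [List.mem_singleton.1 h]
  | succ d ih =>
    obtain ⟨b, -, hb⟩ := List.mem_flatMap.1 h
    exact (List.prefix_append _ _).trans (ih hb)

theorem mem_sols {d : ℕ} (hd : l.length + d = k) (hl : Good S φ l) {y : List (Fin S.n)} :
    y ∈ sols S φ d l ↔ l <+: y ∧ y.length = k ∧ Good S φ y := by
  induction d generalizing l with
  | zero =>
    rw [sols, List.mem_singleton]
    constructor
    · rintro rfl; exact ⟨List.prefix_rfl, hd, hl⟩
    · rintro ⟨h1, h2, -⟩; exact (h1.eq_of_length (by omega)).symm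
  | succ d ih =>
    simp only [sols, List.mem_flatMap, mem_pending_zero]
    constructor
    · rintro ⟨b, hb, hy⟩
      have := (ih (by simp; omega) hb).1 hy
      exact ⟨(List.prefix_append _ _).trans this.1, this.2⟩
    · rintro ⟨⟨t, rfl⟩, h2, h3⟩
      obtain _ | ⟨b, t⟩ := t
      · simp at h2; omega
      · have hp : l ++ [b] <+: l ++ b :: t := ⟨t, by simp⟩
        exact ⟨b, h3.of_prefix hp, (ih (by simp; omega) (h3.of_prefix hp)).2 ⟨hp, h2, h3⟩⟩

/-- Solutions below different next components have different prefixes of equal length, and `news`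
lists every component once. -/
theorem nodup_sols (d : ℕ) (l : List (Fin S.n)) : (sols S φ d l).Nodup := by
  induction d generalizing l with
  | zero => simp [sols]
  | succ d ih =>
    refine List.nodup_flatMap.2 ⟨fun b _ => ih _, nodup_news.imp fun {b b'} hb y hy hy' => hb ?_⟩
    have := (List.prefix_or_prefix_of_prefix (prefix_of_mem_sols hy) (prefix_of_mem_sols hy'))
    rcases this with h | h <;> have := h.eq_of_length (by simp) <;> simp_all

/-- The solutions due from the lower levels depend only on the shorter prefixes and the counters of
these levels, so changes in higher levels do not affect them. -/
theorem remaining_congr {p p' : List (Fin S.n)} {ctr ctr' : ℕ → ℕ} (h : ℕ)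
    (hp : ∀ i < h, p.take i = p'.take i) (hc : ∀ i < h, ctr i = ctr' i) :
    remaining S φ p ctr h = remaining S φ p' ctr' h := by
  induction h with
  | zero => rfl
  | succ h ih =>
    rw [remaining, remaining, hp h (by omega), hc h (by omega),
      ih (fun i hi => hp i (by omega)) (fun i hi => hc i (by omega))]

end BijQuery

/-! ## The search in one level -/

namespace BijQuery

open Function WhileRAM

set_option linter.constructorNameAsVariable false

def hoodTime (d T : ℕ) : ℕ :=
  hoodBound d T * 40 + d * 60 + 100 + (d + 1) * (closureTime d T + 40)

def evalTime (d T : ℕ) : ℕ := evalCost (hoodBound d T + 2) d + 440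

/-- The candidate at the current position; does it occur before? -/
def pick : Cmd Var Arr :=
  (.ite (rd .ell - rd .cc) (.b ≔ .get .vs (rd .cc) ;; .lim ≔ rd .cc)
      (.b ≔ .get .ord (rd .cc - rd .ell) ;; .lim ≔ rd .ell) ;; .dup ≔ 0) ;;
    Cmd.for .i3 .lim (.dup ≔ rd .dup + (1 - (rd .b - .get .vs (rd .i3)) - (.get .vs (rd .i3) - rd .b)))

/-- Is the candidate a possible next component? -/
def attempt : Cmd Var Arr :=
  (.put .env (rd .lv - 1) (rd .b) ;; .jl ≔ rd .lv) ;; buildHoods ;; .m ≔ rd .lv ;; evaluate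

/-- After a success, or after a failure within the hood, the position moves on by one. A failure in
the grouped domain moves it to the end of the class of the candidate. -/
def conclude : Cmd Var Arr :=
  .ite (rd .val) (.res ≔ 1 ;; .put .ctr (rd .lv - 1) (rd .cc + 1))
    (.ite (rd .ell - rd .cc) (.put .ctr (rd .lv - 1) (rd .cc + 1))
      (.put .ctr (rd .lv - 1) (rd .ell + .get .fin (.get .typ (rd .b)))))

/-- The lists for the prefix are rebuilt in every step, because `attempt` overwrites them with those
of the prolonged tuple; this costs bounded time. `res` is 0 during the search, 1 after a success and
2 when the level is exhausted. -/
def seekStep : Cmd Var Arr :=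
  (.jl ≔ rd .lv - 1 ;; buildHoods) ;;
    (.ell ≔ .get .lens (rd .jl) ;; .cc ≔ .get .ctr (rd .jl)) ;;
    .ite (rd .ell + rd .n - rd .cc)
      (pick ;; .ite (rd .dup) (.put .ctr (rd .lv - 1) (rd .cc + 1)) (attempt ;; conclude))
      (.res ≔ 2)

def seek : Cmd Var Arr := .res ≔ 0 ;; .wh (1 - rd .res) seekStep

section
variable {σ : UnarySig} {S : BijStructure σ} {k : ℕ} {φ : FOBij σ k} {B : ℕ}

theorem wp_pick {s : St Var Arr} {l : List (Fin S.n)} {c : ℕ} (hr : Ready S φ s)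
    (hB : Room S φ B) (hl : Hoods S φ l s) (hlk : l.length ≤ k)
    (hell : s.v .ell = (hood S φ l 0).length) (hcc : s.v .cc = c)
    (hc : c < (candidates S φ l).length) :
    Wp 5 B pick (hoodBound (depth φ) φ.code.length * 60 + 80) (fun s' =>
      s'.v .b = (candidates S φ l)[c] ∧
        (s'.v .dup ≠ 0 ↔ (candidates S φ l)[c] ∈ (candidates S φ l).take c)) s := by
  have hdep : depth φ = k + φ.code.length + thresholds φ := rfl
  have hlen := length_candidates (φ := φ) (l := l)
  have hle := length_hood_le (φ := φ) (l := l) (i := 0) (by omega)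
  have hh := hB.hood
  have hmin : min c (hood S φ l 0).length ≤ hoodBound (depth φ) φ.code.length := by omega
  -- Only the part of the hood before the current position has to be searched for an earlier
  -- occurrence, because the grouped domain does not repeat itself.
  have hiff : (candidates S φ l)[c] ∈ (hood S φ l 0).take (min c (hood S φ l 0).length) ↔
      (candidates S φ l)[c] ∈ (candidates S φ l).take c := by
    by_cases h : c < (hood S φ l 0).length
    · rw [(mem_take_candidates_left h hc).2, Nat.min_eq_left h.le]
    · rw [Nat.min_eq_right (by omega), List.take_length]
      exact (mem_take_candidates_right (by omega) hc).choose_spec.2.symm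
  refine (Wp.seq (τ₁ := 60) (R := fun s' => s' = ((s.setV .b (candidates S φ l)[c]).setV .lim
    (min c (hood S φ l 0).length)).setV .dup 0) (Wp.straight (by decide) ?_ ?_) ?_).le
    (τ := 60 + (min c (hood S φ l 0).length * (51 + 9) + 6)) ?_
  · by_cases h : c < (hood S φ l 0).length
    · have : (hood S φ l 0).length - c ≠ 0 := by omega
      simp [Cmd.okL, hell, hcc]
    · have : (hood S φ l 0).length - c = 0 := by omega
      simp [Cmd.okL, hell, hcc]
  · by_cases h : c < (hood S φ l 0).length
    · have h1 : (hood S φ l 0).length - c ≠ 0 := by omega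
      have h2 := hl.get (i := 0) (by omega) h
      simp [Cmd.sem, hell, hcc, h1, h2, (mem_take_candidates_left h hc).1, Nat.min_eq_left h.le]
    · have h1 : (hood S φ l 0).length - c = 0 := by omega
      obtain ⟨hd, e, -⟩ := mem_take_candidates_right (by omega) hc
      have h2 := seg_zero hr.ord (i := c - (hood S φ l 0).length) (by simpa using hd)
      rw [List.getElem_map] at h2
      simp [Cmd.sem, hell, hcc, h1, h2, e, Nat.min_eq_right (Nat.le_of_not_lt h)]
  · rintro s0 - rfl
    refine (Wp.for (i := Var.i3) (l := Var.lim) (N := min c (hood S φ l 0).length) (τ := 51)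
      (fun t s' => s'.v .dup ≤ t ∧ (s'.v .dup ≠ 0 ↔ (candidates S φ l)[c] ∈ (hood S φ l 0).take t))
      (by decide) rfl rfl (by omega) (by simp) ⟨by simp, by simp⟩ ?_).post ?_
    · rintro t ht s1 g1 hi _ ⟨h1, h2⟩
      have htl : t < (hood S φ l 0).length := by omega
      have hb : s1.v .b = (candidates S φ l)[c] := by rw [g1.v _ rfl]; simp
      have hv : s1.a .vs t = (hood S φ l 0)[t] := by
        rw [g1.a _ rfl]; exact hl.get (i := 0) (by omega) htl
      have e : ∀ x y : Fin S.n, 1 - ((x : ℕ) - y) - ((y : ℕ) - x) = if x = y then 1 else 0 := by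
        intro x y
        split_ifs with h
        · subst h; omega
        · have := Fin.val_ne_of_ne h; omega
      have hs : (Cmd.sem (.dup ≔ rd .dup + (1 - (rd .b - .get .vs (rd .i3)) -
          (.get .vs (rd .i3) - rd .b))) s1).v .dup = s1.v .dup +
          if (candidates S φ l)[c] = (hood S φ l 0)[t] then 1 else 0 := by
        simp [Cmd.sem, hb, hv, hi, e]
      refine Wp.straight (by decide) ?_ ?_
      · simp [Cmd.okL, hb, hv, hi, e]
        by_cases hx : (candidates S φ l)[c] = (hood S φ l 0)[t] <;> simp [hx] <;> omega
      · rw [St.setV_v, if_neg (by decide), hs, List.take_succ_eq_append_getElem htl,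
          List.mem_append, List.mem_singleton, ← h2]
        by_cases hx : (candidates S φ l)[c] = (hood S φ l 0)[t] <;> simp [hx] <;> omega
    · rintro s1 g1 ⟨-, h1⟩
      exact ⟨by rw [g1.v _ rfl]; simp, h1.trans hiff⟩
  · omega

theorem wp_attempt {s : St Var Arr} {l : List (Fin S.n)} {x : Fin S.n} (hr : Ready S φ s)
    (hB : Room S φ B) (hlk : l.length < k) (hlv : s.v .lv = l.length + 1) (hb : s.v .b = x)
    (he : Seg (s.a .env) 0 (l.map Fin.val)) :
    Wp 5 B attempt (hoodTime (depth φ) φ.code.length + evalTime (depth φ) φ.code.length + 40)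
      (fun s' => s'.v .val = bit (Good S φ (l ++ [x])) ∧
        s'.a .env = update (s.a .env) l.length x) s := by
  have hdep : depth φ = k + φ.code.length + thresholds φ := rfl
  have hd := hB.depth
  have hX : 2 ≤ hoodBound (depth φ) φ.code.length + 2 := by omega
  have hmono := evalCost_mono hX (show φ.code.length + k ≤ depth φ by omega)
  refine (Wp.seq (R := fun s' => s' = (s.setA .env l.length x).setV .jl
    (l.length + 1)) (Wp.straight (τ := 30) (by decide) ?_ ?_) ?_).le (τ := 30 +
      (hoodTime (depth φ) φ.code.length + (5 +
        (evalCost (hoodBound (depth φ) φ.code.length + 2) (φ.code.length + k) + 440))))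
        (by rw [evalTime]; omega)
  · simp [Cmd.okL]; omega
  · simp [Cmd.sem, hlv, hb]
  rintro s0 - rfl
  have hr0 : Ready S φ ((s.setA .env l.length x).setV .jl (l.length + 1)) :=
    hr.of_eq (by simp) (by simp)
  have he0 : Seg (update (s.a .env) l.length x) 0 ((l ++ [x]).map Fin.val) := seg_map_push he rfl x
  refine Wp.seq (wp_buildHoods (l := l ++ [x]) hr0 (by simpa using he0) (by simp)
    (by simp; omega) hB) ?_
  intro s1 g1 h1
  refine Wp.seq (R := fun s' => s' = s1.setV .m (l.length + 1)) (Wp.straight (by decide) ?_ ?_) ?_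
  · simp [Cmd.okL]
  · have : s1.v .lv = l.length + 1 := by rw [g1.v _ rfl]; simpa using hlv
    simp [Cmd.sem, this]
  rintro s2 - rfl
  have he1 : s1.a .env = update (s.a .env) l.length x := by rw [g1.a _ rfl]; simp
  refine (wp_evaluate (l := l ++ [x]) ((hr0.agree g1 (by decide)).of_eq (by simp) (by simp)) hB
    ⟨by simpa using h1.vs, by simpa using h1.lens⟩ (by simp; omega) (by simp)
    (by simpa [he1] using he0)).post ?_
  rintro s3 g3 ⟨h3, h4⟩
  exact ⟨h3, by simpa [he1] using h4⟩

/-- Running time of a step of the search. -/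
def stepTime (d T : ℕ) : ℕ := 2 * hoodTime d T + evalTime d T + hoodBound d T * 60 + 300

/-- Effect of the search on one level. -/
structure Sought (s s' : St Var Arr) (l : List (Fin S.n)) (x c' : ℕ) : Prop where
  env : s'.a .env = update (s.a .env) l.length x
  ctr : s'.a .ctr = update (s.a .ctr) l.length c'

/-- The list of pending components is the loop invariant: it is unchanged by a failure, which
decreases the measure, loses its head by a success, and is empty when the candidates are exhausted.
-/
theorem wp_seekStep {s : St Var Arr} {l : List (Fin S.n)} {c : ℕ} (hr : Ready S φ s)
    (hB : Room S φ B) (hlk : l.length < k) (hlv : s.v .lv = l.length + 1)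
    (he : Seg (s.a .env) 0 (l.map Fin.val)) (hc : s.a .ctr l.length = c) (hres : s.v .res = 0) :
    Wp 5 B seekStep (stepTime (depth φ) φ.code.length) (fun s' => ∃ x c', Sought s s' l x c' ∧
      ((s'.v .res = 0 ∧ pending S φ l c = pending S φ l c' ∧
          seekMeasure S φ l c' < seekMeasure S φ l c) ∨
        (s'.v .res = 1 ∧ ∃ b, x = Fin.val b ∧ pending S φ l c = b :: pending S φ l c') ∨
        (s'.v .res = 2 ∧ pending S φ l c = []))) s := by
  have hdep : depth φ = k + φ.code.length + thresholds φ := rfl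
  have hd := hB.depth
  have hh := hB.hood
  have hlen := length_candidates (φ := φ) (l := l)
  have hle := length_hood_le (φ := φ) (l := l) (i := 0) (by omega)
  refine (Wp.seq (R := fun s' => Hoods S φ l s' ∧ s'.v .jl = l.length)
    (Wp.seq (R := fun s' => s' = s.setV .jl l.length) (Wp.straight (τ := 10) (by decide)
    ?_ ?_) ?_) ?_).le (τ := (10 + hoodTime (depth φ) φ.code.length) + (20 + (7 +
      ((hoodBound (depth φ) φ.code.length * 60 + 80) + (3 + ((hoodTime (depth φ) φ.code.length +
        evalTime (depth φ) φ.code.length + 40) + 100)))))) (by rw [stepTime]; omega)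
  · simp [Cmd.okL]; omega
  · simp [Cmd.sem, hlv]
  · rintro s0 - rfl
    exact (wp_buildHoods (l := l) (hr.of_eq (by simp) (by simp)) (by simpa using he) (by simp)
      (by omega) hB).post (Q := fun s' => Hoods S φ l s' ∧ s'.v .jl = l.length) fun s' g h =>
        ⟨h, by rw [g.v _ rfl]; simp⟩
  rintro s1 g1 ⟨h1, hjl1⟩
  have hr1 : Ready S φ s1 := hr.agree g1 (by decide)
  have he1 : s1.a .env = s.a .env := g1.a _ rfl
  have hc1 : s1.a .ctr = s.a .ctr := g1.a _ rfl
  have hlv1 : s1.v .lv = l.length + 1 := (g1.v _ rfl).trans hlv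
  have hres1 : s1.v .res = 0 := (g1.v _ rfl).trans hres
  have hlens : s1.a .lens l.length = (hood S φ l 0).length := by
    have := h1.lens 0 (by omega); simpa using this
  refine Wp.seq (R := fun s' => s' = (s1.setV .ell (hood S φ l 0).length).setV .cc c)
    (Wp.straight (by decide) ?_ ?_) ?_
  · simp [Cmd.okL]
  · simp [Cmd.sem, hjl1, hlens, hc1, hc]
  rintro s2 - rfl
  have hr2 : Ready S φ ((s1.setV .ell (hood S φ l 0).length).setV .cc c) :=
    hr1.of_eq (by simp) (by simp)
  have hn2 := hr1.sizes.n
  by_cases hcl : c < (candidates S φ l).length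
  swap
  · refine (Wp.iteF (e := rd .ell + rd .n - rd .cc) (by simp [hn2]; omega) (by simp [hn2]; omega)
      (Wp.straight (τ := 5) (by decide) (by simp [Cmd.okL]; omega)
      ⟨s.a .env l.length, c, ⟨?_, ?_⟩, .inr (.inr ⟨?_, ?_⟩)⟩)).le
      (by simp only [Ex.cost_sub, Ex.cost_add, Ex.cost_var]; omega)
    · simp [Cmd.sem, he1]
    · simp [Cmd.sem, hc1, ← hc]
    · simp [Cmd.sem]
    · exact pending_end (by omega)
  refine Wp.iteT (e := rd .ell + rd .n - rd .cc) (by simp [hn2]; omega) (by simp [hn2]; omega)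
    (Wp.seq (wp_pick (c := c) hr2 hB ⟨by simpa using h1.vs, by simpa using h1.lens⟩ (by omega) (by simp)
    (by simp) hcl) ?_)
  rintro s3 g3 ⟨hb3, hdup⟩
  have hr3 : Ready S φ s3 := hr2.agree g3 (by decide)
  have he3 : s3.a .env = s.a .env := by rw [g3.a _ rfl]; simpa using he1
  have hc3 : s3.a .ctr = s.a .ctr := by rw [g3.a _ rfl]; simpa using hc1
  have hlv3 : s3.v .lv = l.length + 1 := by rw [g3.v _ rfl]; simpa using hlv1
  have hres3 : s3.v .res = 0 := by rw [g3.v _ rfl]; simpa using hres1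
  have hcc3 : s3.v .cc = c := by rw [g3.v _ rfl]; simp
  have hell3 : s3.v .ell = (hood S φ l 0).length := by rw [g3.v _ rfl]; simp
  by_cases hm : (candidates S φ l)[c] ∈ (candidates S φ l).take c
  · refine (Wp.iteT (e := rd .dup) (by simp) (by simpa using hdup.2 hm)
      (Wp.straight (τ := 20) (by decide) (by simp [Cmd.okL, hcc3]; omega)
      ⟨s.a .env l.length, c + 1, ⟨?_, ?_⟩, .inl ⟨?_, pending_of_mem hcl hm, ?_⟩⟩)).le
      (by simp only [Ex.cost_var]; omega)
    · simp [Cmd.sem, he3]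
    · simp [Cmd.sem, hc3, hlv3, hcc3]
    · simpa [Cmd.sem] using hres3
    · by_cases h : c < (hood S φ l 0).length
      · exact seekMeasure_left h
      · exact seekMeasure_mem (by omega) hcl
          ((mem_take_candidates_right (by omega) hcl).choose_spec.2.1 hm)
  refine Wp.iteF (e := rd .dup) (by simp) (by simpa using fun h => hm (hdup.1 h))
    (Wp.seq (wp_attempt (l := l) (x := (candidates S φ l)[c]) hr3 hB hlk hlv3 hb3 (by rwa [he3])) ?_)
  rintro s4 g4 ⟨hval, he4⟩
  have hr4 : Ready S φ s4 := hr3.agree g4 (by decide)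
  have hc4 : s4.a .ctr = s.a .ctr := (g4.a _ rfl).trans hc3
  have hlv4 : s4.v .lv = l.length + 1 := (g4.v _ rfl).trans hlv3
  have hres4 : s4.v .res = 0 := (g4.v _ rfl).trans hres3
  have hcc4 : s4.v .cc = c := (g4.v _ rfl).trans hcc3
  have hb4 : s4.v .b = (candidates S φ l)[c] := (g4.v _ rfl).trans hb3
  have hell4 : s4.v .ell = (hood S φ l 0).length := (g4.v _ rfl).trans hell3
  rw [he3] at he4
  have hty := hr4.typ (candidates S φ l)[c]
  have hfin := hr4.fin _ (typeNum_lt (vals := φ.code) (radius (depth φ)) (candidates S φ l)[c])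
  have hgl := length_grouped_le (ty := typeNum S φ.code (radius (depth φ)))
    (typeNum S φ.code (radius (depth φ)) (candidates S φ l)[c] + 1)
  by_cases hg : Good S φ (l ++ [(candidates S φ l)[c]])
  · rw [bit_pos hg] at hval
    refine Wp.straight (by decide) (by simp [conclude, Cmd.okL, Cmd.sem, hcc4, hval]; omega)
      ⟨(candidates S φ l)[c], c + 1, ⟨?_, ?_⟩, .inr (.inl ⟨?_, _, rfl, pending_of_good hcl hm hg⟩)⟩
    · simp [conclude, Cmd.sem, hval, he4]
    · simp [conclude, Cmd.sem, hval, hc4, hlv4, hcc4]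
    · simp [conclude, Cmd.sem, hval]
  rw [bit_neg hg] at hval
  by_cases hcV : c < (hood S φ l 0).length
  · have : (hood S φ l 0).length - c ≠ 0 := by omega
    refine Wp.straight (by decide) (by simp [conclude, Cmd.okL, hcc4, hval, hell4, this]; omega)
      ⟨(candidates S φ l)[c], c + 1, ⟨?_, ?_⟩, .inl ⟨?_, pending_of_not_good hcl hg, seekMeasure_left hcV⟩⟩
    · simp [conclude, Cmd.sem, hval, he4, hell4, hcc4, this]
    · simp [conclude, Cmd.sem, hval, hc4, hlv4, hcc4, hell4, this]
    · simp [conclude, Cmd.sem, hval, hell4, hcc4, this, hres4]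
  · have : (hood S φ l 0).length - c = 0 := by omega
    have hnV : (candidates S φ l)[c] ∉ hood S φ l 0 := fun h =>
      hm ((mem_take_candidates_right (by omega) hcl).choose_spec.2.2 h)
    obtain ⟨hs1, hs2⟩ := seekMeasure_skip (Nat.le_of_not_lt hcV) hcl
    have hok : conclude.okL B s4 := by
      simp [conclude, Cmd.okL, hcc4, hval, hell4, this, hb4, hty, hfin]; omega
    refine Wp.straight (by decide) hok
      ⟨(candidates S φ l)[c], _, ⟨?_, ?_⟩, .inl ⟨?_, pending_skip hlk (Nat.le_of_not_lt hcV) hcl hnV hg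
        hs1 le_rfl, hs2⟩⟩
    · simp [conclude, Cmd.sem, hval, he4, hell4, hcc4, this]
    · simp [conclude, Cmd.sem, hval, hc4, hlv4, hcc4, hell4, this, hb4, hty, hfin]
    · simp [conclude, Cmd.sem, hval, hell4, hcc4, this, hres4]

/-- Running time of the search in one level. -/
def seekTime (d T : ℕ) : ℕ :=
  (2 * hoodBound d T + numTypes (radius d) T + 1) * (stepTime d T + 10) + 20

theorem wp_seek {s : St Var Arr} {l : List (Fin S.n)} {c : ℕ} (hr : Ready S φ s)
    (hB : Room S φ B) (hlk : l.length < k) (hlv : s.v .lv = l.length + 1)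
    (he : Seg (s.a .env) 0 (l.map Fin.val)) (hc : s.a .ctr l.length = c) :
    Wp 5 B seek (seekTime (depth φ) φ.code.length) (fun s' => ∃ x c', Sought s s' l x c' ∧
      ((s'.v .res = 1 ∧ ∃ b, x = Fin.val b ∧ pending S φ l c = b :: pending S φ l c') ∨
        (s'.v .res = 2 ∧ pending S φ l c = []))) s := by
  have hdep : depth φ = k + φ.code.length + thresholds φ := rfl
  have hle := length_hood_le (φ := φ) (l := l) (i := 0) (by omega)
  have hh := hB.hood
  refine (Wp.seq (R := fun s' => s' = s.setV .res 0) (Wp.straight (τ := 5) (by decide) ?_ ?_) ?_).le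
    (τ := 5 + ((2 * hoodBound (depth φ) φ.code.length + numTypes (radius (depth φ)) φ.code.length + 1) *
      (3 + 2 + stepTime (depth φ) φ.code.length) + 3 + 1)) ?_
  · simp [Cmd.okL]
  · simp [Cmd.sem]
  · rintro s0 - rfl
    -- The factor `1 - res` makes the measure vanish as soon as the search in the level has a
    -- result, whatever the position then is.
    refine (Wp.while_measure (e := 1 - rd .res) (fun s' => Agree seekStep s s' ∧ ∃ x c',
      Sought s s' l x c' ∧ ((s'.v .res = 0 ∧ pending S φ l c = pending S φ l c') ∨
        (s'.v .res = 1 ∧ ∃ b, x = Fin.val b ∧ pending S φ l c = b :: pending S φ l c') ∨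
        (s'.v .res = 2 ∧ pending S φ l c = []))) (fun s' => (1 - s'.v .res) *
          (seekMeasure S φ l (s'.a .ctr l.length) + 1)) _ (fun s' _ => by simp; omega) ?_ ?_ ?_).post ?_
    · rintro s1 ⟨g1, x, c', ⟨h1, h2⟩, h3⟩ h4
      have hres : s1.v .res = 0 := by simp at h4; omega
      have h3 : pending S φ l c = pending S φ l c' := by
        rcases h3 with h3 | h3 | h3
        · exact h3.2
        · omega
        · omega
      have hc1 : s1.a .ctr l.length = c' := by rw [h2, update_self]
      refine (wp_seekStep (hr.agree g1 (by decide)) hB hlk ((g1.v _ rfl).trans hlv) ?_ hc1 hres).post ?_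
      · rw [h1]; exact he.congr fun i hi => update_of_ne (by simp at hi; omega) _ _
      · rintro s2 g2 ⟨x', c'', ⟨k1, k2⟩, k3⟩
        have k2' : s2.a .ctr l.length = c'' := by rw [k2, update_self]
        refine ⟨⟨g1.trans g2, x', c'', ⟨by rw [k1, h1, update_idem], by rw [k2, h2, update_idem]⟩, ?_⟩, ?_⟩
        · rw [h3]
          exact k3.imp_left fun k3 => ⟨k3.1, k3.2.1⟩
        · rw [hres, hc1, k2']
          rcases k3 with k3 | k3 | k3
          · rw [k3.1]; omega
          · rw [k3.1]; omega
          · rw [k3.1]; omega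
    · refine ⟨⟨fun x hx => ?_, fun _ _ => rfl, fun _ => rfl⟩, _, _, ⟨(update_eq_self _ _).symm,
        (update_eq_self _ _).symm⟩, .inl ⟨by simp, by rw [St.setV_a, hc]⟩⟩
      rw [St.setV_v, if_neg]
      rintro rfl
      exact absurd hx (by decide)
    · have := seekMeasure_le (S := S) (φ := φ) (l := l) c
      simp [hc]; omega
    · rintro s1 - ⟨⟨-, x, c', h1, h2⟩, h3⟩
      refine ⟨x, c', h1, h2.resolve_left fun h => ?_⟩
      simp [h.1] at h3
  · rw [seekTime]
    have := Nat.mul_le_mul_left (2 * hoodBound (depth φ) φ.code.length +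
      numTypes (radius (depth φ)) φ.code.length + 1) (show 3 + 2 + stepTime (depth φ) φ.code.length ≤
        stepTime (depth φ) φ.code.length + 10 by omega)
    omega

end

end BijQuery

/-! ## The search for the next solution -/

namespace BijQuery

open Function WhileRAM

set_option linter.constructorNameAsVariable false

/-- Descent to the next level, if there is one. -/
def descend : Cmd Var Arr :=
  .ite (rd .k - rd .lv) (.put .ctr (rd .lv) 0 ;; .lv ≔ rd .lv + 1 ;; .go ≔ 1) (.go ≔ 0)

/-- Continuation of the search in the last active level, if there is one. -/
def resume : Cmd Var Arr := .ite (rd .lv) (.go ≔ 1) (.alive ≔ 0 ;; .go ≔ 0)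

/-- Backtracking: a component that has been found leads one level down, and an exhausted level leads
back to the one above it. -/
def advance : Cmd Var Arr :=
  .wh (rd .go) (seek ;; .ite (2 - rd .res) descend (.lv ≔ rd .lv - 1 ;; resume))

/-- After a solution the level is `k`, and the search is resumed in the last level. For `k = 0`
there is no level to resume, and the enumeration ends at once. -/
def next : Cmd Var Arr := resume ;; advance

def start : Cmd Var Arr :=
  (.jl ≔ 0 ;; buildHoods) ;; .m ≔ 0 ;; evaluate ;;
    (.alive ≔ rd .val ;; .lv ≔ 0 ;; .go ≔ 0) ;; .ite (rd .alive) descend .skip ;; advance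

def writeSolution : Cmd Var Arr := Cmd.for .i6 .k (.wr (.get .env (rd .i6)))

section
variable {σ : UnarySig} {S : BijStructure σ} {k : ℕ} {φ : FOBij σ k} {B : ℕ}
  {p : List (Fin S.n)} {ctr : ℕ → ℕ}

/-- Taking the head of the pending list splits the remaining solutions into those below the new
component and those after it; the counter of the level records the split. -/
theorem remaining_cons {b : Fin S.n} {c : ℕ}
    (h : pending S φ p (ctr p.length) = b :: pending S φ p c) :
    remaining S φ p ctr (p.length + 1) = sols S φ (k - p.length - 1) (p ++ [b]) ++
      remaining S φ (p ++ [b]) (update ctr p.length c) (p.length + 1) := by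
  rw [remaining, remaining, List.take_length, h, List.flatMap_cons, List.append_assoc,
    List.take_left, update_self]
  congr 2
  refine remaining_congr _ (fun i hi => ?_) fun i hi => (update_of_ne hi.ne _ _).symm
  rw [List.take_append_of_le_length hi.le]

theorem remaining_zero (hp : p.length < k) (hc : ctr p.length = 0) :
    remaining S φ p ctr (p.length + 1) = sols S φ (k - p.length) p ++
      remaining S φ p ctr p.length := by
  obtain ⟨d, hd⟩ : ∃ d, k - p.length = d + 1 := ⟨k - p.length - 1, by omega⟩
  rw [remaining, List.take_length, hc, hd, sols, Nat.add_sub_cancel]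

theorem remaining_nil (h : pending S φ p (ctr p.length) = []) :
    remaining S φ p ctr (p.length + 1) = remaining S φ p ctr p.length := by
  rw [remaining, List.take_length, h]; rfl

open scoped Classical in
/-- A bound for the number of steps of the search for the next solution. -/
noncomputable def levelMeasure (S : BijStructure σ) (φ : FOBij σ k) (p : List (Fin S.n)) (c : ℕ) : ℕ :=
  -- Exhausted levels are left upwards, which lowers the first value. As soon as a level has
  -- something pending the search only descends until a solution is complete, which lowers the
  -- second value; and every second value is below every first one.
  if pending S φ p c = [] then k + 2 + p.length else k - p.length

/-- The search stands in the level that follows the tuple `p`, and the solutions in `Y` remain. -/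
structure Level (S : BijStructure σ) (φ : FOBij σ k) (Y : List (List (Fin S.n))) (p : List (Fin S.n))
    (s : St Var Arr) : Prop where
  ready : Ready S φ s
  buf : s.buf = []
  alive : s.v .alive ≠ 0
  short : p.length < k
  lv : s.v .lv = p.length + 1
  env : Seg (s.a .env) 0 (p.map Fin.val)
  sols : Y = remaining S φ p (s.a .ctr) (p.length + 1)

/-- The search has found the first of the solutions in `Y`. -/
def Stopped (S : BijStructure σ) (φ : FOBij σ k) (Y : List (List (Fin S.n))) (s : St Var Arr) : Prop :=
  Ready S φ s ∧ s.buf = [] ∧ ((Y = [] ∧ s.v .alive = 0) ∨ (s.v .alive ≠ 0 ∧ ∃ p : List (Fin S.n),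
    p.length = k ∧ s.v .lv = k ∧ Seg (s.a .env) 0 (p.map Fin.val) ∧
      Y = p :: remaining S φ p (s.a .ctr) k))

/-- The search has stopped, or it goes on with a smaller measure. -/
def Progress (S : BijStructure σ) (φ : FOBij σ k) (Y : List (List (Fin S.n))) (M : ℕ) (s : St Var Arr) :
    Prop :=
  (s.v .go = 0 ∧ Stopped S φ Y s) ∨
    (s.v .go = 1 ∧ ∃ p, Level S φ Y p s ∧ levelMeasure S φ p (s.a .ctr p.length) < M)

theorem Progress.mono {Y : List (List (Fin S.n))} {M M' : ℕ} {s : St Var Arr}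
    (h : Progress S φ Y M s) (hM : M ≤ M') : Progress S φ Y M' s :=
  h.imp_right fun ⟨h1, p, h2, h3⟩ => ⟨h1, p, h2, h3.trans_le hM⟩

theorem wp_resume {Y : List (List (Fin S.n))} {s : St Var Arr} (hB : 1 ≤ B) (hr : Ready S φ s)
    (hb : s.buf = []) (ha : s.v .alive ≠ 0) (hp : p.length ≤ k) (hlv : s.v .lv = p.length)
    (he : Seg (s.a .env) 0 (p.map Fin.val)) (hY : Y = remaining S φ p (s.a .ctr) p.length) :
    Wp 5 B resume 20 (Progress S φ Y (k + 2 + p.length)) s := by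
  obtain rfl | ⟨q, z, rfl⟩ := List.eq_nil_or_concat p
  · refine (Wp.iteF (e := rd .lv) (by simp) (by simpa using hlv) (Wp.straight (τ := 10)
      (by decide) (by simp [Cmd.okL, Cmd.sem]) (.inl ⟨?_, ?_, ?_, .inl ⟨hY, ?_⟩⟩))).le
      (by simp only [Ex.cost_var]; omega)
    · simp [Cmd.sem]
    · exact hr.of_eq (by simp [Cmd.sem]) (by simp [Cmd.sem])
    · simpa [Cmd.sem] using hb
    · simp [Cmd.sem]
  · rw [List.concat_eq_append] at *
    rw [List.length_append, List.length_singleton] at hp hlv hY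
    rw [List.map_append, seg_append] at he
    refine (Wp.iteT (e := rd .lv) (by simp) (by simp [hlv]) (Wp.straight (τ := 10)
      (by decide) ?_ (.inr ⟨?_, q, ⟨?_, ?_, ?_, ?_, ?_, ?_, ?_⟩, ?_⟩))).le
      (by simp only [Ex.cost_var]; omega)
    · simpa [Cmd.okL] using hB
    · simp [Cmd.sem]
    · exact hr.of_eq (by simp [Cmd.sem]) (by simp [Cmd.sem])
    · simpa [Cmd.sem] using hb
    · simpa [Cmd.sem] using ha
    · omega
    · simpa [Cmd.sem] using hlv
    · simpa [Cmd.sem] using he.1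
    · rw [hY]
      refine remaining_congr _ (fun i hi => ?_) fun i _ => by simp [Cmd.sem]
      rw [List.take_append_of_le_length (by omega)]
    · rw [levelMeasure, List.length_append, List.length_singleton]
      split_ifs <;> omega

theorem wp_descend {Y : List (List (Fin S.n))} {s : St Var Arr} (hr : Ready S φ s)
    (hB : Room S φ B) (hb : s.buf = [])
    (ha : s.v .alive ≠ 0) (hp : p.length ≤ k) (hlv : s.v .lv = p.length) (hg : Good S φ p)
    (he : Seg (s.a .env) 0 (p.map Fin.val))
    (hY : Y = sols S φ (k - p.length) p ++ remaining S φ p (s.a .ctr) p.length) :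
    Wp 5 B descend 50 (Progress S φ Y (k - p.length + 1)) s := by
  have hdep : depth φ = k + φ.code.length + thresholds φ := rfl
  have hd := hB.depth
  have hk := hr.sizes.k
  by_cases h : p.length = k
  · refine (Wp.iteF (e := rd .k - rd .lv) (by simp) (by simp [hlv, hk, h]) (Wp.straight (τ := 10)
      (by decide) (by simp [Cmd.okL]) (.inl ⟨?_, ?_, ?_, .inr ⟨?_, p, h, ?_, ?_, ?_⟩⟩))).le
      (by simp only [Ex.cost_sub, Ex.cost_var]; omega)
    · simp [Cmd.sem]
    · exact hr.of_eq (by simp [Cmd.sem]) (by simp [Cmd.sem])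
    · simpa [Cmd.sem] using hb
    · simpa [Cmd.sem] using ha
    · simpa [Cmd.sem, h] using hlv
    · simpa [Cmd.sem] using he
    · rw [hY, h, Nat.sub_self, sols]; simp [Cmd.sem]
  · refine (Wp.iteT (e := rd .k - rd .lv) (by simp) (by simp [hlv, hk]; omega) (Wp.straight
      (τ := 30) (by decide) (by simp [Cmd.okL, Cmd.sem, hlv]; omega)
      (.inr ⟨?_, p, ⟨?_, ?_, ?_, ?_, ?_, ?_, ?_⟩, ?_⟩))).le
      (by simp only [Ex.cost_sub, Ex.cost_var]; omega)
    · simp [Cmd.sem]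
    · exact hr.of_eq (by simp [Cmd.sem]) (by simp [Cmd.sem])
    · simpa [Cmd.sem] using hb
    · simpa [Cmd.sem] using ha
    · omega
    · simpa [Cmd.sem] using hlv
    · simpa [Cmd.sem] using he
    · rw [hY, remaining_zero (by omega) (by simp [Cmd.sem, hlv])]
      congr 1
      refine remaining_congr _ (fun _ _ => rfl) fun i hi => ?_
      simp [Cmd.sem, hlv, update_of_ne hi.ne]
    · rw [levelMeasure, if_neg]
      · omega
      -- The new level starts at position 0 of a tuple that extends to an answer, so something is
      -- pending in it and the smaller value of the measure applies.
      · obtain ⟨b, hb⟩ := hg.exists (by omega)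
        have := mem_pending_zero.2 hb
        intro h0
        rw [show (Cmd.sem _ s).a .ctr p.length = 0 by simp [Cmd.sem, hlv]] at h0
        rw [h0] at this
        simp at this

/-- A measure below `N + 1` allows at most `N` searches in single levels. For `N = 0` the search has
already stopped, as the measure of a level is positive. -/
theorem wp_advance {Y : List (List (Fin S.n))} (hB : Room S φ B) (N : ℕ) {s : St Var Arr}
    (h : Progress S φ Y (N + 1) s) :
    Wp 5 B advance (N * (seekTime (depth φ) φ.code.length + 70) + 10) (Stopped S φ Y) s := by
  have hdep : depth φ = k + φ.code.length + thresholds φ := rfl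
  have hd := hB.depth
  induction N generalizing s with
  | zero =>
    rcases h with ⟨h1, h2⟩ | ⟨h1, p, h2, h3⟩
    · exact (Wp.whF (e := rd .go) (by simp) (by simpa using h1) h2).le
        (by simp only [Ex.cost_var]; omega)
    · have := h2.short
      rw [levelMeasure] at h3
      split_ifs at h3 <;> omega
  | succ N ih =>
    rcases h with ⟨h1, h2⟩ | ⟨h1, p, h2, h3⟩
    · exact (Wp.whF (e := rd .go) (by simp) (by simpa using h1) h2).le
        (by simp only [Ex.cost_var]; omega)
    refine (Wp.whT (e := rd .go) (τ₁ := seekTime (depth φ) φ.code.length + (5 + 55)) (by simp)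
      (by simp [h1]) (Wp.seq (wp_seek h2.ready hB h2.short h2.lv h2.env rfl) ?_)
      (τ₂ := N * (seekTime (depth φ) φ.code.length + 70) + 10)).le (by
        rw [Nat.succ_mul]; simp only [Ex.cost_var]; omega)
    rintro s1 g1 ⟨x, c', ⟨e1, e2⟩, e3⟩
    have hr1 : Ready S φ s1 := h2.ready.agree g1 (by decide)
    have hb1 : s1.buf = [] := (g1.buf rfl).trans h2.buf
    have ha1 : s1.v .alive ≠ 0 := by rw [g1.v _ rfl]; exact h2.alive
    have hlv1 : s1.v .lv = p.length + 1 := (g1.v _ rfl).trans h2.lv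
    have hshort := h2.short
    refine Wp.post (R := Progress S φ Y (N + 1)) ?_ fun s' _ h => ih h
    rcases e3 with ⟨e3, b, rfl, e4⟩ | ⟨e3, e4⟩
    · refine (Wp.iteT (e := 2 - rd .res) (by simp; omega) (by simp [e3]) ((wp_descend (p := p ++ [b])
        hr1 hB hb1 ha1 (by simp; omega) (by simpa using hlv1) (good_of_mem_pending (c := s.a .ctr p.length)
        (by rw [e4]; simp)) ?_ ?_).post fun s' _ h => h.mono ?_)).le
          (by simp only [Ex.cost_sub, Ex.cost_var, Ex.cost_ofNat]; omega)
      · rw [e1]; exact seg_map_push h2.env (by simp) b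
      · rw [h2.sols, remaining_cons e4, e2]; simp [Nat.sub_sub]
      · rw [levelMeasure, if_neg (by rw [e4]; simp)] at h3
        simp; omega
    · refine (Wp.iteF (e := 2 - rd .res) (by simp; omega) (by simp [e3]) (Wp.seq (R := fun s' =>
        s' = s1.setV .lv p.length) (Wp.straight (τ := 10) (by decide) ?_ ?_) ?_) (τ := 10 + 20)).le
          (by simp only [Ex.cost_sub, Ex.cost_var, Ex.cost_ofNat]; omega)
      · simp [Cmd.okL]; omega
      · simp [Cmd.sem, hlv1]
      rintro s2 - rfl
      rw [levelMeasure, if_pos e4] at h3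
      refine (wp_resume (p := p) (Y := Y) (by omega) (hr1.of_eq (by simp) (by simp))
        (by simpa using hb1) (by simpa using ha1)
        hshort.le (by simp) ?_ ?_).post fun s' _ h => h.mono (by omega)
      · rw [St.setV_a, e1]
        exact h2.env.congr fun i hi => update_of_ne (by simp at hi; omega) _ _
      · rw [h2.sols, remaining_nil e4, St.setV_a, e2]
        exact remaining_congr _ (fun _ _ => rfl) fun i hi => (update_of_ne hi.ne _ _).symm

/-- Time between two solutions. -/
def nextTime (d T : ℕ) : ℕ := (2 * d + 2) * (seekTime d T + 70) + 100

theorem wp_next {Y : List (List (Fin S.n))} (hB : Room S φ B) {s : St Var Arr} (hr : Ready S φ s)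
    (hb : s.buf = []) (ha : s.v .alive ≠ 0) (hp : p.length = k) (hlv : s.v .lv = k)
    (he : Seg (s.a .env) 0 (p.map Fin.val)) (hY : Y = remaining S φ p (s.a .ctr) k) :
    Wp 5 B next (nextTime (depth φ) φ.code.length) (Stopped S φ Y) s := by
  have hdep : depth φ = k + φ.code.length + thresholds φ := rfl
  have hd := hB.depth
  have hc := code_pos φ
  refine (Wp.seq (wp_resume (p := p) (Y := Y) (by omega) hr hb ha hp.le (by omega) he (by rw [hp]; exact hY))
    fun s' _ h => wp_advance hB (2 * depth φ + 2) (h.mono (by omega))).le ?_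
  rw [nextTime]; omega

theorem wp_writeSolution (hB : Room S φ B) {s : St Var Arr} (hr : Ready S φ s)
    (hb : s.buf = []) (hp : p.length = k) (he : Seg (s.a .env) 0 (p.map Fin.val)) :
    Wp 5 B writeSolution (nextTime (depth φ) φ.code.length) (fun s' => s'.buf = p.map Fin.val) s := by
  have hdep : depth φ = k + φ.code.length + thresholds φ := rfl
  have hd := hB.depth
  refine ((Wp.for (i := Var.i6) (l := Var.k) (N := k) (τ := 20) (fun t s' => s'.buf =
    (p.take t).map Fin.val) (by decide) rfl rfl (by omega) hr.sizes.k (by simpa using hb) ?_).post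
    ?_).le ?_
  · intro t ht s1 g1 hi _ h1
    refine Wp.straight (by decide) (by simp [Cmd.okL]) ?_
    have : s1.a .env t = p[t] := by
      rw [g1.a _ rfl, seg_zero he (by simpa [hp] using ht), List.getElem_map]
    have e := List.take_succ_eq_append_getElem (show t < p.length by omega)
    simp only [Cmd.sem, St.setV_buf, St.setB_buf, h1, Ex.val_get, Ex.val_var, hi, this, e,
      List.map_append, List.map_cons, List.map_nil]
  · rintro s1 - h1
    rw [h1, ← hp, List.take_length]
  · rw [nextTime]
    have := Nat.mul_le_mul (show k ≤ 2 * depth φ + 2 by omega)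
      (show 20 + 9 ≤ seekTime (depth φ) φ.code.length + 70 by omega)
    omega

open scoped Classical in
/-- The list of all solutions. -/
noncomputable def solutions (S : BijStructure σ) (φ : FOBij σ k) : List (List (Fin S.n)) :=
  if Good S φ [] then sols S φ k [] else []

theorem mem_solutions {y : List (Fin S.n)} :
    y ∈ solutions S φ ↔ y.length = k ∧ Good S φ y := by
  rw [solutions]
  split_ifs with h
  · rw [mem_sols (Nat.zero_add k) h]; simp
  · simp only [List.not_mem_nil, false_iff, not_and]
    exact fun _ h' => h (h'.of_prefix (List.nil_prefix))

theorem nodup_solutions : (solutions S φ).Nodup := by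
  rw [solutions]
  split_ifs
  · exact nodup_sols _ _
  · exact List.nodup_nil

/-- Time until the first solution. -/
def startTime (d T : ℕ) : ℕ := hoodTime d T + evalTime d T + nextTime d T

theorem wp_start (hB : Room S φ B) {s : St Var Arr} (hr : Ready S φ s) (hb : s.buf = []) :
    Wp 5 B start (startTime (depth φ) φ.code.length) (Stopped S φ (solutions S φ)) s := by
  have hdep : depth φ = k + φ.code.length + thresholds φ := rfl
  have hd := hB.depth
  have hX : 2 ≤ hoodBound (depth φ) φ.code.length + 2 := by omega
  have hmono := evalCost_mono hX (show φ.code.length + k ≤ depth φ by omega)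
  refine (Wp.seq (R := fun s' => Hoods S φ [] s') (Wp.seq (R := fun s' => s' = s.setV .jl 0)
    (Wp.straight (τ := 5) (by decide) ?_ ?_) ?_) ?_).le
    (τ := (5 + hoodTime (depth φ) φ.code.length) + (5 + ((evalCost (hoodBound (depth φ)
      φ.code.length + 2) (φ.code.length + k) + 440) + (15 + (53 +
        ((2 * depth φ + 1) * (seekTime (depth φ) φ.code.length + 70) + 10)))))) ?_
  · simp [Cmd.okL]
  · simp [Cmd.sem]
  · rintro s0 - rfl
    exact wp_buildHoods (l := []) (hr.of_eq (by simp) (by simp)) (by simp) (by simp) (by simp) hB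
  · intro s1 g1 h1
    refine Wp.seq (R := fun s' => s' = s1.setV .m 0) (Wp.straight (by decide) ?_ ?_) ?_
    · simp [Cmd.okL]
    · simp [Cmd.sem]
    rintro s2 - rfl
    have hr1 : Ready S φ s1 := hr.agree g1 (by decide)
    refine Wp.seq (wp_evaluate (l := []) (hr1.of_eq (by simp) (by simp)) hB
      ⟨by simpa using h1.vs, by simpa using h1.lens⟩ (by simp) (by simp) (by simp)) ?_
    rintro s3 g3 ⟨h3, -⟩
    have hr3 : Ready S φ s3 := (hr1.of_eq (by simp) (by simp) : Ready S φ (s1.setV .m 0)).agree g3 (by decide)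
    have hb3 : s3.buf = [] := by
      rw [g3.buf rfl, St.setV_buf, g1.buf rfl]; exact hb
    change s3.v .val = bit (Good S φ []) at h3
    refine Wp.seq (R := fun s' => s' = ((s3.setV .alive (s3.v .val)).setV .lv 0).setV .go 0)
      (Wp.straight (by decide) ?_ ?_) ?_
    · simp [Cmd.okL, Cmd.sem]
    · simp [Cmd.sem]
    rintro s4 - rfl
    refine Wp.seq (R := Progress S φ (solutions S φ) (2 * depth φ + 1 + 1)) ?_
      fun s' _ h => wp_advance hB (2 * depth φ + 1) h
    -- The empty prefix is good exactly if there is an answer. This test also decides queries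
    -- without variables.
    by_cases hg : Good S φ []
    · rw [bit_pos hg] at h3
      refine (Wp.iteT (e := rd .alive) (by simp) (by simp [h3]) ((wp_descend (p := [])
        (hr3.of_eq (by simp) (by simp)) hB (by simpa using hb3) (by simp [h3]) (by simp) (by simp) hg
        (by simp) ?_).post fun s' _ h => h.mono (by simp; omega))).le
        (τ := 3 + 50) (by omega)
      rw [solutions, if_pos hg]; simp [remaining]
    · rw [bit_neg hg] at h3
      refine (Wp.iteF (e := rd .alive) (by simp) (by simp [h3]) (Wp.skip (τ := 50)
        (Or.inl ⟨by simp, hr3.of_eq (by simp) (by simp), by simpa using hb3, .inl ⟨?_, by simp [h3]⟩⟩))).le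
        (τ := 3 + 50) (by omega)
      rw [solutions, if_neg hg]
  · rw [startTime, evalTime, nextTime]
    have : (2 * depth φ + 2) * (seekTime (depth φ) φ.code.length + 70) = (2 * depth φ + 1) *
      (seekTime (depth φ) φ.code.length + 70) + (seekTime (depth φ) φ.code.length + 70) :=
        Nat.succ_mul _ _
    omega

end

end BijQuery

/-! ## The query problem -/

namespace BijQuery

open Function WhileRAM

set_option linter.constructorNameAsVariable false

section
variable {σ : UnarySig}

/-! ### Sizes of formulas and of their codes -/

/-- The factor 2 is due to the letters of a word, which count as one symbol but are stored in two
cells, symbol and exponent. -/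
theorem length_code_atom_le {m : ℕ} (α : BijAtom σ m) : α.code.length ≤ 2 * α.size := by
  cases α <;> simp [BijAtom.code, BijAtom.size, BijWord.size, length_wordCode] <;> omega

theorem length_code_bool_le (ψ : BijBool σ) : ψ.code.length ≤ 2 * ψ.size := by
  induction ψ with
  | atom α => exact length_code_atom_le α
  | neg ψ ih => simp [BijBool.code, BijBool.size]; omega
  | and ψ χ ih ih' => simp [BijBool.code, BijBool.size]; omega
  | or ψ χ ih ih' => simp [BijBool.code, BijBool.size]; omega

theorem length_code_le {m : ℕ} (φ : FOBij σ m) : φ.code.length ≤ 2 * φ.size := by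
  induction φ with
  | atom α => exact length_code_atom_le α
  | neg φ ih => simp [FOBij.code, FOBij.size]; omega
  | and φ ψ ih ih' => simp [FOBij.code, FOBij.size]; omega
  | or φ ψ ih ih' => simp [FOBij.code, FOBij.size]; omega
  | ex φ ih => simp [FOBij.code, FOBij.size]; omega
  | all φ ih => simp [FOBij.code, FOBij.size]; omega
  | card r Ψ =>
    have := length_code_bool_le Ψ
    simp [FOBij.code, FOBij.size]; omega

theorem thresholds_le {m : ℕ} (φ : FOBij σ m) : thresholds φ ≤ φ.size := by
  induction φ <;> simp [thresholds, FOBij.size] <;> omega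

theorem le_of_mem_code_word {w : BijWord σ} {v : ℕ} (h : v ∈ w.code) :
    v ≤ w.code.length + σ.numFun := by
  rcases List.mem_cons.1 h with rfl | h
  · rw [length_wordCode]; omega
  · obtain ⟨p, -, hp⟩ := List.mem_flatMap.1 h
    have h1 := p.1.2
    have h2 : 0 < w.code.length := by rw [length_wordCode]; omega
    rcases List.mem_cons.1 hp with rfl | hp
    · omega
    · rw [List.mem_singleton] at hp
      split_ifs at hp <;> omega

theorem le_of_mem_code_atom {m : ℕ} {α : BijAtom σ m} {v : ℕ} (h : v ∈ α.code) :
    v ≤ m + α.code.length + σ.numConst + σ.numPred + σ.numFun := by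
  cases α with
  | eq w i w' j =>
    have := i.2
    have := j.2
    simp only [BijAtom.code, List.mem_cons, List.mem_append, List.not_mem_nil, or_false,
      List.length_cons, List.length_append] at h ⊢
    rcases h with rfl | ((h | rfl) | h) | rfl
    · omega
    · have := le_of_mem_code_word h; omega
    · omega
    · have := le_of_mem_code_word h; omega
    · omega
  | eqConst w i c =>
    have := i.2
    have := c.2
    simp only [BijAtom.code, List.mem_cons, List.mem_append, List.not_mem_nil, or_false,
      List.length_cons, List.length_append] at h ⊢
    rcases h with rfl | h | rfl | rfl
    · omega
    · have := le_of_mem_code_word h; omega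
    · omega
    · omega
  | pred U w i =>
    have := i.2
    have := U.2
    simp only [BijAtom.code, List.mem_cons, List.mem_append, List.not_mem_nil, or_false,
      List.length_cons, List.length_append] at h ⊢
    rcases h with rfl | rfl | h | rfl
    · omega
    · omega
    · have := le_of_mem_code_word h; omega
    · omega

theorem le_of_mem_code_bool {ψ : BijBool σ} {v : ℕ} (h : v ∈ ψ.code) :
    v ≤ ψ.code.length + σ.numConst + σ.numPred + σ.numFun + 8 := by
  induction ψ with
  | atom α => have := le_of_mem_code_atom (α := α) h; simp only [BijBool.code]; omega
  | neg ψ ih =>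
    rcases List.mem_cons.1 h with rfl | h
    · omega
    · have := ih h; simp [BijBool.code]; omega
  | and ψ χ ih ih' =>
    rcases List.mem_cons.1 h with rfl | h
    · omega
    · rcases List.mem_append.1 h with h | h
      · have := ih h; simp [BijBool.code]; omega
      · have := ih' h; simp [BijBool.code]; omega
  | or ψ χ ih ih' =>
    rcases List.mem_cons.1 h with rfl | h
    · omega
    · rcases List.mem_append.1 h with h | h
      · have := ih h; simp [BijBool.code]; omega
      · have := ih' h; simp [BijBool.code]; omega

/-- Space also bounds the contents of cells, so the numbers in the input must be small: symbol
numbers are bounded by the signature, variable numbers by the variables in scope and the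
quantifiers, and thresholds by `thresholds`. -/
theorem le_of_mem_code {m : ℕ} {φ : FOBij σ m} {v : ℕ} (h : v ∈ φ.code) :
    v ≤ m + φ.code.length + thresholds φ + σ.numConst + σ.numPred + σ.numFun + 8 := by
  induction φ with
  | atom α => have := le_of_mem_code_atom (α := α) h; simp only [FOBij.code]; omega
  | neg φ ih | ex φ ih | all φ ih =>
    rcases List.mem_cons.1 h with rfl | h
    · omega
    · have := ih h; simp [FOBij.code, thresholds]; omega
  | and φ ψ ih ih' | or φ ψ ih ih' =>
    rcases List.mem_cons.1 h with rfl | h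
    · omega
    · rcases List.mem_append.1 h with h | h
      · have := ih h; simp [FOBij.code, thresholds]; omega
      · have := ih' h; simp [FOBij.code, thresholds]; omega
  | card r Ψ =>
    rcases List.mem_cons.1 h with rfl | h
    · omega
    · rcases List.mem_cons.1 h with rfl | h
      · simp only [thresholds]; omega
      · have := le_of_mem_code_bool h; simp [FOBij.code]; omega

variable (S : BijStructure σ)

/-- The number of symbols is linear in the size because even an empty predicate contributes its
length register and a function at least one entry. -/
theorem card_le_size : S.n ≤ S.size ∧ 1 ≤ S.size ∧
    σ.numConst + σ.numPred + σ.numFun ≤ S.size := by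
  have h1 := S.n_pos
  have h2 : σ.numPred ≤ ∑ i, ((S.pred i).card + 1) := by
    simp [Finset.sum_add_distrib]
  have h3 := Nat.le_mul_of_pos_right σ.numFun S.n_pos
  rw [BijStructure.size]
  omega

theorem le_of_mem_structCode {v : ℕ} (h : v ∈ S.code) : v ≤ S.size := by
  obtain ⟨h1, h2, h3⟩ := card_le_size S
  simp only [BijStructure.code, List.mem_append, List.mem_cons, List.not_mem_nil, or_false,
    List.mem_ofFn, List.mem_flatMap, List.mem_map] at h
  rcases h with (((h | h | h | h) | ⟨i, rfl⟩) | ⟨i, -, rfl | ⟨a, -, rfl⟩⟩) | ⟨i, -, a, rfl⟩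
  · omega
  · omega
  · omega
  · omega
  · have := (S.const i).2; omega
  · have := Finset.card_le_univ (S.pred i)
    rw [Fintype.card_fin] at this; omega
  · have := a.2; omega
  · have := (S.func i a).2; omega

variable {k : ℕ} (φ : FOBij σ k)

theorem le_of_mem_inputWord {v : ℕ} (h : v ∈ inputWord S φ) : v ≤ 2 * S.size + depth φ + 8 := by
  obtain ⟨h1, h2, h3⟩ := card_le_size S
  have hdep : depth φ = k + φ.code.length + thresholds φ := rfl
  rcases List.mem_append.1 h with h | h
  · have := le_of_mem_structCode S h; omega
  · rcases List.mem_cons.1 h with rfl | h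
    · omega
    · have := le_of_mem_code h; omega

/-! ### Bounds that are linear in the size of the structure -/

/-- Coefficient of the bound for the space. -/
def spaceFactor (d T : ℕ) : ℕ :=
  32 * (T + 6) + 42 + 4 * d + 3 * T + radius d * 3 + hoodBound d T +
    numTypes (radius d) T * quota d T + numTypes (radius d) T

/-- Coefficient of the bound for the time of the precomputation. -/
def timeFactor (d T : ℕ) : ℕ :=
  3200 * (T + 6) + 400 + prepareTime d T 1 1 1 + startTime d T

variable {S φ}

/-- Since the size is positive, additive terms that depend on the parameter alone become multiples
of the size. -/
theorem le_mul_size (c : ℕ) : c ≤ S.size * c := Nat.le_mul_of_pos_left _ (card_le_size S).2.1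

theorem room : Room S φ (S.size * spaceFactor (depth φ) φ.code.length) := by
  obtain ⟨h1, h2, h3⟩ := card_le_size S
  have hdep : depth φ = k + φ.code.length + thresholds φ := rfl
  have hq := queryPos_add (S := S)
  have hT : φ.code.length * S.n ≤ S.size * φ.code.length := by
    rw [Nat.mul_comm]; exact Nat.mul_le_mul_right _ h1
  have e1 := le_mul_size (S := S) φ.code.length
  have e2 := le_mul_size (S := S) (depth φ)
  have e3 := le_mul_size (S := S) (radius (depth φ))
  have e4 := le_mul_size (S := S) (hoodBound (depth φ) φ.code.length)
  have e5 := le_mul_size (S := S) (numTypes (radius (depth φ)) φ.code.length *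
    quota (depth φ) φ.code.length)
  have e6 := le_mul_size (S := S) (numTypes (radius (depth φ)) φ.code.length)
  have e : S.size * spaceFactor (depth φ) φ.code.length = 32 * (S.size * φ.code.length) +
      S.size * 234 + 4 * (S.size * depth φ) + 3 * (S.size * φ.code.length) +
      3 * (S.size * radius (depth φ)) + S.size * hoodBound (depth φ) φ.code.length +
      S.size * (numTypes (radius (depth φ)) φ.code.length * quota (depth φ) φ.code.length) +
      S.size * numTypes (radius (depth φ)) φ.code.length := by
    rw [spaceFactor]; ring
  constructor
  · rw [length_inputWord]; omega
  · omega
  · omega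
  · omega
  · omega
  · omega

theorem inputWord_le {v : ℕ} (h : v ∈ inputWord S φ) :
    v ≤ S.size * spaceFactor (depth φ) φ.code.length := by
  obtain ⟨h1, h2, h3⟩ := card_le_size S
  have := le_of_mem_inputWord S φ h
  have e : S.size * (2 + depth φ + 8) ≤ S.size * spaceFactor (depth φ) φ.code.length :=
    Nat.mul_le_mul_left _ (by rw [spaceFactor]; omega)
  have e1 := le_mul_size (S := S) (depth φ + 8)
  have e2 : S.size * (2 + depth φ + 8) = 2 * S.size + S.size * (depth φ + 8) := by ring
  omega

theorem prepareTime_le {d T s n np nf : ℕ} (hs : 1 ≤ s) (hn : n ≤ s) (hp : np ≤ s) (hf : nf ≤ s) :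
    prepareTime d T n np nf ≤ s * prepareTime d T 1 1 1 := by
  have e : s * prepareTime d T 1 1 1 = (T * (s * 30 + s * 200 + s * 80 + s * 310) + s * 10) +
      s * (d * 20 + closureTime d T + 60) +
      (s * (closureTime d T + hoodBound d T * (T * 100 + 60) + 110) + s * 6) +
      (numTypes (radius d) T * (s * 120 + s * 40) + s * 20) := by
    simp only [prepareTime]; ring
  rw [e, prepareTime]
  have := Nat.le_mul_of_pos_left (d * 20 + closureTime d T + 60) hs
  gcongr <;> omega

theorem time_le : 100 * (σ.numPred + σ.numFun + 1) + 3200 * (inputWord S φ).length + 100 +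
    (prepareTime (depth φ) φ.code.length S.n σ.numPred σ.numFun +
      startTime (depth φ) φ.code.length) ≤ S.size * timeFactor (depth φ) φ.code.length := by
  obtain ⟨h1, h2, h3⟩ := card_le_size S
  have hq := queryPos_add (S := S)
  have e1 := le_mul_size (S := S) φ.code.length
  have e2 := prepareTime_le (d := depth φ) (T := φ.code.length) h2 h1
    (show σ.numPred ≤ S.size by omega) (show σ.numFun ≤ S.size by omega)
  have e3 := le_mul_size (S := S) (startTime (depth φ) φ.code.length)
  have e : S.size * timeFactor (depth φ) φ.code.length = 3200 * (S.size * φ.code.length) +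
    S.size * 19600 + S.size * prepareTime (depth φ) φ.code.length 1 1 1 +
      S.size * startTime (depth φ) φ.code.length := by
    rw [timeFactor]; ring
  rw [length_inputWord]
  omega

/-! ### Correctness of the enumeration -/

/-- The program for the query problem. -/
def queryProgram : RAM.Program :=
  enumProgram layout₀ layout readInput (prepare ;; start) writeSolution next .alive

/-- The solutions as lists of numbers. -/
noncomputable def output (S : BijStructure σ) (φ : FOBij σ k) : List (List ℕ) :=
  (solutions S φ).map (List.map Fin.val)

theorem nodup_output : (output S φ).Nodup :=
  nodup_solutions.map (List.map_injective_iff.2 Fin.val_injective)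

theorem mem_output {y : List ℕ} :
    y ∈ output S φ ↔ y ∈ (fun a => List.ofFn (fun i => (a i : ℕ))) '' φ.answers S := by
  simp only [output, List.mem_map, mem_solutions, Set.mem_image]
  constructor
  · rintro ⟨l, ⟨hl, z, hz, h⟩, rfl⟩
    refine ⟨z, hz, List.ext_getElem (by simp [hl]) fun i h1 h2 => ?_⟩
    have hi : i < k := by simpa using h1
    have := h ⟨i, by omega⟩ hi
    simp [this]
  · rintro ⟨a, ha, rfl⟩
    exact ⟨List.ofFn a, ⟨by simp, a, ha, fun i h => by simp⟩, by rw [List.map_ofFn]; rfl⟩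

/-- The additive 1 is needed for `k = 0`: the output size is then 0, although the empty tuple may be
output. -/
theorem length_output_le : (output S φ).length ≤ k * (φ.answers S).ncard + 1 := by
  have hinj : Injective fun (a : Fin k → Fin S.n) => List.ofFn (fun i => (a i : ℕ)) := fun a b h => by
    have := List.ofFn_injective h
    exact funext fun i => Fin.val_injective (congrFun this i)
  have h1 : (output S φ).length = (φ.answers S).ncard := by
    rw [← List.toFinset_card_of_nodup nodup_output, ← Set.ncard_coe_finset,
      ← Set.ncard_image_of_injective _ hinj]
    congr 1
    ext y
    rw [Finset.mem_coe, List.mem_toFinset, mem_output]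
  rw [h1]
  obtain rfl | hk := Nat.eq_zero_or_pos k
  · have := Set.ncard_le_one_of_subsingleton (φ.answers S)
    omega
  · have := Nat.le_mul_of_pos_left (φ.answers S).ncard hk
    omega

/-- The factor 32 in the space bound is the stretching of addresses by the interleaving of the
arrays. The search for the first solution counts as precomputation, so that every later solution is
ready after one run of `next`. -/
theorem query_correct :
    (∃ t ≤ S.size * timeFactor (depth φ) φ.code.length +
        ((output S φ).length + 1) * (2 * nextTime (depth φ) φ.code.length + 6),
      RAM.HaltedAt queryProgram (inputWord S φ) t ∧
      (RAM.run queryProgram (inputWord S φ) t).out = output S φ) ∧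
    RAM.HasDelay queryProgram (inputWord S φ) (S.size * timeFactor (depth φ) φ.code.length)
      (2 * nextTime (depth φ) φ.code.length + 6) ∧
    RAM.UsesSpace queryProgram (inputWord S φ)
      (S.size * (32 * (spaceFactor (depth φ) φ.code.length + 1))) := by
  have hB := room (S := S) (φ := φ)
  have hlen := hB.input
  have ht := time_le (S := S) (φ := φ)
  refine And.imp ?_ (And.imp_left ?_) (enumProgram_correct (L₀ := layout₀) (L := layout) (c₀ := readInput)
    (c₁ := prepare ;; start) (sol := writeSolution) (nxt := next) (x := .alive)
    (B := S.size * spaceFactor (depth φ) φ.code.length) (w := inputWord S φ) (Y := output S φ)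
    (B' := S.size * (32 * (spaceFactor (depth φ) φ.code.length + 1)))
    (τ := nextTime (depth φ) φ.code.length)
    (t₁ := prepareTime (depth φ) φ.code.length S.n σ.numPred σ.numFun +
      startTime (depth φ) φ.code.length)
    -- The machine sees solutions as lists of numbers, whereas the search keeps lists of elements of
    -- the domain; the invariant links the two.
    (Inv := fun Z s => ∃ Y, Z = Y.map (List.map Fin.val) ∧ Stopped S φ Y s) (by
      have := (card_le_size S).2.1
      have e : S.size * (32 * (spaceFactor (depth φ) φ.code.length + 1)) =
        32 * (S.size * spaceFactor (depth φ) φ.code.length) + 32 * S.size := by ring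
      have e' : 2 ^ layout.h = 32 := rfl
      rw [e, e']
      omega) rfl rfl (fun _ => inputWord_le) (by omega)
    ((wp_readInput S φ hlen).post fun s g ⟨i1, i2, i3⟩ => ?_) ?_ ?_)
  · exact fun ⟨t, ht', h⟩ => ⟨t, ht'.trans (Nat.add_le_add_right ht _), h⟩
  · exact fun ⟨t, ht', h⟩ => ⟨t, ht'.trans ht, h⟩
  · have hz : Sizes S φ (reinterpret layout s) := 
      ⟨i1.n, i1.nc, i1.np, i1.nf, i1.fb, i1.k, i1.fs, i1.tl, i1.rho⟩
    have hinp : (reinterpret layout s).a .inp = fun i => (inputWord S φ).getD i 0 := by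
      rw [i3, if_pos rfl]
    obtain ⟨j1, -, j3⟩ := seg_inputWord S φ (f := (reinterpret layout s).a .inp) (by
      rw [hinp]
      exact fun i hi => by simp [List.getElem?_eq_getElem hi])
    refine Wp.seq (wp_prepare hz j1 j3 (fun T hT => by rw [i3, if_neg hT]) hB) fun s1 g1 hr => ?_
    refine (wp_start hB hr ((g1.buf rfl).trans i2)).post fun s2 _ h => ⟨_, rfl, h⟩
  · rintro s ⟨Y, hY, -, -, ⟨-, h⟩ | ⟨-, p, -, -, -, h⟩⟩
    · exact h
    · rw [h] at hY; simp at hY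
  · rintro y Z s ⟨Y, hY, hr, hb, ⟨h, -⟩ | ⟨ha, p, hp, hlv, he, h⟩⟩
    · rw [h] at hY; simp at hY
    rw [h, List.map_cons, List.cons.injEq] at hY
    obtain ⟨rfl, rfl⟩ := hY
    refine ⟨ha, hb, (wp_writeSolution hB hr hb hp he).post fun s' g h' => ⟨h', ?_⟩⟩
    have hr' : Ready S φ s' := hr.agree g (by decide)
    refine (wp_next (p := p) hB (s := { s' with buf := [] }) (hr'.of_eq (fun _ _ => rfl)
      fun _ _ => rfl) rfl ?_ hp ((g.v .lv rfl).trans hlv) ?_ rfl).post fun s2 _ h2 => ⟨_, ?_, h2⟩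
    · rw [show ({ s' with buf := [] } : St Var Arr).v .alive = s.v .alive from g.v .alive rfl]; exact ha
    · rw [show ({ s' with buf := [] } : St Var Arr).a .env = s.a .env from g.a .env rfl]; exact he
    · rw [show ({ s' with buf := [] } : St Var Arr).a .ctr = s.a .ctr from g.a .ctr rfl]

end

/-! ### Bounds in terms of the parameter, and conclusion -/

theorem run_of_haltedAt {P : RAM.Program} {w : List ℕ} {t t' : ℕ} (h : RAM.HaltedAt P w t)
    (ht : t ≤ t') : RAM.run P w t' = RAM.run P w t := by
  induction t', ht using Nat.le_induction with
  | base => rfl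
  | succ t' _ ih =>
    have e : RAM.run P w (t' + 1) = RAM.step P (RAM.run P w t') := iterate_succ_apply' _ _ _
    rw [e, ih, RAM.step]
    rcases h with h | h <;> rw [h] <;> rfl

/-- A bound for all coefficients. -/
def factor (d T : ℕ) : ℕ :=
  timeFactor d T + 2 * (2 * nextTime d T + 6) + 32 * (spaceFactor d T + 1)

/-- A bound in terms of the parameter. -/
def paramBound (p : ℕ) : ℕ :=
  ∑ d ∈ Finset.range (4 * p + 1), ∑ T ∈ Finset.range (4 * p + 1), factor d T

/-- Depth and code length are at most `4 * p`, and a sum over all such pairs dominates each of its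
terms; this makes monotonicity of `factor` unnecessary. -/
theorem factor_le {σ : UnarySig} {k : ℕ} (φ : FOBij σ k) :
    factor (depth φ) φ.code.length ≤ paramBound (φ.size + k) := by
  have h1 := length_code_le φ
  have h2 := thresholds_le φ
  have hdep : depth φ = k + φ.code.length + thresholds φ := rfl
  refine (Finset.single_le_sum (f := fun T => factor (depth φ) T) (fun _ _ => Nat.zero_le _)
    (Finset.mem_range.2 (show φ.code.length < 4 * (φ.size + k) + 1 by omega))).trans ?_
  exact Finset.single_le_sum (f := fun d => ∑ T ∈ Finset.range (4 * (φ.size + k) + 1), factor d T)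
    (fun _ _ => Nat.zero_le _)
    (Finset.mem_range.2 (show depth φ < 4 * (φ.size + k) + 1 by omega))

theorem UsesSpace.mono {P : RAM.Program} {w : List ℕ} {s s' : ℕ} (h : RAM.UsesSpace P w s)
    (hs : s ≤ s') : RAM.UsesSpace P w s' :=
  ⟨h.1.trans hs, fun t => ⟨fun r => ((h.2 t).1 r).trans hs, fun a => ((h.2 t).2.1 a).trans hs,
    fun a ha => (h.2 t).2.2 a (by omega)⟩⟩

theorem HasDelay.mono {P : RAM.Program} {w : List ℕ} {a b a' b' : ℕ} (h : RAM.HasDelay P w a b)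
    (ha : a ≤ a') (hb : b ≤ b') : RAM.HasDelay P w a' b' :=
  let ⟨t, h1, h2, h3⟩ := h
  ⟨t, h1.trans ha, h2, fun t ht => let ⟨d, h4, h5⟩ := h3 t ht; ⟨d, by omega, h5⟩⟩

theorem query_constantDelayLin_linearTotalTime :
    queryFOBij.ConstantDelayLin ∧ queryFOBij.LinearTotalTime := by
  have key : ∀ x : BijQueryInstance, ∀ c ≤ factor (depth x.formula) x.formula.code.length,
      x.struct.size * c ≤ paramBound (x.formula.size + x.k) * x.struct.size := fun x c hc => by
    rw [Nat.mul_comm]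
    exact Nat.mul_le_mul_right _ (hc.trans (factor_le x.formula))
  refine ⟨⟨queryProgram, paramBound, fun x => ?_⟩, ⟨queryProgram, paramBound, fun x => ?_⟩⟩
  · obtain ⟨⟨t, ht, h1, h2⟩, h3, h4⟩ := query_correct (S := x.struct) (φ := x.formula)
    refine ⟨⟨t, h1, h2 ▸ nodup_output, fun y => h2 ▸ mem_output⟩, HasDelay.mono h3 (key x _ ?_)
      (le_trans ?_ (factor_le x.formula)), UsesSpace.mono h4 (key x _ ?_)⟩ <;> rw [factor] <;> omega
  · obtain ⟨⟨t, ht, h1, h2⟩, h3, h4⟩ := query_correct (S := x.struct) (φ := x.formula)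
    have hle : t ≤ paramBound (x.formula.size + x.k) *
        (x.struct.size + x.k * (x.formula.answers x.struct).ncard) := by
      have hlen := length_output_le (S := x.struct) (φ := x.formula)
      have hs := (card_le_size x.struct).2.1
      have hf := factor_le x.formula
      rw [factor] at hf
      refine ht.trans (le_trans ?_ (Nat.mul_le_mul_right _ hf))
      generalize x.k * (x.formula.answers x.struct).ncard = o at *
      generalize timeFactor (depth x.formula) x.formula.code.length = A at *
      generalize 2 * nextTime (depth x.formula) x.formula.code.length + 6 = D at *
      generalize 32 * (spaceFactor (depth x.formula) x.formula.code.length + 1) = C at *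
      -- The number of outputs exceeds the output size by at most one, and one more delay follows
      -- the last output. Both ones are absorbed by the positive size, at the price of the factor 2
      -- in `factor`.
      have e1 := Nat.mul_le_mul_right D
        (show (output x.struct x.formula).length + 1 ≤ 2 * (x.struct.size + o) by omega)
      have e2 : (A + 2 * D + C) * (x.struct.size + o) = x.struct.size * A + o * A +
        2 * (x.struct.size + o) * D + C * (x.struct.size + o) := by ring
      omega
    have hrun := run_of_haltedAt h1 hle
    refine ⟨⟨?_, ?_, fun y => ?_⟩, UsesSpace.mono h4 (key x _ (by rw [factor]; omega))⟩
    · exact (congrArg (fun c : RAM.Config => queryProgram[c.pc]? = none ∨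
        queryProgram[c.pc]? = some .halt) hrun).mpr h1
    · exact (congrArg (fun c : RAM.Config => c.out.Nodup) hrun).mpr (h2 ▸ nodup_output)
    · exact (congrArg (fun c : RAM.Config => y ∈ c.out ↔ _) hrun).mpr (h2 ▸ mem_output)

end BijQuery

theorem mainTheorem2 :
    queryFOBij.ConstantDelayLin ∧ queryFOBij.LinearTotalTime := by
  exact BijQuery.query_constantDelayLin_linearTotalTime
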